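/- **Setting.** Let $L>0$, $\Omega=\mathbb R/L\mathbb Z$, and let $h_0,c_0\in W^{2,2}(\Omega)$ with $h_0>0$. For $\varepsilon>0$ let $g_\varepsilon:\mathbb R\to\mathbb R$ be $C^3$ with $g_\varepsilon(s)=s+\varepsilon$ for $s\ge 0$, $g_\varepsilon(s)>0$ for $s<0$ and $g_\varepsilon(s)\to\varepsilon/2$ as $s\to-\infty$. Put $f_\varepsilon=g_\varepsilon^3$, $\tilde G_\varepsilon(s)=-\int_s^\infty \frac{dr}{f_\varepsilon(r)g_\varepsilon(r)}$, $G_\varepsilon(s)=-\int_s^\infty\tilde G_\varepsilon(r)\,dr$, and $$J_\varepsilon=f_\varepsilon(h)h_{xxx}-\frac{h_x}{g_\varepsilon(h)}-\frac{f_\varepsilon(h)}{g_\varepsilon(h)}\bigl(g_\varepsilon(h)c_x^2\bigr)_x,\quad \mu_\varepsilon=c^3-c-\frac{(g_\varepsilon(h)c_x)_x}{g_\varepsilon(h)},\quad K_\varepsilon=cJ_\varepsilon-g_\varepsilon(h)\mu_{\varepsilon,x}.$$ Let $(\phi_i)_{i\ge0}$ be a complete orthonormal basis of $L^2(\Omega)$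 of ($L$-periodic) eigenfunctions of the Laplacian, with $\phi_0$ constant. A Galerkin approximation of order $n$ on $[0,T]$ is a pair $h_n=\sum_{i\le n}\eta_i(t)\phi_i$, $c_n=\sum_{i\le n}\gamma_i(t)\phi_i$ with coefficients continuous on $[0,T]$, $\eta_i(0)=\langle h_0,\phi_i\rangle$, $\gamma_i(0)=\langle c_0,\phi_i\rangle$, and, for $j\le n$ and $0<t<T$, $$\tfrac{d}{dt}\langle h_n,\phi_j\rangle=\langle J_\varepsilon(h_n,c_n),\phi_{j,x}\rangle,\qquad \tfrac{d}{dt}\langle g_\varepsilon(h_n)c_n,\phi_j\rangle=\langle K_\varepsilon(h_n,c_n),\phi_{j,x}\rangle .$$ A regularised limit $(h_\varepsilon,c_\varepsilon)$ on $[0,T]$ is a uniform limit, on $[0,T]\times\Omega$, of a subsequence (in $n$) of Galerkin approximations; a limit solution $(h,c)$ on $[0,T]$ is a uniform limit of regularised limits $(h_{\varepsilon_k},c_{\varepsilon_k})$ along some positive $\varepsilon_k\to0$. **Theorem.** There are constants $k_1,k_4,\varepsilon_0>0$, depending only on $L,h_0,c_0$, such that $$M:=-k_1\sqrt L+\sqrt{k_1^2L+\frac{k_1^2L}{e^{k_4k_1^2}-1}}>0$$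 and the following holds. For every basis $(\phi_i)$ as above there is $n_0$ such that for all $n>n_0$ the partial sum $\sum_{i\le n}\langle h_0,\phi_i\rangle\phi_i$ is positive on $\Omega$, and for every family $(g_\varepsilon)_{\varepsilon>0}$ as above: 1. for all $n>n_0$, $0<\varepsilon<\varepsilon_0$ and $T>0$, a Galerkin approximation of order $n$ exists on $[0,T]$, and every such approximation satisfies, for all $t\in[0,T]$, $$\|h_{n,x}(\cdot,t)\|_{L^2(\Omega)}\le k_1,\qquad \int_\Omega G_\varepsilon(h_n(x,t))\,dx\le k_4,\qquad h_n(x,t)\ge M\ \text{ for all }x;$$ 2. for all $0<\varepsilon<\varepsilon_0$ and $T>0$, a regularised limit exists on $[0,T]$, and every regularised limit satisfies $h_\varepsilon\ge M$ on $[0,T]\times\Omega$; 3. for all $T>0$, a limit solution exists on $[0,T]$, and every limit solution satisfies $h\ge M$ on $[0,T]\times\Omega$. -/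

import Mathlib

open MeasureTheory Set Filter Topology

noncomputable section

namespace ThinFilm

/-- `u : ℝ → ℝ` is (the continuous representative of) an element of `W^{2,2}` of the circle
`ℝ / Lℤ`: it is `L`-periodic, differentiable, and its derivative is a primitive of a square
integrable function. -/
def IsPeriodicW22 (L : ℝ) (u : ℝ → ℝ) : Prop :=
  Function.Periodic u L ∧ Differentiable ℝ u ∧
    ∃ v : ℝ → ℝ, MemLp v 2 (volume.restrict (Ioc 0 L)) ∧
      ∀ x ∈ Icc 0 L, deriv u x = deriv u 0 + ∫ y in (0 : ℝ)..x, v y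

/-- `g` is an admissible regularisation `g_ε` of the function `g(s) = s`. -/
structure IsRegularization (ε : ℝ) (g : ℝ → ℝ) : Prop where
  eq_add : ∀ s, 0 ≤ s → g s = s + ε
  pos : ∀ s, s < 0 → 0 < g s
  tendsto_atBot : Tendsto g atBot (𝓝 (ε / 2))
  contDiff : ContDiff ℝ 3 g

/-- The regularised mobility `f_ε = g_ε ^ 3`. -/
def mobility (g : ℝ → ℝ) (s : ℝ) : ℝ := g s ^ 3

/-- `G̃_ε(s) = - ∫_s^∞ dr / (f_ε(r) g_ε(r))`. -/
def Gtilde (g : ℝ → ℝ) (s : ℝ) : ℝ := -∫ r in Ioi s, 1 / (mobility g r * g r)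

/-- `G_ε(s) = - ∫_s^∞ G̃_ε(r) dr`, so that `G_ε'' = 1 / (f_ε g_ε)`. -/
def G (g : ℝ → ℝ) (s : ℝ) : ℝ := -∫ r in Ioi s, Gtilde g r

/-- The flux `J_ε = f_ε(h) h_xxx - h_x / g_ε(h) - (f_ε(h) / g_ε(h)) (g_ε(h) c_x²)_x`. -/
def fluxJ (g h c : ℝ → ℝ) (x : ℝ) : ℝ :=
  mobility g (h x) * iteratedDeriv 3 h x - 1 / g (h x) * deriv h x
    - mobility g (h x) / g (h x) * deriv (fun y => g (h y) * deriv c y ^ 2) x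

/-- The chemical potential `μ_ε = c³ - c - (g_ε(h) c_x)_x / g_ε(h)`. -/
def chemPot (g h c : ℝ → ℝ) (x : ℝ) : ℝ :=
  c x ^ 3 - c x - 1 / g (h x) * deriv (fun y => g (h y) * deriv c y) x

/-- The flux `K_ε = c J_ε - g_ε(h) μ_{ε,x}`. -/
def fluxK (g h c : ℝ → ℝ) (x : ℝ) : ℝ :=
  c x * fluxJ g h c x - g (h x) * deriv (chemPot g h c) x

/-- `φ 0, φ 1, …` is a complete orthonormal basis of `L²(0, L)` consisting of `L`-periodic
eigenfunctions of the Laplacian, `φ 0` being constant. -/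
structure IsLaplaceEigenbasis (L : ℝ) (φ : ℕ → ℝ → ℝ) : Prop where
  smooth : ∀ i, ContDiff ℝ (⊤ : ℕ∞) (φ i)
  periodic : ∀ i, Function.Periodic (φ i) L
  eigen : ∀ i, ∃ lam : ℝ, ∀ x, iteratedDeriv 2 (φ i) x = -lam ^ 2 * φ i x
  const_zero : ∃ a : ℝ, ∀ x, φ 0 x = a
  orthonormal : ∀ i j, ∫ x in (0 : ℝ)..L, φ i x * φ j x = if i = j then 1 else 0
  complete : ∀ u : ℝ → ℝ, MemLp u 2 (volume.restrict (Ioc 0 L)) →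
    (∀ i, ∫ x in (0 : ℝ)..L, u x * φ i x = 0) → u =ᵐ[volume.restrict (Ioc 0 L)] 0

/-- The Galerkin sum `(t, x) ↦ ∑_{i=0}^n a_i(t) φ_i(x)`. -/
def galerkinSum (φ : ℕ → ℝ → ℝ) (n : ℕ) (a : ℕ → ℝ → ℝ) (t x : ℝ) : ℝ :=
  ∑ i ∈ Finset.range (n + 1), a i t * φ i x

/-- The `n`-th partial sum of the expansion of `u` in the basis `φ`. -/
def partialSum (L : ℝ) (φ : ℕ → ℝ → ℝ) (n : ℕ) (u : ℝ → ℝ) (x : ℝ) : ℝ :=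
  ∑ i ∈ Finset.range (n + 1), (∫ y in (0 : ℝ)..L, u y * φ i y) * φ i x

/-- `(η, γ)` are the coefficients, on the time interval `[0, T]`, of a Galerkin approximation
`h_n = ∑ η_i φ_i`, `c_n = ∑ γ_i φ_i` of the regularised problem: the initial coefficients are
those of `h₀`, `c₀`, and `d/dt ⟨h_n, φ_j⟩ = ⟨J, φ_{j,x}⟩`,
`d/dt ⟨g_ε(h_n) c_n, φ_j⟩ = ⟨K, φ_{j,x}⟩` for `j = 0, …, n`. -/
structure IsGalerkinSolution (L : ℝ) (φ : ℕ → ℝ → ℝ) (g h₀ c₀ : ℝ → ℝ) (n : ℕ) (T : ℝ)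
    (η γ : ℕ → ℝ → ℝ) : Prop where
  init_h : ∀ i ≤ n, η i 0 = ∫ x in (0 : ℝ)..L, h₀ x * φ i x
  init_c : ∀ i ≤ n, γ i 0 = ∫ x in (0 : ℝ)..L, c₀ x * φ i x
  cont_h : ∀ i ≤ n, ContinuousOn (η i) (Icc 0 T)
  cont_c : ∀ i ≤ n, ContinuousOn (γ i) (Icc 0 T)
  eq_h : ∀ j ≤ n, ∀ t ∈ Ioo 0 T,
    HasDerivAt (fun s => ∫ x in (0 : ℝ)..L, galerkinSum φ n η s x * φ j x)
      (∫ x in (0 : ℝ)..L,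
        fluxJ g (galerkinSum φ n η t) (galerkinSum φ n γ t) x * deriv (φ j) x) t
  eq_c : ∀ j ≤ n, ∀ t ∈ Ioo 0 T,
    HasDerivAt
      (fun s => ∫ x in (0 : ℝ)..L, g (galerkinSum φ n η s x) * galerkinSum φ n γ s x * φ j x)
      (∫ x in (0 : ℝ)..L,
        fluxK g (galerkinSum φ n η t) (galerkinSum φ n γ t) x * deriv (φ j) x) t

/-- `u k → v` uniformly on `[0, T] × ℝ` (time first, space second). -/
def UniformLimit (T : ℝ) (u : ℕ → ℝ → ℝ → ℝ) (v : ℝ → ℝ → ℝ) : Prop :=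
  TendstoUniformlyOn (fun k (p : ℝ × ℝ) => u k p.1 p.2) (fun p => v p.1 p.2) atTop
    (Icc 0 T ×ˢ univ)

/-- `(h, c)` is a solution `(h_ε, c_ε)` of the regularised problem on `[0, T]` as produced by the
Galerkin method: the uniform limit of a subsequence of Galerkin approximations. -/
def IsRegularizedLimit (L : ℝ) (φ : ℕ → ℝ → ℝ) (g h₀ c₀ : ℝ → ℝ) (T : ℝ)
    (h c : ℝ → ℝ → ℝ) : Prop :=
  ∃ (ν : ℕ → ℕ) (η γ : ℕ → ℕ → ℝ → ℝ), StrictMono ν ∧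
    (∀ k, IsGalerkinSolution L φ g h₀ c₀ (ν k) T (η k) (γ k)) ∧
    UniformLimit T (fun k => galerkinSum φ (ν k) (η k)) h ∧
    UniformLimit T (fun k => galerkinSum φ (ν k) (γ k)) c

/-- `(h, c)` is a limit solution on `[0, T]`: the uniform limit of `(h_ε, c_ε)` along a sequence
of positive `ε` tending to zero. -/
def IsLimitSolution (L : ℝ) (φ : ℕ → ℝ → ℝ) (g : ℝ → ℝ → ℝ) (h₀ c₀ : ℝ → ℝ) (T : ℝ)
    (h c : ℝ → ℝ → ℝ) : Prop :=
  ∃ (e : ℕ → ℝ) (hh cc : ℕ → ℝ → ℝ → ℝ), (∀ k, 0 < e k) ∧ Tendsto e atTop (𝓝 0) ∧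
    (∀ k, IsRegularizedLimit L φ (g (e k)) h₀ c₀ T (hh k) (cc k)) ∧
    UniformLimit T hh h ∧ UniformLimit T cc c

/-- `M = -k₁ √L + √(k₁² L + k₁² L / (exp (k₄ k₁²) - 1))`. -/
def lowerBound (L k₁ k₄ : ℝ) : ℝ :=
  -k₁ * √L + √(k₁ ^ 2 * L + k₁ ^ 2 * L / (Real.exp (k₄ * k₁ ^ 2) - 1))

end ThinFilm

end

/-! The formula for `M` carries little information: since `exp x - 1 ≥ x`, `lowerBound_le` gives `M
≤ √(L / k₄)`, and `k₄` may be enlarged at will. So it suffices to find one positive lower bound for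
the heights that does not depend on `n`, `ε` or `T`, together with bounds for slope and entropy.

All of these come from the energy `E = ∫ a_x²/2 + 1/(6a²) + a (W(c) + c_x²/2)` with `a = h + ε`. On
positive heights the first two terms are the slope and the entropy `∫ G_ε`, and `log a` oscillates
by at most `‖a_x‖ ‖1/a‖`, so that bounded energy keeps `a` away from zero
(`exists_pos_le_of_energy_le`). The task is to bound the energy along Galerkin flows uniformly in
time.

The Galerkin scheme does not dissipate `E` exactly, because the variational derivatives of `E` do
not belong to the Galerkin space. The balance `energyRate_eq` has the dissipation `D` and three
integrals containing projection defects. To compare these with `D`, let `r ^ 8 = 1 + ‖a_xxx‖² +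
‖c_xxx‖²`; under an energy bound `r ^ 8 ≤ C (1 + D)` (`exists_pow_le_dissipation`), the lower order
terms have size `r ^ 3`, and their derivatives have size `r ^ 5`. Combining these two sizes with the
Poincaré inequality on the complement of the Galerkin space yields `r ^ 4` with a small factor when
`n` is large. One contribution remains critical, without a small factor: the pressure defect tested
against the high frequency part `s` of `a_xxx`. It is bounded by `‖s‖ r ^ 4`. It is compensated by
adding to the energy a quadratic form in the height coefficients that acts at high frequencies and
whose derivative is `-∫ J s`, which is at most a negative multiple of `‖s‖²` up to small errors
(`integral_flux_mul_ge`). The result is `energy_inequality`: the corrected energy has rate at most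
`-D + δ (1 + D)`, with `δ` as small as desired.

This rate is not negative when `D` is small, so a second ingredient is needed. States of small
dissipation are nearly stationary, and testing the two nearly stationary equations with `c` minus
its weighted mean and with `a` minus its mean bounds their energy in terms of the conserved masses
alone (`NearStationary.energy_le`). Hence on a sufficiently high level `e` of the corrected energy
the dissipation is bounded below, the rate is negative, and the level is a barrier
(`exists_energyBarrier`, `EnergyBarrier.confined`). The level depends on neither `T`, `ε`, `n` nor
the basis; only the order from which the barrier works and the threshold frequency depend on the
basis.

Existence follows by cutting off the vector field on the coefficients, since the barrier keeps the
flow where the cutoff is inactive. The dissipation also gives Hölder bounds in time, so that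
Arzelà–Ascoli provides the two limits, and pointwise lower bounds survive uniform convergence. -/

namespace ThinFilm

/-! ## Smooth periodic functions and the `L²` norm over a period -/

/-- Smooth functions on the line of period `L`. -/
structure SmoothPeriodic (L : ℝ) (u : ℝ → ℝ) : Prop where
  smooth : ContDiff ℝ (⊤ : ℕ∞) u
  periodic : Function.Periodic u L

/-- The norm of `L²(0, L)`. -/
noncomputable def l2 (L : ℝ) (u : ℝ → ℝ) : ℝ := √(∫ x in (0 : ℝ)..L, u x ^ 2)

lemma periodic_deriv {L : ℝ} {u : ℝ → ℝ} (hu : Function.Periodic u L) :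
    Function.Periodic (deriv u) L := by
  intro x
  rw [← deriv_comp_add_const, show (fun y => u (y + L)) = u from funext hu]

namespace SmoothPeriodic

variable {L : ℝ} {u v : ℝ → ℝ}

lemma continuous (hu : SmoothPeriodic L u) : Continuous u := hu.smooth.continuous

lemma differentiable (hu : SmoothPeriodic L u) : Differentiable ℝ u :=
  hu.smooth.differentiable (by simp)

lemma hasDerivAt (hu : SmoothPeriodic L u) (x : ℝ) : HasDerivAt u (deriv u x) x :=
  (hu.differentiable x).hasDerivAt

lemma deriv (hu : SmoothPeriodic L u) : SmoothPeriodic L (deriv u) :=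
  ⟨((contDiff_succ_iff_deriv (n := ((⊤ : ℕ∞) : WithTop ℕ∞))).1 hu.smooth).2.2,
    periodic_deriv hu.periodic⟩

lemma const (L a : ℝ) : SmoothPeriodic L (fun _ => a) := ⟨contDiff_const, fun _ => rfl⟩

lemma add (hu : SmoothPeriodic L u) (hv : SmoothPeriodic L v) :
    SmoothPeriodic L (fun x => u x + v x) :=
  ⟨hu.smooth.add hv.smooth, fun x => by simp only [hu.periodic x, hv.periodic x]⟩

lemma sub (hu : SmoothPeriodic L u) (hv : SmoothPeriodic L v) :
    SmoothPeriodic L (fun x => u x - v x) :=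
  ⟨hu.smooth.sub hv.smooth, fun x => by simp only [hu.periodic x, hv.periodic x]⟩

lemma neg (hu : SmoothPeriodic L u) : SmoothPeriodic L (fun x => -u x) :=
  ⟨hu.smooth.neg, fun x => by simp only [hu.periodic x]⟩

lemma mul (hu : SmoothPeriodic L u) (hv : SmoothPeriodic L v) :
    SmoothPeriodic L (fun x => u x * v x) :=
  ⟨hu.smooth.mul hv.smooth, fun x => by simp only [hu.periodic x, hv.periodic x]⟩

lemma const_mul (a : ℝ) (hu : SmoothPeriodic L u) : SmoothPeriodic L (fun x => a * u x) :=
  (const L a).mul hu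

lemma pow (hu : SmoothPeriodic L u) (n : ℕ) : SmoothPeriodic L (fun x => u x ^ n) :=
  ⟨hu.smooth.pow n, fun x => by simp only [hu.periodic x]⟩

lemma inv (hu : SmoothPeriodic L u) (h0 : ∀ x, 0 < u x) : SmoothPeriodic L (fun x => (u x)⁻¹) :=
  ⟨hu.smooth.inv fun x => (h0 x).ne', fun x => by simp only [hu.periodic x]⟩

lemma div (hu : SmoothPeriodic L u) (hv : SmoothPeriodic L v) (h0 : ∀ x, 0 < v x) :
    SmoothPeriodic L (fun x => u x / v x) := by
  simpa only [div_eq_mul_inv] using hu.mul (hv.inv h0)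

lemma sum {ι : Type*} (s : Finset ι) {f : ι → ℝ → ℝ} (hf : ∀ i ∈ s, SmoothPeriodic L (f i)) :
    SmoothPeriodic L (fun x => ∑ i ∈ s, f i x) :=
  ⟨ContDiff.sum fun i hi => (hf i hi).smooth,
    fun x => Finset.sum_congr rfl fun i hi => (hf i hi).periodic x⟩

/-- Integration by parts over a period. -/
lemma integral_deriv_mul (hu : SmoothPeriodic L u) (hv : SmoothPeriodic L v) :
    ∫ x in (0 : ℝ)..L, _root_.deriv u x * v x = -∫ x in (0 : ℝ)..L, u x * _root_.deriv v x := by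
  rw [intervalIntegral.integral_mul_deriv_eq_deriv_mul (fun x _ => hu.hasDerivAt x)
    (fun x _ => hv.hasDerivAt x) (hu.deriv.continuous.intervalIntegrable _ _)
    (hv.deriv.continuous.intervalIntegrable _ _)]
  have h1 := hu.periodic 0
  have h2 := hv.periodic 0
  rw [zero_add] at h1 h2
  rw [h1, h2]
  ring

lemma integral_deriv (hu : SmoothPeriodic L u) : ∫ x in (0 : ℝ)..L, _root_.deriv u x = 0 := by
  have := hu.integral_deriv_mul (const L 1)
  simpa using this

end SmoothPeriodic

lemma periodic_bound_of_Icc {L : ℝ} (hL : 0 < L) {u : ℝ → ℝ} (hu : Function.Periodic u L)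
    {P : ℝ → Prop} (h : ∀ x ∈ Icc 0 L, P (u x)) (x : ℝ) : P (u x) := by
  obtain ⟨y, hy, hxy⟩ := hu.exists_mem_Ico₀ hL x
  rw [hxy]
  exact h y ⟨hy.1, hy.2.le⟩

/-! ### Cauchy–Schwarz, supremum and interpolation inequalities over a period. -/

section L2

variable {L : ℝ} {u v w : ℝ → ℝ}

lemma l2_nonneg : 0 ≤ l2 L u := Real.sqrt_nonneg _

lemma integral_sq_nonneg (hL : 0 ≤ L) : 0 ≤ ∫ x in (0 : ℝ)..L, u x ^ 2 :=
  intervalIntegral.integral_nonneg hL fun _ _ => sq_nonneg _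

lemma sq_l2 (hL : 0 ≤ L) : l2 L u ^ 2 = ∫ x in (0 : ℝ)..L, u x ^ 2 :=
  Real.sq_sqrt (integral_sq_nonneg hL)

lemma l2_neg : l2 L (fun x => -u x) = l2 L u := by simp [l2]

lemma l2_abs : l2 L (fun x => |u x|) = l2 L u := by simp [l2]

/-- The Cauchy–Schwarz inequality. -/
lemma abs_integral_mul_le (hL : 0 ≤ L) (hu : Continuous u) (hv : Continuous v) :
    |∫ x in (0 : ℝ)..L, u x * v x| ≤ l2 L u * l2 L v := by
  set A := ∫ x in (0 : ℝ)..L, u x ^ 2 with hA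
  set B := ∫ x in (0 : ℝ)..L, u x * v x with hB
  set C := ∫ x in (0 : ℝ)..L, v x ^ 2 with hC
  have key : ∀ t : ℝ, 0 ≤ A * (t * t) + (2 * B) * t + C := by
    intro t
    have h : ∫ x in (0 : ℝ)..L, (t * u x + v x) ^ 2 = A * (t * t) + (2 * B) * t + C := by
      rw [show (fun x => (t * u x + v x) ^ 2)
        = fun x => (t * t) * u x ^ 2 + (2 * t) * (u x * v x) + v x ^ 2 from by ext x; ring]
      rw [intervalIntegral.integral_add, intervalIntegral.integral_add,
        intervalIntegral.integral_const_mul, intervalIntegral.integral_const_mul]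
      · ring
      all_goals exact Continuous.intervalIntegrable (by fun_prop) _ _
    rw [← h]
    exact integral_sq_nonneg hL
  have hd := discrim_le_zero key
  rw [discrim] at hd
  rw [l2, l2, ← Real.sqrt_mul (integral_sq_nonneg hL)]
  apply Real.abs_le_sqrt
  nlinarith

lemma integral_mul_le (hL : 0 ≤ L) (hu : Continuous u) (hv : Continuous v) :
    ∫ x in (0 : ℝ)..L, u x * v x ≤ l2 L u * l2 L v :=
  (le_abs_self _).trans (abs_integral_mul_le hL hu hv)

lemma l2_add_le (hL : 0 ≤ L) (hu : Continuous u) (hv : Continuous v) :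
    l2 L (fun x => u x + v x) ≤ l2 L u + l2 L v := by
  apply Real.sqrt_le_iff.2 ⟨add_nonneg l2_nonneg l2_nonneg, ?_⟩
  have h1 := integral_mul_le hL hu hv
  rw [show (fun x => (u x + v x) ^ 2) = fun x => u x ^ 2 + 2 * (u x * v x) + v x ^ 2 from by
    ext x; ring]
  rw [intervalIntegral.integral_add, intervalIntegral.integral_add,
    intervalIntegral.integral_const_mul, ← sq_l2 hL, ← sq_l2 hL]
  · nlinarith
  all_goals exact Continuous.intervalIntegrable (by fun_prop) _ _

lemma l2_sub_le (hL : 0 ≤ L) (hu : Continuous u) (hv : Continuous v) :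
    l2 L (fun x => u x - v x) ≤ l2 L u + l2 L v := by
  have := l2_add_le hL hu hv.neg
  rw [Pi.neg_def, l2_neg] at this
  simpa only [sub_eq_add_neg] using this

lemma l2_le_mul_of_abs_le (hL : 0 ≤ L) (hu : Continuous u) (hv : Continuous v) {C : ℝ}
    (hC : 0 ≤ C) (h : ∀ x, |u x| ≤ C * |v x|) : l2 L u ≤ C * l2 L v := by
  apply Real.sqrt_le_iff.2 ⟨mul_nonneg hC l2_nonneg, ?_⟩
  rw [mul_pow, sq_l2 hL, ← intervalIntegral.integral_const_mul]
  apply intervalIntegral.integral_mono_on hL (Continuous.intervalIntegrable (by fun_prop) _ _)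
    (Continuous.intervalIntegrable (by fun_prop) _ _)
  intro x _
  have := pow_le_pow_left₀ (abs_nonneg _) (h x) 2
  rwa [mul_pow, sq_abs, sq_abs] at this

lemma l2_mul_le (hL : 0 ≤ L) (hu : Continuous u) (hv : Continuous v) {C : ℝ}
    (h : ∀ x, |u x| ≤ C) : l2 L (fun x => u x * v x) ≤ C * l2 L v :=
  l2_le_mul_of_abs_le hL (hu.mul hv) hv ((abs_nonneg _).trans (h 0)) fun x => by
    change |u x * v x| ≤ _; rw [abs_mul]; exact mul_le_mul_of_nonneg_right (h x) (abs_nonneg _)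

lemma l2_const (hL : 0 ≤ L) {C : ℝ} (hC : 0 ≤ C) : l2 L (fun _ => C) = √L * C := by
  rw [l2, intervalIntegral.integral_const, sub_zero, smul_eq_mul, Real.sqrt_mul hL,
    Real.sqrt_sq hC]

lemma l2_const_mul {C : ℝ} : l2 L (fun x => C * u x) = |C| * l2 L u := by
  rw [l2, l2]
  simp_rw [mul_pow]
  rw [intervalIntegral.integral_const_mul, Real.sqrt_mul (sq_nonneg _), Real.sqrt_sq_eq_abs]

lemma integral_abs_le (hL : 0 ≤ L) (hu : Continuous u) :
    ∫ x in (0 : ℝ)..L, |u x| ≤ √L * l2 L u := by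
  have := integral_mul_le hL (continuous_const (y := (1 : ℝ))) hu.abs
  rw [l2_const hL zero_le_one, l2_abs] at this
  simpa using this

/-- Increments are controlled by the integral of the derivative over a period. -/
lemma abs_sub_le_integral (hL : 0 < L) (hu : SmoothPeriodic L u) (x y : ℝ) :
    |u x - u y| ≤ ∫ t in (0 : ℝ)..L, |deriv u t| := by
  have hc : Continuous fun t => |deriv u t| := hu.deriv.continuous.abs
  have key : ∀ x ∈ Icc 0 L, ∀ y ∈ Icc 0 L, y ≤ x →
      |u x - u y| ≤ ∫ t in (0 : ℝ)..L, |deriv u t| := by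
    intro x hx y hy hyx
    rw [← intervalIntegral.integral_eq_sub_of_hasDerivAt (fun t _ => hu.hasDerivAt t)
      (hu.deriv.continuous.intervalIntegrable _ _)]
    refine (intervalIntegral.abs_integral_le_integral_abs hyx).trans ?_
    exact intervalIntegral.integral_mono_interval hy.1 hyx hx.2
      (Eventually.of_forall fun t => abs_nonneg _) (hc.intervalIntegrable _ _)
  refine periodic_bound_of_Icc hL hu.periodic (P := fun s => |s - u y| ≤ _) (fun x hx => ?_) x
  refine periodic_bound_of_Icc hL hu.periodic (P := fun s => |u x - s| ≤ _) (fun y hy => ?_) y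
  rcases le_total y x with h | h
  · exact key x hx y hy h
  · rw [abs_sub_comm]; exact key y hy x hx h

lemma abs_sub_le_l2 (hL : 0 < L) (hu : SmoothPeriodic L u) (x y : ℝ) :
    |u x - u y| ≤ √L * l2 L (deriv u) :=
  (abs_sub_le_integral hL hu x y).trans (integral_abs_le hL.le hu.deriv.continuous)

/-- The derivative of `u²` is `2 u u'`, whose integral is bounded by Cauchy–Schwarz. The product
form of the bound, rather than a sum of norms, is what produces the scaling exponents used later. -/
lemma sq_sub_sq_le (hL : 0 < L) (hu : SmoothPeriodic L u) (x y : ℝ) :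
    u x ^ 2 - u y ^ 2 ≤ 2 * (l2 L u * l2 L (deriv u)) := by
  refine ((le_abs_self _).trans (abs_sub_le_integral hL (hu.pow 2) x y)).trans ?_
  have h : ∀ t, deriv (fun x => u x ^ 2) t = 2 * (u t * deriv u t) := fun t => by
    rw [((hu.hasDerivAt t).fun_pow 2).deriv]; ring
  simp_rw [h, abs_mul, abs_two]
  rw [intervalIntegral.integral_const_mul]
  have := integral_mul_le hL.le hu.continuous.abs hu.deriv.continuous.abs
  rw [l2_abs, l2_abs] at this
  linarith

lemma SmoothPeriodic.exists_deriv_eq_zero (hL : 0 < L) (hu : SmoothPeriodic L u) :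
    ∃ x, _root_.deriv u x = 0 := by
  have h1 := hu.periodic 0
  rw [zero_add] at h1
  obtain ⟨x, -, hx⟩ := _root_.exists_deriv_eq_zero hL hu.continuous.continuousOn h1.symm
  exact ⟨x, hx⟩

/-- A derivative vanishes somewhere, which gives a supremum bound. -/
lemma sq_deriv_le (hL : 0 < L) (hu : SmoothPeriodic L u) (x : ℝ) :
    deriv u x ^ 2 ≤ 2 * (l2 L (deriv u) * l2 L (deriv (deriv u))) := by
  obtain ⟨y, hy⟩ := hu.exists_deriv_eq_zero hL
  have := sq_sub_sq_le hL hu.deriv x y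
  rw [hy] at this
  simpa using this

/-- Integration by parts: `∫ u'² = -∫ u u''`. -/
lemma sq_l2_deriv_le (hL : 0 ≤ L) (hu : SmoothPeriodic L u) :
    l2 L (deriv u) ^ 2 ≤ l2 L u * l2 L (deriv (deriv u)) := by
  rw [sq_l2 hL]
  simp_rw [pow_two]
  rw [hu.integral_deriv_mul hu.deriv]
  exact (neg_le_abs _).trans (abs_integral_mul_le hL hu.continuous hu.deriv.deriv.continuous)

lemma exists_le_of_integral_le (hL : 0 < L) (hu : Continuous u) {C : ℝ}
    (h : ∫ x in (0 : ℝ)..L, u x ≤ C * L) : ∃ x ∈ Icc 0 L, u x ≤ C := by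
  by_contra! hcon
  have : ∫ x in (0 : ℝ)..L, (C : ℝ) < ∫ x in (0 : ℝ)..L, u x :=
    intervalIntegral.integral_lt_integral_of_continuousOn_of_le_of_exists_lt hL
      continuousOn_const hu.continuousOn (fun x hx => (hcon x ⟨hx.1.le, hx.2⟩).le)
      ⟨0, ⟨le_rfl, hL.le⟩, hcon 0 ⟨le_rfl, hL.le⟩⟩
  rw [intervalIntegral.integral_const] at this
  simp only [sub_zero, smul_eq_mul] at this
  linarith

/-- Somewhere `u²` is at most its mean value; `sq_sub_sq_le` transports this to every point. -/
lemma sq_le_of_l2 (hL : 0 < L) (hu : SmoothPeriodic L u) (x : ℝ) :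
    u x ^ 2 ≤ l2 L u ^ 2 / L + 2 * (l2 L u * l2 L (deriv u)) := by
  obtain ⟨y, -, hy⟩ := exists_le_of_integral_le hL (u := fun x => u x ^ 2)
    (by have := hu.continuous; fun_prop) (C := l2 L u ^ 2 / L)
    (by rw [sq_l2 hL.le]; exact (div_mul_cancel₀ _ hL.ne').ge)
  have := sq_sub_sq_le hL hu x y
  linarith

lemma eq_zero_of_integral_sq_eq_zero (hL : 0 < L) (hu : SmoothPeriodic L u)
    (h : ∫ x in (0 : ℝ)..L, u x ^ 2 = 0) (x : ℝ) : u x = 0 := by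
  have h1 : l2 L u = 0 := by rw [l2, h, Real.sqrt_zero]
  have := sq_le_of_l2 hL hu x
  rw [h1] at this
  simp only [ne_eq, OfNat.ofNat_ne_zero, not_false_eq_true, zero_pow, zero_div, zero_mul, mul_zero,
    add_zero] at this
  exact pow_eq_zero_iff two_ne_zero |>.1 (le_antisymm this (sq_nonneg _))

/-- Increments over a segment inside a period. -/
lemma abs_sub_le_sqrt (hu : SmoothPeriodic L u) {x y : ℝ} (hx : x ∈ Icc 0 L)
    (hy : y ∈ Icc 0 L) : |u x - u y| ≤ l2 L (deriv u) * √|x - y| := by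
  wlog hyx : y ≤ x generalizing x y
  · rw [abs_sub_comm, abs_sub_comm x]
    exact this hy hx (le_of_not_ge hyx)
  have hc : Continuous (deriv u) := hu.deriv.continuous
  have h1 : u x - u y = ∫ t in (0 : ℝ)..(x - y), deriv u (t + y) := by
    rw [intervalIntegral.integral_comp_add_right, zero_add, sub_add_cancel]
    exact (intervalIntegral.integral_eq_sub_of_hasDerivAt (fun t _ => hu.hasDerivAt t)
      (hc.intervalIntegrable _ _)).symm
  have hxy : 0 ≤ x - y := sub_nonneg.2 hyx
  have h2 := abs_integral_mul_le hxy (continuous_const (y := (1 : ℝ)))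
    (show Continuous fun t => deriv u (t + y) by fun_prop)
  rw [l2_const hxy zero_le_one] at h2
  simp only [one_mul, mul_one] at h2
  rw [h1, abs_of_nonneg hxy, mul_comm]
  refine h2.trans (mul_le_mul_of_nonneg_left ?_ (Real.sqrt_nonneg _))
  apply Real.sqrt_le_sqrt
  rw [intervalIntegral.integral_comp_add_right (f := fun t => deriv u t ^ 2), zero_add,
    sub_add_cancel]
  exact intervalIntegral.integral_mono_interval hy.1 hyx hx.2
    (Eventually.of_forall fun t => sq_nonneg _)
    (Continuous.intervalIntegrable (by fun_prop) _ _)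

end L2


/-! ## The energy and its variational derivatives

Everything is written in terms of `a = h + ε`, which makes the formulas independent of `ε`. -/

/-- The double well potential. -/
noncomputable def doubleWell (s : ℝ) : ℝ := (s ^ 2 - 1) ^ 2 / 4

/-- The free energy `∫ a_x²/2 + 1/(6a²) + a (W(c) + c_x²/2)`. -/
noncomputable def energy (L : ℝ) (a c : ℝ → ℝ) : ℝ :=
  ∫ x in (0 : ℝ)..L, (deriv a x ^ 2 / 2 + (a x)⁻¹ ^ 2 / 6
    + a x * (doubleWell (c x) + deriv c x ^ 2 / 2))

/-- The flux of the film height. -/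
noncomputable def flux (a c : ℝ → ℝ) (x : ℝ) : ℝ :=
  a x ^ 3 * deriv (deriv (deriv a)) x
    - (deriv a x * (a x)⁻¹
      + a x ^ 2 * (deriv a x * deriv c x ^ 2 + 2 * a x * deriv c x * deriv (deriv c) x))

/-- The chemical potential. -/
noncomputable def pot (a c : ℝ → ℝ) (x : ℝ) : ℝ :=
  c x ^ 3 - c x - deriv a x * deriv c x * (a x)⁻¹ - deriv (deriv c) x

/-- The variational derivative of the energy in the film height. -/
noncomputable def enVar (a c : ℝ → ℝ) (x : ℝ) : ℝ :=
  -deriv (deriv a) x - (a x)⁻¹ ^ 3 / 3 + doubleWell (c x) + deriv c x ^ 2 / 2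

/-- The energy dissipation rate. -/
noncomputable def dissipation (L : ℝ) (a c : ℝ → ℝ) : ℝ :=
  ∫ x in (0 : ℝ)..L, (flux a c x ^ 2 * (a x)⁻¹ ^ 3 + a x * deriv (pot a c) x ^ 2)

section

variable {L : ℝ} {a c : ℝ → ℝ}

lemma SmoothPeriodic.doubleWell (hc : SmoothPeriodic L c) :
    SmoothPeriodic L (fun x => doubleWell (c x)) := by
  unfold ThinFilm.doubleWell
  exact (((hc.pow 2).sub (SmoothPeriodic.const L 1)).pow 2).div (SmoothPeriodic.const L 4)
    fun _ => by norm_num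

lemma smoothPeriodic_flux (ha : SmoothPeriodic L a) (hc : SmoothPeriodic L c)
    (h0 : ∀ x, 0 < a x) : SmoothPeriodic L (flux a c) :=
  ((ha.pow 3).mul ha.deriv.deriv.deriv).sub ((ha.deriv.mul (ha.inv h0)).add
    ((ha.pow 2).mul ((ha.deriv.mul (hc.deriv.pow 2)).add
      (((ha.const_mul 2).mul hc.deriv).mul hc.deriv.deriv))))

lemma smoothPeriodic_pot (ha : SmoothPeriodic L a) (hc : SmoothPeriodic L c)
    (h0 : ∀ x, 0 < a x) : SmoothPeriodic L (pot a c) :=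
  (((hc.pow 3).sub hc).sub ((ha.deriv.mul hc.deriv).mul (ha.inv h0))).sub hc.deriv.deriv

lemma smoothPeriodic_enVar (ha : SmoothPeriodic L a) (hc : SmoothPeriodic L c)
    (h0 : ∀ x, 0 < a x) : SmoothPeriodic L (enVar a c) :=
  (((ha.deriv.deriv.neg).sub (((ha.inv h0).pow 3).div (SmoothPeriodic.const L 3)
    fun _ => by norm_num)).add hc.doubleWell).add ((hc.deriv.pow 2).div (SmoothPeriodic.const L 2)
    fun _ => by norm_num)

lemma hasDerivAt_doubleWell (s : ℝ) : HasDerivAt doubleWell (s ^ 3 - s) s := by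
  unfold doubleWell
  have := ((((hasDerivAt_id s).pow 2).sub_const 1).pow 2).div_const 4
  refine (this.congr_deriv ?_)
  simp
  ring

/-- This is the gradient structure of the system: the height flux equals `-a³` times the pressure
gradient, up to the term `c_x μ` that accounts for the transported concentration. -/
lemma deriv_enVar (ha : SmoothPeriodic L a) (hc : SmoothPeriodic L c) (h0 : ∀ x, 0 < a x)
    (x : ℝ) : deriv (enVar a c) x = deriv c x * pot a c x - flux a c x * (a x)⁻¹ ^ 3 := by
  have h := (((ha.deriv.deriv.hasDerivAt x).neg.sub
    ((((ha.hasDerivAt x).inv (h0 x).ne').pow 3).div_const 3)).add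
    ((hasDerivAt_doubleWell (c x)).comp x (hc.hasDerivAt x))).add
    (((hc.deriv.hasDerivAt x).pow 2).div_const 2)
  have h2 : HasDerivAt (enVar a c) _ x := h
  rw [h2.deriv, pot, flux]
  have := (h0 x).ne'
  simp only [Pi.inv_apply, Nat.cast_ofNat, show 3 - 1 = 2 from rfl,
    show 2 - 1 = 1 from rfl, pow_one]
  field_simp
  ring

lemma SmoothPeriodic.log (ha : SmoothPeriodic L a) (h0 : ∀ x, 0 < a x) :
    SmoothPeriodic L (fun x => Real.log (a x)) :=
  ⟨ha.smooth.log fun x => (h0 x).ne', fun x => by simp only [ha.periodic x]⟩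

lemma doubleWell_nonneg (s : ℝ) : 0 ≤ doubleWell s := by unfold doubleWell; positivity

lemma energy_eq (ha : SmoothPeriodic L a) (hc : SmoothPeriodic L c) (h0 : ∀ x, 0 < a x) :
    energy L a c = (∫ x in (0 : ℝ)..L, deriv a x ^ 2) / 2
      + (∫ x in (0 : ℝ)..L, (a x)⁻¹ ^ 2) / 6 + (∫ x in (0 : ℝ)..L, a x * doubleWell (c x))
      + (∫ x in (0 : ℝ)..L, a x * deriv c x ^ 2) / 2 := by
  have c1 := ha.continuous
  have c2 := ha.deriv.continuous
  have c3 := (ha.inv h0).continuous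
  have c4 := hc.deriv.continuous
  have c5 := hc.doubleWell.continuous
  rw [← intervalIntegral.integral_div, ← intervalIntegral.integral_div,
    ← intervalIntegral.integral_div, ← intervalIntegral.integral_add,
    ← intervalIntegral.integral_add, ← intervalIntegral.integral_add, energy]
  · congr 1; ext x; ring
  all_goals exact Continuous.intervalIntegrable (by fun_prop) _ _

/-- What a bound on the energy says about its individual terms. -/
lemma energy_terms_le (hL : 0 ≤ L) (ha : SmoothPeriodic L a) (hc : SmoothPeriodic L c)
    (h0 : ∀ x, 0 < a x) {e : ℝ} (he : energy L a c ≤ e) :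
    (∫ x in (0 : ℝ)..L, deriv a x ^ 2) ≤ 2 * e ∧ (∫ x in (0 : ℝ)..L, (a x)⁻¹ ^ 2) ≤ 6 * e ∧
    (∫ x in (0 : ℝ)..L, a x * doubleWell (c x)) ≤ e ∧
    (∫ x in (0 : ℝ)..L, a x * deriv c x ^ 2) ≤ 2 * e := by
  rw [energy_eq ha hc h0] at he
  have h1 := integral_sq_nonneg (u := deriv a) hL
  have h2 := integral_sq_nonneg (u := fun x => (a x)⁻¹) hL
  have h3 : 0 ≤ ∫ x in (0 : ℝ)..L, a x * doubleWell (c x) :=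
    intervalIntegral.integral_nonneg hL fun x _ => mul_nonneg (h0 x).le (doubleWell_nonneg _)
  have h4 : 0 ≤ ∫ x in (0 : ℝ)..L, a x * deriv c x ^ 2 :=
    intervalIntegral.integral_nonneg hL fun x _ => mul_nonneg (h0 x).le (sq_nonneg _)
  refine ⟨?_, ?_, ?_, ?_⟩ <;> linarith

lemma energy_pos (hL : 0 < L) (ha : SmoothPeriodic L a) (hc : SmoothPeriodic L c)
    (h0 : ∀ x, 0 < a x) : 0 < energy L a c := by
  have c1 := ha.continuous
  have c2 := ha.deriv.continuous
  have c3 := (ha.inv h0).continuous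
  have c4 := hc.deriv.continuous
  have c5 := hc.doubleWell.continuous
  have hp : ∀ x, 0 < deriv a x ^ 2 / 2 + (a x)⁻¹ ^ 2 / 6
      + a x * (doubleWell (c x) + deriv c x ^ 2 / 2) := fun x => by
    have := h0 x
    have := doubleWell_nonneg (c x)
    positivity
  apply intervalIntegral.intervalIntegral_pos_of_pos_on
    (Continuous.intervalIntegrable (by fun_prop) _ _) (fun x _ => hp x) hL

/-- A height of bounded energy is bounded away from zero. -/
theorem exists_pos_le_of_energy_le (hL : 0 < L) {e : ℝ} (he : 0 < e) :
    ∃ m : ℝ, 0 < m ∧ ∀ a c : ℝ → ℝ, SmoothPeriodic L a → SmoothPeriodic L c → (∀ x, 0 < a x) →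
      energy L a c ≤ e → ∀ x, m ≤ a x := by
  refine ⟨√(L / (6 * e)) * Real.exp (-(√(2 * e) * √(6 * e))), by positivity, ?_⟩
  intro a c ha hc h0 hE x
  obtain ⟨h1, h2, -, -⟩ := energy_terms_le hL.le ha hc h0 hE
  have hi := (ha.inv h0).continuous
  -- A point where `1/a²` does not exceed its average, hence where `a` is not small.
  obtain ⟨y, -, hy⟩ := exists_le_of_integral_le hL (u := fun x => (a x)⁻¹ ^ 2) (by fun_prop)
    (C := 6 * e / L) (by rw [div_mul_cancel₀ _ hL.ne']; exact h2)
  have hay : √(L / (6 * e)) ≤ a y := by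
    apply Real.sqrt_le_iff.2 ⟨(h0 y).le, ?_⟩
    rw [inv_pow, inv_le_comm₀ (by have := h0 y; positivity) (by positivity), inv_div] at hy
    exact hy
  -- The derivative of `log a` is `a_x / a`, a product of two functions whose `L²` norms are
  -- controlled by the energy. Thus `a` can drop from its value at `y` only by a fixed factor.
  have hlog : Real.log (a y) - Real.log (a x) ≤ √(2 * e) * √(6 * e) := by
    refine ((le_abs_self _).trans (abs_sub_le_integral hL (ha.log h0) y x)).trans ?_
    have hd : ∀ t, deriv (fun x => Real.log (a x)) t = deriv a t * (a t)⁻¹ := fun t => by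
      rw [((ha.hasDerivAt t).log (h0 t).ne').deriv, div_eq_mul_inv]
    simp_rw [hd, abs_mul]
    refine (integral_mul_le hL.le ha.deriv.continuous.abs hi.abs).trans ?_
    rw [l2_abs, l2_abs]
    exact mul_le_mul (Real.sqrt_le_sqrt h1) (Real.sqrt_le_sqrt h2) l2_nonneg (Real.sqrt_nonneg _)
  calc √(L / (6 * e)) * Real.exp (-(√(2 * e) * √(6 * e)))
      ≤ a y * Real.exp (Real.log (a x) - Real.log (a y)) := by
        have := h0 y
        gcongr
        linarith
    _ = a x := by
        rw [Real.exp_sub, Real.exp_log (h0 x), Real.exp_log (h0 y)]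
        have := (h0 y).ne'
        field_simp

/-- The bounds on height and concentration that follow from a bound on the energy. -/
structure Bounds (L K : ℝ) (a c : ℝ → ℝ) : Prop where
  two_le : 2 ≤ K
  sqrt_le : √L ≤ K
  smooth_a : SmoothPeriodic L a
  smooth_c : SmoothPeriodic L c
  inv_le : ∀ x, K⁻¹ ≤ a x
  le : ∀ x, a x ≤ K
  abs_c_le : ∀ x, |c x| ≤ K
  l2_a : l2 L (deriv a) ≤ K
  l2_c : l2 L (deriv c) ≤ K

theorem exists_bounds_of_energy_le (hL : 0 < L) {e : ℝ} (he : 0 < e) (X₁ : ℝ) :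
    ∃ K : ℝ, 2 ≤ K ∧ ∀ a c : ℝ → ℝ, SmoothPeriodic L a → SmoothPeriodic L c → (∀ x, 0 < a x) →
      ∫ x in (0 : ℝ)..L, a x ≤ X₁ → energy L a c ≤ e → Bounds L K a c := by
  obtain ⟨m, hm, hml⟩ := exists_pos_le_of_energy_le hL he
  set B := √(2 * e) with hB
  set C := √(2 * e / m) with hC
  have hB0 : 0 ≤ B := Real.sqrt_nonneg _
  have hC0 : 0 ≤ C := Real.sqrt_nonneg _
  have hLs := Real.sqrt_nonneg L
  set D := 4 * e / (m * L) + 2 with hD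
  have hD0 : 0 ≤ D := by positivity
  -- One constant for all bounds, namely their sum. `B` and `C` bound the slopes, and `D` bounds
  -- `|c|` at a point where the double well density is at most its average.
  refine ⟨2 + √L + m⁻¹ + (|X₁| / L + √L * B) + (D + √L * C) + B + C, ?_, ?_⟩
  · have : 0 ≤ m⁻¹ := by positivity
    have : 0 ≤ |X₁| / L + √L * B := by positivity
    have : 0 ≤ D + √L * C := by positivity
    linarith
  intro a c ha hc h0 hX hE
  have hma := hml a c ha hc h0 hE
  obtain ⟨h1, h2, h3, h4⟩ := energy_terms_le hL.le ha hc h0 hE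
  have e1 : 0 ≤ m⁻¹ := by positivity
  have e2 : 0 ≤ |X₁| / L + √L * B := by positivity
  have e3 : 0 ≤ D + √L * C := by positivity
  have hla : l2 L (deriv a) ≤ B := Real.sqrt_le_sqrt h1
  have cc := hc.continuous
  have cc' := hc.deriv.continuous
  have ca := ha.continuous
  have hlc : l2 L (deriv c) ≤ C := by
    apply Real.sqrt_le_sqrt
    rw [le_div_iff₀ hm, mul_comm, ← intervalIntegral.integral_const_mul]
    refine (intervalIntegral.integral_mono_on hL.le ?_ ?_ ?_).trans h4
    · exact Continuous.intervalIntegrable (by fun_prop) _ _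
    · exact Continuous.intervalIntegrable (by fun_prop) _ _
    · exact fun x _ => mul_le_mul_of_nonneg_right (hma x) (sq_nonneg _)
  refine ⟨by linarith, by linarith, ha, hc, ?_, ?_, ?_, by linarith, by linarith⟩
  · intro x
    refine le_trans ?_ (hma x)
    rw [inv_le_comm₀ (by linarith) hm]
    linarith
  · intro x
    obtain ⟨y, -, hy⟩ := exists_le_of_integral_le hL ca (C := |X₁| / L)
      (by rw [div_mul_cancel₀ _ hL.ne']; exact hX.trans (le_abs_self _))
    have := (le_abs_self _).trans (abs_sub_le_l2 hL ha x y)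
    have := mul_le_mul_of_nonneg_left hla hLs
    linarith
  · intro x
    obtain ⟨y, -, hy⟩ := exists_le_of_integral_le hL hc.doubleWell.continuous (C := e / (m * L))
      (by
        have : ∫ x in (0 : ℝ)..L, m * doubleWell (c x) ≤ e := by
          refine (intervalIntegral.integral_mono_on hL.le ?_ ?_ ?_).trans h3
          · exact ((hc.doubleWell.const_mul m).continuous).intervalIntegrable _ _
          · exact ((ha.mul hc.doubleWell).continuous).intervalIntegrable _ _
          · exact fun x _ => mul_le_mul_of_nonneg_right (hma x) (doubleWell_nonneg _)
        rw [intervalIntegral.integral_const_mul] at this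
        have e5 : e / (m * L) * L = e / m := by field_simp
        rw [e5, le_div_iff₀ hm]
        linarith)
    have hcy : |c y| ≤ D := by
      unfold doubleWell at hy
      have e6 : 4 * e / (m * L) = 4 * (e / (m * L)) := by ring
      rw [hD, e6]
      have hz : 0 ≤ e / (m * L) := by positivity
      refine abs_le_of_sq_le_sq ?_ (by positivity)
      nlinarith [sq_nonneg (c y ^ 2 - 2), sq_nonneg (c y ^ 2 - 1)]
    have h5 := abs_sub_le_l2 hL hc x y
    have h6 := mul_le_mul_of_nonneg_left hlc hLs
    have h7 : |c x| ≤ |c x - c y| + |c y| := by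
      simpa using abs_add_le (c x - c y) (c y)
    linarith

end


/-! ## Almost stationary states have bounded energy -/

/-- Nearly stationary states: the chemical potential and the pressure have small variation. -/
structure NearStationary (L X₀ X₁ m₁ : ℝ) (a c : ℝ → ℝ) : Prop where
  smooth_a : SmoothPeriodic L a
  smooth_c : SmoothPeriodic L c
  pos : ∀ x, 0 < a x
  le_mass : X₀ ≤ ∫ x in (0 : ℝ)..L, a x
  mass_le : ∫ x in (0 : ℝ)..L, a x ≤ X₁
  moment_le : |∫ x in (0 : ℝ)..L, a x * c x| ≤ m₁
  pot_le : ∫ x in (0 : ℝ)..L, |deriv (pot a c) x| ≤ 1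
  flux_le : ∫ x in (0 : ℝ)..L, |flux a c x * (a x)⁻¹ ^ 3| ≤ 1

/-- The cubic term `β s³` is absorbed by the square of `s²/2 - β s`. What remains below fourth order
is at most `k s² + 2 b + 1` for precisely this `k`, and `k s²` is absorbed by the square of `s²/2 -
k`. -/
lemma quartic_coercive {b k s β : ℝ} (hk : k = b ^ 2 + b + 2) (hb : |β| ≤ b) :
    s ^ 4 / 4 - (k ^ 2 + 2 * b + 1) ≤ (s ^ 3 - s) * (s - β) - |s - β| := by
  have hb0 : 0 ≤ b := (abs_nonneg _).trans hb
  have h1 : |s - β| ≤ |s| + b := (abs_sub _ _).trans (by linarith)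
  have h2 : β ^ 2 ≤ b ^ 2 := by rw [← sq_abs]; exact pow_le_pow_left₀ (abs_nonneg _) hb 2
  have h3 : |s| ≤ s ^ 2 + 1 := by nlinarith [sq_abs s, sq_nonneg (|s| - 1), abs_nonneg s]
  have h4 : -(b * |s|) ≤ β * s := by
    have : |β * s| ≤ b * |s| := by rw [abs_mul]; exact mul_le_mul_of_nonneg_right hb (abs_nonneg _)
    linarith [neg_abs_le (β * s)]
  have h5 : b * |s| ≤ b * (s ^ 2 + 1) := mul_le_mul_of_nonneg_left h3 hb0
  have h6 : β ^ 2 * s ^ 2 ≤ b ^ 2 * s ^ 2 := mul_le_mul_of_nonneg_right h2 (sq_nonneg _)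
  have h7 := sq_nonneg (s ^ 2 / 2 - β * s)
  have h8 := sq_nonneg (s ^ 2 / 2 - k)
  have h9 : k * s ^ 2 = b ^ 2 * s ^ 2 + b * s ^ 2 + 2 * s ^ 2 := by rw [hk]; ring
  nlinarith [sq_nonneg (s ^ 2)]

lemma abs_cube_sub_le (s : ℝ) : |s ^ 3 - s| ≤ s ^ 4 + 1 := by
  rw [abs_le]
  constructor <;>
  nlinarith [sq_nonneg (s ^ 2 - 1 - s), sq_nonneg (s ^ 2 - 1 + s), sq_nonneg s, sq_nonneg (s ^ 2)]

lemma doubleWell_le (s : ℝ) : doubleWell s ≤ s ^ 4 + 1 := by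
  unfold doubleWell
  nlinarith [sq_nonneg (s ^ 2), sq_nonneg (s ^ 2 + 1)]

lemma add_pow_four_le {x y : ℝ} : (x + y) ^ 4 ≤ 8 * (x ^ 4 + y ^ 4) := by
  nlinarith [sq_nonneg (x - y), sq_nonneg (x ^ 2 - y ^ 2), sq_nonneg ((x - y) ^ 2),
    mul_nonneg (sq_nonneg (x - y)) (sq_nonneg (x + y)), mul_nonneg (sq_nonneg (x - y)) (sq_nonneg x),
    mul_nonneg (sq_nonneg (x - y)) (sq_nonneg y)]

lemma self_le_pow_four_add_one (x : ℝ) : x ≤ x ^ 4 + 1 := by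
  nlinarith [sq_nonneg (x ^ 2 - 1), sq_nonneg (x - 1), sq_nonneg (x ^ 2)]

/-- Young's inequality. It serves with `t = 1/a`, to absorb `∫ a⁻²` into a small multiple of `∫
a⁻³`. -/
lemma sq_le_mul_cube_add {t τ : ℝ} (ht : 0 ≤ t) (hτ : 0 < τ) :
    t ^ 2 ≤ τ * t ^ 3 + 1 / τ ^ 2 := by
  have : 0 ≤ 1 / τ ^ 2 := by positivity
  rcases le_total 1 (τ * t) with h | h
  · nlinarith [mul_le_mul_of_nonneg_right h (sq_nonneg t)]
  · have h8 : 0 ≤ τ * t ^ 3 := by positivity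
    have h9 : t ^ 2 ≤ 1 / τ ^ 2 := by
      rw [le_div_iff₀ (by positivity), ← mul_pow, mul_comm]
      exact pow_le_one₀ (by positivity) h
    linarith

section

variable {L X₀ X₁ m₁ : ℝ}

/-- Bounds on the concentration in nearly stationary states. -/
lemma NearStationary.concentration (hL : 0 < L) (hX₀ : 0 < X₀) :
    ∃ C : ℝ, 0 ≤ C ∧ ∀ a c : ℝ → ℝ, NearStationary L X₀ X₁ m₁ a c →
      (∫ x in (0 : ℝ)..L, a x * deriv c x ^ 2) ≤ C ∧ (∫ x in (0 : ℝ)..L, a x * c x ^ 4) ≤ C ∧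
      (∀ x, |pot a c x| ≤ C) ∧ ∀ x, |a x * deriv c x| ≤ C := by
  set b := |m₁| / X₀ with hb
  set k := b ^ 2 + b + 2 with hk
  set C₁ := (k ^ 2 + 2 * b + 1) * |X₁| with hC₁
  set C₂ := 4 * C₁ + |X₁| with hC₂
  set C₃ := (C₂ + |X₁|) / X₀ + 1 with hC₃
  set C₄ := C₂ + C₃ * |X₁| with hC₄
  have b0 : 0 ≤ b := by positivity
  have C₁0 : 0 ≤ C₁ := by positivity
  have C₂0 : 0 ≤ C₂ := by positivity
  have C₃0 : 0 ≤ C₃ := by positivity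
  have C₄0 : 0 ≤ C₄ := by positivity
  refine ⟨4 * C₁ + C₃ + C₄, by positivity, ?_⟩
  intro a c H
  have ha := H.smooth_a
  have hc := H.smooth_c
  have hp := smoothPeriodic_pot ha hc H.pos
  have ca := ha.continuous
  have cc := hc.continuous
  have cc' := hc.deriv.continuous
  have cp := hp.continuous
  set X := ∫ x in (0 : ℝ)..L, a x with hX
  have hXp : 0 < X := hX₀.trans_le H.le_mass
  have hX1 : X ≤ |X₁| := H.mass_le.trans (le_abs_self _)
  set m := ∫ x in (0 : ℝ)..L, a x * c x with hm
  -- The mean of `c` with weight `a`. As `a (c - β)` has integral zero, the unknown additive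
  -- constant of the potential disappears when the equation `(a c_x)_x = a (c³ - c) - a μ` is tested
  -- with `c - β`, and only the oscillation of `μ`, at most one, is left.
  set β := m / X with hβ
  have hβb : |β| ≤ b := by
    rw [hβ, abs_div, abs_of_pos hXp]
    exact div_le_div₀ (abs_nonneg _) (H.moment_le.trans (le_abs_self _)) hX₀ H.le_mass
  have hI : ∀ {f : ℝ → ℝ}, Continuous f → IntervalIntegrable f volume 0 L :=
    fun h => h.intervalIntegrable _ _
  -- the flux of `c`
  have hv := ha.mul hc.deriv
  have hvd : ∀ x, deriv (fun x => a x * deriv c x) x = a x * (c x ^ 3 - c x) - a x * pot a c x := by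
    intro x
    rw [((ha.hasDerivAt x).fun_mul (hc.deriv.hasDerivAt x)).deriv, pot]
    have := (H.pos x).ne'
    field_simp
    ring
  -- test with `c - β`
  have hosc : ∀ x, |pot a c x - pot a c 0| ≤ 1 := fun x =>
    (abs_sub_le_integral hL hp x 0).trans H.pot_le
  have t1 := hv.integral_deriv_mul (hc.sub (SmoothPeriodic.const L β))
  have hd1 : ∀ x, deriv (fun x => c x - β) x = deriv c x := fun x => by rw [deriv_sub_const]
  simp_rw [hvd, hd1] at t1
  have t2 : ∫ x in (0 : ℝ)..L, a x * (c x - β) = 0 := by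
    simp_rw [mul_sub]
    rw [intervalIntegral.integral_sub (hI (by fun_prop)) (hI (by fun_prop)),
      intervalIntegral.integral_mul_const, ← hX, ← hm, hβ]
    field_simp
    ring
  have t3 : ∫ x in (0 : ℝ)..L, (a x * deriv c x ^ 2 + a x * ((c x ^ 3 - c x) * (c x - β)
      - (pot a c x - pot a c 0) * (c x - β))) = 0 := by
    have e : ∀ x, a x * deriv c x ^ 2 + a x * ((c x ^ 3 - c x) * (c x - β)
      - (pot a c x - pot a c 0) * (c x - β)) = a x * deriv c x * deriv c x
      + (a x * (c x ^ 3 - c x) - a x * pot a c x) * (c x - β)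
      + pot a c 0 * (a x * (c x - β)) := fun x => by ring
    simp_rw [e]
    rw [intervalIntegral.integral_add (hI (by fun_prop)) (hI (by fun_prop)),
      intervalIntegral.integral_add (hI (by fun_prop)) (hI (by fun_prop)),
      intervalIntegral.integral_const_mul, t1, t2]
    ring
  have t4 : ∫ x in (0 : ℝ)..L, (a x * deriv c x ^ 2 + (a x * c x ^ 4) / 4
      - (k ^ 2 + 2 * b + 1) * a x) ≤ 0 := by
    refine le_of_le_of_eq ?_ t3
    refine intervalIntegral.integral_mono_on hL.le (hI (by fun_prop)) (hI (by fun_prop)) ?_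
    intro x _
    have h1 := quartic_coercive (s := c x) hk hβb
    have h2 : (pot a c x - pot a c 0) * (c x - β) ≤ |c x - β| := by
      refine (le_abs_self _).trans ?_
      rw [abs_mul]
      exact mul_le_of_le_one_left (abs_nonneg _) (hosc x)
    have h3 := mul_le_mul_of_nonneg_left (show c x ^ 4 / 4 - (k ^ 2 + 2 * b + 1)
      ≤ (c x ^ 3 - c x) * (c x - β) - (pot a c x - pot a c 0) * (c x - β) by linarith)
      (H.pos x).le
    linarith
  rw [intervalIntegral.integral_sub (hI (by fun_prop)) (hI (by fun_prop)),
    intervalIntegral.integral_add (hI (by fun_prop)) (hI (by fun_prop)),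
    intervalIntegral.integral_div, intervalIntegral.integral_const_mul, ← hX] at t4
  have n1 : 0 ≤ ∫ x in (0 : ℝ)..L, a x * deriv c x ^ 2 :=
    intervalIntegral.integral_nonneg hL.le fun x _ => mul_nonneg (H.pos x).le (sq_nonneg _)
  have n2 : 0 ≤ ∫ x in (0 : ℝ)..L, a x * c x ^ 4 :=
    intervalIntegral.integral_nonneg hL.le fun x _ => mul_nonneg (H.pos x).le (by positivity)
  have t5 : (k ^ 2 + 2 * b + 1) * X ≤ C₁ := mul_le_mul_of_nonneg_left hX1 (by positivity)
  have r1 : ∫ x in (0 : ℝ)..L, a x * deriv c x ^ 2 ≤ C₁ := by linarith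
  have r2 : ∫ x in (0 : ℝ)..L, a x * c x ^ 4 ≤ 4 * C₁ := by linarith
  have r3 : ∫ x in (0 : ℝ)..L, |a x * (c x ^ 3 - c x)| ≤ C₂ := by
    have : ∫ x in (0 : ℝ)..L, |a x * (c x ^ 3 - c x)| ≤ ∫ x in (0 : ℝ)..L, (a x * c x ^ 4 + a x) := by
      refine intervalIntegral.integral_mono_on hL.le (hI (by fun_prop)) (hI (by fun_prop)) ?_
      intro x _
      rw [abs_mul, abs_of_pos (H.pos x)]
      linarith [mul_le_mul_of_nonneg_left (abs_cube_sub_le (c x)) (H.pos x).le]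
    rw [intervalIntegral.integral_add (hI (by fun_prop)) (hI (by fun_prop)), ← hX] at this
    linarith
  -- The constant is recovered afterwards: integrating the equation over a period removes `(a
  -- c_x)_x`, so that `μ(0)` times the mass is an integral already bounded.
  have r4 : |pot a c 0| ≤ (C₂ + |X₁|) / X₀ := by
    have s1 := hv.integral_deriv
    simp_rw [hvd] at s1
    have s2 : pot a c 0 * X = ∫ x in (0 : ℝ)..L, (a x * (c x ^ 3 - c x)
        - a x * (pot a c x - pot a c 0)) := by
      have e : ∀ x, a x * (c x ^ 3 - c x) - a x * (pot a c x - pot a c 0)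
        = (a x * (c x ^ 3 - c x) - a x * pot a c x) + pot a c 0 * a x := fun x => by ring
      simp_rw [e]
      rw [intervalIntegral.integral_add (hI (by fun_prop)) (hI (by fun_prop)), s1,
        intervalIntegral.integral_const_mul, zero_add]
    have s3 : |pot a c 0| * X ≤ C₂ + X := by
      rw [← abs_of_pos hXp, ← abs_mul, abs_of_pos hXp, s2]
      refine (intervalIntegral.abs_integral_le_integral_abs hL.le).trans ?_
      calc _ ≤ ∫ x in (0 : ℝ)..L, (|a x * (c x ^ 3 - c x)| + a x) := by
            refine intervalIntegral.integral_mono_on hL.le (hI (by fun_prop))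
              (hI (by fun_prop)) ?_
            intro x _
            refine (abs_sub _ _).trans (add_le_add le_rfl ?_)
            rw [abs_mul, abs_of_pos (H.pos x)]
            exact mul_le_of_le_one_right (H.pos x).le (hosc x)
        _ ≤ _ := by
            rw [intervalIntegral.integral_add (hI (by fun_prop)) (hI (by fun_prop)), ← hX]
            linarith
    rw [le_div_iff₀ hX₀]
    calc |pot a c 0| * X₀ ≤ |pot a c 0| * X :=
          mul_le_mul_of_nonneg_left H.le_mass (abs_nonneg _)
      _ ≤ _ := by linarith
  have r5 : ∀ x, |pot a c x| ≤ C₃ := fun x => by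
    have : |pot a c x| ≤ |pot a c x - pot a c 0| + |pot a c 0| := by
      simpa using abs_add_le (pot a c x - pot a c 0) (pot a c 0)
    linarith [hosc x]
  -- The product `a c_x` vanishes at some point and its derivative is bounded in `L¹`. No bound on
  -- `c_x` alone is available, since `a` may still be small.
  have r6 : ∀ x, |a x * deriv c x| ≤ C₄ := by
    intro x
    obtain ⟨y, hy⟩ := hc.exists_deriv_eq_zero hL
    have s := abs_sub_le_integral hL hv x y
    rw [hy, mul_zero, sub_zero] at s
    refine s.trans ?_
    simp_rw [hvd]
    calc _ ≤ ∫ x in (0 : ℝ)..L, (|a x * (c x ^ 3 - c x)| + C₃ * a x) := by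
          refine intervalIntegral.integral_mono_on hL.le (hI (by fun_prop))
            (hI (by fun_prop)) ?_
          intro x _
          refine (abs_sub _ _).trans (add_le_add le_rfl ?_)
          rw [abs_mul, abs_of_pos (H.pos x), mul_comm]
          exact mul_le_mul_of_nonneg_right (r5 x) (H.pos x).le
      _ ≤ _ := by
          rw [intervalIntegral.integral_add (hI (by fun_prop)) (hI (by fun_prop)),
            intervalIntegral.integral_const_mul, ← hX]
          have := mul_le_mul_of_nonneg_left hX1 C₃0
          linarith
  refine ⟨by linarith, by linarith, fun x => (r5 x).trans (by linarith),
    fun x => (r6 x).trans (by linarith)⟩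

/-- The double well energy density in nearly stationary states. -/
lemma NearStationary.osc_le (hL : 0 < L) (hX₀ : 0 < X₀) :
    ∃ C : ℝ, 0 ≤ C ∧ ∀ a c : ℝ → ℝ, NearStationary L X₀ X₁ m₁ a c →
      (∀ x, doubleWell (c x) ≤ C * (1 + ∫ x in (0 : ℝ)..L, (a x)⁻¹ ^ 2)) ∧
      (∫ x in (0 : ℝ)..L, |deriv c x|) ≤ C * (1 + ∫ x in (0 : ℝ)..L, (a x)⁻¹ ^ 2) := by
  obtain ⟨C₁, hC₁, hC⟩ := NearStationary.concentration (X₁ := X₁) (m₁ := m₁) hL hX₀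
  set b := |m₁| / X₀ with hb
  have b0 : 0 ≤ b := by positivity
  refine ⟨8 * (C₁ ^ 2 * L + b ^ 4) + 1, by positivity, ?_⟩
  intro a c H
  obtain ⟨h1, -, -, -⟩ := hC a c H
  have ha := H.smooth_a
  have hc := H.smooth_c
  have ca := ha.continuous
  have cc := hc.continuous
  have cc' := hc.deriv.continuous
  have ci := (ha.inv H.pos).continuous
  set A := ∫ x in (0 : ℝ)..L, |deriv c x| with hA
  set Q := ∫ x in (0 : ℝ)..L, (a x)⁻¹ ^ 2 with hQ
  have hA0 : 0 ≤ A := intervalIntegral.integral_nonneg hL.le fun x _ => abs_nonneg _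
  have hQ0 : 0 ≤ Q := integral_sq_nonneg hL.le
  -- Cauchy–Schwarz twice: `(∫ |c_x|)² ≤ ∫ a c_x² · ∫ 1/a`, and `∫ 1/a ≤ √L · √Q`. The fourth power,
  -- which is the growth of the double well, is therefore linear in `Q`.
  have hA4 : A ^ 4 ≤ C₁ ^ 2 * L * Q := by
    have s1 := integral_mul_le hL.le (u := fun x => √(a x) * |deriv c x|)
      (v := fun x => √((a x)⁻¹)) (by fun_prop) (by fun_prop)
    have e : ∀ x, √(a x) * |deriv c x| * √((a x)⁻¹) = |deriv c x| := fun x => by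
      rw [mul_right_comm, ← Real.sqrt_mul (H.pos x).le, mul_inv_cancel₀ (H.pos x).ne',
        Real.sqrt_one, one_mul]
    simp_rw [e] at s1
    rw [← hA] at s1
    have s2 : l2 L (fun x => √(a x) * |deriv c x|) ^ 2 ≤ C₁ := by
      rw [sq_l2 hL.le]
      simp_rw [mul_pow, sq_abs]
      refine le_of_eq_of_le ?_ h1
      congr 1; ext x
      rw [Real.sq_sqrt (H.pos x).le]
    have s3 : l2 L (fun x => √((a x)⁻¹)) ^ 2 ≤ √L * l2 L (fun x => (a x)⁻¹) := by
      rw [sq_l2 hL.le]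
      refine le_of_eq_of_le ?_ (integral_abs_le hL.le ci)
      congr 1; ext x
      have := (inv_pos.2 (H.pos x)).le
      rw [Real.sq_sqrt this, abs_of_nonneg this]
    have s4 : A ^ 2 ≤ C₁ * (√L * l2 L (fun x => (a x)⁻¹)) := by
      calc A ^ 2 ≤ (_ * _) ^ 2 := pow_le_pow_left₀ hA0 s1 2
        _ ≤ _ := by
          rw [mul_pow]
          exact mul_le_mul s2 s3 (sq_nonneg _) hC₁
    calc A ^ 4 = (A ^ 2) ^ 2 := by ring
      _ ≤ (C₁ * (√L * l2 L (fun x => (a x)⁻¹))) ^ 2 := pow_le_pow_left₀ (sq_nonneg _) s4 2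
      _ = C₁ ^ 2 * L * Q := by
        rw [mul_pow, mul_pow, Real.sq_sqrt hL.le, sq_l2 hL.le, ← hQ]; ring
  have p1 : 0 ≤ b ^ 4 := by positivity
  have p2 : 0 ≤ C₁ ^ 2 * L := by positivity
  have p3 := mul_nonneg p1 hQ0
  have p4 := mul_nonneg p2 hQ0
  have p5 : (8 * (C₁ ^ 2 * L + b ^ 4) + 1) * (1 + Q) = 8 * (C₁ ^ 2 * L) + 8 * b ^ 4 + 1
    + 8 * (C₁ ^ 2 * L * Q) + 8 * (b ^ 4 * Q) + Q := by ring
  rw [p5]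
  constructor
  · intro x
    -- Comparison of `c x` with the mean of `c` of weight `a`, which is at most `b` in absolute
    -- value.
    have hcx : |c x| ≤ A + b := by
      set X := ∫ x in (0 : ℝ)..L, a x with hX
      have hXp : 0 < X := hX₀.trans_le H.le_mass
      have s1 : c x * X = (∫ y in (0 : ℝ)..L, a y * (c x - c y)) + ∫ y in (0 : ℝ)..L, a y * c y := by
        rw [← intervalIntegral.integral_add
          (Continuous.intervalIntegrable (by fun_prop) _ _)
          (Continuous.intervalIntegrable (by fun_prop) _ _), hX,
          ← intervalIntegral.integral_const_mul]
        congr 1; ext y; ring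
      have s2 : |∫ y in (0 : ℝ)..L, a y * (c x - c y)| ≤ A * X := by
        refine (intervalIntegral.abs_integral_le_integral_abs hL.le).trans ?_
        rw [hX, ← intervalIntegral.integral_const_mul]
        refine intervalIntegral.integral_mono_on hL.le
          (Continuous.intervalIntegrable (by fun_prop) _ _)
          (Continuous.intervalIntegrable (by fun_prop) _ _) fun y _ => ?_
        rw [abs_mul, abs_of_pos (H.pos y), mul_comm]
        exact mul_le_mul_of_nonneg_right (abs_sub_le_integral hL hc x y) (H.pos y).le
      have s3 : |c x| * X ≤ A * X + |m₁| := by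
        rw [← abs_of_pos hXp, ← abs_mul, abs_of_pos hXp, s1]
        exact (abs_add_le _ _).trans (add_le_add s2 (H.moment_le.trans (le_abs_self _)))
      have s4 : |m₁| ≤ b * X := by
        rw [hb, div_mul_eq_mul_div, le_div_iff₀ hX₀]
        exact mul_le_mul_of_nonneg_left H.le_mass (abs_nonneg _)
      exact le_of_mul_le_mul_right (by linarith) hXp
    have h4 : c x ^ 4 ≤ 8 * (A ^ 4 + b ^ 4) := by
      have : c x ^ 4 ≤ (A + b) ^ 4 := by
        rw [← (show Even 4 by decide).pow_abs]
        exact pow_le_pow_left₀ (abs_nonneg _) hcx 4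
      exact this.trans add_pow_four_le
    have h5 := doubleWell_le (c x)
    linarith
  · linarith [self_le_pow_four_add_one A]

set_option maxHeartbeats 1000000 in
/-- Nearly stationary states have energy bounded in terms of their masses. -/
theorem NearStationary.energy_le (hL : 0 < L) (hX₀ : 0 < X₀) :
    ∃ e : ℝ, ∀ a c : ℝ → ℝ, NearStationary L X₀ X₁ m₁ a c → energy L a c ≤ e := by
  obtain ⟨C₁, hC₁, hC⟩ := NearStationary.concentration (X₁ := X₁) (m₁ := m₁) hL hX₀
  obtain ⟨C₂, hC₂, hO⟩ := NearStationary.osc_le (X₁ := X₁) (m₁ := m₁) hL hX₀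
  set x₀ := X₀ / L with hx₀
  set x₁ := |X₁| / L with hx₁
  have x₀0 : 0 < x₀ := by positivity
  have x₁0 : 0 ≤ x₁ := by positivity
  set C₅ := 2 * |X₁| * (C₁ * C₂ + 1) + (1 / 3 + x₁ * C₁ ^ 2 / 2) + x₁ * C₂ * L + 1 with hC₅
  have C₅0 : 0 < C₅ := by positivity
  -- Makes `C₅ τ = x₀ / 6`, half of the coefficient of `∫ a⁻³` available for absorption.
  set τ := x₀ / (6 * C₅) with hτ
  have τ0 : 0 < τ := by positivity
  set C₆ := C₅ + C₅ * L / τ ^ 2 with hC₆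
  have C₆0 : 0 ≤ C₆ := by positivity
  set C₇ := τ * (6 * C₆ / x₀) + L / τ ^ 2 with hC₇
  refine ⟨C₆ / 2 + C₇ / 6 + (C₁ + |X₁|) + C₁ / 2, ?_⟩
  intro a c H
  obtain ⟨h1, h2, h3, h4⟩ := hC a c H
  obtain ⟨h5, h6⟩ := hO a c H
  have ha := H.smooth_a
  have hc := H.smooth_c
  have hp := smoothPeriodic_pot ha hc H.pos
  have hf := smoothPeriodic_flux ha hc H.pos
  have he := smoothPeriodic_enVar ha hc H.pos
  have ca := ha.continuous
  have ca' := ha.deriv.continuous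
  have cc := hc.continuous
  have cc' := hc.deriv.continuous
  have cp := hp.continuous
  have cf := hf.continuous
  have ce := he.continuous
  have cw := hc.doubleWell.continuous
  have ci := (ha.inv H.pos).continuous
  have hI : ∀ {f : ℝ → ℝ}, Continuous f → IntervalIntegrable f volume 0 L :=
    fun h => h.intervalIntegrable _ _
  set X := ∫ x in (0 : ℝ)..L, a x with hX
  have hXp : 0 < X := hX₀.trans_le H.le_mass
  have hX1 : X ≤ |X₁| := H.mass_le.trans (le_abs_self _)
  set Q := ∫ x in (0 : ℝ)..L, (a x)⁻¹ ^ 2 with hQ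
  have hQ0 : 0 ≤ Q := integral_sq_nonneg hL.le
  set S := ∫ x in (0 : ℝ)..L, (a x)⁻¹ ^ 3 with hS
  have hS0 : 0 ≤ S := intervalIntegral.integral_nonneg hL.le fun x _ =>
    pow_nonneg (inv_pos.2 (H.pos x)).le 3
  set ab := X / L with hab
  have hab0 : x₀ ≤ ab := div_le_div_of_nonneg_right H.le_mass hL.le
  have hab1 : ab ≤ x₁ := div_le_div_of_nonneg_right hX1 hL.le
  have habp : 0 < ab := x₀0.trans_le hab0
  set P := ∫ x in (0 : ℝ)..L, deriv a x ^ 2 with hP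
  have hP0 : 0 ≤ P := integral_sq_nonneg hL.le
  -- oscillation of the variational derivative
  have o1 : ∀ x, |enVar a c x - enVar a c 0| ≤ C₁ * (C₂ * (1 + Q)) + 1 := by
    intro x
    refine (abs_sub_le_integral hL he x 0).trans ?_
    simp_rw [deriv_enVar ha hc H.pos]
    calc _ ≤ ∫ x in (0 : ℝ)..L, (C₁ * |deriv c x| + |flux a c x * (a x)⁻¹ ^ 3|) := by
          refine intervalIntegral.integral_mono_on hL.le (hI (by fun_prop))
            (hI (by fun_prop)) fun x _ => ?_
          refine (abs_sub _ _).trans (add_le_add ?_ le_rfl)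
          rw [abs_mul, mul_comm]
          exact mul_le_mul_of_nonneg_right (h3 x) (abs_nonneg _)
      _ ≤ _ := by
          rw [intervalIntegral.integral_add (hI (by fun_prop)) (hI (by fun_prop)),
            intervalIntegral.integral_const_mul]
          exact add_le_add (mul_le_mul_of_nonneg_left h6 hC₁) H.flux_le
  -- The test function `a - ab` has mean zero, so only the oscillation of the variational derivative
  -- contributes.
  have o2 : ∫ x in (0 : ℝ)..L, enVar a c x * (a x - ab) ≤ 2 * |X₁| * (C₁ * (C₂ * (1 + Q)) + 1) := by
    have e : ∀ x, enVar a c x * (a x - ab) = (enVar a c x - enVar a c 0) * (a x - ab)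
      + enVar a c 0 * (a x - ab) := fun x => by ring
    simp_rw [e]
    have z : ∫ x in (0 : ℝ)..L, (a x - ab) = 0 := by
      rw [intervalIntegral.integral_sub (hI (by fun_prop)) (hI (by fun_prop)), ← hX,
        intervalIntegral.integral_const, hab]
      simp only [sub_zero, smul_eq_mul]
      field_simp
      ring
    rw [intervalIntegral.integral_add (hI (by fun_prop)) (hI (by fun_prop)),
      intervalIntegral.integral_const_mul, z, mul_zero, add_zero]
    calc _ ≤ ∫ x in (0 : ℝ)..L, (C₁ * (C₂ * (1 + Q)) + 1) * (a x + ab) := by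
          refine intervalIntegral.integral_mono_on hL.le (hI (by fun_prop))
            (hI (by fun_prop)) fun x _ => ?_
          refine (le_abs_self _).trans ?_
          rw [abs_mul]
          refine mul_le_mul (o1 x) ?_ (abs_nonneg _) (by positivity)
          rw [abs_le]
          have := H.pos x
          constructor <;> linarith
      _ = (C₁ * (C₂ * (1 + Q)) + 1) * (2 * X) := by
          rw [intervalIntegral.integral_const_mul,
            intervalIntegral.integral_add (hI (by fun_prop)) (hI (by fun_prop)), ← hX,
            intervalIntegral.integral_const, hab]
          simp only [sub_zero, smul_eq_mul]
          field_simp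
          ring
      _ ≤ _ := by
          have h8 : 0 ≤ C₁ * (C₂ * (1 + Q)) + 1 := by positivity
          rw [mul_comm]
          exact mul_le_mul_of_nonneg_right (by linarith) h8
  have o3 : ∫ x in (0 : ℝ)..L, deriv (deriv a) x * (a x - ab) = -P := by
    have := ha.deriv.integral_deriv_mul (ha.sub (SmoothPeriodic.const L ab))
    rw [this, hP]
    congr 2; ext x
    rw [deriv_sub_const]; ring
  have ca'' := ha.deriv.deriv.continuous
  -- The same test from below: the capillary term yields `∫ a_x²`, and the singular term yields
  -- `ab/3 ∫ a⁻³ - 1/3 ∫ a⁻²`. The nonnegative terms multiplied by `a` are dropped, and those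
  -- multiplied by `ab` are linear in `Q`, because `|c_x| ≤ C₁ / a`.
  have o4 : P + (ab / 3 * S - (1 / 3 + ab * C₁ ^ 2 / 2) * Q - ab * (C₂ * (1 + Q)) * L)
      ≤ ∫ x in (0 : ℝ)..L, enVar a c x * (a x - ab) := by
    have e : ∀ x, enVar a c x * (a x - ab) = -(deriv (deriv a) x * (a x - ab)) +
      (-((a x)⁻¹ ^ 3 / 3) + doubleWell (c x) + deriv c x ^ 2 / 2) * (a x - ab) := fun x => by
      rw [enVar]; ring
    simp_rw [e]
    rw [intervalIntegral.integral_add (hI (by fun_prop)) (hI (by fun_prop)),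
      intervalIntegral.integral_neg, o3, neg_neg]
    refine add_le_add le_rfl ?_
    have : ∫ x in (0 : ℝ)..L, (ab / 3 * (a x)⁻¹ ^ 3 - (1 / 3 + ab * C₁ ^ 2 / 2) * (a x)⁻¹ ^ 2
        - ab * (C₂ * (1 + Q))) = ab / 3 * S - (1 / 3 + ab * C₁ ^ 2 / 2) * Q
        - ab * (C₂ * (1 + Q)) * L := by
      rw [intervalIntegral.integral_sub (hI (by fun_prop)) (hI (by fun_prop)),
        intervalIntegral.integral_sub (hI (by fun_prop)) (hI (by fun_prop)),
        intervalIntegral.integral_const_mul, intervalIntegral.integral_const_mul,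
        intervalIntegral.integral_const]
      simp only [sub_zero, smul_eq_mul]
      ring
    rw [← this]
    refine intervalIntegral.integral_mono_on hL.le (hI (by fun_prop))
      (hI (by fun_prop)) fun x _ => ?_
    have q0 := H.pos x
    have q1 : deriv c x ^ 2 ≤ C₁ ^ 2 * (a x)⁻¹ ^ 2 := by
      have : (a x * deriv c x) ^ 2 ≤ C₁ ^ 2 := by
        rw [← sq_abs]; exact pow_le_pow_left₀ (abs_nonneg _) (h4 x) 2
      rw [inv_pow, ← div_eq_mul_inv, le_div_iff₀ (by positivity)]
      linarith [mul_pow (a x) (deriv c x) 2]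
    have q2 : (a x)⁻¹ ^ 3 * a x = (a x)⁻¹ ^ 2 := by field_simp
    have q3 := h5 x
    have q4 := doubleWell_nonneg (c x)
    have q5 := mul_nonneg q4 q0.le
    have q6 := mul_nonneg (sq_nonneg (deriv c x)) q0.le
    have q7 := mul_le_mul_of_nonneg_left q3 habp.le
    have q8 := mul_le_mul_of_nonneg_left q1 habp.le
    linarith
  have o5 : Q ≤ τ * S + L / τ ^ 2 := by
    have : ∫ x in (0 : ℝ)..L, (τ * (a x)⁻¹ ^ 3 + 1 / τ ^ 2) = τ * S + L / τ ^ 2 := by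
      rw [intervalIntegral.integral_add (hI (by fun_prop)) (hI (by fun_prop)),
        intervalIntegral.integral_const_mul, intervalIntegral.integral_const]
      simp only [sub_zero, smul_eq_mul]
      ring
    rw [← this]
    refine intervalIntegral.integral_mono_on hL.le (hI (by fun_prop))
      (hI (by fun_prop)) fun x _ => ?_
    exact sq_le_mul_cube_add (inv_pos.2 (H.pos x)).le τ0
  -- conclusion
  have w1 : P + x₀ / 3 * S ≤ C₅ * (1 + Q) := by
    have v1 : x₀ / 3 * S ≤ ab / 3 * S := by gcongr
    have v2 : (1 / 3 + ab * C₁ ^ 2 / 2) * Q ≤ (1 / 3 + x₁ * C₁ ^ 2 / 2) * Q := by gcongr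
    have v3 : ab * (C₂ * (1 + Q)) * L ≤ x₁ * (C₂ * (1 + Q)) * L := by gcongr
    have v4 : 0 ≤ 2 * |X₁| * Q := by positivity
    have v5 : 0 ≤ 1 / 3 + x₁ * C₁ ^ 2 / 2 := by positivity
    have v6 : C₅ * (1 + Q) = 2 * |X₁| * (C₁ * (C₂ * (1 + Q)) + 1) + 2 * |X₁| * Q
      + (1 / 3 + x₁ * C₁ ^ 2 / 2) * Q + (1 / 3 + x₁ * C₁ ^ 2 / 2)
      + x₁ * (C₂ * (1 + Q)) * L + 1 + Q := by rw [hC₅]; ring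
    linarith
  have w2 : C₅ * Q ≤ x₀ / 6 * S + C₅ * L / τ ^ 2 := by
    have := mul_le_mul_of_nonneg_left o5 C₅0.le
    have e : C₅ * (τ * S + L / τ ^ 2) = x₀ / 6 * S + C₅ * L / τ ^ 2 := by
      rw [mul_add, ← mul_assoc, hτ]
      congr 1
      · field_simp
      · ring
    linarith
  have w3 : P + x₀ / 6 * S ≤ C₆ := by linarith
  have w4 : P ≤ C₆ := by linarith [mul_nonneg x₀0.le hS0]
  have w5 : S ≤ 6 * C₆ / x₀ := by rw [le_div_iff₀ x₀0]; linarith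
  have w6 : Q ≤ C₇ := o5.trans (by rw [hC₇]; gcongr)
  have w7 : ∫ x in (0 : ℝ)..L, a x * doubleWell (c x) ≤ C₁ + |X₁| := by
    have : ∫ x in (0 : ℝ)..L, a x * doubleWell (c x) ≤ ∫ x in (0 : ℝ)..L, (a x * c x ^ 4 + a x) := by
      refine intervalIntegral.integral_mono_on hL.le (hI (by fun_prop))
        (hI (by fun_prop)) fun x _ => ?_
      linarith [mul_le_mul_of_nonneg_left (doubleWell_le (c x)) (H.pos x).le]
    rw [intervalIntegral.integral_add (hI (by fun_prop)) (hI (by fun_prop)), ← hX] at this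
    linarith
  rw [energy_eq ha hc H.pos]
  linarith

end


/-! ## Scaling of the lower order terms

The size of the third derivatives is measured by `r` with `r ^ 8 = 1 + ‖a'''‖² + ‖c'''‖²`;
all lower order expressions are compared with powers of `r`. -/

/-- Pointwise domination of `u` by `K ^ j * r ^ k` times a weight. -/
def Dominated (K r : ℝ) (w : ℝ → ℝ) (j k : ℕ) (u : ℝ → ℝ) : Prop :=
  ∀ x, |u x| ≤ K ^ j * r ^ k * w x

namespace Dominated

variable {K r : ℝ} {w : ℝ → ℝ} {j k j' k' : ℕ} {u v : ℝ → ℝ}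

/-- Only one factor may carry the weight, so that the product keeps an `L²` bound; the other is
controlled in supremum norm. -/
lemma mul (hK : 2 ≤ K) (hr : 1 ≤ r) (hu : Dominated K r (fun _ => 1) j k u)
    (hv : Dominated K r w j' k' v) : Dominated K r w (j + j') (k + k') (fun x => u x * v x) := by
  intro x
  rw [abs_mul]
  calc |u x| * |v x| ≤ (K ^ j * r ^ k * 1) * (K ^ j' * r ^ k' * w x) :=
        mul_le_mul (hu x) (hv x) (abs_nonneg _) (by positivity)
    _ = _ := by ring

lemma mono (hK : 2 ≤ K) (hr : 1 ≤ r) (hw : ∀ x, 1 ≤ w x) (h : Dominated K r w j k u)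
    (hj : j ≤ j') (hk : k ≤ k') : Dominated K r w j' k' u := by
  intro x
  have := hw x
  have h1 : K ^ j ≤ K ^ j' := pow_le_pow_right₀ (by linarith) hj
  have h2 : r ^ k ≤ r ^ k' := pow_le_pow_right₀ hr hk
  exact (h x).trans (by gcongr)

/-- The additional power of `K` pays for a factor two. -/
lemma add (hK : 2 ≤ K) (hr : 1 ≤ r) (hw : ∀ x, 1 ≤ w x) (hu : Dominated K r w j k u)
    (hv : Dominated K r w j' k' v) :
    Dominated K r w (max j j' + 1) (max k k') (fun x => u x + v x) := by
  intro x
  have h1 := (hu.mono hK hr hw (le_max_left j j') (le_max_left k k')) x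
  have h2 := (hv.mono hK hr hw (le_max_right j j') (le_max_right k k')) x
  have h3 : 0 ≤ K ^ max j j' * r ^ max k k' * w x := by
    have := hw x
    positivity
  calc |u x + v x| ≤ 2 * (K ^ max j j' * r ^ max k k' * w x) :=
        (abs_add_le _ _).trans (by linarith)
    _ ≤ K * (K ^ max j j' * r ^ max k k' * w x) := by gcongr
    _ = _ := by ring

lemma neg (hu : Dominated K r w j k u) : Dominated K r w j k (fun x => -u x) := by
  intro x; rw [abs_neg]; exact hu x

lemma weight (hK : 2 ≤ K) (hr : 1 ≤ r) (hw : ∀ x, 1 ≤ w x)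
    (hu : Dominated K r (fun _ => 1) j k u) : Dominated K r w j k u := by
  intro x
  refine (hu x).trans ?_
  have := hw x
  gcongr

lemma congr (hu : Dominated K r w j k u) (h : ∀ x, v x = u x) : Dominated K r w j k v :=
  fun x => by rw [h]; exact hu x

lemma const (hK : 2 ≤ K) {b : ℝ} (hb : |b| ≤ 8) : Dominated K r (fun _ => 1) 3 0 (fun _ => b) := by
  intro x
  have : (2 : ℝ) ^ 3 ≤ K ^ 3 := pow_le_pow_left₀ (by norm_num) hK 3
  simp only [pow_zero, mul_one]
  linarith

end Dominated

/-- The terms of the flux of lower order. -/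
noncomputable def lowFlux (a c : ℝ → ℝ) (x : ℝ) : ℝ :=
  deriv a x * (a x)⁻¹
    + a x ^ 2 * (deriv a x * deriv c x ^ 2 + 2 * a x * deriv c x * deriv (deriv c) x)

/-- The terms of the chemical potential of lower order. -/
noncomputable def lowPot (a c : ℝ → ℝ) (x : ℝ) : ℝ :=
  c x ^ 3 - c x - deriv a x * deriv c x * (a x)⁻¹

/-- Bounded height and concentration, with `r` measuring their third derivatives. -/
structure Scaled (L K r : ℝ) (a c : ℝ → ℝ) : Prop extends Bounds L K a c where
  one_le : 1 ≤ r
  pow_eq : r ^ 8 = 1 + l2 L (deriv (deriv (deriv a))) ^ 2 + l2 L (deriv (deriv (deriv c))) ^ 2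

lemma Bounds.scaled {L K : ℝ} {a c : ℝ → ℝ} (H : Bounds L K a c) : ∃ r, Scaled L K r a c := by
  set R := 1 + l2 L (deriv (deriv (deriv a))) ^ 2 + l2 L (deriv (deriv (deriv c))) ^ 2 with hR
  have hR1 : 1 ≤ R := by
    have h1 := sq_nonneg (l2 L (deriv (deriv (deriv a))))
    have h2 := sq_nonneg (l2 L (deriv (deriv (deriv c))))
    linarith
  refine ⟨√√√R, H, ?_, ?_⟩
  · rw [Real.one_le_sqrt, Real.one_le_sqrt, Real.one_le_sqrt]; exact hR1
  · rw [show (√√√R) ^ 8 = (((√√√R) ^ 2) ^ 2) ^ 2 by ring, Real.sq_sqrt (by positivity),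
      Real.sq_sqrt (by positivity), Real.sq_sqrt (by positivity)]

/-- The weight which carries the second and third derivatives. -/
noncomputable def scaleWeight (r : ℝ) (a c : ℝ → ℝ) (x : ℝ) : ℝ :=
  1 + (|deriv (deriv a) x| + |deriv (deriv c) x|) / r ^ 2
    + (|deriv (deriv (deriv a)) x| + |deriv (deriv (deriv c)) x|) / r ^ 4

section

variable {L K r : ℝ} {a c : ℝ → ℝ}

lemma Bounds.pos (H : Bounds L K a c) (x : ℝ) : 0 < a x :=
  (inv_pos.2 (by linarith [H.two_le])).trans_le (H.inv_le x)

lemma lowFlux_smooth (ha : SmoothPeriodic L a) (hc : SmoothPeriodic L c) (h0 : ∀ x, 0 < a x) :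
    SmoothPeriodic L (lowFlux a c) :=
  (ha.deriv.mul (ha.inv h0)).add
    ((ha.pow 2).mul ((ha.deriv.mul (hc.deriv.pow 2)).add
      (((ha.const_mul 2).mul hc.deriv).mul hc.deriv.deriv)))

lemma lowPot_smooth (ha : SmoothPeriodic L a) (hc : SmoothPeriodic L c) (h0 : ∀ x, 0 < a x) :
    SmoothPeriodic L (lowPot a c) :=
  ((hc.pow 3).sub hc).sub ((ha.deriv.mul hc.deriv).mul (ha.inv h0))

lemma deriv_lowFlux (ha : SmoothPeriodic L a) (hc : SmoothPeriodic L c) (h0 : ∀ x, 0 < a x)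
    (x : ℝ) : deriv (lowFlux a c) x =
      deriv (deriv a) x * (a x)⁻¹ - deriv a x * deriv a x * ((a x)⁻¹ * (a x)⁻¹)
      + 2 * a x * deriv a x * (deriv a x * deriv c x ^ 2 + 2 * a x * deriv c x * deriv (deriv c) x)
      + a x ^ 2 * (deriv (deriv a) x * deriv c x ^ 2 + 4 * deriv a x * deriv c x * deriv (deriv c) x
        + 2 * a x * deriv (deriv c) x ^ 2 + 2 * a x * deriv c x * deriv (deriv (deriv c)) x) := by
  have hi := (ha.hasDerivAt x).inv (h0 x).ne'
  have h := ((ha.deriv.hasDerivAt x).mul hi).add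
    (((ha.hasDerivAt x).pow 2).mul (((ha.deriv.hasDerivAt x).mul ((hc.deriv.hasDerivAt x).pow 2)).add
      ((((ha.hasDerivAt x).const_mul 2).mul (hc.deriv.hasDerivAt x)).mul
        (hc.deriv.deriv.hasDerivAt x))))
  have h2 : HasDerivAt (lowFlux a c) _ x := h
  rw [h2.deriv]
  simp only [Pi.inv_apply, Pi.pow_apply, Pi.mul_apply, Pi.add_apply, Nat.cast_ofNat,
    show 2 - 1 = 1 from rfl,
    pow_one]
  have := (h0 x).ne'
  field_simp
  ring

lemma deriv_lowPot (ha : SmoothPeriodic L a) (hc : SmoothPeriodic L c) (h0 : ∀ x, 0 < a x)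
    (x : ℝ) : deriv (lowPot a c) x =
      3 * c x ^ 2 * deriv c x - deriv c x - deriv (deriv a) x * deriv c x * (a x)⁻¹
      - deriv a x * deriv (deriv c) x * (a x)⁻¹
      + deriv a x * deriv a x * deriv c x * ((a x)⁻¹ * (a x)⁻¹) := by
  have hi := (ha.hasDerivAt x).inv (h0 x).ne'
  have h := (((hc.hasDerivAt x).pow 3).sub (hc.hasDerivAt x)).sub
    (((ha.deriv.hasDerivAt x).mul (hc.deriv.hasDerivAt x)).mul hi)
  have h2 : HasDerivAt (lowPot a c) _ x := h
  rw [h2.deriv]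
  simp only [Pi.inv_apply, Pi.mul_apply, Nat.cast_ofNat, show 3 - 1 = 2 from rfl]
  have := (h0 x).ne'
  field_simp
  ring

lemma deriv_deriv_lowPot (ha : SmoothPeriodic L a) (hc : SmoothPeriodic L c) (h0 : ∀ x, 0 < a x)
    (x : ℝ) : deriv (deriv (lowPot a c)) x =
      6 * c x * deriv c x ^ 2 + 3 * c x ^ 2 * deriv (deriv c) x - deriv (deriv c) x
      - deriv c x * (a x)⁻¹ * deriv (deriv (deriv a)) x
      - 2 * (a x)⁻¹ * deriv (deriv a) x * deriv (deriv c) x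
      + 3 * deriv a x * deriv c x * ((a x)⁻¹ * (a x)⁻¹) * deriv (deriv a) x
      - deriv a x * (a x)⁻¹ * deriv (deriv (deriv c)) x
      + 2 * deriv a x ^ 2 * ((a x)⁻¹ * (a x)⁻¹) * deriv (deriv c) x
      - 2 * deriv a x ^ 3 * deriv c x * ((a x)⁻¹ * (a x)⁻¹ * (a x)⁻¹) := by
  have hi := (ha.hasDerivAt x).inv (h0 x).ne'
  have h := ((((((hc.hasDerivAt x).pow 2).const_mul 3).mul (hc.deriv.hasDerivAt x)).sub
    (hc.deriv.hasDerivAt x)).sub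
    (((ha.deriv.deriv.hasDerivAt x).mul (hc.deriv.hasDerivAt x)).mul hi)).sub
    (((ha.deriv.hasDerivAt x).mul (hc.deriv.deriv.hasDerivAt x)).mul hi) |>.add
    ((((ha.deriv.hasDerivAt x).mul (ha.deriv.hasDerivAt x)).mul (hc.deriv.hasDerivAt x)).mul
      (hi.mul hi))
  have h2 : HasDerivAt (deriv (lowPot a c)) _ x :=
    h.congr_of_eventuallyEq (Eventually.of_forall fun y => deriv_lowPot ha hc h0 y)
  rw [h2.deriv]
  simp only [Pi.inv_apply, Pi.mul_apply, Pi.pow_apply, Nat.cast_ofNat, show 2 - 1 = 1 from rfl,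
    pow_one]
  have := (h0 x).ne'
  field_simp
  ring

end

namespace Scaled

variable {L K r : ℝ} {a c : ℝ → ℝ}

lemma l2_third_le (H : Scaled L K r a c) : l2 L (deriv (deriv (deriv a))) ≤ r ^ 4 ∧
    l2 L (deriv (deriv (deriv c))) ≤ r ^ 4 := by
  have h := H.pow_eq
  have hr := H.one_le
  have h1 : (r ^ 4) ^ 2 = r ^ 8 := by ring
  constructor <;> apply le_of_sq_le_sq _ (by positivity) <;> rw [h1, h]
    <;> nlinarith [sq_nonneg (l2 L (deriv (deriv (deriv a)))),
      sq_nonneg (l2 L (deriv (deriv (deriv c))))]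

/-- Interpolation bounds for one function. -/
lemma interpolation (hL : 0 < L) {u : ℝ → ℝ} (hu : SmoothPeriodic L u) (hK : 2 ≤ K) (hr : 1 ≤ r)
    (h1 : l2 L (deriv u) ≤ K) (h3 : l2 L (deriv (deriv (deriv u))) ≤ r ^ 4) :
    l2 L (deriv (deriv u)) ≤ K * r ^ 2 ∧ (∀ x, |deriv u x| ≤ K ^ 2 * r) ∧
      ∀ x, |deriv (deriv u) x| ≤ K * r ^ 3 := by
  have n1 : 0 ≤ l2 L (deriv u) := l2_nonneg
  have n2 : 0 ≤ l2 L (deriv (deriv u)) := l2_nonneg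
  have n3 : 0 ≤ l2 L (deriv (deriv (deriv u))) := l2_nonneg
  -- The counting rule: from `‖u'‖ ~ 1` to `‖u'''‖ ~ r ^ 4` each derivative costs `r ^ 2` in `L²`,
  -- and the supremum norm costs one more power of `r`.
  have e2 : l2 L (deriv (deriv u)) ≤ K * r ^ 2 := by
    apply le_of_sq_le_sq _ (by positivity)
    calc l2 L (deriv (deriv u)) ^ 2 ≤ _ := sq_l2_deriv_le hL.le hu.deriv
      _ ≤ K * r ^ 4 := mul_le_mul h1 h3 n3 (by linarith)
      _ ≤ K * r ^ 4 * K := le_mul_of_one_le_right (by positivity) (by linarith)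
      _ = _ := by ring
  refine ⟨e2, fun x => ?_, fun x => ?_⟩
  · apply abs_le_of_sq_le_sq _ (by positivity)
    calc deriv u x ^ 2 ≤ _ := sq_deriv_le hL hu x
      _ ≤ 2 * (K * (K * r ^ 2)) := by gcongr
      _ ≤ K ^ 2 * (K * (K * r ^ 2)) := by gcongr; nlinarith
      _ = _ := by ring
  · apply abs_le_of_sq_le_sq _ (by positivity)
    calc deriv (deriv u) x ^ 2 ≤ _ := sq_deriv_le hL hu.deriv x
      _ ≤ 2 * ((K * r ^ 2) * r ^ 4) := by gcongr
      _ ≤ K * ((K * r ^ 2) * r ^ 4) := by gcongr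
      _ = _ := by ring

lemma one_le_weight (H : Scaled L K r a c) (x : ℝ) : 1 ≤ scaleWeight r a c x := by
  have := H.one_le
  rw [scaleWeight, add_assoc]
  have : 0 ≤ (|deriv (deriv a) x| + |deriv (deriv c) x|) / r ^ 2
    + (|deriv (deriv (deriv a)) x| + |deriv (deriv (deriv c)) x|) / r ^ 4 := by positivity
  linarith

lemma continuous_weight (H : Scaled L K r a c) : Continuous (scaleWeight r a c) := by
  have h1 := H.smooth_a.deriv.deriv.continuous
  have h2 := H.smooth_a.deriv.deriv.deriv.continuous
  have h3 := H.smooth_c.deriv.deriv.continuous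
  have h4 := H.smooth_c.deriv.deriv.deriv.continuous
  unfold scaleWeight
  fun_prop

/-- Second and third derivatives are divided by exactly the size of their `L²` norms, so that the
weight has a norm independent of `r`. -/
lemma l2_weight_le (hL : 0 < L) (H : Scaled L K r a c) : l2 L (scaleWeight r a c) ≤ K ^ 3 := by
  have h1 := H.smooth_a.deriv.deriv.continuous
  have h2 := H.smooth_a.deriv.deriv.deriv.continuous
  have h3 := H.smooth_c.deriv.deriv.continuous
  have h4 := H.smooth_c.deriv.deriv.deriv.continuous
  have hr := H.one_le
  have hK := H.two_le
  have r2 : 0 < r ^ 2 := by positivity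
  have r4 : 0 < r ^ 4 := by positivity
  obtain ⟨t1, t2⟩ := H.l2_third_le
  obtain ⟨s1, -, -⟩ := interpolation hL H.smooth_a hK hr H.l2_a t1
  obtain ⟨s2, -, -⟩ := interpolation hL H.smooth_c hK hr H.l2_c t2
  have key : ∀ {u v : ℝ → ℝ} {R A : ℝ}, Continuous u → Continuous v → 0 < R → l2 L u ≤ A * R →
      l2 L v ≤ A * R → l2 L (fun x => (|u x| + |v x|) / R) ≤ 2 * A := by
    intro u v R A hu hv hR hA hB
    have e : (fun x => (|u x| + |v x|) / R) = fun x => R⁻¹ * (|u x| + |v x|) := by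
      ext x; rw [div_eq_inv_mul]
    rw [e, l2_const_mul, abs_of_pos (inv_pos.2 hR), inv_mul_le_iff₀ hR]
    have := l2_add_le hL.le hu.abs hv.abs
    rw [l2_abs, l2_abs] at this
    linarith
  have k1 := key h1 h3 r2 s1 s2
  have k2 := key h2 h4 r4 (by rwa [one_mul] : _ ≤ 1 * r ^ 4) (by rwa [one_mul])
  have k3 := l2_add_le hL.le (u := fun x => 1 + (|deriv (deriv a) x| + |deriv (deriv c) x|) / r ^ 2)
    (v := fun x => (|deriv (deriv (deriv a)) x| + |deriv (deriv (deriv c)) x|) / r ^ 4)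
    (by fun_prop) (by fun_prop)
  have k4 := l2_add_le hL.le (u := fun _ => (1 : ℝ))
    (v := fun x => (|deriv (deriv a) x| + |deriv (deriv c) x|) / r ^ 2)
    (by fun_prop) (by fun_prop)
  rw [l2_const hL.le zero_le_one, mul_one] at k4
  have k5 := H.sqrt_le
  have k6 : l2 L (scaleWeight r a c) = l2 L (fun x =>
    1 + (|deriv (deriv a) x| + |deriv (deriv c) x|) / r ^ 2
    + (|deriv (deriv (deriv a)) x| + |deriv (deriv (deriv c)) x|) / r ^ 4) := rfl
  have k7 : 4 * K ≤ K ^ 3 := by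
    nlinarith [mul_nonneg (mul_nonneg (by linarith : 0 ≤ K) (sub_nonneg.2 hK))
      (by linarith : 0 ≤ K + 2)]
  linarith

lemma l2_le (hL : 0 < L) (H : Scaled L K r a c) {j k : ℕ} {u : ℝ → ℝ} (hu : Continuous u)
    (h : Dominated K r (scaleWeight r a c) j k u) : l2 L u ≤ K ^ (j + 3) * r ^ k := by
  have hr := H.one_le
  have hK := H.two_le
  have h1 := l2_le_mul_of_abs_le hL.le hu H.continuous_weight (C := K ^ j * r ^ k) (by positivity)
    fun x => by
      rw [abs_of_pos (a := scaleWeight r a c x) (by linarith [H.one_le_weight x])]; exact h x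
  refine h1.trans ?_
  calc K ^ j * r ^ k * l2 L (scaleWeight r a c) ≤ K ^ j * r ^ k * K ^ 3 := by
        gcongr; exact H.l2_weight_le hL
    _ = _ := by ring

/-- The domination of `a`, `c`, `1 / a` and of the derivatives of `a` and `c`. -/
lemma basic (hL : 0 < L) (H : Scaled L K r a c) :
    (Dominated K r (fun _ => 1) 1 0 a ∧ Dominated K r (fun _ => 1) 1 0 (fun x => (a x)⁻¹) ∧
      Dominated K r (fun _ => 1) 1 0 c) ∧
    (Dominated K r (fun _ => 1) 2 1 (deriv a) ∧ Dominated K r (fun _ => 1) 2 1 (deriv c)) ∧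
    (Dominated K r (fun _ => 1) 1 3 (deriv (deriv a)) ∧
      Dominated K r (fun _ => 1) 1 3 (deriv (deriv c))) ∧
    (Dominated K r (scaleWeight r a c) 0 2 (deriv (deriv a)) ∧
      Dominated K r (scaleWeight r a c) 0 2 (deriv (deriv c))) ∧
    (Dominated K r (scaleWeight r a c) 0 4 (deriv (deriv (deriv a))) ∧
      Dominated K r (scaleWeight r a c) 0 4 (deriv (deriv (deriv c)))) := by
  have hr := H.one_le
  have hK := H.two_le
  obtain ⟨t1, t2⟩ := H.l2_third_le
  obtain ⟨-, s2, s3⟩ := interpolation hL H.smooth_a hK hr H.l2_a t1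
  obtain ⟨-, q2, q3⟩ := interpolation hL H.smooth_c hK hr H.l2_c t2
  have key : ∀ x, scaleWeight r a c x = 1 + |deriv (deriv a) x| / r ^ 2 + |deriv (deriv c) x| / r ^ 2
      + |deriv (deriv (deriv a)) x| / r ^ 4 + |deriv (deriv (deriv c)) x| / r ^ 4 := fun x => by
    rw [scaleWeight]; ring
  have pos : ∀ (s : ℝ) (k : ℕ), 0 ≤ |s| / r ^ k := fun s k => by positivity
  refine ⟨⟨fun x => ?_, fun x => ?_, fun x => ?_⟩, ⟨fun x => ?_, fun x => ?_⟩,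
    ⟨fun x => ?_, fun x => ?_⟩, ⟨fun x => ?_, fun x => ?_⟩, ⟨fun x => ?_, fun x => ?_⟩⟩
  · rw [abs_of_pos (H.pos x)]; simpa using H.le x
  · rw [abs_of_pos (inv_pos.2 (H.pos x))]
    simpa using inv_le_of_inv_le₀ (by linarith) (H.inv_le x)
  · simpa using H.abs_c_le x
  · simpa using s2 x
  · simpa using q2 x
  · simpa using s3 x
  · simpa using q3 x
  all_goals
    rw [pow_zero, one_mul, mul_comm, ← div_le_iff₀ (by positivity), key]
    linarith [pos (deriv (deriv a) x) 2, pos (deriv (deriv c) x) 2,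
      pos (deriv (deriv (deriv a)) x) 4, pos (deriv (deriv (deriv c)) x) 4]

/-- The count in `r`: `a_x c_x²` has three factors of supremum size `r`, and `c_x c_xx` has one such
factor and a second derivative of weighted size `r ^ 2`. The power of `K` is immaterial; 30 is a
common exponent for this estimate and the three that follow, made up of 27 for the pointwise
domination and 3 for the weight. -/
lemma l2_lowFlux_le (hL : 0 < L) (H : Scaled L K r a c) :
    l2 L (lowFlux a c) ≤ K ^ 30 * r ^ 3 := by
  obtain ⟨⟨A, I, C⟩, ⟨A1, C1⟩, ⟨A2, C2⟩, ⟨A2w, C2w⟩, A3w, C3w⟩ := H.basic hL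
  have hr := H.one_le
  have hK := H.two_le
  have hw := H.one_le_weight
  have two : Dominated K r (fun _ => 1) 3 0 (fun _ => 2) := .const hK (by norm_num)
  refine H.l2_le (j := 27) hL (lowFlux_smooth H.smooth_a H.smooth_c H.pos).continuous ?_
  refine ((((A1.mul hK hr I).weight hK hr hw).add hK hr hw ((A.mul hK hr A).mul hK hr
    (((A1.mul hK hr (C1.mul hK hr C1)).weight hK hr hw).add hK hr hw
      (((two.mul hK hr A).mul hK hr C1).mul hK hr C2w)))).mono hK hr hw ?_ ?_).congr ?_
  · norm_num
  · norm_num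
  · intro x; rw [lowFlux]; ring

/-- One more derivative costs `r ^ 2`. In the term with `c_xx²` one factor is estimated in supremum
norm by `r ^ 3` and the other by the weight with `r ^ 2`. -/
lemma l2_deriv_lowFlux_le (hL : 0 < L) (H : Scaled L K r a c) :
    l2 L (deriv (lowFlux a c)) ≤ K ^ 30 * r ^ 5 := by
  obtain ⟨⟨A, I, C⟩, ⟨A1, C1⟩, ⟨A2, C2⟩, ⟨A2w, C2w⟩, A3w, C3w⟩ := H.basic hL
  have hr := H.one_le
  have hK := H.two_le
  have hw := H.one_le_weight
  have two : Dominated K r (fun _ => 1) 3 0 (fun _ => 2) := .const hK (by norm_num)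
  have four : Dominated K r (fun _ => 1) 3 0 (fun _ => 4) := .const hK (by norm_num)
  refine H.l2_le (j := 27) hL (lowFlux_smooth H.smooth_a H.smooth_c H.pos).deriv.continuous ?_
  have T1 := I.mul hK hr A2w
  have T2 := (((A1.mul hK hr A1).mul hK hr (I.mul hK hr I)).weight hK hr hw).neg
  have T3 := (((two.mul hK hr A).mul hK hr A1).mul hK hr
    (((A1.mul hK hr (C1.mul hK hr C1)).weight hK hr hw).add hK hr hw
      (((two.mul hK hr A).mul hK hr C1).mul hK hr C2w)))
  have T4 := (A.mul hK hr A).mul hK hr (((((C1.mul hK hr C1).mul hK hr A2w).add hK hr hw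
    (((four.mul hK hr A1).mul hK hr C1).mul hK hr C2w)).add hK hr hw
      (((two.mul hK hr A).mul hK hr C2).mul hK hr C2w)).add hK hr hw
      (((two.mul hK hr A).mul hK hr C1).mul hK hr C3w))
  refine ((((T1.add hK hr hw T2).add hK hr hw T3).add hK hr hw T4).mono hK hr hw ?_ ?_).congr ?_
  · norm_num
  · norm_num
  · intro x; rw [deriv_lowFlux H.smooth_a H.smooth_c H.pos]; ring

lemma l2_deriv_lowPot_le (hL : 0 < L) (H : Scaled L K r a c) :
    l2 L (deriv (lowPot a c)) ≤ K ^ 30 * r ^ 3 := by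
  obtain ⟨⟨A, I, C⟩, ⟨A1, C1⟩, ⟨A2, C2⟩, ⟨A2w, C2w⟩, A3w, C3w⟩ := H.basic hL
  have hr := H.one_le
  have hK := H.two_le
  have hw := H.one_le_weight
  have three : Dominated K r (fun _ => 1) 3 0 (fun _ => 3) := .const hK (by norm_num)
  refine H.l2_le (j := 27) hL (lowPot_smooth H.smooth_a H.smooth_c H.pos).deriv.continuous ?_
  have T1 := (((three.mul hK hr (C.mul hK hr C)).mul hK hr C1).add hK hr (fun _ => le_rfl)
    C1.neg).weight hK hr hw
  have T2 := ((C1.mul hK hr I).mul hK hr A2w).neg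
  have T3 := ((A1.mul hK hr I).mul hK hr C2w).neg
  have T4 := (((A1.mul hK hr A1).mul hK hr C1).mul hK hr (I.mul hK hr I)).weight hK hr hw
  refine ((((T1.add hK hr hw T2).add hK hr hw T3).add hK hr hw T4).mono hK hr hw ?_ ?_).congr ?_
  · norm_num
  · norm_num
  · intro x; rw [deriv_lowPot H.smooth_a H.smooth_c H.pos]; ring

/-- The third derivatives and `a_xx c_xx` are the terms of top size: `r · r ^ 4` for a slope times a
third derivative, and `r ^ 3 · r ^ 2` with `a_xx` in supremum norm and `c_xx` carrying the weight.
-/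
lemma l2_deriv_deriv_lowPot_le (hL : 0 < L) (H : Scaled L K r a c) :
    l2 L (deriv (deriv (lowPot a c))) ≤ K ^ 30 * r ^ 5 := by
  obtain ⟨⟨A, I, C⟩, ⟨A1, C1⟩, ⟨A2, C2⟩, ⟨A2w, C2w⟩, A3w, C3w⟩ := H.basic hL
  have hr := H.one_le
  have hK := H.two_le
  have hw := H.one_le_weight
  have two : Dominated K r (fun _ => 1) 3 0 (fun _ => 2) := .const hK (by norm_num)
  have three : Dominated K r (fun _ => 1) 3 0 (fun _ => 3) := .const hK (by norm_num)
  have six : Dominated K r (fun _ => 1) 3 0 (fun _ => 6) := .const hK (by norm_num)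
  have hw1 : ∀ _ : ℝ, (1 : ℝ) ≤ 1 := fun _ => le_rfl
  refine H.l2_le (j := 27) hL
    (lowPot_smooth H.smooth_a H.smooth_c H.pos).deriv.deriv.continuous ?_
  have T1 := ((six.mul hK hr C).mul hK hr (C1.mul hK hr C1)).weight hK hr hw
  have T2 := (three.mul hK hr (C.mul hK hr C)).mul hK hr C2w
  have T3 := C2w.neg
  have T4 := ((C1.mul hK hr I).mul hK hr A3w).neg
  have T5 := (((two.mul hK hr I).mul hK hr A2).mul hK hr C2w).neg
  have T6 := (((three.mul hK hr A1).mul hK hr C1).mul hK hr (I.mul hK hr I)).mul hK hr A2w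
  have T7 := ((A1.mul hK hr I).mul hK hr C3w).neg
  have T8 := ((two.mul hK hr (A1.mul hK hr A1)).mul hK hr (I.mul hK hr I)).mul hK hr C2w
  have T9 := (((two.mul hK hr (A1.mul hK hr (A1.mul hK hr A1))).mul hK hr C1).mul hK hr
    ((I.mul hK hr I).mul hK hr I)).neg.weight hK hr hw
  refine ((((T1.add hK hr hw T2).add hK hr hw (T3.add hK hr hw T4)).add hK hr hw
    ((T5.add hK hr hw T6).add hK hr hw (T7.add hK hr hw (T8.add hK hr hw T9)))).mono
      hK hr hw ?_ ?_).congr ?_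
  · norm_num
  · norm_num
  · intro x; rw [deriv_deriv_lowPot H.smooth_a H.smooth_c H.pos]; ring

lemma abs_pow_three_le (H : Scaled L K r a c) (x : ℝ) : |a x ^ 3| ≤ K ^ 3 := by
  rw [abs_of_pos (pow_pos (H.pos x) 3)]
  exact pow_le_pow_left₀ (H.pos x).le (H.le x) 3

lemma l2_flux_le (hL : 0 < L) (H : Scaled L K r a c) : l2 L (flux a c) ≤ K ^ 31 * r ^ 4 := by
  have hr := H.one_le
  have hK := H.two_le
  have ca := H.smooth_a.continuous
  have h1 := l2_sub_le hL.le (H.smooth_a.pow 3 |>.mul H.smooth_a.deriv.deriv.deriv).continuous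
    (lowFlux_smooth H.smooth_a H.smooth_c H.pos).continuous
  have h2 := l2_mul_le hL.le (u := fun x => a x ^ 3) (by fun_prop)
    H.smooth_a.deriv.deriv.deriv.continuous H.abs_pow_three_le
  have h3 := mul_le_mul_of_nonneg_left H.l2_third_le.1 (show 0 ≤ K ^ 3 by positivity)
  have h4 := H.l2_lowFlux_le hL
  have h5 : K ^ 3 ≤ K ^ 30 := pow_le_pow_right₀ (by linarith) (by norm_num)
  have h6 : r ^ 3 ≤ r ^ 4 := pow_le_pow_right₀ hr (by norm_num)
  calc l2 L (flux a c) ≤ K ^ 3 * r ^ 4 + K ^ 30 * r ^ 3 := by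
        exact h1.trans (add_le_add (h2.trans h3) h4)
    _ ≤ K ^ 30 * r ^ 4 + K ^ 30 * r ^ 4 := by gcongr
    _ = 2 * (K ^ 30 * r ^ 4) := by ring
    _ ≤ K * (K ^ 30 * r ^ 4) := by gcongr
    _ = _ := by ring

lemma deriv_pot_eq (H : Scaled L K r a c) (x : ℝ) :
    deriv (pot a c) x = deriv (lowPot a c) x - deriv (deriv (deriv c)) x :=
  (((lowPot_smooth H.smooth_a H.smooth_c H.pos).hasDerivAt x).sub
    (H.smooth_c.deriv.deriv.hasDerivAt x)).deriv

lemma l2_deriv_pot_le (hL : 0 < L) (H : Scaled L K r a c) :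
    l2 L (deriv (pot a c)) ≤ K ^ 31 * r ^ 4 := by
  have hr := H.one_le
  have hK := H.two_le
  have h1 := l2_sub_le hL.le (lowPot_smooth H.smooth_a H.smooth_c H.pos).deriv.continuous
    H.smooth_c.deriv.deriv.deriv.continuous
  rw [← show deriv (pot a c) = _ from funext H.deriv_pot_eq] at h1
  have h4 := H.l2_deriv_lowPot_le hL
  have h3 := H.l2_third_le.2
  have h5 : 1 ≤ K ^ 30 := one_le_pow₀ (by linarith)
  have h6 : r ^ 3 ≤ r ^ 4 := pow_le_pow_right₀ hr (by norm_num)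
  calc l2 L (deriv (pot a c)) ≤ K ^ 30 * r ^ 3 + 1 * r ^ 4 := by linarith
    _ ≤ K ^ 30 * r ^ 4 + K ^ 30 * r ^ 4 := by gcongr
    _ = 2 * (K ^ 30 * r ^ 4) := by ring
    _ ≤ K * (K ^ 30 * r ^ 4) := by gcongr
    _ = _ := by ring

end Scaled

/-! ### Control of the third derivatives by the dissipation. -/

section

variable {L K r : ℝ} {a c : ℝ → ℝ}

lemma Bounds.l2_flux_le_dissipation (hL : 0 < L) (H : Bounds L K a c) :
    l2 L (flux a c) ^ 2 ≤ K ^ 3 * dissipation L a c ∧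
    l2 L (deriv (pot a c)) ^ 2 ≤ K * dissipation L a c := by
  have hK := H.two_le
  have ca := H.smooth_a.continuous
  have ci := (H.smooth_a.inv H.pos).continuous
  have cf := (smoothPeriodic_flux H.smooth_a H.smooth_c H.pos).continuous
  have cp := (smoothPeriodic_pot H.smooth_a H.smooth_c H.pos).deriv.continuous
  have hI : ∀ x, K⁻¹ ≤ (a x)⁻¹ := fun x =>
    (inv_le_inv₀ (by linarith) (H.pos x)).2 (H.le x)
  have hK0 : 0 < K := by linarith
  constructor
  · rw [sq_l2 hL.le, dissipation, ← intervalIntegral.integral_const_mul]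
    refine intervalIntegral.integral_mono_on hL.le (Continuous.intervalIntegrable (by fun_prop) _ _)
      (Continuous.intervalIntegrable (by fun_prop) _ _) fun x _ => ?_
    have h1 : 1 ≤ K ^ 3 * (a x)⁻¹ ^ 3 := by
      rw [← mul_pow]
      refine one_le_pow₀ ?_
      rw [← div_eq_mul_inv, one_le_div (H.pos x)]; exact H.le x
    have h2 : 0 ≤ K ^ 3 * (a x * deriv (pot a c) x ^ 2) := by have := H.pos x; positivity
    nlinarith [mul_le_mul_of_nonneg_right h1 (sq_nonneg (flux a c x))]
  · rw [sq_l2 hL.le, dissipation, ← intervalIntegral.integral_const_mul]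
    refine intervalIntegral.integral_mono_on hL.le (Continuous.intervalIntegrable (by fun_prop) _ _)
      (Continuous.intervalIntegrable (by fun_prop) _ _) fun x _ => ?_
    have h1 : 1 ≤ K * a x := by
      have := mul_le_mul_of_nonneg_left (H.inv_le x) hK0.le
      rwa [mul_inv_cancel₀ hK0.ne'] at this
    have h2 : 0 ≤ K * (flux a c x ^ 2 * (a x)⁻¹ ^ 3) := by
      have := inv_pos.2 (H.pos x); positivity
    nlinarith [mul_le_mul_of_nonneg_right h1 (sq_nonneg (deriv (pot a c) x))]

lemma Bounds.dissipation_nonneg (hL : 0 < L) (H : Bounds L K a c) : 0 ≤ dissipation L a c :=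
  intervalIntegral.integral_nonneg hL.le fun x _ => by
    have := inv_pos.2 (H.pos x)
    have := H.pos x
    positivity

/-- The third derivatives are controlled by the dissipation. -/
lemma exists_pow_le_dissipation (hL : 0 < L) (K : ℝ) :
    ∃ C : ℝ, 0 < C ∧ ∀ (r : ℝ) (a c : ℝ → ℝ), Scaled L K r a c →
      r ^ 8 ≤ C * (1 + dissipation L a c) := by
  -- Nothing is known about `K` yet; `K ≥ 2` comes with the state. The absolute value keeps the
  -- constant positive in any case.
  set q := 4 * |K| ^ 66 with hq
  refine ⟨2 * (1 + 8 * q ^ 4 + 4 * |K| ^ 9), by positivity, ?_⟩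
  intro r a c H
  have hr := H.one_le
  have hK := H.two_le
  have hKa : |K| = K := abs_of_pos (by linarith)
  rw [hKa] at hq ⊢
  set D := dissipation L a c
  have hD : 0 ≤ D := H.toBounds.dissipation_nonneg hL
  obtain ⟨d1, d2⟩ := H.toBounds.l2_flux_le_dissipation hL
  have ci := (H.smooth_a.inv H.pos).continuous
  have cf := (smoothPeriodic_flux H.smooth_a H.smooth_c H.pos).continuous
  have cl := (lowFlux_smooth H.smooth_a H.smooth_c H.pos).continuous
  have n1 : 0 ≤ l2 L (flux a c) := l2_nonneg
  have n2 : 0 ≤ l2 L (deriv (pot a c)) := l2_nonneg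
  have n3 : 0 ≤ l2 L (deriv (deriv (deriv a))) := l2_nonneg
  have n4 : 0 ≤ l2 L (deriv (deriv (deriv c))) := l2_nonneg
  -- Solving the definition of the flux for `a_xxx`. The remainder has size `r ^ 3`, strictly below
  -- the size `r ^ 4` of `a_xxx`.
  have b1 : l2 L (deriv (deriv (deriv a))) ≤ K ^ 3 * (l2 L (flux a c) + K ^ 30 * r ^ 3) := by
    have e : deriv (deriv (deriv a)) = fun x => (a x)⁻¹ ^ 3 * (flux a c x + lowFlux a c x) := by
      ext x
      have := (H.pos x).ne'
      rw [flux, lowFlux]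
      field_simp
      ring
    rw [e]
    refine (l2_mul_le hL.le (u := fun x => (a x)⁻¹ ^ 3) (by fun_prop) (cf.add cl)
      (C := K ^ 3) fun x => ?_).trans ?_
    · have := inv_pos.2 (H.pos x)
      rw [abs_of_pos (by positivity)]
      exact pow_le_pow_left₀ this.le (inv_le_of_inv_le₀ (by linarith) (H.inv_le x)) 3
    · refine mul_le_mul_of_nonneg_left ?_ (by positivity)
      exact (l2_add_le hL.le cf cl).trans (add_le_add le_rfl (H.l2_lowFlux_le hL))
  have b2 : l2 L (deriv (deriv (deriv c))) ≤ l2 L (deriv (pot a c)) + K ^ 30 * r ^ 3 := by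
    have e : deriv (deriv (deriv c)) = fun x => deriv (lowPot a c) x - deriv (pot a c) x := by
      ext x; rw [H.deriv_pot_eq]; ring
    rw [e]
    have := l2_sub_le hL.le (lowPot_smooth H.smooth_a H.smooth_c H.pos).deriv.continuous
      (smoothPeriodic_pot H.smooth_a H.smooth_c H.pos).deriv.continuous
    linarith [H.l2_deriv_lowPot_le hL]
  have b3 : l2 L (deriv (deriv (deriv a))) ^ 2 ≤ 2 * K ^ 9 * D + 2 * K ^ 66 * r ^ 6 := by
    calc _ ≤ (K ^ 3 * (l2 L (flux a c) + K ^ 30 * r ^ 3)) ^ 2 := pow_le_pow_left₀ n3 b1 2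
      _ = K ^ 6 * (l2 L (flux a c) + K ^ 30 * r ^ 3) ^ 2 := by ring
      _ ≤ K ^ 6 * (2 * (l2 L (flux a c) ^ 2 + (K ^ 30 * r ^ 3) ^ 2)) := by
        gcongr; exact add_sq_le
      _ ≤ K ^ 6 * (2 * (K ^ 3 * D + (K ^ 30 * r ^ 3) ^ 2)) := by gcongr
      _ = _ := by ring
  have b4 : l2 L (deriv (deriv (deriv c))) ^ 2 ≤ 2 * K ^ 9 * D + 2 * K ^ 66 * r ^ 6 := by
    calc _ ≤ (l2 L (deriv (pot a c)) + K ^ 30 * r ^ 3) ^ 2 := pow_le_pow_left₀ n4 b2 2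
      _ ≤ (2 * (l2 L (deriv (pot a c)) ^ 2 + (K ^ 30 * r ^ 3) ^ 2)) := add_sq_le
      _ ≤ (2 * (K * D + (K ^ 30 * r ^ 3) ^ 2)) := by gcongr
      _ = 2 * K ^ 1 * D + 2 * K ^ 60 * r ^ 6 := by ring
      _ ≤ _ := by gcongr <;> linarith
  have b5 : r ^ 8 ≤ 1 + 4 * K ^ 9 * D + q * r ^ 6 := by
    rw [H.pow_eq, hq]; linarith
  -- Absorption of the subcritical power: it is half of `r ^ 8` when `r ^ 2 ≥ 2 q`, and bounded by a
  -- constant otherwise.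
  have b6 : q * r ^ 6 ≤ r ^ 8 / 2 + 8 * q ^ 4 := by
    have hq0 : 0 ≤ q := by rw [hq]; positivity
    rcases le_total (2 * q) (r ^ 2) with h | h
    · have : 2 * q * r ^ 6 ≤ r ^ 2 * r ^ 6 := by gcongr
      have e : r ^ 2 * r ^ 6 = r ^ 8 := by ring
      have : 0 ≤ 8 * q ^ 4 := by positivity
      linarith
    · have h3 : (r ^ 2) ^ 3 ≤ (2 * q) ^ 3 := pow_le_pow_left₀ (by positivity) h 3
      have h4 : q * r ^ 6 ≤ q * (2 * q) ^ 3 := by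
        rw [show r ^ 6 = (r ^ 2) ^ 3 by ring]; gcongr
      have h5 : 0 ≤ r ^ 8 / 2 := by positivity
      linarith [show q * (2 * q) ^ 3 = 8 * q ^ 4 by ring]
  have h1 : 0 ≤ (1 + 8 * q ^ 4) * D := by
    have : 0 ≤ q ^ 4 := by positivity
    positivity
  have h2 : 0 ≤ K ^ 9 := by positivity
  linarith

end


/-! ## Galerkin spaces and the energy balance with its projection defects -/

/-- A finite dimensional space of smooth periodic functions which is invariant under the Laplacian
and whose orthogonal complement satisfies a Poincaré inequality with constant `Λ`. -/
structure IsGalerkinSpace (L Λ : ℝ) (V : Submodule ℝ (ℝ → ℝ)) : Prop where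
  smooth : ∀ u ∈ V, SmoothPeriodic L u
  finite : Module.Finite ℝ V
  laplace_mem : ∀ u ∈ V, deriv (deriv u) ∈ V
  gap : ∀ z, SmoothPeriodic L z → (∀ ψ ∈ V, ∫ x in (0 : ℝ)..L, z x * ψ x = 0) →
    Λ * l2 L z ≤ l2 L (deriv z)

lemma integral_add_of_continuous {L : ℝ} {u v : ℝ → ℝ} (hu : Continuous u) (hv : Continuous v) :
    ∫ x in (0 : ℝ)..L, (u x + v x) = (∫ x in (0 : ℝ)..L, u x) + ∫ x in (0 : ℝ)..L, v x :=
  intervalIntegral.integral_add (hu.intervalIntegrable _ _) (hv.intervalIntegrable _ _)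

lemma integral_sub_of_continuous {L : ℝ} {u v : ℝ → ℝ} (hu : Continuous u) (hv : Continuous v) :
    ∫ x in (0 : ℝ)..L, (u x - v x) = (∫ x in (0 : ℝ)..L, u x) - ∫ x in (0 : ℝ)..L, v x :=
  intervalIntegral.integral_sub (hu.intervalIntegrable _ _) (hv.intervalIntegrable _ _)

namespace IsGalerkinSpace

variable {L Λ : ℝ} {V : Submodule ℝ (ℝ → ℝ)}

/-- Existence of weighted orthogonal projections. -/
lemma exists_projection (hL : 0 < L) (hV : IsGalerkinSpace L Λ V) {a z : ℝ → ℝ}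
    (ha : SmoothPeriodic L a) (h0 : ∀ x, 0 < a x) (hz : SmoothPeriodic L z) :
    ∃ p ∈ V, ∀ ψ ∈ V, ∫ x in (0 : ℝ)..L, a x * (z x - p x) * ψ x = 0 := by
  have := hV.finite
  have ca := ha.continuous
  have cV : ∀ u : V, Continuous (u : ℝ → ℝ) := fun u => (hV.smooth u u.2).continuous
  let B : V →ₗ[ℝ] V →ₗ[ℝ] ℝ := LinearMap.mk₂ ℝ
    (fun u v => ∫ x in (0 : ℝ)..L, a x * (u : ℝ → ℝ) x * (v : ℝ → ℝ) x)
    (fun u u' v => by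
      have := cV u; have := cV u'; have := cV v
      rw [← integral_add_of_continuous (by fun_prop) (by fun_prop)]
      congr 1; ext x; simp only [Submodule.coe_add, Pi.add_apply]; ring)
    (fun r u v => by
      rw [smul_eq_mul, ← intervalIntegral.integral_const_mul]
      congr 1; ext x; simp only [Submodule.coe_smul, Pi.smul_apply, smul_eq_mul]; ring)
    (fun u v v' => by
      have := cV u; have := cV v'; have := cV v
      rw [← integral_add_of_continuous (by fun_prop) (by fun_prop)]
      congr 1; ext x; simp only [Submodule.coe_add, Pi.add_apply]; ring)
    (fun r u v => by
      rw [smul_eq_mul, ← intervalIntegral.integral_const_mul]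
      congr 1; ext x; simp only [Submodule.coe_smul, Pi.smul_apply, smul_eq_mul]; ring)
  have hB : ∀ u v : V, B u v = ∫ x in (0 : ℝ)..L, a x * (u : ℝ → ℝ) x * (v : ℝ → ℝ) x :=
    fun _ _ => rfl
  -- The form is definite because `B u u = ∫ a u²`; by finite dimension it then represents every
  -- linear functional, in particular the one given by `z`.
  have hinj : Function.Injective B := by
    rw [injective_iff_map_eq_zero]
    intro u hu
    have h1 : B u u = 0 := by rw [hu]; rfl
    rw [hB] at h1
    have hs := hV.smooth u u.2
    have hsq : SmoothPeriodic L (fun x => √(a x) * (u : ℝ → ℝ) x) :=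
      SmoothPeriodic.mul ⟨ha.smooth.sqrt fun x => (h0 x).ne', fun x => by
        simp only [ha.periodic x]⟩ hs
    have h2 := eq_zero_of_integral_sq_eq_zero hL hsq (by
      rw [← h1]; congr 1; ext x
      rw [mul_pow, Real.sq_sqrt (h0 x).le]; ring)
    ext x
    have := h2 x
    rw [mul_eq_zero] at this
    exact this.resolve_left (Real.sqrt_pos.2 (h0 x)).ne'
  have hsurj : Function.Surjective B :=
    (LinearMap.injective_iff_surjective_of_finrank_eq_finrank
      (Subspace.dual_finrank_eq (K := ℝ) (V := V)).symm).1 hinj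
  let ℓ : V →ₗ[ℝ] ℝ :=
    { toFun := fun v => ∫ x in (0 : ℝ)..L, a x * z x * (v : ℝ → ℝ) x
      map_add' := fun v v' => by
        have := cV v; have := cV v'; have := hz.continuous
        rw [← integral_add_of_continuous (by fun_prop) (by fun_prop)]
        congr 1; ext x; simp only [Submodule.coe_add, Pi.add_apply]; ring
      map_smul' := fun r v => by
        rw [RingHom.id_apply, smul_eq_mul, ← intervalIntegral.integral_const_mul]
        congr 1; ext x; simp only [Submodule.coe_smul, Pi.smul_apply, smul_eq_mul]; ring }
  obtain ⟨p, hp⟩ := hsurj ℓ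
  refine ⟨p, p.2, fun ψ hψ => ?_⟩
  have h1 : B p ⟨ψ, hψ⟩ = ∫ x in (0 : ℝ)..L, a x * z x * ψ x := by rw [hp]; rfl
  rw [hB] at h1
  have := cV p; have := hz.continuous; have := (hV.smooth ψ hψ).continuous
  have e : ∀ x, a x * (z x - (p : ℝ → ℝ) x) * ψ x = a x * z x * ψ x - a x * (p : ℝ → ℝ) x * ψ x :=
    fun x => by ring
  simp_rw [e]
  rw [integral_sub_of_continuous (by fun_prop) (by fun_prop), h1, sub_self]

lemma exists_orthogonal_projection (hL : 0 < L) (hV : IsGalerkinSpace L Λ V) {z : ℝ → ℝ}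
    (hz : SmoothPeriodic L z) :
    ∃ p ∈ V, ∀ ψ ∈ V, ∫ x in (0 : ℝ)..L, (z x - p x) * ψ x = 0 := by
  obtain ⟨p, hp, h⟩ := hV.exists_projection hL (SmoothPeriodic.const L 1)
    (fun _ => zero_lt_one) hz
  exact ⟨p, hp, fun ψ hψ => by simpa using h ψ hψ⟩

/-- Approximation by the orthogonal projection. -/
lemma defect_le (hL : 0 < L) (hΛ : 0 < Λ) (hV : IsGalerkinSpace L Λ V) {u p : ℝ → ℝ}
    (hu : SmoothPeriodic L u) (hp : p ∈ V)
    (h : ∀ ψ ∈ V, ∫ x in (0 : ℝ)..L, (u x - p x) * ψ x = 0) :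
    Λ * l2 L (fun x => u x - p x) ≤ l2 L (deriv fun x => u x - p x) ∧
    l2 L (deriv fun x => u x - p x) ≤ l2 L (deriv u) ∧
    Λ * l2 L (deriv fun x => u x - p x) ≤ l2 L (deriv (deriv u)) := by
  have sp := hV.smooth p hp
  have hz := hu.sub sp
  set z := fun x => u x - p x with hzdef
  have g := hV.gap z hz h
  have d1 : deriv z = fun x => deriv u x - deriv p x :=
    funext fun x => ((hu.hasDerivAt x).sub (sp.hasDerivAt x)).deriv
  have d2 : ∀ x, deriv (deriv z) x = deriv (deriv u) x - deriv (deriv p) x := fun x => by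
    rw [d1]; exact ((hu.deriv.hasDerivAt x).sub (sp.deriv.hasDerivAt x)).deriv
  have n0 : 0 ≤ l2 L (deriv z) := l2_nonneg
  have c0 := hz.continuous
  have c1 := hu.deriv.deriv.continuous
  have c2 := sp.deriv.deriv.continuous
  have zero := h _ (hV.laplace_mem p hp)
  -- The space contains `p''`, so `z` is orthogonal to it and `∫ z'² = -∫ z z''` reduces to `u''`.
  have key : l2 L (deriv z) ^ 2 = -∫ x in (0 : ℝ)..L, z x * deriv (deriv u) x := by
    rw [sq_l2 hL.le]
    simp_rw [pow_two]
    rw [hz.integral_deriv_mul hz.deriv]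
    simp_rw [d2, mul_sub]
    rw [integral_sub_of_continuous (by fun_prop) (by fun_prop)]
    rw [zero, sub_zero]
  have k1 : l2 L (deriv z) ^ 2 ≤ l2 L (deriv u) * l2 L (deriv z) := by
    rw [key]
    have := hu.deriv.integral_deriv_mul hz
    have e : ∫ x in (0 : ℝ)..L, z x * deriv (deriv u) x
        = ∫ x in (0 : ℝ)..L, deriv (deriv u) x * z x := by congr 1; ext x; ring
    rw [e, this, neg_neg]
    exact integral_mul_le hL.le hu.deriv.continuous hz.deriv.continuous
  have k2 : l2 L (deriv z) ^ 2 ≤ l2 L z * l2 L (deriv (deriv u)) := by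
    rw [key]
    exact (neg_le_abs _).trans (abs_integral_mul_le hL.le c0 c1)
  refine ⟨g, ?_, ?_⟩
  · rcases n0.eq_or_lt with h0 | h0
    · rw [← h0]; exact l2_nonneg
    · exact le_of_mul_le_mul_right (by linarith) h0
  · rcases n0.eq_or_lt with h0 | h0
    · rw [← h0, mul_zero]; exact l2_nonneg
    · have n2 : 0 ≤ l2 L (deriv (deriv u)) := l2_nonneg
      refine le_of_mul_le_mul_right (a := l2 L (deriv z)) ?_ h0
      calc Λ * l2 L (deriv z) * l2 L (deriv z) = Λ * l2 L (deriv z) ^ 2 := by ring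
        _ ≤ Λ * (l2 L z * l2 L (deriv (deriv u))) := by gcongr
        _ = (Λ * l2 L z) * l2 L (deriv (deriv u)) := by ring
        _ ≤ l2 L (deriv z) * l2 L (deriv (deriv u)) := by gcongr
        _ = _ := by ring

end IsGalerkinSpace

lemma abs_le_of_l2 {L : ℝ} (hL : 0 < L) {u : ℝ → ℝ} (hu : SmoothPeriodic L u) (x : ℝ) :
    |u x| ≤ (1 / L + 2) * (l2 L u + l2 L (deriv u)) := by
  have n0 : 0 ≤ l2 L u := l2_nonneg
  have n1 : 0 ≤ l2 L (deriv u) := l2_nonneg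
  have hl : 0 ≤ 1 / L := by positivity
  apply abs_le_of_sq_le_sq _ (by positivity)
  refine (sq_le_of_l2 hL hu x).trans ?_
  calc l2 L u ^ 2 / L + 2 * (l2 L u * l2 L (deriv u))
      = 1 / L * l2 L u ^ 2 + 2 * (l2 L u * l2 L (deriv u)) := by ring
    _ ≤ 1 / L * (l2 L u + l2 L (deriv u)) ^ 2 + 2 * (l2 L u + l2 L (deriv u)) ^ 2 := by
        gcongr
        · linarith
        · nlinarith
    _ = (1 / L + 2) * 1 * (l2 L u + l2 L (deriv u)) ^ 2 := by ring
    _ ≤ (1 / L + 2) * (1 / L + 2) * (l2 L u + l2 L (deriv u)) ^ 2 := by gcongr; linarith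
    _ = _ := by ring

/-- Stability in `H¹` of the weighted projection. -/
lemma exists_projection_bound {L : ℝ} (hL : 0 < L) (K : ℝ) :
    ∃ C : ℝ, 1 ≤ C ∧ ∀ (Λ : ℝ) (V : Submodule ℝ (ℝ → ℝ)) (a c z p : ℝ → ℝ), IsGalerkinSpace L Λ V →
      Bounds L K a c → SmoothPeriodic L z → p ∈ V →
      (∀ ψ ∈ V, ∫ x in (0 : ℝ)..L, a x * (z x - p x) * ψ x = 0) →
      l2 L p + l2 L (deriv p) ≤ C * (l2 L z + l2 L (deriv z)) := by
  set σ := 1 / L + 2 with hσ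
  have σ0 : 0 < σ := by positivity
  -- Large enough that the supremum of `p` carries `‖p'‖` with coefficient only `1 / (2 K ^ 2)`. In
  -- the estimate of `‖p'‖` below this coefficient is multiplied by `K ^ 2`, so half of `‖p'‖` can
  -- be absorbed.
  set C := 2 * K ^ 4 + K ^ 2 * σ with hC
  have C0 : 0 ≤ C := by positivity
  refine ⟨1 + K ^ 2 + 2 * K ^ 2 * (σ + 1 + C), by
    nlinarith [sq_nonneg K, mul_nonneg (sq_nonneg K) (show 0 ≤ σ + 1 + C by positivity)], ?_⟩
  intro Λ V a c z p hV H hz hp horth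
  have hK := H.two_le
  have sp := hV.smooth p hp
  have ha := H.smooth_a
  have ca := ha.continuous
  have ca' := ha.deriv.continuous
  have cz := hz.continuous
  have cz' := hz.deriv.continuous
  have cp := sp.continuous
  have cp' := sp.deriv.continuous
  have n0 : 0 ≤ l2 L p := l2_nonneg
  have n1 : 0 ≤ l2 L (deriv p) := l2_nonneg
  have m0 : 0 ≤ l2 L z := l2_nonneg
  have m1 : 0 ≤ l2 L (deriv z) := l2_nonneg
  have hKi : K⁻¹ * K = 1 := inv_mul_cancel₀ (by linarith)
  have aK : ∀ x, |a x| ≤ K := fun x => by rw [abs_of_pos (H.pos x)]; exact H.le x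
  have low : ∀ {f : ℝ → ℝ}, Continuous f →
      l2 L f ^ 2 ≤ K * ∫ x in (0 : ℝ)..L, a x * f x ^ 2 := by
    intro f hf
    rw [sq_l2 hL.le, ← intervalIntegral.integral_const_mul]
    refine intervalIntegral.integral_mono_on hL.le (Continuous.intervalIntegrable (by fun_prop) _ _)
      (Continuous.intervalIntegrable (by fun_prop) _ _) fun x _ => ?_
    have : 1 ≤ K * a x := by
      have := mul_le_mul_of_nonneg_left (H.inv_le x) (show 0 ≤ K by linarith)
      rwa [mul_comm, hKi] at this
    nlinarith [mul_le_mul_of_nonneg_right this (sq_nonneg (f x))]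
  have cancel : ∀ {s t : ℝ}, 0 ≤ s → 0 ≤ t → s ^ 2 ≤ t * s → s ≤ t := by
    intro s t hs ht h
    rcases hs.eq_or_lt with h0 | h0
    · rwa [← h0]
    · exact le_of_mul_le_mul_right (by linarith) h0
  set S := l2 L z + l2 L (deriv z) with hS
  have S0 : 0 ≤ S := by positivity
  -- Orthogonality tested with `p` itself.
  have p0 : l2 L p ≤ K ^ 2 * S := by
    have h1 : l2 L p ≤ K ^ 2 * l2 L z := by
      apply cancel n0 (by positivity)
      refine (low cp).trans ?_
      have h2 := horth p hp
      have e : ∀ x, a x * (z x - p x) * p x = a x * z x * p x - a x * p x ^ 2 := fun x => by ring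
      simp_rw [e] at h2
      rw [integral_sub_of_continuous (by fun_prop) (by fun_prop), sub_eq_zero] at h2
      rw [← h2]
      have h3 := integral_mul_le hL.le (u := fun x => a x * z x) (by fun_prop) cp
      have h4 := l2_mul_le hL.le ca cz aK
      calc K * ∫ x in (0 : ℝ)..L, a x * z x * p x ≤ K * (K * l2 L z * l2 L p) := by
            gcongr; exact h3.trans (by gcongr)
        _ = _ := by ring
    refine h1.trans ?_
    gcongr; linarith
  have supz : ∀ x, |z x| ≤ σ * S := fun x => abs_le_of_l2 hL hz x
  have supp : ∀ x, |p x| ≤ l2 L (deriv p) / (2 * K ^ 2) + C * S := by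
    intro x
    apply abs_le_of_sq_le_sq _ (by positivity)
    refine (sq_le_of_l2 hL sp x).trans ?_
    have e1 : l2 L p ^ 2 / L ≤ (K ^ 2 * σ * S) ^ 2 := by
      calc l2 L p ^ 2 / L = 1 / L * l2 L p ^ 2 := by ring
        _ ≤ σ * (K ^ 2 * S) ^ 2 := by gcongr; linarith
        _ = σ * 1 * (K ^ 2 * S) ^ 2 := by ring
        _ ≤ σ * σ * (K ^ 2 * S) ^ 2 := by
          gcongr
          have : 0 ≤ 1 / L := by positivity
          linarith
        _ = _ := by ring
    have e2 : 2 * (l2 L p * l2 L (deriv p)) ≤ 2 * (l2 L (deriv p) / (2 * K ^ 2)) * (C * S) := by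
      have : 2 * (l2 L (deriv p) / (2 * K ^ 2)) * (C * S) =
        (C / K ^ 2) * (S * l2 L (deriv p)) := by field_simp
      rw [this]
      have h5 : 2 * K ^ 2 ≤ C / K ^ 2 := by
        rw [le_div_iff₀ (by positivity), hC]
        have : 0 ≤ K ^ 2 * σ := by positivity
        linarith [show 2 * K ^ 2 * K ^ 2 = 2 * K ^ 4 by ring]
      calc 2 * (l2 L p * l2 L (deriv p)) ≤ 2 * (K ^ 2 * S * l2 L (deriv p)) := by gcongr
        _ = (2 * K ^ 2) * (S * l2 L (deriv p)) := by ring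
        _ ≤ _ := by gcongr
    have e3 : (K ^ 2 * σ * S) ^ 2 ≤ (C * S) ^ 2 := by
      gcongr
      rw [hC]
      have : 0 ≤ 2 * K ^ 4 := by positivity
      linarith
    nlinarith [sq_nonneg (l2 L (deriv p) / (2 * K ^ 2))]
  -- Orthogonality tested with `p''`, which lies in the space, followed by integration by parts. The
  -- weight is not constant, so `a_x` multiplies `z` and `p` undifferentiated; these are estimated
  -- in supremum norm, as `a_x` is bounded only in `L²`.
  have p1 : l2 L (deriv p) ≤ K * (σ * S * K + K * S + (l2 L (deriv p) / (2 * K ^ 2) + C * S) * K) := by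
    apply cancel n1 (by positivity)
    refine (low cp').trans ?_
    rw [mul_assoc]
    refine mul_le_mul_of_nonneg_left ?_ (by linarith)
    have h2 := horth _ (hV.laplace_mem p hp)
    have h3 := sp.deriv.integral_deriv_mul (ha.mul (hz.sub sp))
    have e : ∀ x, a x * (z x - p x) * deriv (deriv p) x
      = deriv (deriv p) x * (a x * (z x - p x)) := fun x => by ring
    simp_rw [e] at h2
    rw [h2] at h3
    have d : ∀ x, deriv (fun x => a x * (z x - p x)) x
        = deriv a x * (z x - p x) + a x * (deriv z x - deriv p x) := fun x =>
      ((ha.hasDerivAt x).mul ((hz.hasDerivAt x).sub (sp.hasDerivAt x))).deriv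
    simp_rw [d] at h3
    have e2 : ∀ x, deriv p x * (deriv a x * (z x - p x) + a x * (deriv z x - deriv p x))
      = (z x * deriv a x + a x * deriv z x - p x * deriv a x) * deriv p x - a x * deriv p x ^ 2 :=
      fun x => by ring
    simp_rw [e2] at h3
    rw [integral_sub_of_continuous (by fun_prop) (by fun_prop)] at h3
    have h4 : ∫ x in (0 : ℝ)..L, a x * deriv p x ^ 2 = ∫ x in (0 : ℝ)..L,
      (z x * deriv a x + a x * deriv z x - p x * deriv a x) * deriv p x := by linarith
    rw [h4]
    refine (integral_mul_le hL.le (by fun_prop) cp').trans ?_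
    refine mul_le_mul_of_nonneg_right ?_ n1
    refine (l2_sub_le hL.le (u := fun x => z x * deriv a x + a x * deriv z x)
      (v := fun x => p x * deriv a x) (by fun_prop) (by fun_prop)).trans ?_
    refine add_le_add ((l2_add_le hL.le (u := fun x => z x * deriv a x)
      (v := fun x => a x * deriv z x) (by fun_prop) (by fun_prop)).trans (add_le_add ?_ ?_)) ?_
    · refine (l2_mul_le hL.le cz ca' supz).trans ?_
      gcongr; exact H.l2_a
    · refine (l2_mul_le hL.le ca cz' aK).trans ?_
      gcongr; linarith
    · refine (l2_mul_le hL.le cp ca' supp).trans ?_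
      gcongr; exact H.l2_a
  have p2 : K * (σ * S * K + K * S + (l2 L (deriv p) / (2 * K ^ 2) + C * S) * K)
      = K ^ 2 * (σ + 1 + C) * S + l2 L (deriv p) / 2 := by
    have : K ≠ 0 := by linarith
    field_simp
    ring
  rw [p2] at p1
  nlinarith

/-! ### The energy balance -/

/-- The velocities prescribed by the Galerkin scheme. -/
structure IsVelocity (L : ℝ) (V : Submodule ℝ (ℝ → ℝ)) (a c a' c' : ℝ → ℝ) : Prop where
  mem_a : a' ∈ V
  mem_c : c' ∈ V
  eq_a : ∀ ψ ∈ V, ∫ x in (0 : ℝ)..L, a' x * ψ x = ∫ x in (0 : ℝ)..L, flux a c x * deriv ψ x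
  eq_c : ∀ ψ ∈ V, ∫ x in (0 : ℝ)..L, (c x * a' x + a x * c' x) * ψ x
    = ∫ x in (0 : ℝ)..L, (c x * flux a c x - a x * deriv (pot a c) x) * deriv ψ x

/-- The rate of change of the energy. -/
noncomputable def energyRate (L : ℝ) (a c a' c' : ℝ → ℝ) : ℝ :=
  ∫ x in (0 : ℝ)..L, (a' x * enVar a c x + a x * pot a c x * c' x)

section

variable {L Λ K r : ℝ} {V : Submodule ℝ (ℝ → ℝ)} {a c a' c' : ℝ → ℝ}

/-- The energy balance; `w` and `Z` are the defects caused by the projections. -/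
lemma energyRate_eq (hV : IsGalerkinSpace L Λ V) (ha : SmoothPeriodic L a)
    (hc : SmoothPeriodic L c) (h0 : ∀ x, 0 < a x) (hcV : c ∈ V) (hvel : IsVelocity L V a c a' c')
    {P p w Y Q : ℝ → ℝ} (hP : P ∈ V) (hp : p ∈ V)
    (hpo : ∀ ψ ∈ V, ∫ x in (0 : ℝ)..L, a x * ((lowPot a c x - P x) - p x) * ψ x = 0)
    (hw : w = fun x => (lowPot a c x - P x) - p x)
    (hY : Y = fun x => enVar a c x - c x * (pot a c x - w x)) (hQ : Q ∈ V)
    (hQo : ∀ ψ ∈ V, ∫ x in (0 : ℝ)..L, (Y x - Q x) * ψ x = 0) :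
    energyRate L a c a' c' = -dissipation L a c + (∫ x in (0 : ℝ)..L, w x * (flux a c x * deriv c x))
      + (∫ x in (0 : ℝ)..L, a x * deriv (pot a c) x * deriv w x)
      - ∫ x in (0 : ℝ)..L, flux a c x * deriv (fun x => Y x - Q x) x := by
  have sP := hV.smooth P hP
  have sp := hV.smooth p hp
  have sQ := hV.smooth Q hQ
  have sf := smoothPeriodic_flux ha hc h0
  have spot := smoothPeriodic_pot ha hc h0
  have se := smoothPeriodic_enVar ha hc h0
  have sw : SmoothPeriodic L w := by
    rw [hw]; exact ((lowPot_smooth ha hc h0).sub sP).sub sp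
  have sY : SmoothPeriodic L Y := by rw [hY]; exact se.sub (hc.mul (spot.sub sw))
  set m := fun x => pot a c x - w x with hm
  have sm : SmoothPeriodic L m := spot.sub sw
  -- Only the lower order part of the potential has to be projected: `c` lies in the space, hence so
  -- does the top order term `c''`.
  have hmV : m ∈ V := by
    have e : m = P - deriv (deriv c) + p := by
      ext x
      simp only [hm, hw, pot, lowPot, Pi.add_apply, Pi.sub_apply]
      ring
    rw [e]
    exact V.add_mem (V.sub_mem hP (hV.laplace_mem c hcV)) hp
  have k1 := ha.continuous
  have k2 := hc.continuous
  have k3 := hc.deriv.continuous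
  have k4 := (hV.smooth _ hvel.mem_a).continuous
  have k5 := (hV.smooth _ hvel.mem_c).continuous
  have k6 := sf.continuous
  have k7 := spot.continuous
  have k8 := spot.deriv.continuous
  have k9 := se.continuous
  have k10 := sw.continuous
  have k11 := sw.deriv.continuous
  have k12 := sY.continuous
  have k13 := sY.deriv.continuous
  have k14 := sm.continuous
  have k15 := sm.deriv.continuous
  have k16 := sQ.continuous
  have k17 := sQ.deriv.continuous
  have k18 := (ha.inv h0).continuous
  have dm : ∀ x, deriv m x = deriv (pot a c) x - deriv w x := fun x =>
    ((spot.hasDerivAt x).sub (sw.hasDerivAt x)).deriv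
  have dYQ : ∀ x, deriv (fun x => Y x - Q x) x = deriv Y x - deriv Q x := fun x =>
    ((sY.hasDerivAt x).sub (sQ.hasDerivAt x)).deriv
  have dY : ∀ x, deriv Y x = deriv c x * pot a c x - flux a c x * (a x)⁻¹ ^ 3
      - (deriv c x * m x + c x * deriv m x) := fun x => by
    have e : Y = fun x => enVar a c x - c x * m x := by rw [hY]
    rw [e, ((se.hasDerivAt x).fun_sub ((hc.hasDerivAt x).fun_mul (sm.hasDerivAt x))).deriv,
      deriv_enVar ha hc h0]
  have h1 := hpo c' hvel.mem_c
  have h2 := hvel.eq_c m hmV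
  have h3 := hQo a' hvel.mem_a
  have h4 := hvel.eq_a Q hQ
  -- The variational derivatives are split into functions `m` and `Q` of the Galerkin space, which
  -- may be used as test functions, and two defects. These defects are orthogonal to `c'` with
  -- weight `a` and to `a'`, respectively, so their integrals vanish. The defects reappear after the
  -- flux integrals have been completed to the dissipation.
  have s1 : energyRate L a c a' c' = (∫ x in (0 : ℝ)..L, (c x * a' x + a x * c' x) * m x)
      + ((∫ x in (0 : ℝ)..L, a x * ((lowPot a c x - P x) - p x) * c' x)
      + ((∫ x in (0 : ℝ)..L, (Y x - Q x) * a' x) + ∫ x in (0 : ℝ)..L, a' x * Q x)) := by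
    have ew : ∀ x, (lowPot a c x - P x) - p x = w x := fun x => by rw [hw]
    simp_rw [ew]
    rw [← integral_add_of_continuous (by fun_prop) (by fun_prop),
      ← integral_add_of_continuous (by fun_prop) (by fun_prop),
      ← integral_add_of_continuous (by fun_prop) (by fun_prop), energyRate]
    congr 1; ext x
    simp only [hY, hm]
    ring
  rw [s1, h1, h2, h3, h4, zero_add, zero_add]
  simp_rw [dYQ]
  have s2 : (∫ x in (0 : ℝ)..L, flux a c x * deriv Q x) = (∫ x in (0 : ℝ)..L, flux a c x * deriv Y x)
      - ∫ x in (0 : ℝ)..L, flux a c x * (deriv Y x - deriv Q x) := by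
    rw [← integral_sub_of_continuous (by fun_prop) (by fun_prop)]
    congr 1; ext x; ring
  rw [s2, ← add_sub_assoc, dissipation, ← intervalIntegral.integral_neg,
    ← integral_add_of_continuous (by fun_prop) (by fun_prop),
    ← integral_add_of_continuous (by fun_prop) (by fun_prop),
    ← integral_add_of_continuous (by fun_prop) (by fun_prop)]
  congr 2; ext x
  simp only [dY, dm]
  rw [show m x = pot a c x - w x from rfl]
  ring

end


/-! ## The projection defects are dominated by the dissipation -/

section

variable {L : ℝ}

/-- The defect of the chemical potential. -/
lemma exists_potDefect_bound (hL : 0 < L) {K : ℝ} (hK : 2 ≤ K) :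
    ∃ C : ℝ, 1 ≤ C ∧ ∀ (l r : ℝ) (V : Submodule ℝ (ℝ → ℝ)) (a c P p : ℝ → ℝ), 1 ≤ l →
      IsGalerkinSpace L (l ^ 2) V → Scaled L K r a c → P ∈ V → p ∈ V →
      (∀ ψ ∈ V, ∫ x in (0 : ℝ)..L, (lowPot a c x - P x) * ψ x = 0) →
      (∀ ψ ∈ V, ∫ x in (0 : ℝ)..L, a x * ((lowPot a c x - P x) - p x) * ψ x = 0) →
      l2 L (deriv fun x => (lowPot a c x - P x) - p x) ≤ C * (r ^ 4 / l) ∧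
      ∀ x, |(lowPot a c x - P x) - p x| ≤ C * (r ^ 4 / l) := by
  obtain ⟨C₁, hC₁, hC⟩ := exists_projection_bound hL K
  have hσ : 0 ≤ 1 / L := by positivity
  set B := (1 + C₁) * (2 * K ^ 30) with hB
  have hB1 : 1 ≤ B := by
    have : 1 ≤ K ^ 30 := one_le_pow₀ (by linarith)
    nlinarith
  refine ⟨(1 / L + 2) * B, by nlinarith, ?_⟩
  intro l r V a c P p hl hV H hP hp hPo hpo
  have hr := H.one_le
  have slow := lowPot_smooth H.smooth_a H.smooth_c H.pos
  have sP := hV.smooth P hP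
  have sp := hV.smooth p hp
  have sz := slow.sub sP
  have sw := sz.sub sp
  obtain ⟨d1, d2, d3⟩ := hV.defect_le hL (by positivity) slow hP hPo
  set z := fun x => lowPot a c x - P x with hz
  have m0 : 0 ≤ l2 L z := l2_nonneg
  have m1 : 0 ≤ l2 L (deriv z) := l2_nonneg
  have e1 := H.l2_deriv_lowPot_le hL
  have e2 := H.l2_deriv_deriv_lowPot_le hL
  -- Geometric mean of two bounds from `defect_le`: `r ^ 3` without gain, and `r ^ 5 / l ^ 2`.
  have z1 : l2 L (deriv z) ≤ K ^ 30 * (r ^ 4 / l) := by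
    apply le_of_sq_le_sq _ (by positivity)
    have : l ^ 2 * l2 L (deriv z) ^ 2 ≤ l ^ 2 * (K ^ 30 * (r ^ 4 / l)) ^ 2 := by
      calc l ^ 2 * l2 L (deriv z) ^ 2 = (l ^ 2 * l2 L (deriv z)) * l2 L (deriv z) := by ring
        _ ≤ (K ^ 30 * r ^ 5) * (K ^ 30 * r ^ 3) :=
          mul_le_mul (d3.trans e2) (d2.trans e1) m1 (by positivity)
        _ = _ := by field_simp
    exact le_of_mul_le_mul_left this (by positivity)
  have z0 : l2 L z ≤ K ^ 30 * (r ^ 4 / l) := by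
    refine le_trans ?_ z1
    refine le_trans ?_ d1
    exact le_mul_of_one_le_left m0 (one_le_pow₀ hl)
  have hpb := hC _ V a c z p hV H.toBounds sz hp hpo
  have dw : deriv (fun x => z x - p x) = fun x => deriv z x - deriv p x :=
    funext fun x => ((sz.hasDerivAt x).sub (sp.hasDerivAt x)).deriv
  have w1 := l2_sub_le hL.le sz.deriv.continuous sp.deriv.continuous
  have w0 := l2_sub_le hL.le sz.continuous sp.continuous
  rw [← dw] at w1
  have n0 : 0 ≤ l2 L (fun x => z x - p x) := l2_nonneg
  have n1 : 0 ≤ l2 L (deriv fun x => z x - p x) := l2_nonneg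
  have tot : l2 L (fun x => z x - p x) + l2 L (deriv fun x => z x - p x) ≤ B * (r ^ 4 / l) := by
    calc _ ≤ (1 + C₁) * (l2 L z + l2 L (deriv z)) := by linarith
      _ ≤ (1 + C₁) * (K ^ 30 * (r ^ 4 / l) + K ^ 30 * (r ^ 4 / l)) := by gcongr
      _ = _ := by rw [hB]; ring
  have hR : 0 ≤ B * (r ^ 4 / l) := by positivity
  constructor
  · calc _ ≤ B * (r ^ 4 / l) := by linarith
      _ ≤ (1 / L + 2) * (B * (r ^ 4 / l)) := le_mul_of_one_le_left hR (by linarith)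
      _ = _ := by ring
  · intro x
    calc _ ≤ (1 / L + 2) * (l2 L (fun x => z x - p x) + l2 L (deriv fun x => z x - p x)) :=
          abs_le_of_l2 hL sw x
      _ ≤ (1 / L + 2) * (B * (r ^ 4 / l)) := by gcongr
      _ = _ := by ring

/-- The gradient of the variational derivative at constant `a * c`. -/
lemma l2_deriv_pressure_le (hL : 0 < L) {K r C : ℝ} {a c w : ℝ → ℝ} (hC : 1 ≤ C)
    (H : Scaled L K r a c) (sw : SmoothPeriodic L w) (h1 : l2 L (deriv w) ≤ C * r ^ 4)
    (h2 : ∀ x, |w x| ≤ C * r ^ 4) :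
    l2 L (deriv fun x => enVar a c x - c x * (pot a c x - w x)) ≤ 4 * (K ^ 34 * C) * r ^ 4 := by
  have hr := H.one_le
  have hK := H.two_le
  have ha := H.smooth_a
  have hc := H.smooth_c
  have h0 := H.pos
  have sf := smoothPeriodic_flux ha hc h0
  have spot := smoothPeriodic_pot ha hc h0
  have se := smoothPeriodic_enVar ha hc h0
  have k1 := hc.continuous
  have k2 := hc.deriv.continuous
  have k3 := sf.continuous
  have k4 := (ha.inv h0).continuous
  have k5 := spot.deriv.continuous
  have k6 := sw.continuous
  have k7 := sw.deriv.continuous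
  -- The terms `c_x μ` cancel, so only the derivative of the potential has to be estimated and not
  -- the potential itself.
  have dY : deriv (fun x => enVar a c x - c x * (pot a c x - w x))
      = fun x => (w x * deriv c x - (a x)⁻¹ ^ 3 * flux a c x)
        - (c x * deriv (pot a c) x - c x * deriv w x) := by
    ext x
    rw [((se.hasDerivAt x).fun_sub ((hc.hasDerivAt x).fun_mul
      ((spot.hasDerivAt x).fun_sub (sw.hasDerivAt x)))).deriv, deriv_enVar ha hc h0]
    ring
  rw [dY]
  have i3 : ∀ x, |(a x)⁻¹ ^ 3| ≤ K ^ 3 := fun x => by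
    have := inv_pos.2 (h0 x)
    rw [abs_of_pos (by positivity)]
    exact pow_le_pow_left₀ this.le (inv_le_of_inv_le₀ (by linarith) (H.inv_le x)) 3
  have t1 := l2_mul_le hL.le k6 k2 h2
  have t2 := l2_mul_le hL.le (u := fun x => (a x)⁻¹ ^ 3) (by fun_prop) k3 i3
  have t3 := l2_mul_le hL.le k1 k5 H.abs_c_le
  have t4 := l2_mul_le hL.le k1 k7 H.abs_c_le
  have s1 := l2_sub_le hL.le (u := fun x => w x * deriv c x) (v := fun x => (a x)⁻¹ ^ 3 * flux a c x)
    (by fun_prop) (by fun_prop)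
  have s2 := l2_sub_le hL.le (u := fun x => c x * deriv (pot a c) x) (v := fun x => c x * deriv w x)
    (by fun_prop) (by fun_prop)
  have s3 := l2_sub_le hL.le (u := fun x => w x * deriv c x - (a x)⁻¹ ^ 3 * flux a c x)
    (v := fun x => c x * deriv (pot a c) x - c x * deriv w x) (by fun_prop) (by fun_prop)
  have hp : ∀ {j : ℕ}, j ≤ 34 → K ^ j ≤ K ^ 34 * C := fun hj => by
    calc K ^ _ ≤ K ^ 34 := pow_le_pow_right₀ (by linarith) hj
      _ ≤ _ := le_mul_of_one_le_right (by positivity) hC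
  have r4 : 0 ≤ r ^ 4 := by positivity
  have hKC : K ^ 1 * C ≤ K ^ 34 * C := by gcongr <;> linarith
  have u1 : C * r ^ 4 * l2 L (deriv c) ≤ (K ^ 34 * C) * r ^ 4 := by
    calc C * r ^ 4 * l2 L (deriv c) ≤ C * r ^ 4 * K := by gcongr; exact H.l2_c
      _ = (K ^ 1 * C) * r ^ 4 := by ring
      _ ≤ _ := by gcongr
  have u2 : K ^ 3 * l2 L (flux a c) ≤ (K ^ 34 * C) * r ^ 4 := by
    calc K ^ 3 * l2 L (flux a c) ≤ K ^ 3 * (K ^ 31 * r ^ 4) := by gcongr; exact H.l2_flux_le hL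
      _ = K ^ 34 * r ^ 4 := by ring
      _ ≤ _ := by gcongr; exact hp le_rfl
  have u3 : K * l2 L (deriv (pot a c)) ≤ (K ^ 34 * C) * r ^ 4 := by
    calc K * l2 L (deriv (pot a c)) ≤ K * (K ^ 31 * r ^ 4) := by gcongr; exact H.l2_deriv_pot_le hL
      _ = K ^ 32 * r ^ 4 := by ring
      _ ≤ _ := by gcongr; exact hp (by norm_num)
  have u4 : K * l2 L (deriv w) ≤ (K ^ 34 * C) * r ^ 4 := by
    calc K * l2 L (deriv w) ≤ K * (C * r ^ 4) := by gcongr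
      _ = (K ^ 1 * C) * r ^ 4 := by ring
      _ ≤ _ := by gcongr
  linarith

/-- The geometric mean of two bounds. -/
lemma le_of_two_bounds {t A B m : ℝ} (h1 : |t| ≤ A) (h2 : |t| ≤ B) (hm : 0 ≤ m)
    (h : A * B ≤ m ^ 2) : |t| ≤ m := by
  apply le_of_sq_le_sq _ hm
  rw [pow_two]
  exact (mul_le_mul h1 h2 (abs_nonneg _) ((abs_nonneg _).trans h1)).trans h

/-- The functions obtained from the third derivative of `a` by splitting it into a low and a high
frequency part. -/
structure FrequencySplit (L κ : ℝ) (a v s : ℝ → ℝ) : Prop where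
  smooth_v : SmoothPeriodic L v
  zero : ∃ y, v y = 0
  s_eq : ∀ x, s x = -(κ⁻¹ ^ 2 * deriv (deriv v) x)
  add_eq : ∀ x, deriv (deriv (deriv a)) x = v x + s x

namespace FrequencySplit

variable {κ : ℝ} {a v s : ℝ → ℝ}

lemma smooth_s (h : FrequencySplit L κ a v s) : SmoothPeriodic L s := by
  rw [funext h.s_eq]
  exact (h.smooth_v.deriv.deriv.const_mul _).neg

/-- Since `∫ v s = κ⁻² ‖v'‖²` is nonnegative, the squared norm of the sum dominates those of both
parts, and also `κ⁻² ‖v'‖²`. -/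
lemma l2_bounds (hL : 0 < L) (hκ : 0 < κ) (h : FrequencySplit L κ a v s) :
    l2 L v ≤ l2 L (deriv (deriv (deriv a))) ∧ l2 L s ≤ l2 L (deriv (deriv (deriv a))) ∧
    l2 L (deriv v) ≤ κ * l2 L (deriv (deriv (deriv a))) := by
  have cv := h.smooth_v.continuous
  have cv1 := h.smooth_v.deriv.continuous
  have cv2 := h.smooth_v.deriv.deriv.continuous
  have cs := h.smooth_s.continuous
  have vs : ∫ x in (0 : ℝ)..L, v x * s x = κ⁻¹ ^ 2 * l2 L (deriv v) ^ 2 := by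
    have := h.smooth_v.deriv.integral_deriv_mul h.smooth_v
    have e : ∀ x, v x * s x = -κ⁻¹ ^ 2 * (deriv (deriv v) x * v x) := fun x => by
      rw [h.s_eq]; ring
    simp_rw [e]
    rw [intervalIntegral.integral_const_mul, this, sq_l2 hL.le]
    simp_rw [pow_two]
    ring
  have tot : l2 L (deriv (deriv (deriv a))) ^ 2
      = l2 L v ^ 2 + 2 * (κ⁻¹ ^ 2 * l2 L (deriv v) ^ 2) + l2 L s ^ 2 := by
    rw [sq_l2 hL.le, ← vs, sq_l2 hL.le, sq_l2 hL.le, ← intervalIntegral.integral_const_mul,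
      ← integral_add_of_continuous (by fun_prop) (by fun_prop),
      ← integral_add_of_continuous (by fun_prop) (by fun_prop)]
    congr 1; ext x
    rw [h.add_eq]; ring
  have n : 0 ≤ l2 L (deriv (deriv (deriv a))) := l2_nonneg
  have p1 := sq_nonneg (l2 L v)
  have p2 := sq_nonneg (l2 L s)
  have p3 : 0 ≤ κ⁻¹ ^ 2 * l2 L (deriv v) ^ 2 := by positivity
  refine ⟨le_of_sq_le_sq (by linarith) n, le_of_sq_le_sq (by linarith) n,
    le_of_sq_le_sq ?_ (by positivity)⟩
  have : κ⁻¹ ^ 2 * l2 L (deriv v) ^ 2 ≤ l2 L (deriv (deriv (deriv a))) ^ 2 := by linarith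
  rw [inv_pow, inv_mul_le_iff₀ (by positivity)] at this
  rwa [mul_pow]

end FrequencySplit

/-- The high frequency energy is dissipated. -/
lemma integral_flux_mul_ge (hL : 0 < L) {K r k : ℝ} {a c v s : ℝ → ℝ} (hk : 1 ≤ k)
    (H : Scaled L K r a c) (hS : FrequencySplit L (k ^ 2) a v s) :
    (K ^ 3)⁻¹ * l2 L s ^ 2 - K ^ 34 * (r ^ 8 / k) ≤ ∫ x in (0 : ℝ)..L, flux a c x * s x := by
  have hr := H.one_le
  have hK := H.two_le
  have ha := H.smooth_a
  have sl := lowFlux_smooth H.smooth_a H.smooth_c H.pos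
  obtain ⟨b1, b2, b3⟩ := hS.l2_bounds hL (by positivity)
  have t := H.l2_third_le.1
  have k1 := ha.continuous
  have k2 := ha.deriv.continuous
  have k3 := sl.continuous
  have k4 := sl.deriv.continuous
  have k5 := hS.smooth_v.continuous
  have k6 := hS.smooth_v.deriv.continuous
  have k7 := hS.smooth_v.deriv.deriv.continuous
  have k8 := hS.smooth_s.continuous
  have n0 : 0 ≤ l2 L v := l2_nonneg
  have n1 : 0 ≤ l2 L (deriv v) := l2_nonneg
  have v1 : l2 L (deriv v) ≤ k ^ 2 * r ^ 4 := b3.trans (by gcongr)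
  have s1 : l2 L s ≤ r ^ 4 := b2.trans t
  have supv : ∀ x, |v x| ≤ 2 * k * r ^ 4 := by
    intro x
    obtain ⟨y, hy⟩ := hS.zero
    apply abs_le_of_sq_le_sq _ (by positivity)
    have := sq_sub_sq_le hL hS.smooth_v x y
    rw [hy] at this
    calc v x ^ 2 ≤ 2 * (l2 L v * l2 L (deriv v)) := by linarith
      _ ≤ 2 * (r ^ 4 * (k ^ 2 * r ^ 4)) := by gcongr; exact b1.trans t
      _ ≤ 4 * (r ^ 4 * (k ^ 2 * r ^ 4)) := by gcongr; norm_num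
      _ = _ := by ring
  -- the three parts
  have split : ∫ x in (0 : ℝ)..L, flux a c x * s x = (∫ x in (0 : ℝ)..L, a x ^ 3 * s x ^ 2)
      + (∫ x in (0 : ℝ)..L, a x ^ 3 * v x * s x) - ∫ x in (0 : ℝ)..L, lowFlux a c x * s x := by
    rw [← integral_add_of_continuous (by fun_prop) (by fun_prop),
      ← integral_sub_of_continuous (by fun_prop) (by fun_prop)]
    congr 1; ext x
    have : flux a c x = a x ^ 3 * (v x + s x) - lowFlux a c x := by rw [← hS.add_eq]; rfl
    rw [this]; ring
  have part1 : (K ^ 3)⁻¹ * l2 L s ^ 2 ≤ ∫ x in (0 : ℝ)..L, a x ^ 3 * s x ^ 2 := by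
    rw [sq_l2 hL.le, ← intervalIntegral.integral_const_mul]
    refine intervalIntegral.integral_mono_on hL.le (Continuous.intervalIntegrable (by fun_prop) _ _)
      (Continuous.intervalIntegrable (by fun_prop) _ _) fun x _ => ?_
    rw [← inv_pow]
    have : 0 < K⁻¹ := inv_pos.2 (by linarith)
    exact mul_le_mul_of_nonneg_right (pow_le_pow_left₀ this.le (H.inv_le x) 3) (sq_nonneg _)
  -- With `s = -κ⁻² v''` an integration by parts yields `κ⁻² ∫ a³ v'²`, which has the good sign and
  -- is dropped, and a term with `a_x`. The latter has the factors `k⁻⁴` from `κ⁻²`, `k` from the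
  -- supremum of `v` and `k²` from `‖v'‖`.
  have part2 : -(6 * K ^ 3 * (r ^ 8 / k)) ≤ ∫ x in (0 : ℝ)..L, a x ^ 3 * v x * s x := by
    have i1 := hS.smooth_v.deriv.integral_deriv_mul ((ha.pow 3).mul hS.smooth_v)
    have d : ∀ x, deriv (fun x => a x ^ 3 * v x) x
        = 3 * a x ^ 2 * deriv a x * v x + a x ^ 3 * deriv v x := fun x => by
      rw [(((ha.hasDerivAt x).fun_pow 3).fun_mul (hS.smooth_v.hasDerivAt x)).deriv]
      push_cast
      ring
    simp_rw [d] at i1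
    have e : ∀ x, a x ^ 3 * v x * s x
        = -((k ^ 2)⁻¹ ^ 2) * (deriv (deriv v) x * (a x ^ 3 * v x)) := fun x => by
      rw [hS.s_eq]; ring
    simp_rw [e]
    rw [intervalIntegral.integral_const_mul, i1, neg_mul_neg]
    have e2 : ∀ x, deriv v x * (3 * a x ^ 2 * deriv a x * v x + a x ^ 3 * deriv v x)
      = a x ^ 3 * deriv v x ^ 2 + (3 * a x ^ 2 * v x * deriv a x) * deriv v x := fun x => by ring
    simp_rw [e2]
    rw [integral_add_of_continuous (by fun_prop) (by fun_prop)]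
    have pos : 0 ≤ ∫ x in (0 : ℝ)..L, a x ^ 3 * deriv v x ^ 2 :=
      intervalIntegral.integral_nonneg hL.le fun x _ => by have := H.pos x; positivity
    have cr := abs_integral_mul_le hL.le (u := fun x => 3 * a x ^ 2 * v x * deriv a x)
      (by fun_prop) k6
    have cr2 := l2_mul_le hL.le (u := fun x => 3 * a x ^ 2 * v x) (by fun_prop) k2
      (C := 3 * K ^ 2 * (2 * k * r ^ 4)) fun x => by
        rw [abs_mul, abs_of_pos (by have := H.pos x; positivity : 0 < 3 * a x ^ 2)]
        gcongr
        · exact (H.pos x).le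
        · exact H.le x
        · exact supv x
    have cr3 : l2 L (fun x => 3 * a x ^ 2 * v x * deriv a x) * l2 L (deriv v)
        ≤ (3 * K ^ 2 * (2 * k * r ^ 4) * K) * (k ^ 2 * r ^ 4) := by
      refine mul_le_mul (cr2.trans ?_) v1 n1 (by positivity)
      gcongr; exact H.l2_a
    have cr4 := (abs_le.1 (cr.trans cr3)).1
    have : (k ^ 2)⁻¹ ^ 2 * (-((3 * K ^ 2 * (2 * k * r ^ 4) * K) * (k ^ 2 * r ^ 4)))
        = -(6 * K ^ 3 * (r ^ 8 / k)) := by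
      have : k ≠ 0 := by linarith
      field_simp
      ring
    rw [← this]
    gcongr
    linarith
  -- Geometric mean of `r ^ 7`, obtained directly, and `r ^ 9 / k ^ 2`, obtained by moving one
  -- derivative from `s` to the lower order flux.
  have part3 : |∫ x in (0 : ℝ)..L, lowFlux a c x * s x| ≤ K ^ 30 * (r ^ 8 / k) := by
    have lb := H.l2_lowFlux_le hL
    have lb' := H.l2_deriv_lowFlux_le hL
    have q1 : |∫ x in (0 : ℝ)..L, lowFlux a c x * s x| ≤ (K ^ 30 * r ^ 3) * r ^ 4 :=
      (abs_integral_mul_le hL.le k3 k8).trans (mul_le_mul lb s1 l2_nonneg (by positivity))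
    have q2 : |∫ x in (0 : ℝ)..L, lowFlux a c x * s x|
        ≤ (k ^ 2)⁻¹ ^ 2 * ((K ^ 30 * r ^ 5) * (k ^ 2 * r ^ 4)) := by
      have i1 := hS.smooth_v.deriv.integral_deriv_mul sl
      have e : ∀ x, lowFlux a c x * s x
          = -((k ^ 2)⁻¹ ^ 2) * (deriv (deriv v) x * lowFlux a c x) := fun x => by
        rw [hS.s_eq]; ring
      simp_rw [e]
      rw [intervalIntegral.integral_const_mul, i1, neg_mul_neg, abs_mul,
        abs_of_nonneg (by positivity : 0 ≤ (k ^ 2)⁻¹ ^ 2)]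
      gcongr
      refine (abs_integral_mul_le hL.le k6 k4).trans ?_
      rw [mul_comm]
      exact mul_le_mul lb' v1 n1 (by positivity)
    refine le_of_two_bounds q1 q2 (by positivity) (le_of_eq ?_)
    have : k ≠ 0 := by linarith
    field_simp
  have hf : 6 * K ^ 3 * (r ^ 8 / k) + K ^ 30 * (r ^ 8 / k) ≤ K ^ 34 * (r ^ 8 / k) := by
    rw [← add_mul]
    gcongr
    have h1 : K ^ 3 ≤ K ^ 30 := pow_le_pow_right₀ (by linarith) (by norm_num)
    have h2 : (2 : ℝ) ^ 4 ≤ K ^ 4 := pow_le_pow_left₀ (by norm_num) hK 4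
    have h3 : K ^ 34 = K ^ 4 * K ^ 30 := by ring
    rw [h3]
    nlinarith [show 0 < K ^ 30 by positivity]
  have := (abs_le.1 part3).2
  rw [split]
  linarith

/-- The defect of the pressure. -/
lemma abs_integral_flux_defect_le (hL : 0 < L) {K r k l C : ℝ} {a c v s Y Q : ℝ → ℝ}
    {V : Submodule ℝ (ℝ → ℝ)} (hk : 1 ≤ k) (hl : 1 ≤ l) (hC : 1 ≤ C)
    (hV : IsGalerkinSpace L (l ^ 2) V) (H : Scaled L K r a c)
    (hS : FrequencySplit L (k ^ 2) a v s) (sY : SmoothPeriodic L Y)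
    (hY : l2 L (deriv Y) ≤ C * r ^ 4) (hQ : Q ∈ V)
    (hQo : ∀ ψ ∈ V, ∫ x in (0 : ℝ)..L, (Y x - Q x) * ψ x = 0) :
    |∫ x in (0 : ℝ)..L, flux a c x * deriv (fun x => Y x - Q x) x|
      ≤ K ^ 30 * C * ((4 * k ^ 2 / l ^ 2 + 1 / l) * r ^ 8 + l2 L s * r ^ 4) := by
  have hr := H.one_le
  have hK := H.two_le
  have ha := H.smooth_a
  have sl := lowFlux_smooth H.smooth_a H.smooth_c H.pos
  have sQ := hV.smooth Q hQ
  have sZ := sY.sub sQ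
  obtain ⟨d1, d2, -⟩ := hV.defect_le hL (by positivity) sY hQ hQo
  set Z := fun x => Y x - Q x with hZ
  obtain ⟨b1, b2, b3⟩ := hS.l2_bounds hL (by positivity)
  have t := H.l2_third_le.1
  have k1 := ha.continuous
  have k2 := ha.deriv.continuous
  have k3 := sl.continuous
  have k4 := sl.deriv.continuous
  have k5 := hS.smooth_v.continuous
  have k6 := hS.smooth_v.deriv.continuous
  have k8 := hS.smooth_s.continuous
  have k9 := sZ.continuous
  have k10 := sZ.deriv.continuous
  have n1 : 0 ≤ l2 L (deriv v) := l2_nonneg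
  have z1 : l2 L (deriv Z) ≤ C * r ^ 4 := d2.trans hY
  have z0 : l2 L Z ≤ C * r ^ 4 / l ^ 2 := by
    rw [le_div_iff₀ (by positivity), mul_comm]; exact d1.trans z1
  have v1 : l2 L (deriv v) ≤ k ^ 2 * r ^ 4 := b3.trans (by gcongr)
  have supv : ∀ x, |v x| ≤ K * (k ^ 2 * r ^ 4) := by
    intro x
    obtain ⟨y, hy⟩ := hS.zero
    have := abs_sub_le_l2 hL hS.smooth_v x y
    rw [hy, sub_zero] at this
    exact this.trans (mul_le_mul H.sqrt_le v1 n1 (by linarith))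
  have pK : ∀ {j : ℕ}, j ≤ 30 → K ^ j ≤ K ^ 30 := fun hj => pow_le_pow_right₀ (by linarith) hj
  have split : ∫ x in (0 : ℝ)..L, flux a c x * deriv Z x
      = (∫ x in (0 : ℝ)..L, a x ^ 3 * v x * deriv Z x)
      + (∫ x in (0 : ℝ)..L, a x ^ 3 * s x * deriv Z x)
      - ∫ x in (0 : ℝ)..L, lowFlux a c x * deriv Z x := by
    rw [← integral_add_of_continuous (by fun_prop) (by fun_prop),
      ← integral_sub_of_continuous (by fun_prop) (by fun_prop)]
    congr 1; ext x
    have : flux a c x = a x ^ 3 * (v x + s x) - lowFlux a c x := by rw [← hS.add_eq]; rfl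
    rw [this]; ring
  -- The derivative is moved to the low frequency part, where it costs `k ^ 2`, while the
  -- undifferentiated defect gains `1 / l ^ 2`.
  have part1 : |∫ x in (0 : ℝ)..L, a x ^ 3 * v x * deriv Z x|
      ≤ K ^ 30 * C * (4 * k ^ 2 / l ^ 2 * r ^ 8) := by
    have i1 := sZ.integral_deriv_mul ((ha.pow 3).mul hS.smooth_v)
    have d : ∀ x, deriv (fun x => a x ^ 3 * v x) x
        = 3 * a x ^ 2 * v x * deriv a x + a x ^ 3 * deriv v x := fun x => by
      rw [(((ha.hasDerivAt x).fun_pow 3).fun_mul (hS.smooth_v.hasDerivAt x)).deriv]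
      push_cast
      ring
    simp_rw [d] at i1
    have e : ∀ x, a x ^ 3 * v x * deriv Z x = deriv Z x * (a x ^ 3 * v x) := fun x => by ring
    simp_rw [e]
    rw [i1, abs_neg]
    refine (abs_integral_mul_le hL.le k9 (by fun_prop)).trans ?_
    have c1 := l2_mul_le hL.le (u := fun x => 3 * a x ^ 2 * v x) (by fun_prop) k2
      (C := 3 * K ^ 2 * (K * (k ^ 2 * r ^ 4))) fun x => by
        rw [abs_mul, abs_of_pos (by have := H.pos x; positivity : 0 < 3 * a x ^ 2)]
        gcongr
        · exact (H.pos x).le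
        · exact H.le x
        · exact supv x
    have c2 := l2_mul_le hL.le (u := fun x => a x ^ 3) (by fun_prop) k6 H.abs_pow_three_le
    have c3 := l2_add_le hL.le (u := fun x => 3 * a x ^ 2 * v x * deriv a x)
      (v := fun x => a x ^ 3 * deriv v x) (by fun_prop) (by fun_prop)
    have c4 : l2 L (fun x => 3 * a x ^ 2 * v x * deriv a x + a x ^ 3 * deriv v x)
        ≤ 4 * K ^ 4 * (k ^ 2 * r ^ 4) := by
      have u1 : 3 * K ^ 2 * (K * (k ^ 2 * r ^ 4)) * l2 L (deriv a)
          ≤ 3 * K ^ 2 * (K * (k ^ 2 * r ^ 4)) * K := by gcongr; exact H.l2_a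
      have u2 : K ^ 3 * l2 L (deriv v) ≤ K ^ 4 * (k ^ 2 * r ^ 4) := by
        have : K ^ 3 ≤ K ^ 4 := pow_le_pow_right₀ (by linarith) (by norm_num)
        gcongr
      linarith [show 3 * K ^ 2 * (K * (k ^ 2 * r ^ 4)) * K = 3 * K ^ 4 * (k ^ 2 * r ^ 4) by ring]
    calc _ ≤ (C * r ^ 4 / l ^ 2) * (4 * K ^ 4 * (k ^ 2 * r ^ 4)) :=
          mul_le_mul z0 c4 l2_nonneg (by positivity)
      _ = K ^ 4 * C * (4 * k ^ 2 / l ^ 2 * r ^ 8) := by ring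
      _ ≤ _ := by
        gcongr
        exacts [by linarith, by norm_num]
  -- The critical term: neither factor has regularity to spare, so there is no gain in `k` or `l`.
  -- It is the reason for the correction of the energy.
  have part2 : |∫ x in (0 : ℝ)..L, a x ^ 3 * s x * deriv Z x| ≤ K ^ 30 * C * (l2 L s * r ^ 4) := by
    refine (abs_integral_mul_le hL.le (u := fun x => a x ^ 3 * s x) (by fun_prop) k10).trans ?_
    have c2 := l2_mul_le hL.le (u := fun x => a x ^ 3) (by fun_prop) k8 H.abs_pow_three_le
    have ns : 0 ≤ l2 L s := l2_nonneg
    calc _ ≤ (K ^ 3 * l2 L s) * (C * r ^ 4) := mul_le_mul c2 z1 l2_nonneg (by positivity)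
      _ = K ^ 3 * C * (l2 L s * r ^ 4) := by ring
      _ ≤ _ := by
        gcongr
        exacts [by linarith, by norm_num]
  -- Again a geometric mean, here of `r ^ 7` and `r ^ 9 / l ^ 2`.
  have part3 : |∫ x in (0 : ℝ)..L, lowFlux a c x * deriv Z x| ≤ K ^ 30 * C * (1 / l * r ^ 8) := by
    have lb := H.l2_lowFlux_le hL
    have lb' := H.l2_deriv_lowFlux_le hL
    have q1 := (abs_integral_mul_le hL.le k3 k10).trans
      (mul_le_mul lb z1 l2_nonneg (by positivity))
    have q2 : |∫ x in (0 : ℝ)..L, lowFlux a c x * deriv Z x|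
        ≤ (C * r ^ 4 / l ^ 2) * (K ^ 30 * r ^ 5) := by
      have i1 := sZ.integral_deriv_mul sl
      have e : ∀ x, lowFlux a c x * deriv Z x = deriv Z x * lowFlux a c x := fun x => by ring
      simp_rw [e]
      rw [i1, abs_neg]
      exact (abs_integral_mul_le hL.le k9 k4).trans (mul_le_mul z0 lb' l2_nonneg (by positivity))
    refine le_of_two_bounds q1 q2 (by positivity) (le_of_eq ?_)
    field_simp
  rw [split]
  have a1 := abs_sub ((∫ x in (0 : ℝ)..L, a x ^ 3 * v x * deriv Z x)
      + (∫ x in (0 : ℝ)..L, a x ^ 3 * s x * deriv Z x)) (∫ x in (0 : ℝ)..L, lowFlux a c x * deriv Z x)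
  have a2 := abs_add_le (∫ x in (0 : ℝ)..L, a x ^ 3 * v x * deriv Z x)
      (∫ x in (0 : ℝ)..L, a x ^ 3 * s x * deriv Z x)
  linarith

/-- The rate of the energy, with the high frequency correction, in terms of all parameters. -/
lemma exists_rate_bound (hL : 0 < L) {K : ℝ} (hK : 2 ≤ K) :
    ∃ C : ℝ, 1 ≤ C ∧ ∀ (A k l r : ℝ) (V : Submodule ℝ (ℝ → ℝ)) (a c a' c' v s : ℝ → ℝ), 0 ≤ A →
      1 ≤ k → 1 ≤ l → IsGalerkinSpace L (l ^ 2) V → Scaled L K r a c → c ∈ V →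
      FrequencySplit L (k ^ 2) a v s → IsVelocity L V a c a' c' →
      energyRate L a c a' c' - A * (∫ x in (0 : ℝ)..L, flux a c x * s x)
        ≤ -dissipation L a c + C * ((k ^ 2 / l ^ 2 + 1 / l) * r ^ 8 + l2 L s * r ^ 4)
          + A * (C * (r ^ 8 / k) - (K ^ 3)⁻¹ * l2 L s ^ 2) := by
  obtain ⟨C₁, hC₁, hw⟩ := exists_potDefect_bound hL hK
  set B := 4 * (K ^ 34 * C₁) with hB
  have hK34 : 1 ≤ K ^ 34 := one_le_pow₀ (by linarith)
  have hK30 : 1 ≤ K ^ 30 := one_le_pow₀ (by linarith)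
  have hB1 : 1 ≤ B := by nlinarith
  refine ⟨K ^ 34 + 2 * K ^ 32 * C₁ + 4 * (K ^ 30 * B), by
    have : 0 ≤ 2 * K ^ 32 * C₁ := by positivity
    have : 0 ≤ 4 * (K ^ 30 * B) := by positivity
    linarith, ?_⟩
  intro A k l r V a c a' c' v s hA hk hl hV H hcV hS hvel
  have hr := H.one_le
  have ha := H.smooth_a
  have hc := H.smooth_c
  have h0 := H.pos
  have slow := lowPot_smooth ha hc h0
  have sf := smoothPeriodic_flux ha hc h0
  have spot := smoothPeriodic_pot ha hc h0
  have se := smoothPeriodic_enVar ha hc h0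
  obtain ⟨P, hP, hPo⟩ := hV.exists_orthogonal_projection hL slow
  have sP := hV.smooth P hP
  obtain ⟨p, hp, hpo⟩ := hV.exists_projection hL ha h0 (slow.sub sP)
  have sp := hV.smooth p hp
  set w := fun x => (lowPot a c x - P x) - p x with hwdef
  have sw : SmoothPeriodic L w := (slow.sub sP).sub sp
  obtain ⟨w1, w2⟩ := hw l r V a c P p hl hV H hP hp hPo hpo
  have hrl : r ^ 4 / l ≤ r ^ 4 := div_le_self (by positivity) hl
  have w1' : l2 L (deriv w) ≤ C₁ * r ^ 4 := w1.trans (by gcongr)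
  have w2' : ∀ x, |w x| ≤ C₁ * r ^ 4 := fun x => (w2 x).trans (by gcongr)
  set Y := fun x => enVar a c x - c x * (pot a c x - w x) with hY
  have sY : SmoothPeriodic L Y := se.sub (hc.mul (spot.sub sw))
  have Y1 : l2 L (deriv Y) ≤ B * r ^ 4 := l2_deriv_pressure_le hL hC₁ H sw w1' w2'
  obtain ⟨Q, hQ, hQo⟩ := hV.exists_orthogonal_projection hL sY
  rw [energyRate_eq hV ha hc h0 hcV hvel hP hp hpo hwdef hY hQ hQo]
  have T3 := abs_integral_flux_defect_le hL hk hl hB1 hV H hS sY Y1 hQ hQo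
  have TA := integral_flux_mul_ge hL hk H hS
  have ka := ha.continuous
  have kc := hc.deriv.continuous
  have kw := sw.continuous
  have kw' := sw.deriv.continuous
  have kf := sf.continuous
  have kp := spot.deriv.continuous
  have nf : 0 ≤ l2 L (flux a c) := l2_nonneg
  have nw : 0 ≤ l2 L (deriv w) := l2_nonneg
  have T1 : ∫ x in (0 : ℝ)..L, w x * (flux a c x * deriv c x) ≤ K ^ 32 * C₁ * (1 / l * r ^ 8) := by
    have e : ∀ x, w x * (flux a c x * deriv c x) = flux a c x * (w x * deriv c x) :=
      fun x => by ring
    simp_rw [e]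
    refine (integral_mul_le hL.le kf (by fun_prop)).trans ?_
    have := l2_mul_le hL.le kw kc w2
    calc _ ≤ (K ^ 31 * r ^ 4) * (C₁ * (r ^ 4 / l) * K) := by
          refine mul_le_mul (H.l2_flux_le hL) (this.trans ?_) l2_nonneg (by positivity)
          gcongr; exact H.l2_c
      _ = _ := by ring
  have T2 : ∫ x in (0 : ℝ)..L, a x * deriv (pot a c) x * deriv w x
      ≤ K ^ 32 * C₁ * (1 / l * r ^ 8) := by
    refine (integral_mul_le hL.le (u := fun x => a x * deriv (pot a c) x) (by fun_prop) kw').trans ?_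
    have := l2_mul_le hL.le ka kp (C := K) fun x => by rw [abs_of_pos (h0 x)]; exact H.le x
    calc _ ≤ (K * (K ^ 31 * r ^ 4)) * (C₁ * (r ^ 4 / l)) := by
          refine mul_le_mul (this.trans ?_) w1 l2_nonneg (by positivity)
          gcongr; exact H.l2_deriv_pot_le hL
      _ = _ := by ring
  have T3' := (abs_le.1 T3).1
  have TA' := mul_le_mul_of_nonneg_left TA hA
  have ns : 0 ≤ l2 L s := l2_nonneg
  set X₁ := k ^ 2 / l ^ 2 * r ^ 8 with hX₁
  set X₂ := 1 / l * r ^ 8 with hX₂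
  set X₃ := l2 L s * r ^ 4 with hX₃
  set X₄ := r ^ 8 / k with hX₄
  have p1 : 0 ≤ X₁ := by positivity
  have p2 : 0 ≤ X₂ := by positivity
  have p3 : 0 ≤ X₃ := by positivity
  have p4 : 0 ≤ X₄ := by positivity
  have e1 : (4 * k ^ 2 / l ^ 2 + 1 / l) * r ^ 8 + l2 L s * r ^ 4 = 4 * X₁ + X₂ + X₃ := by
    rw [hX₁, hX₂, hX₃]; ring
  have e2 : (k ^ 2 / l ^ 2 + 1 / l) * r ^ 8 + l2 L s * r ^ 4 = X₁ + X₂ + X₃ := by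
    rw [hX₁, hX₂, hX₃]; ring
  rw [e1] at T3'
  rw [e2]
  have q1 : 0 ≤ K ^ 30 * B := by positivity
  have q2 : 0 ≤ K ^ 32 * C₁ := by positivity
  have q3 : 0 ≤ K ^ 34 := by positivity
  have g1 := mul_nonneg q1 p1
  have g2 := mul_nonneg q1 p2
  have g3 := mul_nonneg q1 p3
  have g4 := mul_nonneg q2 p1
  have g5 := mul_nonneg q2 p3
  have g6 := mul_nonneg q3 p1
  have g7 := mul_nonneg q3 p2
  have g8 := mul_nonneg q3 p3
  have g9 : 0 ≤ A * ((2 * K ^ 32 * C₁ + 4 * (K ^ 30 * B)) * X₄) := by positivity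
  have expand : A * ((K ^ 34 + 2 * K ^ 32 * C₁ + 4 * (K ^ 30 * B)) * X₄ - (K ^ 3)⁻¹ * l2 L s ^ 2)
    = A * ((2 * K ^ 32 * C₁ + 4 * (K ^ 30 * B)) * X₄)
      - A * ((K ^ 3)⁻¹ * l2 L s ^ 2 - K ^ 34 * X₄) := by ring
  rw [expand]
  linarith

/-- **The energy inequality for Galerkin approximations.**  With a correction of weight `A` at high
frequencies, the energy decays up to an arbitrarily small multiple of `1 + D`. -/
theorem energy_inequality (hL : 0 < L) {K : ℝ} (hK : 2 ≤ K) {δ : ℝ} (hδ : 0 < δ) :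
    ∃ A : ℝ, 0 ≤ A ∧ ∃ k₀ : ℝ, 1 ≤ k₀ ∧ ∀ k ≥ k₀, ∃ l₀ : ℝ, 1 ≤ l₀ ∧ ∀ l ≥ l₀,
      ∀ (V : Submodule ℝ (ℝ → ℝ)) (a c a' c' v s : ℝ → ℝ),
      IsGalerkinSpace L (l ^ 2) V → Bounds L K a c → c ∈ V →
      FrequencySplit L (k ^ 2) a v s → IsVelocity L V a c a' c' →
      energyRate L a c a' c' - A * (∫ x in (0 : ℝ)..L, flux a c x * s x)
        ≤ -dissipation L a c + δ * (1 + dissipation L a c) := by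
  obtain ⟨C, hC, hrate⟩ := exists_rate_bound hL hK
  obtain ⟨C₂, hC₂, hpow⟩ := exists_pow_le_dissipation hL K
  set η := δ / C₂ with hη
  have hη0 : 0 < η := by positivity
  -- The weight required by Young's inequality for `C ‖s‖ r ^ 4 ≤ η/4 r ^ 8 + A K⁻³ ‖s‖²`. The
  -- correction itself causes an error `A C r ^ 8 / k`, made small by `k`; the projection errors
  -- growing with `k` are then made small by `l`.
  set A := K ^ 3 * C ^ 2 / η with hA
  have hA0 : 0 ≤ A := by positivity
  refine ⟨A, hA0, max 1 (4 * A * C / η), le_max_left _ _, ?_⟩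
  intro k hk
  have hk1 : 1 ≤ k := (le_max_left _ _).trans hk
  have hk2 : 4 * A * C / η ≤ k := (le_max_right _ _).trans hk
  refine ⟨max 1 (8 * C * k ^ 2 / η), le_max_left _ _, ?_⟩
  intro l hl V a c a' c' v s hV H hcV hS hvel
  have hl1 : 1 ≤ l := (le_max_left _ _).trans hl
  have hl2 : 8 * C * k ^ 2 / η ≤ l := (le_max_right _ _).trans hl
  obtain ⟨r, hr⟩ := H.scaled
  have h1 := hrate A k l r V a c a' c' v s hA0 hk1 hl1 hV hr hcV hS hvel
  have h2 := hpow r a c hr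
  set D := dissipation L a c
  have hR : 0 ≤ r ^ 8 := by have := hr.one_le; positivity
  set σ := l2 L s
  have e1 : A * (C * (r ^ 8 / k)) ≤ η / 4 * r ^ 8 := by
    rw [div_le_iff₀ hη0] at hk2
    have : A * C / k ≤ η / 4 := by rw [div_le_iff₀ (by linarith)]; linarith
    calc A * (C * (r ^ 8 / k)) = A * C / k * r ^ 8 := by ring
      _ ≤ _ := by gcongr
  have e2 : C * ((k ^ 2 / l ^ 2 + 1 / l) * r ^ 8) ≤ η / 4 * r ^ 8 := by
    rw [div_le_iff₀ hη0] at hl2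
    have u1 : k ^ 2 / l ^ 2 ≤ k ^ 2 / l := by
      gcongr; exact le_self_pow₀ hl1 (by norm_num)
    have u2 : 1 / l ≤ k ^ 2 / l := by
      gcongr; exact one_le_pow₀ hk1
    have u3 : k ^ 2 / l * (8 * C) ≤ η := by
      rw [div_mul_eq_mul_div, div_le_iff₀ (by linarith)]; linarith
    have u4 : C * (k ^ 2 / l ^ 2 + 1 / l) ≤ η / 4 := by
      have : C * (k ^ 2 / l ^ 2 + 1 / l) ≤ C * (k ^ 2 / l + k ^ 2 / l) := by gcongr
      linarith
    calc _ = C * (k ^ 2 / l ^ 2 + 1 / l) * r ^ 8 := by ring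
      _ ≤ _ := by gcongr
  have e3 : C * (σ * r ^ 4) ≤ η / 4 * r ^ 8 + A * ((K ^ 3)⁻¹ * σ ^ 2) := by
    have : A * ((K ^ 3)⁻¹ * σ ^ 2) = C ^ 2 / η * σ ^ 2 := by
      rw [hA]; field_simp
    rw [this]
    have key : 0 ≤ η * (r ^ 4 / 2 - C / η * σ) ^ 2 := by positivity
    have ex : η * (r ^ 4 / 2 - C / η * σ) ^ 2
        = η / 4 * r ^ 8 - C * (σ * r ^ 4) + C ^ 2 / η * σ ^ 2 := by
      field_simp
      ring
    linarith
  have e4 : η * r ^ 8 ≤ δ * (1 + D) := by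
    calc η * r ^ 8 ≤ η * (C₂ * (1 + D)) := by gcongr
      _ = _ := by rw [hη]; field_simp
  have e5 : 0 ≤ η / 4 * r ^ 8 := by positivity
  rw [mul_add] at h1
  rw [mul_sub] at h1
  linarith

end


/-! ## Expansions in eigenfunctions of the Laplacian -/

/-- Periodic functions that are continuously differentiable. -/
structure PeriodicC1 (L : ℝ) (u : ℝ → ℝ) : Prop where
  periodic : Function.Periodic u L
  differentiable : Differentiable ℝ u
  deriv_cont : ContinuousOn (deriv u) (Icc 0 L)

lemma SmoothPeriodic.periodicC1 {L : ℝ} {u : ℝ → ℝ} (hu : SmoothPeriodic L u) : PeriodicC1 L u :=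
  ⟨hu.periodic, hu.differentiable, hu.deriv.continuous.continuousOn⟩

lemma IsPeriodicW22.periodicC1 {L : ℝ} (hL : 0 < L) {u : ℝ → ℝ} (hu : IsPeriodicW22 L u) :
    PeriodicC1 L u := by
  obtain ⟨h1, h2, v, hv, h3⟩ := hu
  refine ⟨h1, h2, ?_⟩
  have hint : IntegrableOn v (Icc 0 L) := by
    rw [integrableOn_Icc_iff_integrableOn_Ioc]
    exact hv.integrable (by norm_num)
  have h4 := intervalIntegral.continuousOn_primitive_interval (a := 0) (b := L) (f := v)
    (by rwa [uIcc_of_le hL.le])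
  rw [uIcc_of_le hL.le] at h4
  exact (continuousOn_const.add h4).congr fun x hx => h3 x hx

lemma PeriodicC1.continuous {L : ℝ} {u : ℝ → ℝ} (hu : PeriodicC1 L u) : Continuous u :=
  hu.differentiable.continuous

/-- The coefficients of `u`. -/
noncomputable def coeff (L : ℝ) (φ : ℕ → ℝ → ℝ) (u : ℝ → ℝ) (i : ℕ) : ℝ :=
  ∫ x in (0 : ℝ)..L, u x * φ i x

/-- The eigenvalues of minus the Laplacian. -/
noncomputable def eigval (L : ℝ) (φ : ℕ → ℝ → ℝ) (i : ℕ) : ℝ := l2 L (deriv (φ i)) ^ 2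

lemma eigval_nonneg {L : ℝ} {φ : ℕ → ℝ → ℝ} (i : ℕ) : 0 ≤ eigval L φ i := sq_nonneg _

namespace IsLaplaceEigenbasis

variable {L : ℝ} {φ : ℕ → ℝ → ℝ}

lemma smoothPeriodic (hφ : IsLaplaceEigenbasis L φ) (i : ℕ) : SmoothPeriodic L (φ i) :=
  ⟨hφ.smooth i, hφ.periodic i⟩

lemma smoothPeriodic_sum (hφ : IsLaplaceEigenbasis L φ) (s : Finset ℕ) (b : ℕ → ℝ) :
    SmoothPeriodic L (fun x => ∑ i ∈ s, b i * φ i x) :=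
  SmoothPeriodic.sum s fun i _ => (hφ.smoothPeriodic i).const_mul _

/-- Testing the eigenvalue equation with the normalised eigenfunction identifies `lam²` with the
squared norm of its derivative. -/
lemma deriv_deriv (hL : 0 < L) (hφ : IsLaplaceEigenbasis L φ) (i : ℕ) :
    deriv (deriv (φ i)) = fun x => -eigval L φ i * φ i x := by
  obtain ⟨lam, h⟩ := hφ.eigen i
  have h' : ∀ x, deriv (deriv (φ i)) x = -lam ^ 2 * φ i x := fun x => by
    rw [← h x, iteratedDeriv_succ, iteratedDeriv_one]
  have s := hφ.smoothPeriodic i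
  have e : eigval L φ i = lam ^ 2 := by
    rw [eigval, sq_l2 hL.le]
    have h1 := s.integral_deriv_mul s.deriv
    simp_rw [h', ← mul_assoc, mul_comm (φ i _) (-lam ^ 2), mul_assoc] at h1
    rw [intervalIntegral.integral_const_mul, hφ.orthonormal i i, if_pos rfl] at h1
    simp_rw [pow_two] at h1 ⊢
    rw [h1]
    ring
  rw [e]
  exact funext h'

lemma exists_const (hφ : IsLaplaceEigenbasis L φ) :
    ∃ a : ℝ, a ≠ 0 ∧ ∀ x, φ 0 x = a := by
  obtain ⟨a, ha⟩ := hφ.const_zero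
  refine ⟨a, ?_, ha⟩
  rintro rfl
  have := hφ.orthonormal 0 0
  simp [ha] at this

lemma integral_deriv_mul_eq (hL : 0 < L) (hφ : IsLaplaceEigenbasis L φ) {u : ℝ → ℝ}
    (hu : PeriodicC1 L u) (i : ℕ) :
    ∫ x in (0 : ℝ)..L, deriv u x * deriv (φ i) x = eigval L φ i * coeff L φ u i := by
  have s := hφ.smoothPeriodic i
  have h := intervalIntegral.integral_mul_deriv_eq_deriv_mul (a := 0) (b := L) (u := deriv (φ i))
    (v := u) (u' := deriv (deriv (φ i))) (v' := deriv u)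
    (fun x _ => s.deriv.hasDerivAt x) (fun x _ => (hu.differentiable x).hasDerivAt)
    (s.deriv.deriv.continuous.intervalIntegrable _ _)
    (ContinuousOn.intervalIntegrable (by rw [uIcc_of_le hL.le]; exact hu.deriv_cont))
  have h1 := s.deriv.periodic 0
  have h2 := hu.periodic 0
  rw [zero_add] at h1 h2
  rw [h1, h2, sub_self, zero_sub, hφ.deriv_deriv hL] at h
  simp_rw [mul_comm (deriv u _)]
  rw [h, coeff, ← intervalIntegral.integral_const_mul, ← intervalIntegral.integral_neg]
  congr 1
  ext x
  ring

lemma coeff_basis (hφ : IsLaplaceEigenbasis L φ) (i j : ℕ) :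
    coeff L φ (φ i) j = if i = j then 1 else 0 := hφ.orthonormal i j

lemma integral_mul_sum (hφ : IsLaplaceEigenbasis L φ) {u : ℝ → ℝ} (hu : Continuous u)
    (s : Finset ℕ) (b : ℕ → ℝ) :
    ∫ x in (0 : ℝ)..L, u x * ∑ i ∈ s, b i * φ i x = ∑ i ∈ s, b i * coeff L φ u i := by
  simp_rw [Finset.mul_sum]
  rw [intervalIntegral.integral_finsetSum]
  · refine Finset.sum_congr rfl fun i _ => ?_
    rw [coeff, ← intervalIntegral.integral_const_mul]
    congr 1; ext x; ring
  · intro i _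
    have := (hφ.smoothPeriodic i).continuous
    exact Continuous.intervalIntegrable (by fun_prop) _ _

lemma coeff_sum (hφ : IsLaplaceEigenbasis L φ) (s : Finset ℕ) (b : ℕ → ℝ) (j : ℕ) :
    coeff L φ (fun x => ∑ i ∈ s, b i * φ i x) j = if j ∈ s then b j else 0 := by
  have h := hφ.integral_mul_sum (hφ.smoothPeriodic j).continuous s b
  simp_rw [hφ.coeff_basis] at h
  rw [coeff]
  simp_rw [mul_comm _ (φ j _)]
  rw [h]
  simp

lemma deriv_sum (hφ : IsLaplaceEigenbasis L φ) (s : Finset ℕ) (b : ℕ → ℝ) :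
    deriv (fun x => ∑ i ∈ s, b i * φ i x) = fun x => ∑ i ∈ s, b i * deriv (φ i) x :=
  funext fun x => (HasDerivAt.fun_sum fun i _ =>
    ((hφ.smoothPeriodic i).hasDerivAt x).const_mul (b i)).deriv

lemma deriv_deriv_sum (hL : 0 < L) (hφ : IsLaplaceEigenbasis L φ) (s : Finset ℕ) (b : ℕ → ℝ) :
    deriv (deriv (fun x => ∑ i ∈ s, b i * φ i x))
      = fun x => ∑ i ∈ s, (-(eigval L φ i * b i)) * φ i x := by
  rw [hφ.deriv_sum]
  ext x
  rw [(HasDerivAt.fun_sum fun i _ =>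
    ((hφ.smoothPeriodic i).deriv.hasDerivAt x).const_mul (b i)).deriv]
  refine Finset.sum_congr rfl fun i _ => ?_
  rw [hφ.deriv_deriv hL]
  ring

lemma sq_l2_sum (hL : 0 < L) (hφ : IsLaplaceEigenbasis L φ) (s : Finset ℕ) (b : ℕ → ℝ) :
    l2 L (fun x => ∑ i ∈ s, b i * φ i x) ^ 2 = ∑ i ∈ s, b i ^ 2 := by
  rw [sq_l2 hL.le]
  simp_rw [pow_two]
  rw [hφ.integral_mul_sum (hφ.smoothPeriodic_sum s b).continuous]
  refine Finset.sum_congr rfl fun i hi => ?_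
  rw [hφ.coeff_sum, if_pos hi]

lemma sq_l2_deriv_sum (hL : 0 < L) (hφ : IsLaplaceEigenbasis L φ) (s : Finset ℕ) (b : ℕ → ℝ) :
    l2 L (deriv fun x => ∑ i ∈ s, b i * φ i x) ^ 2 = ∑ i ∈ s, eigval L φ i * b i ^ 2 := by
  have S := hφ.smoothPeriodic_sum s b
  rw [sq_l2 hL.le]
  simp_rw [pow_two]
  rw [S.integral_deriv_mul S.deriv, hφ.deriv_deriv_sum hL, hφ.integral_mul_sum S.continuous,
    ← Finset.sum_neg_distrib]
  refine Finset.sum_congr rfl fun i hi => ?_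
  rw [hφ.coeff_sum, if_pos hi]
  ring

/-- Bessel's inequality for the derivative: the derivatives of the eigenfunctions are again
orthogonal, with squared norms equal to the eigenvalues. -/
lemma bessel (hL : 0 < L) (hφ : IsLaplaceEigenbasis L φ) {u : ℝ → ℝ} (hu : PeriodicC1 L u)
    (s : Finset ℕ) :
    ∑ i ∈ s, eigval L φ i * coeff L φ u i ^ 2 ≤ l2 L (deriv u) ^ 2 := by
  have S := hφ.smoothPeriodic_sum s (coeff L φ u)
  set f := fun x => ∑ i ∈ s, coeff L φ u i * φ i x with hf
  have c1 : ContinuousOn (deriv u) (uIcc 0 L) := by rw [uIcc_of_le hL.le]; exact hu.deriv_cont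
  have c2 : ContinuousOn (deriv f) (uIcc 0 L) := S.deriv.continuous.continuousOn
  have h1 : ∫ x in (0 : ℝ)..L, deriv u x * deriv f x
      = ∑ i ∈ s, eigval L φ i * coeff L φ u i ^ 2 := by
    rw [hf, hφ.deriv_sum]
    simp_rw [Finset.mul_sum]
    rw [intervalIntegral.integral_finsetSum]
    · refine Finset.sum_congr rfl fun i _ => ?_
      rw [show eigval L φ i * coeff L φ u i ^ 2
        = coeff L φ u i * (eigval L φ i * coeff L φ u i) by ring,
        ← hφ.integral_deriv_mul_eq hL hu, ← intervalIntegral.integral_const_mul]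
      congr 1; ext x; ring
    · intro i _
      exact (c1.mul ((hφ.smoothPeriodic i).deriv.continuous.continuousOn.const_mul _)).intervalIntegrable
  have h2 : 0 ≤ ∫ x in (0 : ℝ)..L, (deriv u x - deriv f x) ^ 2 := integral_sq_nonneg hL.le
  have e : ∀ x, (deriv u x - deriv f x) ^ 2
    = deriv u x ^ 2 - 2 * (deriv u x * deriv f x) + deriv f x ^ 2 := fun x => by ring
  simp_rw [e] at h2
  rw [intervalIntegral.integral_add, intervalIntegral.integral_sub,
    intervalIntegral.integral_const_mul, h1, ← sq_l2 hL.le, ← sq_l2 hL.le,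
    hφ.sq_l2_deriv_sum hL] at h2
  · linarith
  · exact (c1.pow 2).intervalIntegrable
  · exact ((c1.mul c2).const_mul _).intervalIntegrable
  · exact ((c1.pow 2).sub ((c1.mul c2).const_mul _)).intervalIntegrable
  · exact (c2.pow 2).intervalIntegrable

lemma summable_eigval (hL : 0 < L) (hφ : IsLaplaceEigenbasis L φ) {u : ℝ → ℝ}
    (hu : PeriodicC1 L u) : Summable fun i => eigval L φ i * coeff L φ u i ^ 2 :=
  summable_of_sum_le (fun i => mul_nonneg (eigval_nonneg i) (sq_nonneg _)) (hφ.bessel hL hu)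

/-- Sums without constant part are controlled by their derivative. -/
lemma abs_sum_le (hL : 0 < L) (hφ : IsLaplaceEigenbasis L φ) (s : Finset ℕ) (h0 : 0 ∉ s)
    (b : ℕ → ℝ) (x : ℝ) :
    |∑ i ∈ s, b i * φ i x| ≤ √L * √(∑ i ∈ s, eigval L φ i * b i ^ 2) := by
  have S := hφ.smoothPeriodic_sum s b
  obtain ⟨a, ha, hφ0⟩ := hφ.exists_const
  have hint : ∫ x in (0 : ℝ)..L, ∑ i ∈ s, b i * φ i x = 0 := by
    have h1 := hφ.coeff_sum s b 0
    rw [if_neg h0, coeff] at h1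
    simp_rw [hφ0] at h1
    rw [intervalIntegral.integral_mul_const] at h1
    exact (mul_eq_zero.1 h1).resolve_right ha
  obtain ⟨y, -, hy⟩ := exists_le_of_integral_le hL S.continuous (C := 0)
    (by rw [hint, zero_mul])
  obtain ⟨z, -, hz⟩ := exists_le_of_integral_le hL S.neg.continuous (C := 0)
    (by rw [intervalIntegral.integral_neg, hint, neg_zero, zero_mul])
  have e1 := abs_le.1 (abs_sub_le_l2 hL S x y)
  have e2 := abs_le.1 (abs_sub_le_l2 hL S x z)
  have e3 : l2 L (deriv fun x => ∑ i ∈ s, b i * φ i x) = √(∑ i ∈ s, eigval L φ i * b i ^ 2) := by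
    rw [← hφ.sq_l2_deriv_sum hL, Real.sqrt_sq l2_nonneg]
  rw [← e3]
  apply abs_le.2
  constructor <;> linarith

lemma coeff_partialSum (hφ : IsLaplaceEigenbasis L φ) (u : ℝ → ℝ) {n j : ℕ} (hj : j ≤ n) :
    coeff L φ (partialSum L φ n u) j = coeff L φ u j := by
  have := hφ.coeff_sum (Finset.range (n + 1)) (coeff L φ u) j
  rwa [if_pos (Finset.mem_range.2 (by omega))] at this

lemma abs_partialSum_sub_le (hL : 0 < L) (hφ : IsLaplaceEigenbasis L φ) {u : ℝ → ℝ} {n m : ℕ}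
    (hnm : n ≤ m) (x : ℝ) :
    |partialSum L φ m u x - partialSum L φ n u x|
      ≤ √L * √(∑ i ∈ Finset.Ico (n + 1) (m + 1), eigval L φ i * coeff L φ u i ^ 2) := by
  have := hφ.abs_sum_le hL (Finset.Ico (n + 1) (m + 1)) (by simp) (coeff L φ u) x
  rwa [Finset.sum_Ico_eq_sub _ (by omega)] at this

/-- Expansions of continuously differentiable functions converge uniformly. -/
theorem tendstoUniformly_partialSum (hL : 0 < L) (hφ : IsLaplaceEigenbasis L φ) {u : ℝ → ℝ}
    (hu : PeriodicC1 L u) : TendstoUniformly (fun n => partialSum L φ n u) u atTop := by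
  have hsum := hφ.summable_eigval hL hu
  have sp : ∀ n, SmoothPeriodic L (partialSum L φ n u) := fun n =>
    hφ.smoothPeriodic_sum (Finset.range (n + 1)) (coeff L φ u)
  -- A difference of partial sums has no constant mode, so its supremum is controlled by a block of
  -- the convergent series from Bessel's inequality.
  have cauchy : UniformCauchySeqOn (fun n => partialSum L φ n u) atTop univ := by
    rw [Metric.uniformCauchySeqOn_iff]
    intro ε hε
    have hδ : 0 < (ε / (2 * (√L + 1))) ^ 2 := by positivity
    obtain ⟨N, hN⟩ := (Metric.cauchySeq_iff'.1 hsum.hasSum.tendsto_sum_nat.cauchySeq)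
      ((ε / (2 * (√L + 1))) ^ 2) hδ
    have key : ∀ m ≥ N, ∀ x, |partialSum L φ m u x - partialSum L φ N u x| < ε / 2 := by
      intro m hm x
      refine (hφ.abs_partialSum_sub_le hL hm x).trans_lt ?_
      have h1 : ∑ i ∈ Finset.Ico (N + 1) (m + 1), eigval L φ i * coeff L φ u i ^ 2
          ≤ (ε / (2 * (√L + 1))) ^ 2 := by
        have h2 := hN (m + 1) (by omega)
        rw [Real.dist_eq, ← Finset.sum_Ico_eq_sub _ (by omega)] at h2
        refine le_trans ?_ ((le_abs_self _).trans h2.le)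
        exact Finset.sum_le_sum_of_subset_of_nonneg
          (Finset.Ico_subset_Ico (by omega) le_rfl)
          fun i _ _ => mul_nonneg (eigval_nonneg i) (sq_nonneg _)
      have h3 := Real.sqrt_le_sqrt h1
      rw [Real.sqrt_sq (by positivity)] at h3
      have hs := Real.sqrt_nonneg L
      calc √L * √(∑ i ∈ Finset.Ico (N + 1) (m + 1), eigval L φ i * coeff L φ u i ^ 2)
          ≤ √L * (ε / (2 * (√L + 1))) := by gcongr
        _ < (√L + 1) * (ε / (2 * (√L + 1))) := by gcongr; linarith
        _ = ε / 2 := by field_simp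
    refine ⟨N, fun m hm n hn x _ => ?_⟩
    rw [Real.dist_eq]
    have a1 := abs_lt.1 (key m hm x)
    have a2 := abs_lt.1 (key n hn x)
    rw [abs_lt]
    constructor <;> linarith
  have lim : ∀ x, ∃ y, Tendsto (fun n => partialSum L φ n u x) atTop (𝓝 y) := fun x =>
    cauchySeq_tendsto_of_complete (cauchy.cauchySeq (mem_univ x))
  choose w hw using lim
  have unif : TendstoUniformly (fun n => partialSum L φ n u) w atTop := by
    rw [← tendstoUniformlyOn_univ]
    exact cauchy.tendstoUniformlyOn_of_tendsto fun x _ => hw x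
  have cw : Continuous w := unif.continuous (Frequently.of_forall fun n => (sp n).continuous)
  have pw : Function.Periodic w L := fun x =>
    tendsto_nhds_unique (hw (x + L)) (by simpa only [(sp _).periodic x] using hw x)
  have cu := hu.continuous
  -- The uniform limit has the same coefficients as `u`. Completeness gives equality almost
  -- everywhere, and continuity gives it everywhere.
  have hco : ∀ j, ∫ x in (0 : ℝ)..L, (u x - w x) * φ j x = 0 := by
    intro j
    have cj := (hφ.smoothPeriodic j).continuous
    have e1 : ∫ x in (0 : ℝ)..L, w x * φ j x = coeff L φ u j := by
      refine tendsto_nhds_unique (f := fun n => coeff L φ (partialSum L φ n u) j) (l := atTop)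
        ?_ ?_
      · have hb := unif.tendstoUniformlyOn (s := Icc 0 L)
        obtain ⟨B, hB⟩ := isCompact_Icc.exists_bound_of_continuousOn (s := Icc 0 L)
          cj.continuousOn
        rw [Metric.tendsto_atTop]
        intro ε hε
        have hB0 : 0 ≤ B := (norm_nonneg _).trans (hB 0 ⟨le_rfl, hL.le⟩)
        obtain ⟨N, hN⟩ := eventually_atTop.1 (Metric.tendstoUniformly_iff.1 unif
          (ε / (2 * ((B + 1) * L))) (by positivity))
        refine ⟨N, fun n hn => ?_⟩
        have cn := (sp n).continuous
        rw [Real.dist_eq, coeff, ← integral_sub_of_continuous (by fun_prop) (by fun_prop)]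
        have h1 := intervalIntegral.norm_integral_le_of_norm_le_const (a := 0) (b := L)
          (f := fun x => partialSum L φ n u x * φ j x - w x * φ j x)
          (C := ε / (2 * ((B + 1) * L)) * (B + 1)) fun x hx => by
            rw [uIoc_of_le hL.le] at hx
            rw [← sub_mul, norm_mul]
            have h2 := hN n hn x
            rw [dist_comm, Real.dist_eq] at h2
            exact mul_le_mul h2.le ((hB x ⟨hx.1.le, hx.2⟩).trans (by linarith)) (norm_nonneg _)
              (by positivity)
        rw [Real.norm_eq_abs, sub_zero, abs_of_pos hL] at h1
        refine h1.trans_lt ?_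
        have : ε / (2 * ((B + 1) * L)) * (B + 1) * L = ε / 2 := by field_simp
        linarith
      · refine tendsto_const_nhds.congr' ?_
        filter_upwards [eventually_ge_atTop j] with n hn
        exact (hφ.coeff_partialSum u hn).symm
    have e2 : ∀ x, (u x - w x) * φ j x = u x * φ j x - w x * φ j x := fun x => by ring
    simp_rw [e2]
    rw [integral_sub_of_continuous (by fun_prop) (by fun_prop), e1, coeff, sub_self]
  have hmem : MemLp (fun x => u x - w x) 2 (volume.restrict (Ioc 0 L)) := by
    have cuw : Continuous fun x => u x - w x := by fun_prop
    obtain ⟨B, hB⟩ := isCompact_Icc.exists_bound_of_continuousOn (s := Icc 0 L) cuw.continuousOn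
    refine MemLp.of_bound cuw.aestronglyMeasurable B ?_
    filter_upwards [ae_restrict_mem measurableSet_Ioc] with x hx
    exact hB x ⟨hx.1.le, hx.2⟩
  have hae := hφ.complete _ hmem hco
  have heq : EqOn (fun x => u x - w x) 0 (Icc 0 L) := by
    rw [Measure.restrict_congr_set Ioc_ae_eq_Icc] at hae
    refine Measure.eqOn_Icc_of_ae_eq volume hL.ne hae ?_ continuousOn_const
    exact (cu.sub cw).continuousOn
  have hfin : w = u := by
    ext x
    have := periodic_bound_of_Icc hL (u := fun x => u x - w x) (P := fun s => s = 0)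
      (fun x => by simp only [hu.periodic x, pw x]) (fun x hx => heq hx) x
    linarith
  rwa [hfin] at unif

/-- The Poincaré inequality on the orthogonal complement of the low modes. -/
lemma poincare (hL : 0 < L) (hφ : IsLaplaceEigenbasis L φ) {n : ℕ} {R : ℝ}
    (hR : ∀ i > n, R ^ 2 ≤ eigval L φ i) {z : ℝ → ℝ} (hz : SmoothPeriodic L z)
    (horth : ∀ i ≤ n, coeff L φ z i = 0) : R * l2 L z ≤ l2 L (deriv z) := by
  have unif := hφ.tendstoUniformly_partialSum hL hz.periodicC1
  have cz := hz.continuous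
  have key : R ^ 2 * l2 L z ^ 2 ≤ l2 L (deriv z) ^ 2 := by
    -- This replaces Parseval's identity: uniform convergence of the expansion lets the squared norm
    -- be written as a limit of sums of squared coefficients, each of which Bessel's inequality
    -- bounds.
    have lim : Tendsto (fun m => R ^ 2 * ∫ x in (0 : ℝ)..L, z x * partialSum L φ m z x) atTop
        (𝓝 (R ^ 2 * l2 L z ^ 2)) := by
      refine Tendsto.const_mul _ ?_
      rw [sq_l2 hL.le]
      simp_rw [pow_two]
      obtain ⟨B, hB⟩ := isCompact_Icc.exists_bound_of_continuousOn (s := Icc 0 L) cz.continuousOn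
      have hB0 : 0 ≤ B := (norm_nonneg _).trans (hB 0 ⟨le_rfl, hL.le⟩)
      rw [Metric.tendsto_atTop]
      intro ε hε
      obtain ⟨N, hN⟩ := eventually_atTop.1 (Metric.tendstoUniformly_iff.1 unif
        (ε / (2 * ((B + 1) * L))) (by positivity))
      refine ⟨N, fun m hm => ?_⟩
      have cn : Continuous (partialSum L φ m z) :=
        (hφ.smoothPeriodic_sum (Finset.range (m + 1)) (coeff L φ z)).continuous
      rw [Real.dist_eq, ← integral_sub_of_continuous (by fun_prop) (by fun_prop)]
      have h1 := intervalIntegral.norm_integral_le_of_norm_le_const (a := 0) (b := L)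
        (f := fun x => z x * partialSum L φ m z x - z x * z x)
        (C := (B + 1) * (ε / (2 * ((B + 1) * L)))) fun x hx => by
          rw [uIoc_of_le hL.le] at hx
          rw [← mul_sub, norm_mul]
          have h2 := hN m hm x
          rw [dist_comm, Real.dist_eq] at h2
          exact mul_le_mul ((hB x ⟨hx.1.le, hx.2⟩).trans (by linarith)) h2.le (norm_nonneg _)
            (by positivity)
      rw [Real.norm_eq_abs, sub_zero, abs_of_pos hL] at h1
      refine h1.trans_lt ?_
      have : (B + 1) * (ε / (2 * ((B + 1) * L))) * L = ε / 2 := by field_simp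
      linarith
    refine le_of_tendsto' lim fun m => ?_
    have e := hφ.integral_mul_sum cz (Finset.range (m + 1)) (coeff L φ z)
    have e' : ∫ x in (0 : ℝ)..L, z x * partialSum L φ m z x
        = ∑ i ∈ Finset.range (m + 1), coeff L φ z i * coeff L φ z i := e
    rw [e', Finset.mul_sum]
    refine (Finset.sum_le_sum fun i _ => ?_).trans (hφ.bessel hL hz.periodicC1 _)
    rcases le_or_gt i n with h | h
    · rw [horth i h]; simp
    · rw [← pow_two]
      exact mul_le_mul_of_nonneg_right (hR i h) (sq_nonneg _)
  rw [← mul_pow] at key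
  exact le_of_sq_le_sq key l2_nonneg

/-- Only finitely many eigenvalues lie below any bound. -/
lemma exists_forall_le_eigval (hL : 0 < L) (hφ : IsLaplaceEigenbasis L φ) (R : ℝ) :
    ∃ n₀ : ℕ, ∀ i > n₀, R ≤ eigval L φ i := by
  by_contra! hcon
  set S : Set ℕ := {i | eigval L φ i < R} with hS
  have hinf : S.Infinite := by
    rw [Set.infinite_iff_exists_gt]
    intro a
    obtain ⟨i, hi, h⟩ := hcon a
    exact ⟨i, h, hi⟩
  set C := ((1 / L + 2) * (1 + √R)) ^ 2 with hC
  obtain ⟨m, hm⟩ := exists_nat_gt (C * L)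
  obtain ⟨s, hsS, hcard⟩ := hinf.exists_subset_card_eq m
  -- A reproducing kernel argument: the function `y ↦ ∑ φ i x * φ i y` has value `q` at `x`, `L²`
  -- norm `√q`, and derivative of norm at most `√R √q`. The supremum bound gives `q ≤ C^{1/2} √q`.
  -- Integration over a period then limits the number of such eigenfunctions.
  have hq : ∀ x, ∑ i ∈ s, φ i x ^ 2 ≤ C := by
    intro x
    have Sm := hφ.smoothPeriodic_sum s (fun i => φ i x)
    have h1 := abs_le_of_l2 hL Sm x
    have e1 := hφ.sq_l2_sum hL s (fun i => φ i x)
    have e2 := hφ.sq_l2_deriv_sum hL s (fun i => φ i x)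
    set q := ∑ i ∈ s, φ i x ^ 2 with hq
    have q0 : 0 ≤ q := Finset.sum_nonneg fun i _ => sq_nonneg _
    have e3 : ∑ i ∈ s, φ i x * φ i x = q := Finset.sum_congr rfl fun i _ => by ring
    rw [e3, abs_of_nonneg q0] at h1
    have l1 : l2 L (fun y => ∑ i ∈ s, φ i x * φ i y) = √q := by
      rw [← e1, Real.sqrt_sq l2_nonneg]
    have l2' : l2 L (deriv fun y => ∑ i ∈ s, φ i x * φ i y) ≤ √R * √q := by
      rw [← Real.sqrt_sq (l2_nonneg (L := L) (u := deriv fun y => ∑ i ∈ s, φ i x * φ i y)), e2,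
        ← Real.sqrt_mul' _ q0]
      apply Real.sqrt_le_sqrt
      rw [Finset.mul_sum]
      exact Finset.sum_le_sum fun i hi => mul_le_mul_of_nonneg_right (hsS hi).le (sq_nonneg _)
    have h2 : q ≤ (1 / L + 2) * (1 + √R) * √q := by
      refine h1.trans ?_
      rw [l1, mul_assoc]
      gcongr
      linarith
    have h3 : √q ≤ (1 / L + 2) * (1 + √R) := by
      rcases (Real.sqrt_nonneg q).eq_or_lt with h | h
      · rw [← h]; positivity
      · refine le_of_mul_le_mul_right ?_ h
        rwa [Real.mul_self_sqrt q0]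
    calc q = √q ^ 2 := (Real.sq_sqrt q0).symm
      _ ≤ C := pow_le_pow_left₀ (Real.sqrt_nonneg _) h3 2
  have hi : ∫ x in (0 : ℝ)..L, ∑ i ∈ s, φ i x ^ 2 = m := by
    rw [intervalIntegral.integral_finsetSum]
    · simp_rw [pow_two, hφ.orthonormal]
      simp [hcard]
    · intro i _
      have := (hφ.smoothPeriodic i).continuous
      exact Continuous.intervalIntegrable (by fun_prop) _ _
  have hle : ∫ x in (0 : ℝ)..L, ∑ i ∈ s, φ i x ^ 2 ≤ ∫ x in (0 : ℝ)..L, C := by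
    refine intervalIntegral.integral_mono_on hL.le ?_ ?_ fun x _ => hq x
    · refine Continuous.intervalIntegrable (continuous_finsetSum _ fun i _ => ?_) _ _
      exact (hφ.smoothPeriodic i).continuous.pow 2
    · exact continuous_const.intervalIntegrable _ _
  rw [hi, intervalIntegral.integral_const, smul_eq_mul, sub_zero, mul_comm] at hle
  linarith

end IsLaplaceEigenbasis

/-! ### Galerkin spaces, the splitting of frequencies, and the size of the correction. -/

/-- The span of the first eigenfunctions. -/
def galerkinSpace (φ : ℕ → ℝ → ℝ) (n : ℕ) : Submodule ℝ (ℝ → ℝ) :=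
  Submodule.span ℝ (range fun i : Fin (n + 1) => φ i)

lemma mem_galerkinSpace {φ : ℕ → ℝ → ℝ} {n : ℕ} {u : ℝ → ℝ} :
    u ∈ galerkinSpace φ n ↔ ∃ b : ℕ → ℝ, u = fun x => ∑ i ∈ Finset.range (n + 1), b i * φ i x := by
  rw [galerkinSpace, Submodule.mem_span_range_iff_exists_fun]
  constructor
  · rintro ⟨b, rfl⟩
    refine ⟨fun i => if h : i < n + 1 then b ⟨i, h⟩ else 0, ?_⟩
    ext x
    rw [Finset.sum_apply, Finset.sum_range]
    refine Finset.sum_congr rfl fun i _ => ?_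
    simp [Nat.lt_succ_iff.1 i.2]
  · rintro ⟨b, rfl⟩
    refine ⟨fun i => b i, ?_⟩
    ext x
    rw [Finset.sum_apply, Finset.sum_range]
    simp

lemma sum_mem_galerkinSpace (φ : ℕ → ℝ → ℝ) (n : ℕ) (b : ℕ → ℝ) :
    (fun x => ∑ i ∈ Finset.range (n + 1), b i * φ i x) ∈ galerkinSpace φ n :=
  mem_galerkinSpace.2 ⟨b, rfl⟩

lemma basis_mem_galerkinSpace (φ : ℕ → ℝ → ℝ) {n i : ℕ} (hi : i ≤ n) : φ i ∈ galerkinSpace φ n :=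
  Submodule.subset_span ⟨⟨i, by omega⟩, rfl⟩

namespace IsLaplaceEigenbasis

variable {L : ℝ} {φ : ℕ → ℝ → ℝ}

lemma const_mem (hφ : IsLaplaceEigenbasis L φ) (n : ℕ) (r : ℝ) :
    (fun _ => r) ∈ galerkinSpace φ n := by
  obtain ⟨a, ha, h⟩ := hφ.exists_const
  have := (galerkinSpace φ n).smul_mem (r / a) (basis_mem_galerkinSpace φ (Nat.zero_le n))
  convert this using 1
  ext x
  simp only [Pi.smul_apply, h, smul_eq_mul]
  field_simp

lemma isGalerkinSpace (hL : 0 < L) (hφ : IsLaplaceEigenbasis L φ) {n : ℕ} {R : ℝ}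
    (hR : ∀ i > n, R ^ 2 ≤ eigval L φ i) : IsGalerkinSpace L R (galerkinSpace φ n) where
  smooth u hu := by
    obtain ⟨b, rfl⟩ := mem_galerkinSpace.1 hu
    exact hφ.smoothPeriodic_sum _ _
  finite := by
    have : (range fun i : Fin (n + 1) => φ i).Finite := finite_range _
    exact Module.Finite.span_of_finite ℝ this
  laplace_mem u hu := by
    obtain ⟨b, rfl⟩ := mem_galerkinSpace.1 hu
    rw [hφ.deriv_deriv_sum hL]
    exact sum_mem_galerkinSpace φ n _
  gap z hz h := hφ.poincare hL hR hz fun i hi => h _ (basis_mem_galerkinSpace φ hi)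

/-- The low frequency part of the third derivative of a Galerkin sum. -/
lemma frequencySplit (hL : 0 < L) (hφ : IsLaplaceEigenbasis L φ) {κ : ℝ} (hκ : 0 < κ)
    (s : Finset ℕ) (b : ℕ → ℝ) (e : ℝ) :
    FrequencySplit L κ (fun x => (∑ i ∈ s, b i * φ i x) + e)
      (fun x => ∑ i ∈ s, (-(κ ^ 2 / (κ ^ 2 + eigval L φ i) * eigval L φ i * b i)) * deriv (φ i) x)
      (fun x => ∑ i ∈ s, (-(eigval L φ i ^ 2 / (κ ^ 2 + eigval L φ i) * b i)) * deriv (φ i) x) := by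
  -- The low frequency part is the third derivative smoothed by the resolvent `(1 - κ⁻² ∂²)⁻¹`. On
  -- the `i`-th mode the two parts have the multipliers `κ² / (κ² + λ)` and `λ / (κ² + λ)`, so that
  -- `s = -κ⁻² v''` holds exactly, as it would not for a sharp cutoff.
  set β : ℕ → ℝ := fun i => -(κ ^ 2 / (κ ^ 2 + eigval L φ i) * eigval L φ i * b i) with hβ
  have pos : ∀ i, 0 < κ ^ 2 + eigval L φ i := fun i => by
    have := eigval_nonneg (L := L) (φ := φ) i; positivity
  have S := hφ.smoothPeriodic_sum s β
  have hd := hφ.deriv_sum s β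
  have d3 : ∀ b : ℕ → ℝ, deriv (deriv (deriv fun x => ∑ i ∈ s, b i * φ i x))
      = fun x => ∑ i ∈ s, (-(eigval L φ i * b i)) * deriv (φ i) x := fun b => by
    rw [hφ.deriv_deriv_sum hL, hφ.deriv_sum]
  refine ⟨?_, ?_, ?_, ?_⟩
  · rw [← hd]; exact S.deriv
  · obtain ⟨y, hy⟩ := S.exists_deriv_eq_zero hL
    rw [hd] at hy
    exact ⟨y, hy⟩
  · intro x
    rw [← hd, d3, Finset.mul_sum, ← Finset.sum_neg_distrib]
    refine Finset.sum_congr rfl fun i _ => ?_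
    rw [hβ]
    have := (pos i).ne'
    field_simp
  · intro x
    have e1 : deriv (fun x => (∑ i ∈ s, b i * φ i x) + e) = deriv fun x => ∑ i ∈ s, b i * φ i x :=
      funext fun x => deriv_add_const e
    rw [e1, d3, ← Finset.sum_add_distrib]
    refine Finset.sum_congr rfl fun i _ => ?_
    have := (pos i).ne'
    field_simp
    ring

/-- The correction of the energy is small when the energy dissipation is bounded. -/
lemma correction_le (hL : 0 < L) (hφ : IsLaplaceEigenbasis L φ) {κ : ℝ} (hκ : 0 < κ)
    (s : Finset ℕ) (b : ℕ → ℝ) :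
    ∑ i ∈ s, eigval L φ i ^ 2 / (κ ^ 2 + eigval L φ i) * b i ^ 2
      ≤ κ⁻¹ ^ 2 * l2 L (deriv (deriv fun x => ∑ i ∈ s, b i * φ i x)) ^ 2 := by
  rw [hφ.deriv_deriv_sum hL, hφ.sq_l2_sum hL, Finset.mul_sum]
  refine Finset.sum_le_sum fun i _ => ?_
  have h0 := eigval_nonneg (L := L) (φ := φ) i
  have : eigval L φ i ^ 2 / (κ ^ 2 + eigval L φ i) ≤ eigval L φ i ^ 2 / κ ^ 2 := by
    gcongr; linarith
  calc _ ≤ eigval L φ i ^ 2 / κ ^ 2 * b i ^ 2 := by gcongr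
    _ = _ := by field_simp

/-- The correction of the energy is small initially if the threshold frequency is large. -/
lemma exists_correction_le (hL : 0 < L) (hφ : IsLaplaceEigenbasis L φ) {u : ℝ → ℝ}
    (hu : PeriodicC1 L u) {δ : ℝ} (hδ : 0 < δ) :
    ∃ κ₀ : ℝ, 0 < κ₀ ∧ ∀ κ ≥ κ₀, ∀ n : ℕ, ∑ i ∈ Finset.range (n + 1),
      eigval L φ i ^ 2 / (κ ^ 2 + eigval L φ i) * coeff L φ u i ^ 2 ≤ δ := by
  have hsum := hφ.summable_eigval hL hu
  have hnn : ∀ i, 0 ≤ eigval L φ i * coeff L φ u i ^ 2 := fun i =>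
    mul_nonneg (eigval_nonneg i) (sq_nonneg _)
  -- The weight is at most `λ` and at most `λ² / κ²`. The first bound and summability handle all
  -- modes outside a finite set `s`; on `s` the second bound is small for large `κ`. Neither depends
  -- on `n`.
  obtain ⟨s, hs⟩ := summable_iff_vanishing_norm.1 hsum (δ / 2) (by positivity)
  set B := ∑ i ∈ s, eigval L φ i ^ 2 * coeff L φ u i ^ 2 with hB
  have hB0 : 0 ≤ B := Finset.sum_nonneg fun i _ => by positivity
  refine ⟨√(2 * B / δ) + 1, by positivity, fun κ hκ n => ?_⟩
  have hκ0 : 0 < κ := lt_of_lt_of_le (by positivity) hκ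
  have hκ2 : 2 * B / δ ≤ κ ^ 2 := by
    rw [← Real.sqrt_le_left hκ0.le]
    linarith
  have pos : ∀ i, 0 < κ ^ 2 + eigval L φ i := fun i => by
    have := eigval_nonneg (L := L) (φ := φ) i; positivity
  rw [← Finset.sum_filter_add_sum_filter_not _ (fun i => i ∈ s)]
  have h1 : ∑ i ∈ (Finset.range (n + 1)).filter (fun i => i ∈ s),
      eigval L φ i ^ 2 / (κ ^ 2 + eigval L φ i) * coeff L φ u i ^ 2 ≤ δ / 2 := by
    calc _ ≤ ∑ i ∈ s, eigval L φ i ^ 2 / (κ ^ 2 + eigval L φ i) * coeff L φ u i ^ 2 := by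
          refine Finset.sum_le_sum_of_subset_of_nonneg (fun i hi => (Finset.mem_filter.1 hi).2)
            fun i _ _ => ?_
          have := pos i
          positivity
      _ ≤ ∑ i ∈ s, (κ ^ 2)⁻¹ * (eigval L φ i ^ 2 * coeff L φ u i ^ 2) := by
          refine Finset.sum_le_sum fun i _ => ?_
          have h0 := eigval_nonneg (L := L) (φ := φ) i
          have : eigval L φ i ^ 2 / (κ ^ 2 + eigval L φ i) ≤ eigval L φ i ^ 2 / κ ^ 2 := by
            gcongr; linarith
          calc _ ≤ eigval L φ i ^ 2 / κ ^ 2 * coeff L φ u i ^ 2 := by gcongr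
            _ = _ := by ring
      _ = (κ ^ 2)⁻¹ * B := by rw [hB, Finset.mul_sum]
      _ ≤ δ / 2 := by
          rw [inv_mul_le_iff₀ (by positivity)]
          rw [div_le_iff₀ hδ] at hκ2
          linarith
  have h2 : ∑ i ∈ (Finset.range (n + 1)).filter (fun i => ¬ i ∈ s),
      eigval L φ i ^ 2 / (κ ^ 2 + eigval L φ i) * coeff L φ u i ^ 2 ≤ δ / 2 := by
    have h3 := hs ((Finset.range (n + 1)).filter (fun i => ¬ i ∈ s))
      (Finset.disjoint_left.2 fun i hi => (Finset.mem_filter.1 hi).2)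
    refine le_trans (Finset.sum_le_sum fun i _ => ?_) ((le_abs_self _).trans h3.le)
    have h0 := eigval_nonneg (L := L) (φ := φ) i
    have : eigval L φ i ^ 2 / (κ ^ 2 + eigval L φ i) ≤ eigval L φ i := by
      rw [div_le_iff₀ (pos i)]
      nlinarith [mul_nonneg (sq_nonneg κ) h0]
    gcongr
  linarith

end IsLaplaceEigenbasis


/-! ## Integrals depending on parameters -/

section Parametric

variable {X : Type*} [NormedAddCommGroup X] [NormedSpace ℝ X] {Φ : X → ℝ → ℝ}

/-- The partial derivative in the parameter. -/
noncomputable def paramDeriv (Φ : X → ℝ → ℝ) (y : X) (x : ℝ) : X →L[ℝ] ℝ :=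
  (fderiv ℝ (fun p : X × ℝ => Φ p.1 p.2) (y, x)).comp (ContinuousLinearMap.inl ℝ X ℝ)

lemma hasFDerivAt_param (hΦ : ContDiff ℝ 1 (fun p : X × ℝ => Φ p.1 p.2)) (y : X) (x : ℝ) :
    HasFDerivAt (fun y => Φ y x) (paramDeriv Φ y x) y := by
  have h1 : HasFDerivAt (fun p : X × ℝ => Φ p.1 p.2) _ (y, x) :=
    ((hΦ.differentiable one_ne_zero) (y, x)).hasFDerivAt
  exact HasFDerivAt.comp (f := fun e : X => (e, x)) y h1 (hasFDerivAt_prodMk_left y x)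

lemma continuous_paramDeriv (hΦ : ContDiff ℝ 1 (fun p : X × ℝ => Φ p.1 p.2)) :
    Continuous (Function.uncurry (paramDeriv Φ)) := by
  have := hΦ.continuous_fderiv one_ne_zero
  exact this.clm_comp continuous_const

variable [ProperSpace X]

lemma hasFDerivAt_integral (hΦ : ContDiff ℝ 1 (fun p : X × ℝ => Φ p.1 p.2)) (L : ℝ) (y : X) :
    HasFDerivAt (fun y => ∫ x in (0 : ℝ)..L, Φ y x) (∫ x in (0 : ℝ)..L, paramDeriv Φ y x) y := by
  have c := continuous_paramDeriv hΦ
  have cΦ : ∀ y, Continuous (Φ y) := fun y =>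
    hΦ.continuous.comp (f := fun x : ℝ => (y, x)) (by fun_prop)
  have c' : ∀ y, Continuous (paramDeriv Φ y) := fun y =>
    c.comp (f := fun x : ℝ => (y, x)) (by fun_prop)
  obtain ⟨B, hB⟩ := ((isCompact_closedBall y 1).prod (isCompact_uIcc (a := (0 : ℝ))
    (b := L))).exists_bound_of_continuousOn c.continuousOn
  refine intervalIntegral.hasFDerivAt_integral_of_dominated_of_fderiv_le (s := Metric.closedBall y 1)
    (bound := fun _ => B) (Metric.closedBall_mem_nhds y one_pos) ?_ ?_ ?_ ?_ ?_ ?_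
  · exact Eventually.of_forall fun z => (cΦ z).aestronglyMeasurable
  · exact (cΦ y).intervalIntegrable _ _
  · exact (c' y).aestronglyMeasurable
  · refine Eventually.of_forall fun x hx z hz => hB (z, x) ⟨hz, uIoc_subset_uIcc hx⟩
  · exact continuous_const.intervalIntegrable _ _
  · exact Eventually.of_forall fun x _ z _ => hasFDerivAt_param hΦ z x

lemma contDiff_integral (hΦ : ContDiff ℝ 1 (fun p : X × ℝ => Φ p.1 p.2)) (L : ℝ) :
    ContDiff ℝ 1 (fun y => ∫ x in (0 : ℝ)..L, Φ y x) := by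
  rw [contDiff_one_iff_hasFDerivAt]
  exact ⟨_, intervalIntegral.continuous_parametric_intervalIntegral_of_continuous'
    (continuous_paramDeriv hΦ) 0 L, hasFDerivAt_integral hΦ L⟩

/-- Differentiation under the integral sign along a curve. -/
lemma hasDerivAt_integral (hΦ : ContDiff ℝ 1 (fun p : X × ℝ => Φ p.1 p.2)) (L : ℝ) {y : ℝ → X}
    {y' : X} {t : ℝ} (hy : HasDerivAt y y' t) {ψ : ℝ → ℝ}
    (hψ : ∀ x, HasDerivAt (fun s => Φ (y s) x) (ψ x) t) :
    HasDerivAt (fun s => ∫ x in (0 : ℝ)..L, Φ (y s) x) (∫ x in (0 : ℝ)..L, ψ x) t := by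
  have h1 := (hasFDerivAt_integral hΦ L (y t)).comp_hasDerivAt t hy
  have c := continuous_paramDeriv hΦ
  have c' : Continuous (paramDeriv Φ (y t)) := c.comp (f := fun x : ℝ => (y t, x)) (by fun_prop)
  rw [ContinuousLinearMap.intervalIntegral_apply (c'.intervalIntegrable _ _)] at h1
  have e : ∀ x, paramDeriv Φ (y t) x y' = ψ x := fun x =>
    ((hasFDerivAt_param hΦ (y t) x).comp_hasDerivAt t hy).unique (hψ x)
  simp_rw [e] at h1
  exact h1

end Parametric

/-! ## Determinants and Cramer's rule -/

section Cramer

variable {ι : Type*} [Fintype ι] [DecidableEq ι]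

lemma contDiff_det {X : Type*} [NormedAddCommGroup X] [NormedSpace ℝ X] {M : X → Matrix ι ι ℝ}
    (hM : ∀ i j, ContDiff ℝ 1 fun x => M x i j) : ContDiff ℝ 1 fun x => (M x).det := by
  simp_rw [Matrix.det_apply']
  exact ContDiff.sum fun σ _ => contDiff_const.mul (contDiff_prod fun i _ => hM _ _)

lemma differentiableAt_det {M : ℝ → Matrix ι ι ℝ} {t : ℝ}
    (hM : ∀ i j, DifferentiableAt ℝ (fun x => M x i j) t) :
    DifferentiableAt ℝ (fun x => (M x).det) t := by
  simp_rw [Matrix.det_apply']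
  exact DifferentiableAt.fun_sum fun σ _ => (differentiableAt_const _).mul
    (DifferentiableAt.fun_finsetProd fun i _ => hM _ _)

/-- Writes coefficients as quotients of determinants in the mass matrix and the moments, so that
differentiability of the latter passes to the coefficients. -/
lemma eq_cramer {M : Matrix ι ι ℝ} (hM : M.det ≠ 0) {v b : ι → ℝ} (h : M.mulVec v = b) (i : ι) :
    v i = (M.updateCol i b).det / M.det := by
  have h1 : M.cramer b = M.det • v := by
    have := Matrix.cramer_eq_adjugate_mulVec M b
    rw [this, ← h, Matrix.mulVec_mulVec, Matrix.adjugate_mul, Matrix.smul_mulVec, Matrix.one_mulVec]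
  have h2 := congrFun h1 i
  rw [Matrix.cramer_apply, Pi.smul_apply, smul_eq_mul] at h2
  rw [h2]
  field_simp

lemma mulVec_cramer_div {M : Matrix ι ι ℝ} (hM : M.det ≠ 0) (b : ι → ℝ) :
    M.mulVec (fun i => (M.updateCol i b).det / M.det) = b := by
  have h1 := Matrix.mulVec_cramer M b
  have e : (fun i => (M.updateCol i b).det / M.det) = (M.det)⁻¹ • M.cramer b := by
    ext i
    rw [Pi.smul_apply, Matrix.cramer_apply, smul_eq_mul, div_eq_inv_mul]
  rw [e, Matrix.mulVec_smul, h1, smul_smul, inv_mul_cancel₀ hM, one_smul]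

end Cramer

/-! ## The nonlinear terms as functions of the derivatives -/

/-- The flux as a function of the derivatives of height and concentration. -/
noncomputable def fluxF (a a1 a3 c1 c2 : ℝ) : ℝ :=
  a ^ 3 * a3 - (a1 * a⁻¹ + a ^ 2 * (a1 * c1 ^ 2 + 2 * a * c1 * c2))

/-- The derivative of the chemical potential as a function of the derivatives. -/
noncomputable def potF (a a1 a2 c c1 c2 c3 : ℝ) : ℝ :=
  3 * c ^ 2 * c1 - c1 - ((a2 * c1 + a1 * c2) * a⁻¹ - a1 * c1 * (a1 * a⁻¹ ^ 2)) - c3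

/-- The energy density as a function of the derivatives. -/
noncomputable def energyF (a a1 c c1 : ℝ) : ℝ :=
  a1 ^ 2 / 2 + a⁻¹ ^ 2 / 6 + a * (doubleWell c + c1 ^ 2 / 2)

section ContDiffF

variable {Y : Type*} [NormedAddCommGroup Y] [NormedSpace ℝ Y] {a a1 a2 a3 c c1 c2 c3 : Y → ℝ}

lemma contDiff_fluxF (h0 : ∀ y, a y ≠ 0) (ha : ContDiff ℝ 1 a) (ha1 : ContDiff ℝ 1 a1)
    (ha3 : ContDiff ℝ 1 a3) (hc1 : ContDiff ℝ 1 c1) (hc2 : ContDiff ℝ 1 c2) :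
    ContDiff ℝ 1 fun y => fluxF (a y) (a1 y) (a3 y) (c1 y) (c2 y) := by
  have := ha.inv h0
  unfold fluxF
  fun_prop

lemma contDiff_potF (h0 : ∀ y, a y ≠ 0) (ha : ContDiff ℝ 1 a) (ha1 : ContDiff ℝ 1 a1)
    (ha2 : ContDiff ℝ 1 a2) (hc : ContDiff ℝ 1 c) (hc1 : ContDiff ℝ 1 c1)
    (hc2 : ContDiff ℝ 1 c2) (hc3 : ContDiff ℝ 1 c3) :
    ContDiff ℝ 1 fun y => potF (a y) (a1 y) (a2 y) (c y) (c1 y) (c2 y) (c3 y) := by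
  have := ha.inv h0
  unfold potF
  fun_prop

lemma contDiff_energyF (h0 : ∀ y, a y ≠ 0) (ha : ContDiff ℝ 1 a) (ha1 : ContDiff ℝ 1 a1)
    (hc : ContDiff ℝ 1 c) (hc1 : ContDiff ℝ 1 c1) :
    ContDiff ℝ 1 fun y => energyF (a y) (a1 y) (c y) (c1 y) := by
  have := ha.inv h0
  unfold energyF doubleWell
  fun_prop

end ContDiffF

lemma hasDerivAt_energyF {a a1 c c1 : ℝ → ℝ} {a' a1' c' c1' t : ℝ} (h0 : a t ≠ 0)
    (ha : HasDerivAt a a' t) (ha1 : HasDerivAt a1 a1' t) (hc : HasDerivAt c c' t)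
    (hc1 : HasDerivAt c1 c1' t) :
    HasDerivAt (fun s => energyF (a s) (a1 s) (c s) (c1 s))
      (a1 t * a1' - (a t)⁻¹ ^ 3 / 3 * a' + a' * (doubleWell (c t) + c1 t ^ 2 / 2)
        + a t * ((c t ^ 3 - c t) * c' + c1 t * c1')) t := by
  have hW : HasDerivAt (fun s => doubleWell (c s)) ((c t ^ 3 - c t) * c') t :=
    (hasDerivAt_doubleWell (c t)).comp t hc
  have := (((ha1.fun_pow 2).div_const 2).fun_add (((ha.fun_inv h0).fun_pow 2).div_const 6)).fun_add
    (ha.fun_mul (hW.fun_add ((hc1.fun_pow 2).div_const 2)))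
  refine this.congr_deriv ?_
  push_cast
  ring

/-! ### The rate of the energy, and the regularised fluxes at positive height. -/

section

variable {L ε : ℝ} {g h a c a' c' : ℝ → ℝ}

lemma flux_eq_fluxF (x : ℝ) : flux a c x = fluxF (a x) (deriv a x) (deriv (deriv (deriv a)) x)
    (deriv c x) (deriv (deriv c) x) := rfl

lemma energy_eq_energyF : energy L a c = ∫ x in (0 : ℝ)..L, energyF (a x) (deriv a x) (c x)
    (deriv c x) := rfl

lemma deriv_pot (ha : SmoothPeriodic L a) (hc : SmoothPeriodic L c) (h0 : ∀ x, 0 < a x) (x : ℝ) :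
    deriv (pot a c) x = potF (a x) (deriv a x) (deriv (deriv a) x) (c x) (deriv c x)
      (deriv (deriv c) x) (deriv (deriv (deriv c)) x) := by
  have h1 := ((hc.hasDerivAt x).fun_pow 3).fun_sub (hc.hasDerivAt x)
  have h2 := ((ha.deriv.hasDerivAt x).fun_mul (hc.deriv.hasDerivAt x)).fun_mul
    ((ha.hasDerivAt x).fun_inv (h0 x).ne')
  have := (h1.fun_sub h2).fun_sub (hc.deriv.deriv.hasDerivAt x)
  rw [show pot a c = fun x => c x ^ 3 - c x - deriv a x * deriv c x * (a x)⁻¹ - deriv (deriv c) x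
    from rfl, this.deriv, potF]
  push_cast
  have := (h0 x).ne'
  field_simp
  ring

/-- The rate of change of the energy, before integration by parts. -/
lemma integral_eq_energyRate (ha : SmoothPeriodic L a) (hc : SmoothPeriodic L c)
    (ha' : SmoothPeriodic L a') (hc' : SmoothPeriodic L c') (h0 : ∀ x, 0 < a x) :
    ∫ x in (0 : ℝ)..L, (deriv a x * deriv a' x - (a x)⁻¹ ^ 3 / 3 * a' x
      + a' x * (doubleWell (c x) + deriv c x ^ 2 / 2)
      + a x * ((c x ^ 3 - c x) * c' x + deriv c x * deriv c' x)) = energyRate L a c a' c' := by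
  have h1 := ha'.integral_deriv_mul ha.deriv
  have h2 := hc'.integral_deriv_mul (ha.mul hc.deriv)
  have d : ∀ x, deriv (fun x => a x * deriv c x) x = deriv a x * deriv c x
      + a x * deriv (deriv c) x := fun x =>
    ((ha.hasDerivAt x).fun_mul (hc.deriv.hasDerivAt x)).deriv
  simp_rw [d] at h2
  have k1 := ha.continuous
  have k2 := ha.deriv.continuous
  have k3 := ha.deriv.deriv.continuous
  have k4 := hc.continuous
  have k5 := hc.deriv.continuous
  have k6 := hc.deriv.deriv.continuous
  have k7 := ha'.continuous
  have k8 := hc'.continuous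
  have k9 := hc.doubleWell.continuous
  have k10 := (ha.inv h0).continuous
  have k11 := ha'.deriv.continuous
  have k12 := hc'.deriv.continuous
  have k13 := (smoothPeriodic_enVar ha hc h0).continuous
  have k14 := (smoothPeriodic_pot ha hc h0).continuous
  rw [energyRate, ← sub_eq_zero, ← integral_sub_of_continuous (by fun_prop) (by fun_prop)]
  have e : ∀ x, (deriv a x * deriv a' x - (a x)⁻¹ ^ 3 / 3 * a' x
      + a' x * (doubleWell (c x) + deriv c x ^ 2 / 2)
      + a x * ((c x ^ 3 - c x) * c' x + deriv c x * deriv c' x))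
      - (a' x * enVar a c x + a x * pot a c x * c' x)
      = (deriv a' x * deriv a x + a' x * deriv (deriv a) x)
        + (deriv c' x * (a x * deriv c x)
          + c' x * (deriv a x * deriv c x + a x * deriv (deriv c) x)) := fun x => by
    have := (h0 x).ne'
    unfold enVar pot
    field_simp
    ring
  simp_rw [e]
  rw [integral_add_of_continuous (by fun_prop) (by fun_prop),
    integral_add_of_continuous (by fun_prop) (by fun_prop),
    integral_add_of_continuous (by fun_prop) (by fun_prop), h1, h2]
  ring

lemma IsRegularization.pos_all (hg : IsRegularization ε g) (hε : 0 < ε) (s : ℝ) : 0 < g s := by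
  rcases lt_or_ge s 0 with h | h
  · exact hg.pos s h
  · rw [hg.eq_add s h]; linarith

lemma IsRegularization.hasDerivAt (hg : IsRegularization ε g) {s : ℝ} (hs : 0 < s) :
    HasDerivAt g 1 s := by
  have h1 : HasDerivAt (fun s => s + ε) 1 s := (hasDerivAt_id s).add_const ε
  refine h1.congr_of_eventuallyEq ?_
  filter_upwards [lt_mem_nhds hs] with y hy using hg.eq_add y hy.le

lemma deriv_shift (h : ℝ → ℝ) (ε : ℝ) : deriv (fun x => h x + ε) = deriv h :=
  funext fun _ => deriv_add_const ε

/-- At positive heights the regularisation is just the shift by `ε`; its values on the negative axis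
play no role. -/
lemma fluxJ_eq_flux (hg : IsRegularization ε g) (hε : 0 < ε) (hh : SmoothPeriodic L h)
    (hc : SmoothPeriodic L c) (h0 : ∀ x, 0 < h x) (x : ℝ) :
    fluxJ g h c x = flux (fun x => h x + ε) c x := by
  have e : ∀ y, g (h y) = h y + ε := fun y => hg.eq_add _ (h0 y).le
  have d : deriv (fun y => (h y + ε) * deriv c y ^ 2) x
      = deriv h x * deriv c x ^ 2 + 2 * (h x + ε) * deriv c x * deriv (deriv c) x := by
    rw [(((hh.hasDerivAt x).add_const ε).fun_mul ((hc.deriv.hasDerivAt x).fun_pow 2)).deriv]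
    push_cast
    ring
  have : h x + ε ≠ 0 := by have := h0 x; positivity
  rw [fluxJ, flux, deriv_shift]
  simp_rw [e, mobility, e, d]
  rw [iteratedDeriv_succ, iteratedDeriv_succ, iteratedDeriv_one]
  field_simp
  ring

lemma fluxK_eq (hg : IsRegularization ε g) (hε : 0 < ε) (hh : SmoothPeriodic L h)
    (hc : SmoothPeriodic L c) (h0 : ∀ x, 0 < h x) (x : ℝ) :
    fluxK g h c x = c x * flux (fun x => h x + ε) c x
      - (h x + ε) * deriv (pot (fun x => h x + ε) c) x := by
  have e : ∀ y, g (h y) = h y + ε := fun y => hg.eq_add _ (h0 y).le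
  have d : ∀ y, deriv (fun y => (h y + ε) * deriv c y) y
      = deriv h y * deriv c y + (h y + ε) * deriv (deriv c) y := fun y =>
    (((hh.hasDerivAt y).add_const ε).fun_mul (hc.deriv.hasDerivAt y)).deriv
  have hp : chemPot g h c = pot (fun x => h x + ε) c := by
    ext y
    have : h y + ε ≠ 0 := by have := h0 y; positivity
    rw [chemPot, pot, deriv_shift]
    simp_rw [e, d]
    field_simp
    ring
  rw [fluxK, fluxJ_eq_flux hg hε hh hc h0, hp, e]

end


/-! ## States of small dissipation -/

/-- Flux and gradient of the potential are bounded by the square root of the dissipation, so that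
small dissipation makes the state nearly stationary. The order of the quantifiers is essential: `e`
is fixed before `K`, since `K` will later be derived from an energy level above `e`. Only the
threshold `d` and the bound on the second derivative depend on `K`. -/
lemma exists_energy_le_of_dissipation_le {L X₀ : ℝ} (hL : 0 < L) (hX₀ : 0 < X₀) (X₁ m₁ : ℝ) :
    ∃ e : ℝ, ∀ K, 2 ≤ K → ∃ C d : ℝ, 0 ≤ C ∧ 0 < d ∧ ∀ a c : ℝ → ℝ, Bounds L K a c → X₀ ≤ ∫ x in (0 : ℝ)..L, a x →
      ∫ x in (0 : ℝ)..L, a x ≤ X₁ → |∫ x in (0 : ℝ)..L, a x * c x| ≤ m₁ →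
      dissipation L a c ≤ d → energy L a c ≤ e ∧ l2 L (deriv (deriv a)) ^ 2 ≤ C := by
  obtain ⟨e, he⟩ := NearStationary.energy_le (X₁ := X₁) (m₁ := m₁) hL hX₀
  refine ⟨e, fun K hK => ?_⟩
  obtain ⟨C, hC, hpow⟩ := exists_pow_le_dissipation hL K
  have hK0 : 0 < K := by linarith
  have hK1 : 1 ≤ K := by linarith
  have hs := Real.sqrt_nonneg L
  -- Small enough that a function with squared `L²` norm at most `K ^ 3 d` has `L¹` norm at most
  -- one, even after multiplication by `a⁻³ ≤ K ^ 3`.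
  set d : ℝ := ((√L + 1) ^ 2 * K ^ 9)⁻¹ with hd
  have hd0 : 0 < d := by positivity
  have hd1 : d ≤ 1 := by
    apply inv_le_one_of_one_le₀
    exact one_le_mul_of_one_le_of_one_le (one_le_pow₀ (by linarith)) (one_le_pow₀ hK1)
  refine ⟨K * (2 * C), d, by positivity, hd0, ?_⟩
  intro a c H h1 h2 h3 hD
  have ha := H.smooth_a
  have hc := H.smooth_c
  have h0 := H.pos
  have k1 := (smoothPeriodic_flux ha hc h0).continuous
  have k2 := (smoothPeriodic_pot ha hc h0).deriv.continuous
  have k3 := (ha.inv h0).continuous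
  obtain ⟨f1, f2⟩ := H.l2_flux_le_dissipation hL
  have small : ∀ {t : ℝ}, 0 ≤ t → t ^ 2 ≤ K ^ 3 * d → √L * (K ^ 3 * t) ≤ 1 := by
    intro t ht h
    have : (√L * (K ^ 3 * t)) ^ 2 ≤ 1 ^ 2 := by
      calc (√L * (K ^ 3 * t)) ^ 2 = √L ^ 2 * K ^ 6 * t ^ 2 := by ring
        _ ≤ (√L + 1) ^ 2 * K ^ 6 * (K ^ 3 * d) := by gcongr; linarith
        _ = ((√L + 1) ^ 2 * K ^ 9) * d := by ring
        _ = 1 ^ 2 := by rw [hd, mul_inv_cancel₀ (by positivity)]; ring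
    exact le_of_sq_le_sq this zero_le_one
  have i3 : ∀ x, |(a x)⁻¹ ^ 3| ≤ K ^ 3 := fun x => by
    have := inv_pos.2 (h0 x)
    rw [abs_of_pos (by positivity)]
    exact pow_le_pow_left₀ this.le (inv_le_of_inv_le₀ hK0 (H.inv_le x)) 3
  have near : NearStationary L X₀ X₁ m₁ a c := by
    refine ⟨ha, hc, h0, h1, h2, h3, ?_, ?_⟩
    · refine (integral_abs_le hL.le k2).trans ?_
      have n0 : 0 ≤ l2 L (deriv (pot a c)) := l2_nonneg
      refine le_trans ?_ (small n0 ?_)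
      · refine mul_le_mul_of_nonneg_left ?_ hs
        exact le_mul_of_one_le_left n0 (one_le_pow₀ hK1)
      · refine f2.trans (mul_le_mul ?_ hD (H.dissipation_nonneg hL) (by positivity))
        exact le_self_pow₀ hK1 (by norm_num)
    · refine (integral_abs_le hL.le (by fun_prop)).trans ?_
      refine le_trans ?_ (small (l2_nonneg (L := L) (u := flux a c)) ?_)
      · refine mul_le_mul_of_nonneg_left ?_ hs
        have := l2_mul_le hL.le (u := fun x => (a x)⁻¹ ^ 3) (by fun_prop) k1 i3
        simpa only [mul_comm] using this
      · exact f1.trans (by gcongr)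
  refine ⟨he a c near, ?_⟩
  obtain ⟨r, hr⟩ := H.scaled
  have p1 := hpow r a c hr
  have p2 := hr.l2_third_le.1
  have p3 := sq_l2_deriv_le hL.le ha.deriv
  have p4 := H.l2_a
  have r1 : r ^ 4 ≤ r ^ 8 := pow_le_pow_right₀ hr.one_le (by norm_num)
  have n1 : 0 ≤ l2 L (deriv (deriv (deriv a))) := l2_nonneg
  have p5 : r ^ 8 ≤ 2 * C := by
    refine p1.trans ?_
    have : 1 + dissipation L a c ≤ 2 := by linarith
    nlinarith
  calc l2 L (deriv (deriv a)) ^ 2 ≤ K * l2 L (deriv (deriv (deriv a))) :=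
        p3.trans (mul_le_mul_of_nonneg_right p4 n1)
    _ ≤ K * (2 * C) := by gcongr; linarith

/-! ## Linear combinations depending on their coefficients -/

/-- The combination of the first `n + 1` functions with coefficients `ξ`. -/
def vec (f : ℕ → ℝ → ℝ) (n : ℕ) (ξ : Fin (n + 1) → ℝ) (x : ℝ) : ℝ := ∑ i, ξ i * f i x

/-- The coefficients of a Galerkin approximation. -/
abbrev State (n : ℕ) : Type := (Fin (n + 1) → ℝ) × (Fin (n + 1) → ℝ)

lemma galerkinSum_eq_vec (φ : ℕ → ℝ → ℝ) (n : ℕ) (η : ℕ → ℝ → ℝ) (t : ℝ) :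
    galerkinSum φ n η t = vec φ n (fun i => η i t) := by
  ext x
  rw [galerkinSum, vec, Finset.sum_range]

/-- Coefficients indexed by all natural numbers, extended by zero. -/
def extend {n : ℕ} (ξ : Fin (n + 1) → ℝ) (i : ℕ) : ℝ := if h : i < n + 1 then ξ ⟨i, h⟩ else 0

lemma extend_val {n : ℕ} (ξ : Fin (n + 1) → ℝ) (i : Fin (n + 1)) : extend ξ i = ξ i := by
  simp [extend, Nat.lt_succ_iff.1 i.2]

lemma vec_eq_sum (f : ℕ → ℝ → ℝ) (n : ℕ) (ξ : Fin (n + 1) → ℝ) :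
    vec f n ξ = fun x => ∑ i ∈ Finset.range (n + 1), extend ξ i * f i x := by
  ext x
  rw [vec, Finset.sum_range]
  simp_rw [extend_val]

lemma vec_mem (φ : ℕ → ℝ → ℝ) (n : ℕ) (ξ : Fin (n + 1) → ℝ) : vec φ n ξ ∈ galerkinSpace φ n := by
  rw [vec_eq_sum]; exact sum_mem_galerkinSpace φ n _

lemma contDiff_vec {f : ℕ → ℝ → ℝ} (hf : ∀ i, ContDiff ℝ (⊤ : ℕ∞) (f i)) (n : ℕ) :
    ContDiff ℝ 1 fun p : (Fin (n + 1) → ℝ) × ℝ => vec f n p.1 p.2 := by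
  unfold vec
  refine ContDiff.sum fun i _ => ?_
  have h1 : ContDiff ℝ 1 (f i) := (hf i).of_le (by exact_mod_cast le_top)
  have h2 : ContDiff ℝ 1 fun p : (Fin (n + 1) → ℝ) × ℝ => p.1 i := by fun_prop
  exact h2.mul (h1.comp contDiff_snd)

lemma contDiff_vec_fst {f : ℕ → ℝ → ℝ} (hf : ∀ i, ContDiff ℝ (⊤ : ℕ∞) (f i)) (n : ℕ) :
    ContDiff ℝ 1 fun p : State n × ℝ => vec f n p.1.1 p.2 :=
  (contDiff_vec hf n).comp (f := fun p : State n × ℝ => (p.1.1, p.2)) (by fun_prop)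

lemma contDiff_vec_snd {f : ℕ → ℝ → ℝ} (hf : ∀ i, ContDiff ℝ (⊤ : ℕ∞) (f i)) (n : ℕ) :
    ContDiff ℝ 1 fun p : State n × ℝ => vec f n p.1.2 p.2 :=
  (contDiff_vec hf n).comp (f := fun p : State n × ℝ => (p.1.2, p.2)) (by fun_prop)

lemma hasDerivAt_vec (f : ℕ → ℝ → ℝ) (n : ℕ) {ξ : ℝ → Fin (n + 1) → ℝ} {ξ' : Fin (n + 1) → ℝ}
    {t : ℝ} (h : HasDerivAt ξ ξ' t) (x : ℝ) :
    HasDerivAt (fun s => vec f n (ξ s) x) (vec f n ξ' x) t :=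
  HasDerivAt.fun_sum fun i _ => ((hasDerivAt_pi.1 h) i).mul_const _

lemma deriv_vec {f : ℕ → ℝ → ℝ} (hf : ∀ i, ContDiff ℝ (⊤ : ℕ∞) (f i)) (n : ℕ)
    (ξ : Fin (n + 1) → ℝ) : deriv (vec f n ξ) = vec (fun i => deriv (f i)) n ξ :=
  funext fun x => (HasDerivAt.fun_sum fun (i : Fin (n + 1)) _ =>
    (((hf i).differentiable (by simp)) x).hasDerivAt.const_mul (ξ i)).deriv

section Functionals

variable {L ε κ A : ℝ} {φ : ℕ → ℝ → ℝ} {g : ℝ → ℝ} {n : ℕ}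

lemma IsLaplaceEigenbasis.smooth_vec (hφ : IsLaplaceEigenbasis L φ) (ξ : Fin (n + 1) → ℝ) :
    SmoothPeriodic L (vec φ n ξ) := by
  rw [vec_eq_sum]; exact hφ.smoothPeriodic_sum _ _

lemma contDiff_deriv_basis (hφ : ∀ i, ContDiff ℝ (⊤ : ℕ∞) (φ i)) (i : ℕ) :
    ContDiff ℝ (⊤ : ℕ∞) (deriv (φ i)) :=
  ((contDiff_succ_iff_deriv (n := ((⊤ : ℕ∞) : WithTop ℕ∞))).1 (hφ i)).2.2

/-- The energy of a Galerkin approximation. -/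
noncomputable def galerkinEnergy (L : ℝ) (φ : ℕ → ℝ → ℝ) (g : ℝ → ℝ) (n : ℕ) (z : State n) : ℝ :=
  ∫ x in (0 : ℝ)..L, energyF (g (vec φ n z.1 x)) (vec (fun i => deriv (φ i)) n z.1 x)
    (vec φ n z.2 x) (vec (fun i => deriv (φ i)) n z.2 x)

/-- The weights of the correction to the energy. -/
noncomputable def weight (L : ℝ) (φ : ℕ → ℝ → ℝ) (κ : ℝ) (i : ℕ) : ℝ :=
  eigval L φ i ^ 2 / (κ ^ 2 + eigval L φ i)

lemma weight_nonneg (i : ℕ) : 0 ≤ weight L φ κ i := by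
  have := eigval_nonneg (L := L) (φ := φ) i
  unfold weight
  positivity

/-- The Lyapunov functional. -/
noncomputable def lyapunov (L : ℝ) (φ : ℕ → ℝ → ℝ) (g : ℝ → ℝ) (κ A : ℝ) (n : ℕ)
    (z : State n) : ℝ :=
  galerkinEnergy L φ g n z + A * (1 / 2 * ∑ i : Fin (n + 1), weight L φ κ i * z.1 i ^ 2)

lemma IsRegularization.contDiff_one (hg : IsRegularization ε g) : ContDiff ℝ 1 g :=
  hg.contDiff.of_le (by norm_num)

lemma contDiff_galerkinEnergy (hφ : IsLaplaceEigenbasis L φ) (hg : IsRegularization ε g)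
    (hε : 0 < ε) : ContDiff ℝ 1 (galerkinEnergy L φ g n) := by
  refine contDiff_integral (Φ := fun (z : State n) x => energyF (g (vec φ n z.1 x))
    (vec (fun i => deriv (φ i)) n z.1 x) (vec φ n z.2 x) (vec (fun i => deriv (φ i)) n z.2 x)) ?_ L
  exact contDiff_energyF (fun _ => (hg.pos_all hε _).ne')
    (hg.contDiff_one.comp (contDiff_vec_fst hφ.smooth n))
    (contDiff_vec_fst (contDiff_deriv_basis hφ.smooth) n) (contDiff_vec_snd hφ.smooth n)
    (contDiff_vec_snd (contDiff_deriv_basis hφ.smooth) n)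

lemma continuous_lyapunov (hφ : IsLaplaceEigenbasis L φ) (hg : IsRegularization ε g)
    (hε : 0 < ε) : Continuous (lyapunov L φ g κ A n) := by
  have := (contDiff_galerkinEnergy (n := n) hφ hg hε).continuous
  unfold lyapunov
  fun_prop

/-- The weighted moments of the concentration. -/
noncomputable def moment (L : ℝ) (φ : ℕ → ℝ → ℝ) (g : ℝ → ℝ) (n : ℕ) (ψ : ℝ → ℝ) (z : State n) : ℝ :=
  ∫ x in (0 : ℝ)..L, g (vec φ n z.1 x) * vec φ n z.2 x * ψ x

lemma contDiff_moment_aux (hφ : IsLaplaceEigenbasis L φ) (hg : IsRegularization ε g) {ψ : ℝ → ℝ}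
    (hψ : SmoothPeriodic L ψ) : ContDiff ℝ 1 fun p : State n × ℝ =>
      g (vec φ n p.1.1 p.2) * vec φ n p.1.2 p.2 * ψ p.2 := by
  have h1 : ContDiff ℝ 1 ψ := hψ.smooth.of_le (by exact_mod_cast le_top)
  exact ((hg.contDiff_one.comp (contDiff_vec_fst hφ.smooth n)).mul
    (contDiff_vec_snd hφ.smooth n)).mul (h1.comp contDiff_snd)

lemma contDiff_moment (hφ : IsLaplaceEigenbasis L φ) (hg : IsRegularization ε g) {ψ : ℝ → ℝ}
    (hψ : SmoothPeriodic L ψ) : ContDiff ℝ 1 (moment L φ g n ψ) :=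
  contDiff_integral (Φ := fun (z : State n) x => g (vec φ n z.1 x) * vec φ n z.2 x * ψ x)
    (contDiff_moment_aux hφ hg hψ) L

lemma contDiff_mass_aux (hφ : IsLaplaceEigenbasis L φ) {ψ : ℝ → ℝ}
    (hψ : SmoothPeriodic L ψ) :
    ContDiff ℝ 1 fun p : State n × ℝ => vec φ n p.1.1 p.2 * ψ p.2 := by
  have h1 : ContDiff ℝ 1 ψ := hψ.smooth.of_le (by exact_mod_cast le_top)
  exact (contDiff_vec_fst hφ.smooth n).mul (h1.comp contDiff_snd)

/-- The moments of the height. -/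
noncomputable def mass (L : ℝ) (φ : ℕ → ℝ → ℝ) (n : ℕ) (ψ : ℝ → ℝ) (z : State n) : ℝ :=
  ∫ x in (0 : ℝ)..L, vec φ n z.1 x * ψ x

lemma contDiff_mass (hφ : IsLaplaceEigenbasis L φ) {ψ : ℝ → ℝ} (hψ : SmoothPeriodic L ψ) :
    ContDiff ℝ 1 (mass L φ n ψ) :=
  contDiff_integral (Φ := fun (z : State n) x => vec φ n z.1 x * ψ x)
    (contDiff_mass_aux hφ hψ) L

variable {x : ℝ → State n} {x' : State n} {t : ℝ}

lemma hasDerivAt_mass (hφ : IsLaplaceEigenbasis L φ) {ψ : ℝ → ℝ} (hψ : SmoothPeriodic L ψ)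
    (hx : HasDerivAt x x' t) :
    HasDerivAt (fun s => mass L φ n ψ (x s)) (∫ y in (0 : ℝ)..L, vec φ n x'.1 y * ψ y) t :=
  hasDerivAt_integral (Φ := fun (z : State n) x => vec φ n z.1 x * ψ x)
    (contDiff_mass_aux hφ hψ) L hx fun y => (hasDerivAt_vec φ n hx.fst y).mul_const _

lemma hasDerivAt_moment (hφ : IsLaplaceEigenbasis L φ) (hg : IsRegularization ε g) {ψ : ℝ → ℝ}
    (hψ : SmoothPeriodic L ψ) (hx : HasDerivAt x x' t) (h0 : ∀ y, 0 < vec φ n (x t).1 y) :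
    HasDerivAt (fun s => moment L φ g n ψ (x s))
      (∫ y in (0 : ℝ)..L, (vec φ n (x t).2 y * vec φ n x'.1 y
        + (vec φ n (x t).1 y + ε) * vec φ n x'.2 y) * ψ y) t := by
  refine hasDerivAt_integral (Φ := fun (z : State n) x => g (vec φ n z.1 x) * vec φ n z.2 x * ψ x)
    (contDiff_moment_aux hφ hg hψ) L hx fun y => ?_
  have h1 := (hg.hasDerivAt (h0 y)).comp t (hasDerivAt_vec φ n hx.fst y)
  refine ((h1.fun_mul (hasDerivAt_vec φ n hx.snd y)).mul_const (ψ y)).congr_deriv ?_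
  simp only [Function.comp]
  rw [hg.eq_add _ (h0 y).le]
  ring

lemma galerkinEnergy_eq (hφ : IsLaplaceEigenbasis L φ) (hg : IsRegularization ε g) {z : State n}
    (h0 : ∀ y, 0 < vec φ n z.1 y) :
    galerkinEnergy L φ g n z = energy L (fun y => vec φ n z.1 y + ε) (vec φ n z.2) := by
  rw [galerkinEnergy, energy_eq_energyF, deriv_shift, deriv_vec hφ.smooth, deriv_vec hφ.smooth]
  simp_rw [hg.eq_add _ (h0 _).le]

lemma hasDerivAt_galerkinEnergy (hφ : IsLaplaceEigenbasis L φ) (hg : IsRegularization ε g)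
    (hε : 0 < ε) (hx : HasDerivAt x x' t) (h0 : ∀ y, 0 < vec φ n (x t).1 y) :
    HasDerivAt (fun s => galerkinEnergy L φ g n (x s))
      (energyRate L (fun y => vec φ n (x t).1 y + ε) (vec φ n (x t).2) (vec φ n x'.1)
        (vec φ n x'.2)) t := by
  have ha : SmoothPeriodic L fun y => vec φ n (x t).1 y + ε :=
    (hφ.smooth_vec _).add (SmoothPeriodic.const L ε)
  rw [← integral_eq_energyRate ha (hφ.smooth_vec _) (hφ.smooth_vec _) (hφ.smooth_vec _)
    fun y => by have := h0 y; positivity]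
  rw [deriv_shift, deriv_vec hφ.smooth, deriv_vec hφ.smooth, deriv_vec hφ.smooth,
    deriv_vec hφ.smooth]
  refine hasDerivAt_integral (Φ := fun (z : State n) x => energyF (g (vec φ n z.1 x))
    (vec (fun i => deriv (φ i)) n z.1 x) (vec φ n z.2 x) (vec (fun i => deriv (φ i)) n z.2 x)) ?_ L
    hx fun y => ?_
  · exact contDiff_energyF (fun _ => (hg.pos_all hε _).ne')
      (hg.contDiff_one.comp (contDiff_vec_fst hφ.smooth n))
      (contDiff_vec_fst (contDiff_deriv_basis hφ.smooth) n) (contDiff_vec_snd hφ.smooth n)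
      (contDiff_vec_snd (contDiff_deriv_basis hφ.smooth) n)
  · have h1 : HasDerivAt (fun s => g (vec φ n (x s).1 y)) (1 * vec φ n x'.1 y) t :=
      (hg.hasDerivAt (h0 y)).comp t (hasDerivAt_vec φ n hx.fst y)
    have h2 := hasDerivAt_energyF (a := fun s => g (vec φ n (x s).1 y)) (hg.pos_all hε _).ne' h1
      (hasDerivAt_vec (fun i => deriv (φ i)) n hx.fst y)
      (hasDerivAt_vec φ n hx.snd y) (hasDerivAt_vec (fun i => deriv (φ i)) n hx.snd y)
    simp only [one_mul] at h2
    rw [hg.eq_add _ (h0 y).le] at h2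
    exact h2

lemma galerkinEnergy_le_lyapunov (hA : 0 ≤ A) (z : State n) :
    galerkinEnergy L φ g n z ≤ lyapunov L φ g κ A n z := by
  unfold lyapunov
  have : 0 ≤ ∑ i : Fin (n + 1), weight L φ κ i * z.1 i ^ 2 :=
    Finset.sum_nonneg fun i _ => mul_nonneg (weight_nonneg _) (sq_nonneg _)
  have := mul_nonneg hA (mul_nonneg (by norm_num : (0 : ℝ) ≤ 1 / 2) this)
  linarith

/-- The high frequency part of the third derivative of the height. -/
noncomputable def highPart (L : ℝ) (φ : ℕ → ℝ → ℝ) (κ : ℝ) (n : ℕ) (ξ : Fin (n + 1) → ℝ) (y : ℝ) : ℝ :=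
  ∑ i ∈ Finset.range (n + 1), (-(eigval L φ i ^ 2 / (κ ^ 2 + eigval L φ i) * extend ξ i))
    * deriv (φ i) y

lemma exists_frequencySplit (hL : 0 < L) (hφ : IsLaplaceEigenbasis L φ) (hκ : 0 < κ)
    (ξ : Fin (n + 1) → ℝ) (ε : ℝ) :
    ∃ v, FrequencySplit L κ (fun y => vec φ n ξ y + ε) v (highPart L φ κ n ξ) := by
  rw [vec_eq_sum]
  exact ⟨_, hφ.frequencySplit hL hκ (Finset.range (n + 1)) (extend ξ) ε⟩

lemma coeff_vec (hφ : IsLaplaceEigenbasis L φ) (ξ : Fin (n + 1) → ℝ) (i : Fin (n + 1)) :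
    ∫ y in (0 : ℝ)..L, vec φ n ξ y * φ i y = ξ i := by
  have := hφ.coeff_sum (Finset.range (n + 1)) (extend ξ) i
  rw [if_pos (Finset.mem_range.2 i.2), extend_val] at this
  rw [vec_eq_sum]
  exact this

/-- The weights are chosen for this: testing the height equation with `φ i` gives the derivative of
the `i`-th coefficient, and the coefficients of the high frequency part are those of the height
times minus the weights. Thus the correction has derivative `-A ∫ J s`. -/
lemma hasDerivAt_lyapunov (hφ : IsLaplaceEigenbasis L φ)
    (hg : IsRegularization ε g) (hε : 0 < ε) (hx : HasDerivAt x x' t)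
    (h0 : ∀ y, 0 < vec φ n (x t).1 y)
    (hvel : IsVelocity L (galerkinSpace φ n) (fun y => vec φ n (x t).1 y + ε) (vec φ n (x t).2)
      (vec φ n x'.1) (vec φ n x'.2)) :
    HasDerivAt (fun s => lyapunov L φ g κ A n (x s))
      (energyRate L (fun y => vec φ n (x t).1 y + ε) (vec φ n (x t).2) (vec φ n x'.1)
        (vec φ n x'.2) - A * ∫ y in (0 : ℝ)..L,
          flux (fun y => vec φ n (x t).1 y + ε) (vec φ n (x t).2) y
            * highPart L φ κ n (x t).1 y) t := by
  have h1 := hasDerivAt_galerkinEnergy hφ hg hε hx h0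
  have h2 : HasDerivAt (fun s => ∑ i : Fin (n + 1), weight L φ κ i * (x s).1 i ^ 2)
      (∑ i : Fin (n + 1), weight L φ κ i * (2 * (x t).1 i * x'.1 i)) t := by
    refine HasDerivAt.fun_sum fun i _ => ?_
    have := ((hasDerivAt_pi.1 hx.fst i).fun_pow 2).const_mul (weight L φ κ i)
    refine this.congr_deriv ?_
    push_cast
    ring
  have h3 := h1.fun_add ((h2.const_mul (1 / 2)).const_mul A)
  refine h3.congr_deriv ?_
  rw [sub_eq_add_neg, ← mul_neg]
  congr 2
  have hs : ∀ y, 0 < vec φ n (x t).1 y + ε := fun y => by have := h0 y; positivity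
  have cf := (smoothPeriodic_flux ((hφ.smooth_vec (x t).1).add (SmoothPeriodic.const L ε))
    (hφ.smooth_vec (x t).2) hs).continuous
  unfold highPart
  simp_rw [Finset.mul_sum]
  rw [intervalIntegral.integral_finsetSum]
  · rw [Finset.sum_range, ← Finset.sum_neg_distrib]
    refine Finset.sum_congr rfl fun i _ => ?_
    have e1 := hvel.eq_a (φ i) (basis_mem_galerkinSpace φ (Nat.lt_succ_iff.1 i.2))
    rw [coeff_vec hφ] at e1
    rw [e1, extend_val, weight, ← intervalIntegral.integral_neg]
    simp_rw [← intervalIntegral.integral_const_mul]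
    congr 1; ext y; ring
  · intro i _
    have := (hφ.smoothPeriodic i).deriv.continuous
    exact Continuous.intervalIntegrable (by fun_prop) _ _

end Functionals


/-! ## Confinement of Galerkin flows -/

/-- A curve of Galerkin coefficients that satisfies the Galerkin equations as long as the height is
positive and the bounds with constant `K` hold. -/
structure IsConditionalFlow (L ε K : ℝ) (φ : ℕ → ℝ → ℝ) (n : ℕ) (T : ℝ) (x : ℝ → State n) :
    Prop where
  cont : ContinuousOn x (Icc 0 T)
  vel : ∀ t ∈ Ioo 0 T, (∀ y, 0 < vec φ n (x t).1 y) →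
    Bounds L K (fun y => vec φ n (x t).1 y + ε) (vec φ n (x t).2) →
    ∃ x' : State n, HasDerivAt x x' t ∧
      IsVelocity L (galerkinSpace φ n) (fun y => vec φ n (x t).1 y + ε) (vec φ n (x t).2)
        (vec φ n x'.1) (vec φ n x'.2)

/-- The level `e` of the Lyapunov functional cannot be crossed by flows with the given masses. -/
structure EnergyBarrier (L κ A K e m X₀ X₁ m₁ : ℝ) (φ : ℕ → ℝ → ℝ) (n : ℕ) : Prop where
  nonneg : 0 ≤ A
  -- The margins of one make the bounds hold in a neighbourhood of any confined state, where the
  -- equations must be available before confinement is known.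
  bounds : ∀ a c : ℝ → ℝ, SmoothPeriodic L a → SmoothPeriodic L c → (∀ y, 0 < a y) →
    ∫ y in (0 : ℝ)..L, a y ≤ X₁ + 1 → energy L a c ≤ e + 1 → Bounds L K a c
  lower : ∀ a c : ℝ → ℝ, SmoothPeriodic L a → SmoothPeriodic L c → (∀ y, 0 < a y) →
    energy L a c ≤ e → ∀ y, m ≤ a y
  -- Not needed for confinement, which uses only the field `barrier`. It provides control of the
  -- dissipation for the continuity in time.
  rate : ∀ (ε : ℝ) (z z' : State n), Bounds L K (fun y => vec φ n z.1 y + ε) (vec φ n z.2) →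
    IsVelocity L (galerkinSpace φ n) (fun y => vec φ n z.1 y + ε) (vec φ n z.2)
      (vec φ n z'.1) (vec φ n z'.2) →
    energyRate L (fun y => vec φ n z.1 y + ε) (vec φ n z.2) (vec φ n z'.1) (vec φ n z'.2)
      - A * ∫ y in (0 : ℝ)..L, flux (fun y => vec φ n z.1 y + ε) (vec φ n z.2) y
        * highPart L φ κ n z.1 y ≤ -(dissipation L (fun y => vec φ n z.1 y + ε) (vec φ n z.2) / 2) + 1
  barrier : ∀ (ε : ℝ) (z z' : State n), Bounds L K (fun y => vec φ n z.1 y + ε) (vec φ n z.2) →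
    IsVelocity L (galerkinSpace φ n) (fun y => vec φ n z.1 y + ε) (vec φ n z.2)
      (vec φ n z'.1) (vec φ n z'.2) →
    X₀ ≤ ∫ y in (0 : ℝ)..L, (vec φ n z.1 y + ε) → ∫ y in (0 : ℝ)..L, (vec φ n z.1 y + ε) ≤ X₁ →
    |∫ y in (0 : ℝ)..L, (vec φ n z.1 y + ε) * vec φ n z.2 y| ≤ m₁ →
    e ≤ energy L (fun y => vec φ n z.1 y + ε) (vec φ n z.2)
      + A * (1 / 2 * ∑ i : Fin (n + 1), weight L φ κ i * z.1 i ^ 2) →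
    energyRate L (fun y => vec φ n z.1 y + ε) (vec φ n z.2) (vec φ n z'.1) (vec φ n z'.2)
      - A * ∫ y in (0 : ℝ)..L, flux (fun y => vec φ n z.1 y + ε) (vec φ n z.2) y
        * highPart L φ κ n z.1 y < 0

/-- Coefficients with height at least `m - ε`, Lyapunov functional at most `e`, and given masses. -/
structure Confined (L ε κ A e m μ₀ μ₁ : ℝ) (φ : ℕ → ℝ → ℝ) (g : ℝ → ℝ) (n : ℕ) (z : State n) :
    Prop where
  height : ∀ y, m ≤ vec φ n z.1 y + ε
  lyap : lyapunov L φ g κ A n z ≤ e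
  mass : mass L φ n (fun _ => 1) z = μ₀
  moment : moment L φ g n (fun _ => 1) z = μ₁

section

variable {L ε κ A K e m X₀ X₁ m₁ μ₀ μ₁ T : ℝ} {φ : ℕ → ℝ → ℝ} {g : ℝ → ℝ} {n : ℕ}
  {x : ℝ → State n}

lemma continuous_vec_fst (φ : ℕ → ℝ → ℝ) (n : ℕ) (y : ℝ) :
    Continuous fun z : State n => vec φ n z.1 y := by
  unfold vec
  fun_prop

lemma isClosed_confined (hφ : IsLaplaceEigenbasis L φ) (hg : IsRegularization ε g) (hε : 0 < ε) :
    IsClosed {z | Confined L ε κ A e m μ₀ μ₁ φ g n z} := by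
  have e1 : {z | Confined L ε κ A e m μ₀ μ₁ φ g n z}
      = (⋂ y, {z | m ≤ vec φ n z.1 y + ε}) ∩ ({z | lyapunov L φ g κ A n z ≤ e} ∩
        ({z | ThinFilm.mass L φ n (fun _ => 1) z = μ₀}
          ∩ {z | ThinFilm.moment L φ g n (fun _ => 1) z = μ₁})) := by
    ext z
    simp only [mem_inter_iff, mem_iInter, mem_ofPred_eq]
    exact ⟨fun h => ⟨h.1, h.2, h.3, h.4⟩, fun h => ⟨h.1, h.2.1, h.2.2.1, h.2.2.2⟩⟩
  rw [e1]
  refine (isClosed_iInter fun y => ?_).inter ((isClosed_le ?_ ?_).inter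
    ((isClosed_eq ?_ ?_).inter (isClosed_eq ?_ ?_)))
  · exact isClosed_le continuous_const ((continuous_vec_fst φ n y).add continuous_const)
  · exact continuous_lyapunov hφ hg hε
  · exact continuous_const
  · exact (contDiff_mass hφ (SmoothPeriodic.const L 1)).continuous
  · exact continuous_const
  · exact (contDiff_moment hφ hg (SmoothPeriodic.const L 1)).continuous
  · exact continuous_const

lemma eventually_pos (hL : 0 < L) (hφ : IsLaplaceEigenbasis L φ) {z : State n}
    (h0 : ∀ y, 0 < vec φ n z.1 y) : ∀ᶠ w in 𝓝 z, ∀ y, 0 < vec φ n w.1 y := by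
  have h1 : ∀ᶠ w in 𝓝 z, ∀ y ∈ Icc 0 L, 0 < vec φ n w.1 y := by
    refine isCompact_Icc.eventually_forall_of_forall_eventually fun y _ => ?_
    exact (contDiff_vec_fst hφ.smooth n).continuous.continuousAt.eventually (lt_mem_nhds (h0 y))
  filter_upwards [h1] with w hw
  exact periodic_bound_of_Icc hL (hφ.smooth_vec w.1).periodic (P := fun s => 0 < s) hw

lemma integral_add_const (hφ : IsLaplaceEigenbasis L φ) (z : State n) :
    ∫ y in (0 : ℝ)..L, (vec φ n z.1 y + ε) = mass L φ n (fun _ => 1) z + ε * L := by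
  rw [integral_add_of_continuous (hφ.smooth_vec z.1).continuous continuous_const, mass]
  simp [mul_comm]

lemma moment_eq (hg : IsRegularization ε g) (ψ : ℝ → ℝ) {z : State n}
    (h0 : ∀ y, 0 < vec φ n z.1 y) :
    moment L φ g n ψ z = ∫ y in (0 : ℝ)..L, (vec φ n z.1 y + ε) * vec φ n z.2 y * ψ y := by
  rw [moment]
  simp_rw [hg.eq_add _ (h0 _).le]

lemma EnergyBarrier.bounds_of_lt (hB : EnergyBarrier L κ A K e m X₀ X₁ m₁ φ n)
    (hφ : IsLaplaceEigenbasis L φ) (hg : IsRegularization ε g) (hε : 0 < ε) {z : State n}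
    (h0 : ∀ y, 0 < vec φ n z.1 y) (hE : lyapunov L φ g κ A n z < e + 1)
    (hm : mass L φ n (fun _ => 1) z + ε * L < X₁ + 1) :
    Bounds L K (fun y => vec φ n z.1 y + ε) (vec φ n z.2) := by
  refine hB.bounds _ _ ((hφ.smooth_vec _).add (SmoothPeriodic.const L ε)) (hφ.smooth_vec _)
    (fun y => by have := h0 y; positivity) ?_ ?_
  · rw [integral_add_const hφ]; exact hm.le
  · rw [← galerkinEnergy_eq hφ hg h0]
    exact (galerkinEnergy_le_lyapunov hB.nonneg z).trans hE.le

/-- A function that is continuous on an interval and stationary inside is constant. -/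
lemma eq_of_hasDerivAt_zero {f : ℝ → ℝ} {a b : ℝ} (hab : a < b) (hf : ContinuousOn f (Icc a b))
    (h : ∀ s ∈ Ioo a b, HasDerivAt f 0 s) : f b = f a := by
  obtain ⟨c, hc, h1⟩ := exists_hasDerivAt_eq_slope f (fun _ => 0) hab hf h
  have := sub_pos.2 hab
  rw [eq_comm, div_eq_zero_iff] at h1
  rcases h1 with h1 | h1 <;> linarith

lemma eventually_lt_of_hasDerivAt_neg {f : ℝ → ℝ} {f' t : ℝ} (h : HasDerivAt f f' t)
    (hf : f' < 0) : ∀ᶠ s in 𝓝[>] t, f s < f t := by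
  have h1 := (hasDerivAt_iff_tendsto_slope.1 h).eventually (gt_mem_nhds hf)
  have h2 : ∀ᶠ s in 𝓝[>] t, slope f t s < 0 :=
    h1.filter_mono (nhdsWithin_mono t fun s hs => (ne_of_gt hs : s ≠ t))
  filter_upwards [h2, self_mem_nhdsWithin] with s hs hts
  rw [slope_def_field, div_neg_iff] at hs
  have := sub_pos.2 (show t < s from hts)
  rcases hs with hs | hs <;> linarith

lemma IsVelocity.mass_zero (hφ : IsLaplaceEigenbasis L φ) {a c a' c' : ℝ → ℝ}
    (h : IsVelocity L (galerkinSpace φ n) a c a' c') : ∫ y in (0 : ℝ)..L, a' y * 1 = 0 := by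
  have := h.eq_a _ (hφ.const_mem n 1)
  simpa using this

lemma IsVelocity.moment_zero (hφ : IsLaplaceEigenbasis L φ) {a c a' c' : ℝ → ℝ}
    (h : IsVelocity L (galerkinSpace φ n) a c a' c') :
    ∫ y in (0 : ℝ)..L, (c y * a' y + a y * c' y) * 1 = 0 := by
  have := h.eq_c _ (hφ.const_mem n 1)
  simpa using this

/-- Flows that start below the barrier stay below it. -/
theorem EnergyBarrier.confined (hL : 0 < L) (hφ : IsLaplaceEigenbasis L φ)
    (hg : IsRegularization ε g) (hε : 0 < ε) (hεm : ε < m)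
    (hB : EnergyBarrier L κ A K e m X₀ X₁ m₁ φ n) (hx : IsConditionalFlow L ε K φ n T x)
    (hpos : ∀ y, 0 < vec φ n (x 0).1 y) (hlt : lyapunov L φ g κ A n (x 0) < e)
    (hX₀ : X₀ ≤ mass L φ n (fun _ => 1) (x 0) + ε * L)
    (hX₁ : mass L φ n (fun _ => 1) (x 0) + ε * L ≤ X₁)
    (hm₁ : |moment L φ g n (fun _ => 1) (x 0)| ≤ m₁) :
    ∀ t ∈ Icc 0 T, Confined L ε κ A e m (mass L φ n (fun _ => 1) (x 0))
      (moment L φ g n (fun _ => 1) (x 0)) φ g n (x t) := by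
  set μ₀ := mass L φ n (fun _ => 1) (x 0) with hμ₀
  set μ₁ := moment L φ g n (fun _ => 1) (x 0) with hμ₁
  set C : Set (State n) := {z | Confined L ε κ A e m μ₀ μ₁ φ g n z} with hC
  have s1 := SmoothPeriodic.const L 1
  have cE := continuous_lyapunov (κ := κ) (A := A) (n := n) hφ hg hε
  have cM := (contDiff_mass (n := n) hφ s1).continuous
  have cN := (contDiff_moment (n := n) hφ hg s1).continuous
  have low : ∀ z : State n, (∀ y, 0 < vec φ n z.1 y) → lyapunov L φ g κ A n z ≤ e →
      ∀ y, m ≤ vec φ n z.1 y + ε := fun z h0 hE =>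
    hB.lower _ _ ((hφ.smooth_vec _).add (SmoothPeriodic.const L ε)) (hφ.smooth_vec z.2)
      (fun y => by have := h0 y; positivity) (by
        rw [← galerkinEnergy_eq hφ hg h0]
        exact (galerkinEnergy_le_lyapunov hB.nonneg z).trans hE)
  have hclosed : IsClosed ({t | x t ∈ C} ∩ Icc 0 T) := by
    have := hx.cont.preimage_isClosed_of_isClosed isClosed_Icc
      (isClosed_confined (κ := κ) (A := A) (e := e) (m := m) (μ₀ := μ₀) (μ₁ := μ₁) (n := n) hφ hg hε)
    rwa [inter_comm] at this
  -- Continuous induction: the set of confined times is closed and contains zero, and it remains to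
  -- move a little to the right of each of its points.
  refine fun t ht => hclosed.Icc_subset_of_forall_exists_gt (a := 0) (b := T)
    (show x 0 ∈ C from ⟨low _ hpos hlt.le, hlt.le, rfl, rfl⟩) ?_ ht
  rintro t ⟨htC, ht0, htT⟩ y' hy'
  have hCt : Confined L ε κ A e m μ₀ μ₁ φ g n (x t) := htC
  have hpt : ∀ y, 0 < vec φ n (x t).1 y := fun y => by
    have := hCt.height y
    linarith
  -- At time `t` the height of the confined state is at least `m - ε > 0`, so positivity and the
  -- bounds persist nearby and the equations hold immediately after `t`.
  have hnear : ∀ᶠ z in 𝓝 (x t), (∀ y, 0 < vec φ n z.1 y) ∧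
      Bounds L K (fun y => vec φ n z.1 y + ε) (vec φ n z.2) := by
    have h2 : ∀ᶠ z in 𝓝 (x t), lyapunov L φ g κ A n z < e + 1 :=
      cE.continuousAt.eventually (gt_mem_nhds (by linarith [hCt.lyap]))
    have h3 : ∀ᶠ z in 𝓝 (x t), mass L φ n (fun _ => 1) z + ε * L < X₁ + 1 :=
      (cM.add continuous_const).continuousAt.eventually
        (gt_mem_nhds (by
          change mass L φ n (fun _ => 1) (x t) + ε * L < X₁ + 1
          rw [hCt.mass]; linarith))
    filter_upwards [eventually_pos hL hφ hpt, h2, h3] with z z1 z2 z3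
    exact ⟨z1, hB.bounds_of_lt hφ hg hε z1 z2 z3⟩
  have hcw : Tendsto x (𝓝[>] t) (𝓝 (x t)) := by
    have : ContinuousWithinAt x (Ioc t T) t :=
      (hx.cont t ⟨ht0, htT.le⟩).mono fun s hs => ⟨ht0.trans hs.1.le, hs.2⟩
    rwa [ContinuousWithinAt, nhdsWithin_Ioc_eq_nhdsGT htT] at this
  obtain ⟨t₁, ht₁, hs₁⟩ := (mem_nhdsGT_iff_exists_Ioo_subset).1 (hcw.eventually hnear)
  -- Conservation of mass and of the first moment, by testing with the constant function.
  have hconst : ∀ s ∈ Ioo t (min t₁ T), mass L φ n (fun _ => 1) (x s) = μ₀ ∧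
      moment L φ g n (fun _ => 1) (x s) = μ₁ := by
    rintro s ⟨hts, hsm⟩
    have hsT : s < T := hsm.trans_le (min_le_right _ _)
    have hst₁ : s < t₁ := hsm.trans_le (min_le_left _ _)
    have hcs : ContinuousOn x (Icc t s) := hx.cont.mono (Icc_subset_Icc ht0 hsT.le)
    have hd : ∀ r ∈ Ioo t s, ∃ x' : State n, HasDerivAt x x' r ∧ (∀ y, 0 < vec φ n (x r).1 y) ∧
        IsVelocity L (galerkinSpace φ n) (fun y => vec φ n (x r).1 y + ε) (vec φ n (x r).2)
          (vec φ n x'.1) (vec φ n x'.2) := fun r hr => by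
      obtain ⟨p1, p2⟩ := hs₁ ⟨hr.1, hr.2.trans hst₁⟩
      obtain ⟨x', hx', hv⟩ := hx.vel r ⟨ht0.trans_lt hr.1, hr.2.trans hsT⟩ p1 p2
      exact ⟨x', hx', p1, hv⟩
    rw [← hCt.mass, ← hCt.moment]
    constructor
    · refine eq_of_hasDerivAt_zero (f := fun r => mass L φ n (fun _ => 1) (x r)) hts
        (cM.comp_continuousOn hcs) fun r hr => ?_
      obtain ⟨x', hx', -, hv⟩ := hd r hr
      have := hasDerivAt_mass hφ s1 hx'
      rwa [hv.mass_zero hφ] at this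
    · refine eq_of_hasDerivAt_zero (f := fun r => moment L φ g n (fun _ => 1) (x r)) hts
        (cN.comp_continuousOn hcs) fun r hr => ?_
      obtain ⟨x', hx', p1, hv⟩ := hd r hr
      have := hasDerivAt_moment hφ hg s1 hx' p1
      rwa [hv.moment_zero hφ] at this
  have hlyap : ∀ᶠ s in 𝓝[>] t, lyapunov L φ g κ A n (x s) ≤ e := by
    rcases hCt.lyap.lt_or_eq with h | h
    · exact (hcw.eventually (cE.continuousAt.eventually (gt_mem_nhds h))).mono fun s hs => hs.le
    -- On the level `e` itself. The time is positive because the initial value lies strictly below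
    -- the level, so the equation is available at `t`, and the barrier makes the functional strictly
    -- decrease.
    · have ht0' : 0 < t := by
        rcases ht0.lt_or_eq with h' | h'
        · exact h'
        · rw [← h'] at h; linarith
      obtain ⟨p1, p2⟩ := hnear.self_of_nhds
      obtain ⟨x', hx', hv⟩ := hx.vel t ⟨ht0', htT⟩ p1 p2
      have hd := hasDerivAt_lyapunov (κ := κ) (A := A) hφ hg hε hx' p1 hv
      have hneg := hB.barrier ε (x t) x' p2 hv
        (by rw [integral_add_const hφ, hCt.mass]; exact hX₀)
        (by rw [integral_add_const hφ, hCt.mass]; exact hX₁)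
        (by
          have := moment_eq (L := L) hg (fun _ => 1) p1
          simp only [mul_one] at this
          rw [← this, hCt.moment]; exact hm₁)
        (by rw [← galerkinEnergy_eq hφ hg p1]; exact h.ge)
      filter_upwards [eventually_lt_of_hasDerivAt_neg hd hneg] with s hs
      rw [← h]; exact hs.le
  have hev : ∀ᶠ s in 𝓝[>] t, s ∈ {t | x t ∈ C} ∩ Ioc t y' := by
    filter_upwards [hlyap, hcw.eventually hnear, Ioo_mem_nhdsGT (lt_min ht₁ htT),
      Ioo_mem_nhdsGT (show t < y' from hy')] with s q1 q2 q3 q4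
    exact ⟨⟨low _ q2.1 q1, q1, (hconst s q3).1, (hconst s q3).2⟩, q4.1, q4.2.le⟩
  exact hev.exists

end


/-! ## Existence of barriers, and the initial data -/

/-- The map `D ↦ D / (1 + D)` increases, so above the threshold `d` the error `δ (1 + D)` is at most
`D / 2`. -/
lemma rate_neg {d D δ r : ℝ} (hd : 0 < d) (hD : d < D) (hδ : δ ≤ d / (2 * (1 + d)))
    (hr : r ≤ -D + δ * (1 + D)) : r < 0 := by
  have h1 : δ * (1 + D) ≤ d / (2 * (1 + d)) * (1 + D) := by gcongr; linarith
  have h2 : d / (2 * (1 + d)) * (1 + D) ≤ D / 2 := by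
    rw [div_mul_eq_mul_div, div_le_div_iff₀ (by positivity) two_pos]
    nlinarith
  linarith

/-- The constants are chosen without circularity in this order: the energy bound for nearly
stationary states, the level `e` above it, the bounds `K` and `m` for energies of that size, the
threshold `d` for the dissipation, the tolerance `δ`, the weight `A`, the frequency `k`, and finally
the spectral gap and with it `n₀`. Only `n₀` depends on the basis. -/
theorem exists_energyBarrier {L X₀ : ℝ} (hL : 0 < L) (hX₀ : 0 < X₀) (X₁ m₁ e₀ : ℝ) :
    ∃ e m K A : ℝ, e₀ + 2 ≤ e ∧ 0 < e ∧ 0 < m ∧ 2 ≤ K ∧ 0 ≤ A ∧ ∃ k₀ : ℝ, 1 ≤ k₀ ∧ ∀ k ≥ k₀,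
      ∀ φ : ℕ → ℝ → ℝ, IsLaplaceEigenbasis L φ → ∃ n₀ : ℕ, ∀ n ≥ n₀,
        EnergyBarrier L (k ^ 2) A K e m X₀ X₁ m₁ φ n := by
  obtain ⟨eS, hS⟩ := exists_energy_le_of_dissipation_le hL hX₀ X₁ m₁
  set e := |e₀| + |eS| + 3 with he
  have he0 : 0 < e := by positivity
  obtain ⟨K, hK, hbounds⟩ := exists_bounds_of_energy_le hL (by linarith : 0 < e + 1) (X₁ + 1)
  obtain ⟨m, hm, hlower⟩ := exists_pos_le_of_energy_le hL he0
  obtain ⟨C, d, hC, hd, hlow⟩ := hS K hK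
  set δ := min (1 / 2) (d / (2 * (1 + d))) with hδ
  have hδ0 : 0 < δ := lt_min (by norm_num) (by positivity)
  obtain ⟨A, hA, k₀, hk₀, hineq⟩ := energy_inequality hL hK hδ0
  -- The second entry of the maximum makes the correction at most one on states of small
  -- dissipation, where `‖a_xx‖² ≤ C`.
  refine ⟨e, m, K, A, ?_, he0, hm, hK, hA, max k₀ (1 + A * C), hk₀.trans (le_max_left _ _), ?_⟩
  · have := le_abs_self e₀
    have := abs_nonneg eS
    linarith
  intro k hk φ hφ
  have hk1 : 1 ≤ k := hk₀.trans ((le_max_left _ _).trans hk)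
  have hk2 : 1 + A * C ≤ k := (le_max_right _ _).trans hk
  obtain ⟨l, hl1, hl⟩ := hineq k ((le_max_left _ _).trans hk)
  obtain ⟨n₀, hn₀⟩ := hφ.exists_forall_le_eigval hL ((l ^ 2) ^ 2)
  have hκ : 0 < k ^ 2 := by positivity
  refine ⟨n₀, fun n hn => ?_⟩
  have hV : IsGalerkinSpace L (l ^ 2) (galerkinSpace φ n) :=
    hφ.isGalerkinSpace hL fun i hi => hn₀ i (lt_of_le_of_lt hn hi)
  have main : ∀ (ε : ℝ) (z z' : State n),
      Bounds L K (fun y => vec φ n z.1 y + ε) (vec φ n z.2) →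
      IsVelocity L (galerkinSpace φ n) (fun y => vec φ n z.1 y + ε) (vec φ n z.2)
        (vec φ n z'.1) (vec φ n z'.2) →
      energyRate L (fun y => vec φ n z.1 y + ε) (vec φ n z.2) (vec φ n z'.1) (vec φ n z'.2)
        - A * ∫ y in (0 : ℝ)..L, flux (fun y => vec φ n z.1 y + ε) (vec φ n z.2) y
        * highPart L φ (k ^ 2) n z.1 y ≤ -dissipation L (fun y => vec φ n z.1 y + ε) (vec φ n z.2)
          + δ * (1 + dissipation L (fun y => vec φ n z.1 y + ε) (vec φ n z.2)) := by
    intro ε z z' H hv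
    obtain ⟨v, hS⟩ := exists_frequencySplit hL hφ hκ z.1 ε
    exact hl l le_rfl _ _ _ _ _ v _ hV H (vec_mem φ n z.2) hS hv
  refine ⟨hA, hbounds, hlower, fun ε z z' H hv => ?_, fun ε z z' H hv q1 q2 q3 q4 => ?_⟩
  · have h1 := main ε z z' H hv
    have h2 := H.dissipation_nonneg hL
    set D := dissipation L (fun y => vec φ n z.1 y + ε) (vec φ n z.2)
    have h3 : δ * (1 + D) ≤ 1 / 2 * (1 + D) := by
      have := min_le_left (1 / 2) (d / (2 * (1 + d)))
      gcongr
    linarith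
  · have h1 := main ε z z' H hv
    by_cases hD : dissipation L (fun y => vec φ n z.1 y + ε) (vec φ n z.2) ≤ d
    -- Small dissipation cannot occur on or above the level: the energy would be at most `eS` and
    -- the correction at most one, whereas the level exceeds their sum.
    · exfalso
      obtain ⟨g1, g2⟩ := hlow _ _ H q1 q2 q3 hD
      have g3 := hφ.correction_le hL hκ (Finset.range (n + 1)) (extend z.1)
      rw [← vec_eq_sum, Finset.sum_range] at g3
      rw [deriv_shift] at g2
      simp_rw [extend_val] at g3
      have g4 : A * (1 / 2 * ∑ i : Fin (n + 1), weight L φ (k ^ 2) i * z.1 i ^ 2) ≤ 1 := by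
        have g5 : ∑ i : Fin (n + 1), weight L φ (k ^ 2) i * z.1 i ^ 2 ≤ (k ^ 2)⁻¹ ^ 2 * C :=
          g3.trans (by gcongr)
        have g6 : A * C ≤ (k ^ 2) ^ 2 := by
          have : k ≤ (k ^ 2) ^ 2 := by rw [← pow_mul]; exact le_self_pow₀ hk1 (by norm_num)
          linarith
        have g7 : (k ^ 2)⁻¹ ^ 2 * (A * C) ≤ 1 := by
          rw [inv_pow, inv_mul_le_iff₀ (by positivity)]
          linarith
        have g8 : 0 ≤ (k ^ 2)⁻¹ ^ 2 * (A * C) := by positivity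
        calc A * (1 / 2 * ∑ i : Fin (n + 1), weight L φ (k ^ 2) i * z.1 i ^ 2)
            ≤ A * (1 / 2 * ((k ^ 2)⁻¹ ^ 2 * C)) := by gcongr
          _ = 1 / 2 * ((k ^ 2)⁻¹ ^ 2 * (A * C)) := by ring
          _ ≤ 1 := by linarith
      have := le_abs_self eS
      have := abs_nonneg e₀
      linarith
    · exact rate_neg hd (not_le.1 hD) (min_le_right _ _) h1

/-! ### The projected initial data. -/

section Initial

variable {L : ℝ} {φ : ℕ → ℝ → ℝ}

lemma IsLaplaceEigenbasis.smooth_partialSum (hφ : IsLaplaceEigenbasis L φ) (n : ℕ) (u : ℝ → ℝ) :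
    SmoothPeriodic L (partialSum L φ n u) :=
  hφ.smoothPeriodic_sum (Finset.range (n + 1)) (coeff L φ u)

lemma IsLaplaceEigenbasis.l2_deriv_partialSum_le (hL : 0 < L) (hφ : IsLaplaceEigenbasis L φ)
    {u : ℝ → ℝ} (hu : PeriodicC1 L u) (n : ℕ) :
    l2 L (deriv (partialSum L φ n u)) ≤ l2 L (deriv u) := by
  apply le_of_sq_le_sq _ l2_nonneg
  have := hφ.sq_l2_deriv_sum hL (Finset.range (n + 1)) (coeff L φ u)
  have e : partialSum L φ n u = fun x => ∑ i ∈ Finset.range (n + 1), coeff L φ u i * φ i x := rfl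
  rw [e, this]
  exact hφ.bessel hL hu _

lemma IsLaplaceEigenbasis.integral_partialSum (hφ : IsLaplaceEigenbasis L φ) (n : ℕ)
    (u : ℝ → ℝ) : ∫ x in (0 : ℝ)..L, partialSum L φ n u x = ∫ x in (0 : ℝ)..L, u x := by
  obtain ⟨a, ha, h⟩ := hφ.exists_const
  have := hφ.coeff_partialSum u (Nat.zero_le n)
  rw [coeff, coeff] at this
  simp_rw [h] at this
  rw [intervalIntegral.integral_mul_const, intervalIntegral.integral_mul_const] at this
  exact mul_right_cancel₀ ha this

lemma PeriodicC1.exists_bound {u : ℝ → ℝ} (hL : 0 < L) (hu : PeriodicC1 L u) :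
    ∃ B, ∀ x, |u x| ≤ B := by
  obtain ⟨B, hB⟩ := isCompact_Icc.exists_bound_of_continuousOn (s := Icc 0 L)
    hu.continuous.continuousOn
  exact ⟨B, periodic_bound_of_Icc hL hu.periodic (P := fun s => |s| ≤ B) hB⟩

lemma PeriodicC1.exists_pos_le {u : ℝ → ℝ} (hL : 0 < L) (hu : PeriodicC1 L u)
    (h0 : ∀ x, 0 < u x) : ∃ m, 0 < m ∧ ∀ x, m ≤ u x := by
  obtain ⟨x, -, hx⟩ := isCompact_Icc.exists_isMinOn (s := Icc 0 L) ⟨0, le_rfl, hL.le⟩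
    hu.continuous.continuousOn
  exact ⟨u x, h0 x, periodic_bound_of_Icc hL hu.periodic (P := fun s => u x ≤ s) hx⟩

/-- The energies and moments of the projected initial data are bounded independently of the
basis. -/
lemma exists_initial_bounds (hL : 0 < L) {h₀ c₀ : ℝ → ℝ} (hh : PeriodicC1 L h₀)
    (hc : PeriodicC1 L c₀) (hpos : ∀ x, 0 < h₀ x) :
    ∃ e₀ m₁ : ℝ, ∀ φ : ℕ → ℝ → ℝ, IsLaplaceEigenbasis L φ → ∃ N : ℕ, ∀ n ≥ N,
      (∀ x, 0 < partialSum L φ n h₀ x) ∧ ∀ ε ∈ Ioo (0 : ℝ) 1,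
        energy L (fun x => partialSum L φ n h₀ x + ε) (partialSum L φ n c₀) ≤ e₀ ∧
        |∫ x in (0 : ℝ)..L, (partialSum L φ n h₀ x + ε) * partialSum L φ n c₀ x| ≤ m₁ := by
  obtain ⟨B, hB⟩ := hh.exists_bound hL
  obtain ⟨C, hC⟩ := hc.exists_bound hL
  obtain ⟨m, hm, hml⟩ := hh.exists_pos_le hL hpos
  have hB0 : 0 ≤ B := (abs_nonneg _).trans (hB 0)
  have hC0 : 0 ≤ C := (abs_nonneg _).trans (hC 0)
  refine ⟨l2 L (deriv h₀) ^ 2 / 2 + (L * (((m / 2)⁻¹) ^ 2 / 6) + (B + 2) * (L * ((C + 1) ^ 4 + 1)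
    + l2 L (deriv c₀) ^ 2 / 2)), (B + 2) * (C + 1) * L, fun φ hφ => ?_⟩
  have u1 := Metric.tendstoUniformly_iff.1 (hφ.tendstoUniformly_partialSum hL hh) (min (m / 2) 1)
    (lt_min (by positivity) one_pos)
  have u2 := Metric.tendstoUniformly_iff.1 (hφ.tendstoUniformly_partialSum hL hc) 1 one_pos
  obtain ⟨N, hN⟩ := eventually_atTop.1 (u1.and u2)
  refine ⟨N, fun n hn => ?_⟩
  obtain ⟨v1, v2⟩ := hN n hn
  have sh := hφ.smooth_partialSum n h₀
  have sc := hφ.smooth_partialSum n c₀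
  have w1 : ∀ x, m / 2 ≤ partialSum L φ n h₀ x := fun x => by
    have h1 := (v1 x).trans_le (min_le_left _ _)
    rw [Real.dist_eq] at h1
    have := (abs_lt.1 h1).2
    have := hml x
    linarith
  have w2 : ∀ x, partialSum L φ n h₀ x ≤ B + 1 := fun x => by
    have h1 := (v1 x).trans_le (min_le_right _ _)
    rw [Real.dist_eq] at h1
    have := (abs_lt.1 h1).1
    have := (le_abs_self _).trans (hB x)
    linarith
  have w3 : ∀ x, |partialSum L φ n c₀ x| ≤ C + 1 := fun x => by
    have h1 := v2 x
    rw [dist_comm, Real.dist_eq] at h1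
    have h2 := abs_add_le (partialSum L φ n c₀ x - c₀ x) (c₀ x)
    rw [sub_add_cancel] at h2
    have := hC x
    linarith
  have w0 : ∀ x, 0 < partialSum L φ n h₀ x := fun x => by have := w1 x; linarith
  refine ⟨w0, fun ε hε => ?_⟩
  have hε0 := hε.1
  have hε1 := hε.2
  have a0 : ∀ x, 0 < partialSum L φ n h₀ x + ε := fun x => by have := w0 x; linarith
  have aB : ∀ x, partialSum L φ n h₀ x + ε ≤ B + 2 := fun x => by have := w2 x; linarith
  have sa := sh.add (SmoothPeriodic.const L ε)
  have k1 := sh.continuous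
  have k2 := sc.continuous
  have k3 := sc.deriv.continuous
  have k4 := (sa.inv a0).continuous
  have k5 := sc.doubleWell.continuous
  have hLB : ∀ {f : ℝ → ℝ} {M : ℝ}, Continuous f → (∀ x, f x ≤ M) →
      ∫ x in (0 : ℝ)..L, f x ≤ L * M := fun {f M} hf h => by
    refine (intervalIntegral.integral_mono_on hL.le (hf.intervalIntegrable _ _)
      (continuous_const.intervalIntegrable _ _) fun x _ => h x).trans ?_
    rw [intervalIntegral.integral_const, sub_zero, smul_eq_mul]
  constructor
  · rw [energy_eq sa sc a0, deriv_shift]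
    have d1 := hφ.l2_deriv_partialSum_le hL hh n
    have d2 := hφ.l2_deriv_partialSum_le hL hc n
    have i1 : ∫ x in (0 : ℝ)..L, deriv (partialSum L φ n h₀) x ^ 2 ≤ l2 L (deriv h₀) ^ 2 := by
      rw [← sq_l2 hL.le]
      exact pow_le_pow_left₀ l2_nonneg d1 2
    have i2 : ∫ x in (0 : ℝ)..L, (partialSum L φ n h₀ x + ε)⁻¹ ^ 2 ≤ L * ((m / 2)⁻¹) ^ 2 := by
      refine hLB (by fun_prop) fun x => ?_
      have : 0 < (partialSum L φ n h₀ x + ε)⁻¹ := inv_pos.2 (a0 x)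
      gcongr
      have := w1 x
      linarith
    have i3 : ∫ x in (0 : ℝ)..L, (partialSum L φ n h₀ x + ε) * doubleWell (partialSum L φ n c₀ x)
        ≤ L * ((B + 2) * ((C + 1) ^ 4 + 1)) := by
      refine hLB (by fun_prop) fun x => ?_
      refine mul_le_mul (aB x) ?_ (doubleWell_nonneg _) (by linarith)
      refine (doubleWell_le _).trans ?_
      have : partialSum L φ n c₀ x ^ 4 = |partialSum L φ n c₀ x| ^ 4 :=
        ((Even.pow_abs (by decide) _)).symm
      rw [this]
      gcongr
      exact w3 x
    have i4 : ∫ x in (0 : ℝ)..L, (partialSum L φ n h₀ x + ε) * deriv (partialSum L φ n c₀) x ^ 2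
        ≤ (B + 2) * l2 L (deriv c₀) ^ 2 := by
      have : ∫ x in (0 : ℝ)..L, (partialSum L φ n h₀ x + ε) * deriv (partialSum L φ n c₀) x ^ 2
          ≤ ∫ x in (0 : ℝ)..L, (B + 2) * deriv (partialSum L φ n c₀) x ^ 2 := by
        refine intervalIntegral.integral_mono_on hL.le
          (Continuous.intervalIntegrable (by fun_prop) _ _)
          (Continuous.intervalIntegrable (by fun_prop) _ _) fun x _ => ?_
        have := aB x
        gcongr
      refine this.trans ?_
      rw [intervalIntegral.integral_const_mul, ← sq_l2 hL.le]
      gcongr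
      exact l2_nonneg
    linarith
  · have h1 := intervalIntegral.norm_integral_le_of_norm_le_const (a := 0) (b := L)
      (f := fun x => (partialSum L φ n h₀ x + ε) * partialSum L φ n c₀ x)
      (C := (B + 2) * (C + 1)) fun x _ => by
        rw [norm_mul, Real.norm_eq_abs, Real.norm_eq_abs, abs_of_pos (a0 x)]
        exact mul_le_mul (aB x) (w3 x) (abs_nonneg _) (by linarith)
    rwa [Real.norm_eq_abs, sub_zero, abs_of_pos hL] at h1

end Initial


/-! ## Galerkin solutions and the flow of a vector field -/

section MassMatrix

variable {L ε : ℝ} {φ : ℕ → ℝ → ℝ} {g : ℝ → ℝ} {n : ℕ}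

/-- The mass matrix with density `g(h)`. -/
noncomputable def massMatrix (L : ℝ) (φ : ℕ → ℝ → ℝ) (g : ℝ → ℝ) (n : ℕ) (ξ : Fin (n + 1) → ℝ) :
    Matrix (Fin (n + 1)) (Fin (n + 1)) ℝ :=
  Matrix.of fun i j => ∫ y in (0 : ℝ)..L, g (vec φ n ξ y) * φ j y * φ i y

lemma massMatrix_mulVec (hφ : IsLaplaceEigenbasis L φ) (hg : IsRegularization ε g)
    (ξ ζ : Fin (n + 1) → ℝ) (i : Fin (n + 1)) :
    (massMatrix L φ g n ξ).mulVec ζ i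
      = ∫ y in (0 : ℝ)..L, g (vec φ n ξ y) * vec φ n ζ y * φ i y := by
  have k1 := hg.contDiff_one.continuous
  have k2 := (hφ.smooth_vec ξ).continuous
  have k3 := fun i => (hφ.smoothPeriodic i).continuous
  have e : ∀ y, g (vec φ n ξ y) * vec φ n ζ y * φ i y
      = ∑ j : Fin (n + 1), g (vec φ n ξ y) * φ j y * φ i y * ζ j := fun y => by
    rw [vec.eq_1 φ n ζ, Finset.mul_sum, Finset.sum_mul]
    exact Finset.sum_congr rfl fun j _ => by ring
  simp_rw [e]
  rw [intervalIntegral.integral_finsetSum]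
  · simp_rw [intervalIntegral.integral_mul_const]
    rfl
  · intro j _
    have := k3 i
    have := k3 j
    exact Continuous.intervalIntegrable (by fun_prop) _ _

lemma contDiff_massMatrix (hφ : IsLaplaceEigenbasis L φ) (hg : IsRegularization ε g)
    (i j : Fin (n + 1)) : ContDiff ℝ 1 fun ξ => massMatrix L φ g n ξ i j := by
  have h1 : ∀ i, ContDiff ℝ 1 (φ i) := fun i => (hφ.smooth i).of_le (by exact_mod_cast le_top)
  exact contDiff_integral (Φ := fun (ξ : Fin (n + 1) → ℝ) y => g (vec φ n ξ y) * φ j y * φ i y)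
    (((hg.contDiff_one.comp (contDiff_vec hφ.smooth n)).mul ((h1 j).comp contDiff_snd)).mul
      ((h1 i).comp contDiff_snd)) L

lemma vec_injective (hφ : IsLaplaceEigenbasis L φ) {ξ : Fin (n + 1) → ℝ}
    (h : ∀ y, vec φ n ξ y = 0) : ξ = 0 := by
  ext i
  rw [← coeff_vec hφ ξ i]
  simp [h]

/-- It is a Gram matrix for a positive density: a vector in the kernel gives a Galerkin sum whose
weighted square has integral zero. -/
lemma det_massMatrix_ne_zero (hL : 0 < L) (hφ : IsLaplaceEigenbasis L φ)
    (hg : IsRegularization ε g) (hε : 0 < ε) (ξ : Fin (n + 1) → ℝ) :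
    (massMatrix L φ g n ξ).det ≠ 0 := by
  intro hdet
  obtain ⟨v, hv, h⟩ := Matrix.exists_mulVec_eq_zero_iff.2 hdet
  apply hv
  have k1 := hg.contDiff_one.continuous
  have k2 := (hφ.smooth_vec ξ).continuous
  have k3 := fun i => (hφ.smoothPeriodic i).continuous
  have k4 := (hφ.smooth_vec v).continuous
  have h1 : ∫ y in (0 : ℝ)..L, g (vec φ n ξ y) * vec φ n v y ^ 2 = 0 := by
    have e : ∀ y, g (vec φ n ξ y) * vec φ n v y ^ 2
        = ∑ i : Fin (n + 1), v i * (g (vec φ n ξ y) * vec φ n v y * φ i y) := fun y => by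
      rw [pow_two, ← mul_assoc]
      conv_lhs => arg 2; rw [vec]
      rw [Finset.mul_sum]
      exact Finset.sum_congr rfl fun j _ => by ring
    simp_rw [e]
    rw [intervalIntegral.integral_finsetSum]
    · simp_rw [intervalIntegral.integral_const_mul, ← massMatrix_mulVec hφ hg, h]
      simp
    · intro j _
      have := k3 j
      exact Continuous.intervalIntegrable (by fun_prop) _ _
  apply vec_injective hφ
  have cont : Continuous fun y => g (vec φ n ξ y) * vec φ n v y ^ 2 := by fun_prop
  have nn : ∀ y, 0 ≤ g (vec φ n ξ y) * vec φ n v y ^ 2 := fun y =>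
    mul_nonneg (hg.pos_all hε _).le (sq_nonneg _)
  by_contra! hcon
  obtain ⟨y₀, hy₀⟩ := hcon
  obtain ⟨y, hy, hyy⟩ := (hφ.smooth_vec v).periodic.exists_mem_Ico₀ hL y₀
  have hpos : 0 < ∫ y in (0 : ℝ)..L, g (vec φ n ξ y) * vec φ n v y ^ 2 := by
    refine intervalIntegral.integral_pos hL cont.continuousOn (fun y _ => nn y)
      ⟨y, ⟨hy.1, hy.2.le⟩, ?_⟩
    refine mul_pos (hg.pos_all hε _) (sq_pos_of_ne_zero ?_)
    rw [← hyy]; exact hy₀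
  linarith

end MassMatrix

section Solutions

variable {L ε K T : ℝ} {φ : ℕ → ℝ → ℝ} {g h₀ c₀ : ℝ → ℝ} {n : ℕ}

/-- It suffices to test with the basis. -/
lemma forall_mem_galerkinSpace (hφ : IsLaplaceEigenbasis L φ) {u F : ℝ → ℝ} (hu : Continuous u)
    (hF : Continuous F)
    (h : ∀ j : Fin (n + 1), ∫ y in (0 : ℝ)..L, u y * φ j y = ∫ y in (0 : ℝ)..L, F y * deriv (φ j) y) :
    ∀ ψ ∈ galerkinSpace φ n, ∫ y in (0 : ℝ)..L, u y * ψ y = ∫ y in (0 : ℝ)..L, F y * deriv ψ y := by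
  intro ψ hψ
  obtain ⟨b, rfl⟩ := mem_galerkinSpace.1 hψ
  rw [hφ.deriv_sum]
  simp_rw [Finset.mul_sum]
  have k := fun i => (hφ.smoothPeriodic i).continuous
  have k' := fun i => (hφ.smoothPeriodic i).deriv.continuous
  rw [intervalIntegral.integral_finsetSum, intervalIntegral.integral_finsetSum]
  · refine Finset.sum_congr rfl fun i hi => ?_
    have := h ⟨i, Finset.mem_range.1 hi⟩
    simp_rw [mul_left_comm _ (b i)]
    rw [intervalIntegral.integral_const_mul, intervalIntegral.integral_const_mul]
    simp only at this
    rw [this]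
  · intro i _
    have := k' i
    exact Continuous.intervalIntegrable (by fun_prop) _ _
  · intro i _
    have := k i
    exact Continuous.intervalIntegrable (by fun_prop) _ _

/-- The coefficients of a Galerkin solution. -/
def toState (n : ℕ) (η γ : ℕ → ℝ → ℝ) (t : ℝ) : State n := (fun i => η i t, fun i => γ i t)

/-- The equations prescribe derivatives of the moments of `g(h) c` and presuppose no
differentiability of the concentration coefficients. Cramer's rule for the mass matrix supplies it,
because the height coefficients are differentiable. -/
lemma IsGalerkinSolution.isConditionalFlow (hL : 0 < L) (hφ : IsLaplaceEigenbasis L φ)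
    (hg : IsRegularization ε g) (hε : 0 < ε) {η γ : ℕ → ℝ → ℝ}
    (hs : IsGalerkinSolution L φ g h₀ c₀ n T η γ) (K : ℝ) :
    IsConditionalFlow L ε K φ n T (toState n η γ) where
  cont := (continuousOn_pi.2 fun i : Fin (n + 1) => hs.cont_h i (Nat.lt_succ_iff.1 i.2)).prodMk
    (continuousOn_pi.2 fun i : Fin (n + 1) => hs.cont_c i (Nat.lt_succ_iff.1 i.2))
  vel t ht hpos H := by
    set x := toState n η γ with hx
    have eh : ∀ s, galerkinSum φ n η s = vec φ n (x s).1 := galerkinSum_eq_vec φ n η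
    have ec : ∀ s, galerkinSum φ n γ s = vec φ n (x s).2 := galerkinSum_eq_vec φ n γ
    have hh := hs.eq_h
    have hc := hs.eq_c
    simp_rw [eh, ec] at hh hc
    have d1 : ∀ i : Fin (n + 1), HasDerivAt (fun s => (x s).1 i)
        (∫ y in (0 : ℝ)..L, fluxJ g (vec φ n (x t).1) (vec φ n (x t).2) y * deriv (φ i) y) t :=
      fun i => by
        have := hh i (Nat.lt_succ_iff.1 i.2) t ht
        simp_rw [coeff_vec hφ] at this
        exact this
    have d1' := hasDerivAt_pi.2 d1
    set ξ' : Fin (n + 1) → ℝ := fun i =>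
      ∫ y in (0 : ℝ)..L, fluxJ g (vec φ n (x t).1) (vec φ n (x t).2) y * deriv (φ i) y with hξ'
    have d2 : ∀ i : Fin (n + 1), DifferentiableAt ℝ (fun s => (x s).2 i) t := fun i => by
      have e : (fun s => (x s).2 i) = fun s => ((massMatrix L φ g n (x s).1).updateCol i
          (fun j => ∫ y in (0 : ℝ)..L, g (vec φ n (x s).1 y) * vec φ n (x s).2 y * φ j y)).det
          / (massMatrix L φ g n (x s).1).det := funext fun s =>
        eq_cramer (det_massMatrix_ne_zero hL hφ hg hε _)
          (funext fun j => massMatrix_mulVec hφ hg _ _ j) i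
      have dM : ∀ i j, DifferentiableAt ℝ (fun s => massMatrix L φ g n (x s).1 i j) t :=
        fun i j => ((contDiff_massMatrix hφ hg i j).differentiable one_ne_zero _).comp t
          d1'.differentiableAt
      rw [e]
      refine (differentiableAt_det fun k l => ?_).fun_div (differentiableAt_det dM)
        (det_massMatrix_ne_zero hL hφ hg hε _)
      simp_rw [Matrix.updateCol_apply]
      by_cases hl : l = i
      · simp_rw [if_pos hl]
        exact (hc k (Nat.lt_succ_iff.1 k.2) t ht).differentiableAt
      · simp_rw [if_neg hl]
        exact dM k l
    have d2' := hasDerivAt_pi.2 fun i => (d2 i).hasDerivAt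
    set ζ' : Fin (n + 1) → ℝ := fun i => deriv (fun s => (x s).2 i) t
    have dx : HasDerivAt x (ξ', ζ') t := d1'.prodMk d2'
    have sh := hφ.smooth_vec (x t).1
    have sc := hφ.smooth_vec (x t).2
    have hJ := fun y => fluxJ_eq_flux hg hε sh sc hpos y
    have hK := fun y => fluxK_eq hg hε sh sc hpos y
    have k1 := (smoothPeriodic_flux H.smooth_a sc H.pos).continuous
    have k2 := (smoothPeriodic_pot H.smooth_a sc H.pos).deriv.continuous
    have k3 := H.smooth_a.continuous
    have k4 := sc.continuous
    have k5 := (hφ.smooth_vec ξ').continuous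
    have k6 := (hφ.smooth_vec ζ').continuous
    refine ⟨(ξ', ζ'), dx, vec_mem _ _ _, vec_mem _ _ _, ?_, ?_⟩
    · refine forall_mem_galerkinSpace hφ k5 k1 fun j => ?_
      rw [coeff_vec hφ]
      simp_rw [← hJ]
      rfl
    · refine forall_mem_galerkinSpace hφ (by fun_prop) (by fun_prop) fun j => ?_
      have h1 := hc j (Nat.lt_succ_iff.1 j.2) t ht
      have h2 := hasDerivAt_moment hφ hg (hφ.smoothPeriodic j) dx hpos
      simp_rw [hK] at h1
      exact h2.unique h1

/-- Flows that remain positive and bounded are Galerkin solutions. -/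
lemma IsConditionalFlow.isGalerkinSolution (hφ : IsLaplaceEigenbasis L φ)
    (hg : IsRegularization ε g) (hε : 0 < ε) {x : ℝ → State n}
    (hx : IsConditionalFlow L ε K φ n T x)
    (hpos : ∀ t ∈ Ioo 0 T, ∀ y, 0 < vec φ n (x t).1 y)
    (hbd : ∀ t ∈ Ioo 0 T, Bounds L K (fun y => vec φ n (x t).1 y + ε) (vec φ n (x t).2))
    (h1 : ∀ i, (x 0).1 i = coeff L φ h₀ i) (h2 : ∀ i, (x 0).2 i = coeff L φ c₀ i) :
    IsGalerkinSolution L φ g h₀ c₀ n T (fun i t => extend (x t).1 i)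
      (fun i t => extend (x t).2 i) := by
  have e1 : ∀ t, galerkinSum φ n (fun i t => extend (x t).1 i) t = vec φ n (x t).1 := fun t => by
    rw [galerkinSum_eq_vec]; simp_rw [extend_val]
  have e2 : ∀ t, galerkinSum φ n (fun i t => extend (x t).2 i) t = vec φ n (x t).2 := fun t => by
    rw [galerkinSum_eq_vec]; simp_rw [extend_val]
  have c1 := continuousOn_pi.1 (continuous_fst.comp_continuousOn hx.cont)
  have c2 := continuousOn_pi.1 (continuous_snd.comp_continuousOn hx.cont)
  have ext_of : ∀ {i : ℕ} (hi : i ≤ n) (ξ : Fin (n + 1) → ℝ),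
      extend ξ i = ξ ⟨i, Nat.lt_succ_iff.2 hi⟩ := fun hi ξ => extend_val ξ ⟨_, Nat.lt_succ_iff.2 hi⟩
  refine ⟨fun i hi => ?_, fun i hi => ?_, fun i hi => ?_, fun i hi => ?_, fun j hj t ht => ?_,
    fun j hj t ht => ?_⟩
  · rw [ext_of hi, h1]; rfl
  · rw [ext_of hi, h2]; rfl
  · simp_rw [ext_of hi]; exact c1 _
  · simp_rw [ext_of hi]; exact c2 _
  · simp_rw [e1, e2]
    have p := hpos t ht
    obtain ⟨x', hx', hv⟩ := hx.vel t ht p (hbd t ht)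
    have := hasDerivAt_mass hφ (hφ.smoothPeriodic j) hx'
    rw [hv.eq_a _ (basis_mem_galerkinSpace φ hj)] at this
    simp_rw [fluxJ_eq_flux hg hε (hφ.smooth_vec (x t).1) (hφ.smooth_vec (x t).2) p]
    exact this
  · simp_rw [e1, e2]
    have p := hpos t ht
    obtain ⟨x', hx', hv⟩ := hx.vel t ht p (hbd t ht)
    have := hasDerivAt_moment hφ hg (hφ.smoothPeriodic j) hx' p
    rw [hv.eq_c _ (basis_mem_galerkinSpace φ hj)] at this
    simp_rw [fluxK_eq hg hε (hφ.smooth_vec (x t).1) (hφ.smooth_vec (x t).2) p]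
    exact this

end Solutions

/-! ### The vector field -/

section Field

variable {L ε K T : ℝ} {φ : ℕ → ℝ → ℝ} {g h₀ c₀ : ℝ → ℝ} {n : ℕ}

/-- The regularised flux as a function of the coefficients. -/
noncomputable def stateFlux (φ : ℕ → ℝ → ℝ) (g : ℝ → ℝ) (n : ℕ) (z : State n) (y : ℝ) : ℝ :=
  fluxF (g (vec φ n z.1 y)) (vec (fun i => deriv (φ i)) n z.1 y)
    (vec (fun i => deriv (deriv (deriv (φ i)))) n z.1 y) (vec (fun i => deriv (φ i)) n z.2 y)
    (vec (fun i => deriv (deriv (φ i))) n z.2 y)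

/-- The derivative of the regularised potential as a function of the coefficients. -/
noncomputable def statePot (φ : ℕ → ℝ → ℝ) (g : ℝ → ℝ) (n : ℕ) (z : State n) (y : ℝ) : ℝ :=
  potF (g (vec φ n z.1 y)) (vec (fun i => deriv (φ i)) n z.1 y)
    (vec (fun i => deriv (deriv (φ i))) n z.1 y) (vec φ n z.2 y)
    (vec (fun i => deriv (φ i)) n z.2 y) (vec (fun i => deriv (deriv (φ i))) n z.2 y)
    (vec (fun i => deriv (deriv (deriv (φ i)))) n z.2 y)

/-- The velocity of the height coefficients. -/
noncomputable def heightField (L : ℝ) (φ : ℕ → ℝ → ℝ) (g : ℝ → ℝ) (n : ℕ) (z : State n)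
    (i : Fin (n + 1)) : ℝ :=
  ∫ y in (0 : ℝ)..L, stateFlux φ g n z y * deriv (φ i) y

/-- The moments of the velocity of the concentration. -/
noncomputable def momentField (L : ℝ) (φ : ℕ → ℝ → ℝ) (g : ℝ → ℝ) (n : ℕ) (z : State n)
    (i : Fin (n + 1)) : ℝ :=
  ∫ y in (0 : ℝ)..L, ((vec φ n z.2 y * stateFlux φ g n z y - g (vec φ n z.1 y) * statePot φ g n z y)
    * deriv (φ i) y - vec φ n z.2 y * vec φ n (heightField L φ g n z) y * φ i y)

/-- The vector field on the coefficients. -/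
noncomputable def galerkinField (L : ℝ) (φ : ℕ → ℝ → ℝ) (g : ℝ → ℝ) (n : ℕ) (z : State n) :
    State n :=
  (heightField L φ g n z, fun i => ((massMatrix L φ g n z.1).updateCol i
    (momentField L φ g n z)).det / (massMatrix L φ g n z.1).det)

lemma contDiff_stateFlux (hφ : IsLaplaceEigenbasis L φ) (hg : IsRegularization ε g) (hε : 0 < ε) :
    ContDiff ℝ 1 fun p : State n × ℝ => stateFlux φ g n p.1 p.2 := by
  have s1 := contDiff_deriv_basis hφ.smooth
  have s2 := contDiff_deriv_basis s1
  have s3 := contDiff_deriv_basis s2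
  exact contDiff_fluxF (fun _ => (hg.pos_all hε _).ne')
    (hg.contDiff_one.comp (contDiff_vec_fst hφ.smooth n)) (contDiff_vec_fst s1 n)
    (contDiff_vec_fst s3 n) (contDiff_vec_snd s1 n) (contDiff_vec_snd s2 n)

lemma contDiff_statePot (hφ : IsLaplaceEigenbasis L φ) (hg : IsRegularization ε g) (hε : 0 < ε) :
    ContDiff ℝ 1 fun p : State n × ℝ => statePot φ g n p.1 p.2 := by
  have s1 := contDiff_deriv_basis hφ.smooth
  have s2 := contDiff_deriv_basis s1
  have s3 := contDiff_deriv_basis s2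
  exact contDiff_potF (fun _ => (hg.pos_all hε _).ne')
    (hg.contDiff_one.comp (contDiff_vec_fst hφ.smooth n)) (contDiff_vec_fst s1 n)
    (contDiff_vec_fst s2 n) (contDiff_vec_snd hφ.smooth n) (contDiff_vec_snd s1 n)
    (contDiff_vec_snd s2 n) (contDiff_vec_snd s3 n)

lemma contDiff_one_basis (hφ : IsLaplaceEigenbasis L φ) (i : ℕ) :
    ContDiff ℝ 1 (φ i) ∧ ContDiff ℝ 1 (deriv (φ i)) :=
  ⟨(hφ.smooth i).of_le (by exact_mod_cast le_top),
    (contDiff_deriv_basis hφ.smooth i).of_le (by exact_mod_cast le_top)⟩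

lemma contDiff_heightField (hφ : IsLaplaceEigenbasis L φ) (hg : IsRegularization ε g)
    (hε : 0 < ε) : ContDiff ℝ 1 (heightField L φ g n) := by
  refine contDiff_pi.2 fun i => ?_
  exact contDiff_integral (Φ := fun (z : State n) y => stateFlux φ g n z y * deriv (φ i) y)
    ((contDiff_stateFlux hφ hg hε).mul ((contDiff_one_basis hφ i).2.comp contDiff_snd)) L

lemma contDiff_momentField (hφ : IsLaplaceEigenbasis L φ) (hg : IsRegularization ε g)
    (hε : 0 < ε) (i : Fin (n + 1)) : ContDiff ℝ 1 fun z => momentField L φ g n z i := by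
  refine contDiff_integral (Φ := fun (z : State n) y => (vec φ n z.2 y * stateFlux φ g n z y
    - g (vec φ n z.1 y) * statePot φ g n z y) * deriv (φ i) y
    - vec φ n z.2 y * vec φ n (heightField L φ g n z) y * φ i y) ?_ L
  have h1 : ContDiff ℝ 1 fun p : State n × ℝ => vec φ n (heightField L φ g n p.1) p.2 :=
    (contDiff_vec hφ.smooth n).comp (f := fun p : State n × ℝ => (heightField L φ g n p.1, p.2))
      (((contDiff_heightField hφ hg hε).comp contDiff_fst).prodMk contDiff_snd)
  have h2 := contDiff_vec_snd hφ.smooth n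
  have h3 := hg.contDiff_one.comp (contDiff_vec_fst hφ.smooth n)
  exact (((h2.mul (contDiff_stateFlux hφ hg hε)).sub (h3.mul (contDiff_statePot hφ hg hε))).mul
    ((contDiff_one_basis hφ i).2.comp contDiff_snd)).sub
    ((h2.mul h1).mul ((contDiff_one_basis hφ i).1.comp contDiff_snd))

lemma contDiff_galerkinField (hL : 0 < L) (hφ : IsLaplaceEigenbasis L φ)
    (hg : IsRegularization ε g) (hε : 0 < ε) : ContDiff ℝ 1 (galerkinField L φ g n) := by
  refine (contDiff_heightField hφ hg hε).prodMk (contDiff_pi.2 fun i => ?_)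
  have hM : ∀ i j, ContDiff ℝ 1 fun z : State n => massMatrix L φ g n z.1 i j := fun i j =>
    (contDiff_massMatrix hφ hg i j).comp contDiff_fst
  refine (contDiff_det fun k l => ?_).div (contDiff_det hM)
    fun z => det_massMatrix_ne_zero hL hφ hg hε _
  simp_rw [Matrix.updateCol_apply]
  by_cases hl : l = i
  · simp_rw [if_pos hl]
    exact contDiff_momentField hφ hg hε k
  · simp_rw [if_neg hl]
    exact hM k l

lemma isVelocity_galerkinField (hL : 0 < L) (hφ : IsLaplaceEigenbasis L φ)
    (hg : IsRegularization ε g) (hε : 0 < ε) {z : State n} (h0 : ∀ y, 0 < vec φ n z.1 y) :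
    IsVelocity L (galerkinSpace φ n) (fun y => vec φ n z.1 y + ε) (vec φ n z.2)
      (vec φ n (galerkinField L φ g n z).1) (vec φ n (galerkinField L φ g n z).2) := by
  have sh := hφ.smooth_vec z.1
  have sa := sh.add (SmoothPeriodic.const L ε)
  have sc := hφ.smooth_vec z.2
  have a0 : ∀ y, 0 < vec φ n z.1 y + ε := fun y => by have := h0 y; positivity
  have s1 := contDiff_deriv_basis hφ.smooth
  have s2 := contDiff_deriv_basis s1
  have eg : ∀ y, g (vec φ n z.1 y) = vec φ n z.1 y + ε := fun y => hg.eq_add _ (h0 y).le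
  have hF : ∀ y, flux (fun y => vec φ n z.1 y + ε) (vec φ n z.2) y = stateFlux φ g n z y :=
    fun y => by
      rw [flux_eq_fluxF, deriv_shift, stateFlux]
      simp only [deriv_vec hφ.smooth, deriv_vec s1, deriv_vec s2, eg]
  have hP : ∀ y, deriv (pot (fun y => vec φ n z.1 y + ε) (vec φ n z.2)) y = statePot φ g n z y :=
    fun y => by
      rw [deriv_pot sa sc a0, deriv_shift, statePot]
      simp only [deriv_vec hφ.smooth, deriv_vec s1, deriv_vec s2, eg]
  have k1 := (smoothPeriodic_flux sa sc a0).continuous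
  have k2 := (smoothPeriodic_pot sa sc a0).deriv.continuous
  have k3 := sa.continuous
  have k4 := sc.continuous
  have k5 := (hφ.smooth_vec (galerkinField L φ g n z).1).continuous
  have k6 := (hφ.smooth_vec (galerkinField L φ g n z).2).continuous
  have k7 := sh.continuous
  refine ⟨vec_mem _ _ _, vec_mem _ _ _, ?_, ?_⟩
  · refine forall_mem_galerkinSpace hφ k5 k1 fun j => ?_
    rw [coeff_vec hφ]
    simp_rw [hF]
    rfl
  · refine forall_mem_galerkinSpace hφ (by fun_prop) (by fun_prop) fun j => ?_
    have h1 := congrFun (mulVec_cramer_div (det_massMatrix_ne_zero hL hφ hg hε z.1)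
      (momentField L φ g n z)) j
    have h2 := massMatrix_mulVec hφ hg z.1 (galerkinField L φ g n z).2 j
    have h3 : ∫ y in (0 : ℝ)..L, g (vec φ n z.1 y) * vec φ n (galerkinField L φ g n z).2 y * φ j y
        = momentField L φ g n z j := h2.symm.trans h1
    have k8 := (hφ.smoothPeriodic j).continuous
    have k9 := (hφ.smoothPeriodic j).deriv.continuous
    rw [momentField] at h3
    simp_rw [eg, ← hF, ← hP] at h3
    rw [integral_sub_of_continuous (by fun_prop) (by
      have : Continuous (vec φ n (heightField L φ g n z)) := k5
      fun_prop)] at h3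
    have e : ∀ y, (vec φ n z.2 y * vec φ n (galerkinField L φ g n z).1 y
        + (vec φ n z.1 y + ε) * vec φ n (galerkinField L φ g n z).2 y) * φ j y
        = vec φ n z.2 y * vec φ n (galerkinField L φ g n z).1 y * φ j y
          + (vec φ n z.1 y + ε) * vec φ n (galerkinField L φ g n z).2 y * φ j y := fun y => by ring
    simp_rw [e]
    rw [integral_add_of_continuous (by fun_prop) (by fun_prop), h3]
    exact add_sub_cancel _ _

/-- Vector fields with compact support have solutions on arbitrary time intervals. -/
lemma exists_solution_of_hasCompactSupport {E : Type*} [NormedAddCommGroup E] [NormedSpace ℝ E]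
    [CompleteSpace E] {f : E → E} (hf : ContDiff ℝ 1 f) (hs : HasCompactSupport f) (x₀ : E)
    {T : ℝ} (hT : 0 < T) :
    ∃ x : ℝ → E, x 0 = x₀ ∧ ∀ t ∈ Icc 0 T, HasDerivWithinAt x (f (x t)) (Icc 0 T) t := by
  obtain ⟨C, hC⟩ := hf.lipschitzWith_of_hasCompactSupport hs one_ne_zero
  obtain ⟨B, hB⟩ := hs.exists_bound_of_continuous hf.continuous
  have hB0 : 0 ≤ B := (norm_nonneg _).trans (hB x₀)
  -- The field is globally Lipschitz and bounded by `B`, so the ball of radius `B * T` permits a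
  -- single step of length `T`.
  have hPL : IsPicardLindelof (fun _ => f) (tmin := 0) (tmax := T) ⟨0, le_rfl, hT.le⟩ x₀
      ⟨B * T, by positivity⟩ 0 ⟨B, hB0⟩ C := by
    refine ⟨fun t _ => hC.lipschitzOnWith, fun _ _ => continuousOn_const, fun t _ x _ => hB x, ?_⟩
    simp only [sub_zero, sub_self, max_eq_left hT.le, NNReal.coe_zero]
    exact le_refl (B * T)
  obtain ⟨x, h1, h2⟩ := hPL.exists_eq_forall_mem_Icc_hasDerivWithinAt₀
  exact ⟨x, h1, h2⟩

lemma norm_le_of_bounds (hL : 0 < L) (hφ : IsLaplaceEigenbasis L φ) (hε : 0 < ε) {z : State n}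
    (h0 : ∀ y, 0 < vec φ n z.1 y) (H : Bounds L K (fun y => vec φ n z.1 y + ε) (vec φ n z.2)) :
    ‖z‖ ≤ √L * K := by
  have hK : 0 ≤ K := by linarith [H.two_le]
  have key : ∀ ξ : Fin (n + 1) → ℝ, (∀ y, |vec φ n ξ y| ≤ K) → ‖ξ‖ ≤ √L * K := by
    intro ξ hξ
    refine (pi_norm_le_iff_of_nonneg (by positivity)).2 fun i => ?_
    rw [Real.norm_eq_abs, ← coeff_vec hφ ξ i]
    refine (abs_integral_mul_le hL.le (hφ.smooth_vec ξ).continuous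
      (hφ.smoothPeriodic i).continuous).trans ?_
    have h1 : l2 L (φ i) = 1 := by
      rw [l2]
      simp_rw [pow_two]
      rw [hφ.orthonormal, if_pos rfl, Real.sqrt_one]
    have h2 := l2_le_mul_of_abs_le hL.le (hφ.smooth_vec ξ).continuous
      (continuous_const (y := (1 : ℝ))) hK (fun y => by simpa using hξ y)
    rw [l2_const hL.le zero_le_one] at h2
    rw [h1]
    linarith
  refine norm_prod_le_iff.2 ⟨key _ fun y => ?_, key _ H.abs_c_le⟩
  rw [abs_of_pos (h0 y)]
  have := H.le y
  linarith

/-- Existence of conditional flows. -/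
lemma exists_conditionalFlow (hL : 0 < L) (hφ : IsLaplaceEigenbasis L φ)
    (hg : IsRegularization ε g) (hε : 0 < ε) (hT : 0 < T) (hK : 0 ≤ K) (x₀ : State n) :
    ∃ x, x 0 = x₀ ∧ IsConditionalFlow L ε K φ n T x := by
  set ρ := √L * K with hρ
  have hρ0 : 0 ≤ ρ := by positivity
  -- The cutoff equals one on all states that satisfy the bounds with `K`, and a conditional flow
  -- has to solve the equations at such states only.
  let χ : ContDiffBump (0 : State n) := ⟨ρ + 1, ρ + 2, by linarith, by linarith⟩
  have hf : ContDiff ℝ 1 fun z => χ z • galerkinField L φ g n z :=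
    (χ.contDiff (n := 1)).smul (contDiff_galerkinField hL hφ hg hε)
  have hs : HasCompactSupport fun z => χ z • galerkinField L φ g n z :=
    χ.hasCompactSupport.smul_right
  obtain ⟨x, hx0, hx⟩ := exists_solution_of_hasCompactSupport hf hs x₀ hT
  refine ⟨x, hx0, fun t ht => (hx t ht).continuousWithinAt, fun t ht h0 H => ?_⟩
  have hd := (hx t ⟨ht.1.le, ht.2.le⟩).hasDerivAt (Icc_mem_nhds ht.1 ht.2)
  have h1 : χ (x t) = 1 := by
    apply χ.one_of_mem_closedBall
    rw [mem_closedBall_zero_iff]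
    exact (norm_le_of_bounds hL hφ hε h0 H).trans (by change ρ ≤ ρ + 1; linarith)
  rw [h1, one_smul] at hd
  exact ⟨_, hd, isVelocity_galerkinField hL hφ hg hε h0⟩

end Field


/-! ## Moduli of continuity -/

/-- A quantity whose rate of change is controlled by the square root of the dissipation is Hölder
continuous. -/
lemma sub_le_sqrt_of_dissipation {f F : ℝ → ℝ} {T B e : ℝ} (hB : 0 < B)
    (hf : ContinuousOn f (Icc 0 T)) (hF : ContinuousOn F (Icc 0 T))
    (hF0 : ∀ t ∈ Icc 0 T, 0 ≤ F t) (hFe : ∀ t ∈ Icc 0 T, F t ≤ e)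
    (h : ∀ t ∈ Ioo 0 T, ∃ f' F' D : ℝ, HasDerivAt f f' t ∧ HasDerivAt F F' t ∧
      f' ^ 2 ≤ B ^ 2 * D ∧ F' ≤ -(D / 2) + 1) {s t : ℝ} (hs : s ∈ Icc 0 T) (ht : t ∈ Icc 0 T)
    (hst : s ≤ t) : f t - f s ≤ B * (e + T + 1) * √(t - s) := by
  rcases hst.eq_or_lt with rfl | hlt
  · simp
  set β := √(t - s) with hβ
  have hβ0 : 0 < β := Real.sqrt_pos.2 (sub_pos.2 hlt)
  have hβ2 : β ^ 2 = t - s := Real.sq_sqrt (sub_nonneg.2 hst)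
  set c := B * β + B / (2 * β) with hc
  -- Young's inequality turns `f'` into a multiple of `B β D/2` plus a constant, and `D/2 ≤ 1 - F'`;
  -- hence `G` is nonincreasing. This avoids integrating the dissipation in time. The choice `β =
  -- √(t - s)` balances the two parts.
  set G := fun τ => f τ + B * β * F τ - c * τ with hG
  have sub : Icc s t ⊆ Icc 0 T := Icc_subset_Icc hs.1 ht.2
  have hanti : AntitoneOn G (Icc s t) := by
    refine antitoneOn_of_deriv_nonpos (convex_Icc s t) ?_ ?_ ?_
    · exact ((hf.mono sub).add ((hF.mono sub).const_mul _)).sub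
        (continuousOn_const.mul continuousOn_id)
    · rw [interior_Icc]
      intro τ hτ
      obtain ⟨f', F', D, h1, h2, -, -⟩ := h τ ⟨hs.1.trans_lt hτ.1, hτ.2.trans_le ht.2⟩
      exact (((h1.fun_add (h2.const_mul (B * β))).fun_sub
        ((hasDerivAt_id τ).const_mul c)).differentiableAt).differentiableWithinAt
    · rw [interior_Icc]
      intro τ hτ
      obtain ⟨f', F', D, h1, h2, h3, h4⟩ := h τ ⟨hs.1.trans_lt hτ.1, hτ.2.trans_le ht.2⟩
      have h5 := ((h1.fun_add (h2.const_mul (B * β))).fun_sub ((hasDerivAt_id τ).const_mul c)).deriv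
      have e1 : deriv G τ = f' + B * β * F' - c * 1 := h5
      rw [e1, mul_one, hc]
      have h6 : f' ≤ β / (2 * B) * f' ^ 2 + B / (2 * β) := by
        have : β / (2 * B) * f' ^ 2 + B / (2 * β) - f' = (β * f' - B) ^ 2 / (2 * B * β) := by
          field_simp
          ring
        have h7 : 0 ≤ (β * f' - B) ^ 2 / (2 * B * β) := by positivity
        linarith
      have h8 : β / (2 * B) * f' ^ 2 ≤ B * β * (D / 2) := by
        calc β / (2 * B) * f' ^ 2 ≤ β / (2 * B) * (B ^ 2 * D) := by gcongr
          _ = B * β * (D / 2) := by field_simp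
      have h9 : B * β * F' ≤ B * β * (-(D / 2) + 1) := by gcongr
      linarith
  have h1 := hanti ⟨le_rfl, hst⟩ ⟨hst, le_rfl⟩ hst
  simp only [hG] at h1
  have h2 : B * β * F s ≤ B * β * e := by gcongr; exact hFe s hs
  have h3 : 0 ≤ B * β * F t := mul_nonneg (by positivity) (hF0 t ht)
  have h4 : c * (t - s) ≤ B * (T + 1) * β := by
    rw [hc, ← hβ2]
    have h5 : β ^ 2 ≤ T := by rw [hβ2]; linarith [hs.1, ht.2]
    have h6 : B / (2 * β) * β ^ 2 = B * β / 2 := by field_simp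
    have h7 : 0 < B * β := by positivity
    nlinarith [mul_le_mul_of_nonneg_left h5 h7.le]
  linarith [show B * (e + T + 1) * β = B * β * e + B * (T + 1) * β by ring]

/-- The `L²` modulus of continuity in time of the height. -/
noncomputable def heightMod (K e T τ : ℝ) : ℝ := 4 * K ^ 4 * (e + T + 1) * √τ

/-- The `L²` modulus of continuity in time of the concentration. -/
noncomputable def concMod (L K e T τ : ℝ) : ℝ :=
  K * (heightMod K e T τ + 2 * K ^ 2 * √L * √(heightMod K e T τ))

/-- A modulus of continuity. -/
noncomputable def spaceTimeMod (L K e T τ : ℝ) : ℝ :=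
  √(concMod L K e T τ / L + 4 * K * √(concMod L K e T τ)) + K * √τ

lemma tendsto_spaceTimeMod (L K e T : ℝ) :
    Tendsto (spaceTimeMod L K e T) (𝓝 0) (𝓝 0) := by
  have h : Continuous (spaceTimeMod L K e T) := by
    unfold spaceTimeMod concMod heightMod
    fun_prop
  have h0 : spaceTimeMod L K e T 0 = 0 := by simp [spaceTimeMod, concMod, heightMod]
  have := h.tendsto 0
  rwa [h0] at this

/-- Bounded space-time functions, periodic in space, with a given modulus of continuity. -/
structure IsEquiregular (L T B : ℝ) (m : ℝ → ℝ) (u : ℝ → ℝ → ℝ) : Prop where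
  periodic : ∀ t ∈ Icc 0 T, Function.Periodic (u t) L
  bound : ∀ t ∈ Icc 0 T, ∀ x, |u t x| ≤ B
  modulus : ∀ s ∈ Icc 0 T, ∀ t ∈ Icc 0 T, ∀ x ∈ Icc 0 L, ∀ y ∈ Icc 0 L,
    |u s x - u t y| ≤ m |s - t| + m |x - y|

section Flow

variable {L ε κ A K e m X₀ X₁ m₁ T : ℝ} {φ : ℕ → ℝ → ℝ} {g : ℝ → ℝ} {n : ℕ} {x : ℝ → State n}

/-- Flows along which all bounds hold. -/
structure IsBoundedFlow (L ε κ A K e : ℝ) (φ : ℕ → ℝ → ℝ) (g : ℝ → ℝ) (n : ℕ) (T : ℝ)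
    (x : ℝ → State n) : Prop extends IsConditionalFlow L ε K φ n T x where
  pos : ∀ t ∈ Icc 0 T, ∀ y, 0 < vec φ n (x t).1 y
  bounds : ∀ t ∈ Icc 0 T, Bounds L K (fun y => vec φ n (x t).1 y + ε) (vec φ n (x t).2)
  lyap : ∀ t ∈ Icc 0 T, lyapunov L φ g κ A n (x t) ≤ e

lemma l2_deriv_sub_le (hL : 0 < L) (hφ : IsLaplaceEigenbasis L φ) {ξ ζ : Fin (n + 1) → ℝ}
    (h1 : l2 L (deriv (vec φ n ξ)) ≤ K) (h2 : l2 L (deriv (vec φ n ζ)) ≤ K) :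
    l2 L (deriv fun y => vec φ n ξ y - vec φ n ζ y) ≤ 2 * K := by
  have s1 := hφ.smooth_vec ξ
  have s2 := hφ.smooth_vec ζ
  have e : deriv (fun y => vec φ n ξ y - vec φ n ζ y)
      = fun y => deriv (vec φ n ξ) y - deriv (vec φ n ζ) y :=
    funext fun y => ((s1.hasDerivAt y).fun_sub (s2.hasDerivAt y)).deriv
  rw [e]
  have := l2_sub_le hL.le s1.deriv.continuous s2.deriv.continuous
  linarith

lemma vec_sub_mem (φ : ℕ → ℝ → ℝ) (n : ℕ) (ξ ζ : Fin (n + 1) → ℝ) :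
    (fun y => vec φ n ξ y - vec φ n ζ y) ∈ galerkinSpace φ n :=
  (galerkinSpace φ n).sub_mem (vec_mem φ n ξ) (vec_mem φ n ζ)

lemma IsBoundedFlow.lyapunov_nonneg (hL : 0 < L) (hφ : IsLaplaceEigenbasis L φ)
    (hg : IsRegularization ε g) (hB : EnergyBarrier L κ A K e m X₀ X₁ m₁ φ n)
    (hx : IsBoundedFlow L ε κ A K e φ g n T x) {t : ℝ} (ht : t ∈ Icc 0 T) :
    0 ≤ lyapunov L φ g κ A n (x t) := by
  refine le_trans ?_ (galerkinEnergy_le_lyapunov hB.nonneg (x t))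
  rw [galerkinEnergy_eq hφ hg (hx.pos t ht)]
  have H := hx.bounds t ht
  exact (energy_pos hL H.smooth_a H.smooth_c H.pos).le

lemma IsBoundedFlow.l2_deriv_le (hx : IsBoundedFlow L ε κ A K e φ g n T x) {t : ℝ}
    (ht : t ∈ Icc 0 T) : l2 L (deriv (vec φ n (x t).1)) ≤ K ∧
      l2 L (deriv (vec φ n (x t).2)) ≤ K := by
  have H := hx.bounds t ht
  have := H.l2_a
  rw [deriv_shift] at this
  exact ⟨this, H.l2_c⟩

/-- The increment of the height, frozen in time, is an admissible test function `ψ`, and the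
increment of the moment against it is `‖ψ‖²`. The rate of that moment is `∫ J ψ_x`, controlled by
the square root of the dissipation since `‖ψ_x‖ ≤ 2 K`. -/
lemma IsBoundedFlow.height_l2_le (hL : 0 < L) (hφ : IsLaplaceEigenbasis L φ)
    (hg : IsRegularization ε g) (hε : 0 < ε) (hB : EnergyBarrier L κ A K e m X₀ X₁ m₁ φ n)
    (hx : IsBoundedFlow L ε κ A K e φ g n T x) {s t : ℝ} (hs : s ∈ Icc 0 T) (ht : t ∈ Icc 0 T)
    (hst : s ≤ t) :
    l2 L (fun y => vec φ n (x t).1 y - vec φ n (x s).1 y) ^ 2 ≤ heightMod K e T (t - s) := by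
  have hK := (hx.bounds t ht).two_le
  set ψ := fun y => vec φ n (x t).1 y - vec φ n (x s).1 y with hψ
  have hψV : ψ ∈ galerkinSpace φ n := vec_sub_mem φ n _ _
  have sψ : SmoothPeriodic L ψ := (hφ.smooth_vec _).sub (hφ.smooth_vec _)
  have dψ : l2 L (deriv ψ) ≤ 2 * K :=
    l2_deriv_sub_le hL hφ (hx.l2_deriv_le ht).1 (hx.l2_deriv_le hs).1
  have n1 : 0 ≤ l2 L (deriv ψ) := l2_nonneg
  have h1 := sub_le_sqrt_of_dissipation (f := fun τ => mass L φ n ψ (x τ))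
    (F := fun τ => lyapunov L φ g κ A n (x τ)) (T := T) (B := 4 * K ^ 4) (e := e) (by positivity)
    ((contDiff_mass hφ sψ).continuous.comp_continuousOn hx.cont)
    ((continuous_lyapunov hφ hg hε).comp_continuousOn hx.cont)
    (fun τ hτ => hx.lyapunov_nonneg hL hφ hg hB hτ) hx.lyap (fun τ hτ => ?_) hs ht hst
  · refine le_of_eq_of_le ?_ h1
    have c1 := (hφ.smooth_vec (x t).1).continuous
    have c2 := (hφ.smooth_vec (x s).1).continuous
    have c3 := sψ.continuous
    rw [sq_l2 hL.le, mass, mass, ← integral_sub_of_continuous (by fun_prop) (by fun_prop)]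
    congr 1
    ext y
    rw [hψ]
    ring
  · have hτ' : τ ∈ Icc 0 T := ⟨hτ.1.le, hτ.2.le⟩
    have H := hx.bounds τ hτ'
    obtain ⟨x', hx', hv⟩ := hx.vel τ hτ (hx.pos τ hτ') H
    refine ⟨_, _, _, hasDerivAt_mass hφ sψ hx', hasDerivAt_lyapunov hφ hg hε hx' (hx.pos τ hτ') hv,
      ?_, hB.rate ε (x τ) x' H hv⟩
    rw [hv.eq_a ψ hψV]
    have cf := (smoothPeriodic_flux H.smooth_a H.smooth_c H.pos).continuous
    have h2 := abs_integral_mul_le hL.le cf sψ.deriv.continuous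
    have h3 := (H.l2_flux_le_dissipation hL).1
    have hD := H.dissipation_nonneg hL
    rw [← sq_abs]
    calc _ ≤ (l2 L (flux (fun y => vec φ n (x τ).1 y + ε) (vec φ n (x τ).2)) * l2 L (deriv ψ)) ^ 2 :=
          pow_le_pow_left₀ (abs_nonneg _) h2 2
      _ = l2 L (flux (fun y => vec φ n (x τ).1 y + ε) (vec φ n (x τ).2)) ^ 2 * l2 L (deriv ψ) ^ 2 :=
          mul_pow _ _ _
      _ ≤ (K ^ 3 * dissipation L (fun y => vec φ n (x τ).1 y + ε) (vec φ n (x τ).2))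
          * (2 * K) ^ 2 := by gcongr
      _ = (4 * K ^ 5) * dissipation L (fun y => vec φ n (x τ).1 y + ε) (vec φ n (x τ).2) := by ring
      _ ≤ _ := by
          gcongr
          have : K ^ 5 ≤ K ^ 8 := pow_le_pow_right₀ (by linarith) (by norm_num)
          calc 4 * K ^ 5 ≤ 16 * K ^ 8 := by gcongr; norm_num
            _ = (4 * K ^ 4) ^ 2 := by ring

/-- As for the height, but the equation controls the product `a c`; the increment of `a` enters as
an error, which accounts for the square root of the height modulus. -/
lemma IsBoundedFlow.conc_l2_le (hL : 0 < L) (hφ : IsLaplaceEigenbasis L φ)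
    (hg : IsRegularization ε g) (hε : 0 < ε) (hB : EnergyBarrier L κ A K e m X₀ X₁ m₁ φ n)
    (hx : IsBoundedFlow L ε κ A K e φ g n T x) {s t : ℝ} (hs : s ∈ Icc 0 T) (ht : t ∈ Icc 0 T)
    (hst : s ≤ t) :
    l2 L (fun y => vec φ n (x t).2 y - vec φ n (x s).2 y) ^ 2 ≤ concMod L K e T (t - s) := by
  have Ht := hx.bounds t ht
  have Hs := hx.bounds s hs
  have hK := Ht.two_le
  have hK0 : 0 < K := by linarith
  set ψ := fun y => vec φ n (x t).2 y - vec φ n (x s).2 y with hψ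
  have hψV : ψ ∈ galerkinSpace φ n := vec_sub_mem φ n _ _
  have sψ : SmoothPeriodic L ψ := (hφ.smooth_vec _).sub (hφ.smooth_vec _)
  have dψ : l2 L (deriv ψ) ≤ 2 * K :=
    l2_deriv_sub_le hL hφ (hx.l2_deriv_le ht).2 (hx.l2_deriv_le hs).2
  have n1 : 0 ≤ l2 L (deriv ψ) := l2_nonneg
  have c1 := (hφ.smooth_vec (x t).1).continuous
  have c2 := (hφ.smooth_vec (x s).1).continuous
  have c3 := sψ.continuous
  have c4 := (hφ.smooth_vec (x t).2).continuous
  have c5 := (hφ.smooth_vec (x s).2).continuous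
  have h1 := sub_le_sqrt_of_dissipation (f := fun τ => moment L φ g n ψ (x τ))
    (F := fun τ => lyapunov L φ g κ A n (x τ)) (T := T) (B := 4 * K ^ 4) (e := e) (by positivity)
    ((contDiff_moment hφ hg sψ).continuous.comp_continuousOn hx.cont)
    ((continuous_lyapunov hφ hg hε).comp_continuousOn hx.cont)
    (fun τ hτ => hx.lyapunov_nonneg hL hφ hg hB hτ) hx.lyap (fun τ hτ => ?_) hs ht hst
  · rw [moment_eq hg ψ (hx.pos t ht), moment_eq hg ψ (hx.pos s hs)] at h1
    have k1 := hx.height_l2_le hL hφ hg hε hB hs ht hst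
    set q := heightMod K e T (t - s) with hq
    have e1 : (∫ y in (0 : ℝ)..L, (vec φ n (x t).1 y + ε) * ψ y ^ 2)
        = ((∫ y in (0 : ℝ)..L, (vec φ n (x t).1 y + ε) * vec φ n (x t).2 y * ψ y)
          - ∫ y in (0 : ℝ)..L, (vec φ n (x s).1 y + ε) * vec φ n (x s).2 y * ψ y)
          - ∫ y in (0 : ℝ)..L, (vec φ n (x t).1 y - vec φ n (x s).1 y)
            * (vec φ n (x s).2 y * ψ y) := by
      rw [← integral_sub_of_continuous (by fun_prop) (by fun_prop),
        ← integral_sub_of_continuous (by fun_prop) (by fun_prop)]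
      congr 1
      ext y
      rw [hψ]
      ring
    have e2 : K⁻¹ * l2 L ψ ^ 2 ≤ ∫ y in (0 : ℝ)..L, (vec φ n (x t).1 y + ε) * ψ y ^ 2 := by
      rw [sq_l2 hL.le, ← intervalIntegral.integral_const_mul]
      refine intervalIntegral.integral_mono_on hL.le
        (Continuous.intervalIntegrable (by fun_prop) _ _)
        (Continuous.intervalIntegrable (by fun_prop) _ _) fun y _ => ?_
      exact mul_le_mul_of_nonneg_right (Ht.inv_le y) (sq_nonneg _)
    have e3 : |∫ y in (0 : ℝ)..L, (vec φ n (x t).1 y - vec φ n (x s).1 y)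
        * (vec φ n (x s).2 y * ψ y)| ≤ √q * (2 * K ^ 2 * √L) := by
      refine (abs_integral_mul_le hL.le (u := fun y => vec φ n (x t).1 y - vec φ n (x s).1 y)
        (v := fun y => vec φ n (x s).2 y * ψ y) (by fun_prop) (by fun_prop)).trans ?_
      have k2 : l2 L (fun y => vec φ n (x t).1 y - vec φ n (x s).1 y) ≤ √q := by
        rw [← Real.sqrt_sq (l2_nonneg (L := L)
          (u := fun y => vec φ n (x t).1 y - vec φ n (x s).1 y))]
        exact Real.sqrt_le_sqrt k1
      have k3 : l2 L (fun y => vec φ n (x s).2 y * ψ y) ≤ 2 * K ^ 2 * √L := by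
        have k4 := l2_le_mul_of_abs_le hL.le (u := fun y => vec φ n (x s).2 y * ψ y) (by fun_prop)
          (continuous_const (y := (1 : ℝ))) (C := 2 * K ^ 2) (by positivity) fun y => by
            rw [abs_one, mul_one, abs_mul]
            have k5 : |ψ y| ≤ 2 * K := (abs_sub _ _).trans (by
              have := Ht.abs_c_le y
              have := Hs.abs_c_le y
              linarith)
            calc _ ≤ K * (2 * K) := mul_le_mul (Hs.abs_c_le y) k5 (abs_nonneg _) hK0.le
              _ = _ := by ring
        rwa [l2_const hL.le zero_le_one, mul_one] at k4
      exact mul_le_mul k2 k3 l2_nonneg (Real.sqrt_nonneg _)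
    have e4 := neg_le_abs (∫ y in (0 : ℝ)..L, (vec φ n (x t).1 y - vec φ n (x s).1 y)
        * (vec φ n (x s).2 y * ψ y))
    have e5 : K⁻¹ * l2 L ψ ^ 2 ≤ q + 2 * K ^ 2 * √L * √q := by
      have : 4 * K ^ 4 * (e + T + 1) * √(t - s) = q := rfl
      linarith
    rwa [inv_mul_le_iff₀ hK0] at e5
  · have hτ' : τ ∈ Icc 0 T := ⟨hτ.1.le, hτ.2.le⟩
    have H := hx.bounds τ hτ'
    obtain ⟨x', hx', hv⟩ := hx.vel τ hτ (hx.pos τ hτ') H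
    refine ⟨_, _, _, hasDerivAt_moment hφ hg sψ hx' (hx.pos τ hτ'),
      hasDerivAt_lyapunov hφ hg hε hx' (hx.pos τ hτ') hv, ?_, hB.rate ε (x τ) x' H hv⟩
    rw [hv.eq_c ψ hψV]
    set a := fun y => vec φ n (x τ).1 y + ε with ha
    set c := vec φ n (x τ).2 with hc
    have k1 := (smoothPeriodic_flux H.smooth_a H.smooth_c H.pos).continuous
    have k2 := (smoothPeriodic_pot H.smooth_a H.smooth_c H.pos).deriv.continuous
    have k3 := H.smooth_a.continuous
    have k4 := H.smooth_c.continuous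
    have h2 := abs_integral_mul_le hL.le (u := fun y => c y * flux a c y - a y * deriv (pot a c) y)
      (by fun_prop) sψ.deriv.continuous
    obtain ⟨h3, h4⟩ := H.l2_flux_le_dissipation hL
    have hD := H.dissipation_nonneg hL
    have h5 := l2_mul_le hL.le k4 k1 H.abs_c_le
    have h6 := l2_mul_le hL.le k3 k2 fun y => by rw [abs_of_pos (H.pos y)]; exact H.le y
    have h7 := l2_sub_le hL.le (u := fun y => c y * flux a c y)
      (v := fun y => a y * deriv (pot a c) y) (by fun_prop) (by fun_prop)
    have h8 : l2 L (fun y => c y * flux a c y - a y * deriv (pot a c) y) ^ 2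
        ≤ 4 * K ^ 5 * dissipation L a c := by
      set D := dissipation L a c
      have h9 : l2 L (fun y => c y * flux a c y - a y * deriv (pot a c) y)
          ≤ K * (l2 L (flux a c) + l2 L (deriv (pot a c))) := by linarith
      have h10 : K * D ≤ K ^ 3 * D := by gcongr; exact le_self_pow₀ (by linarith) (by norm_num)
      calc _ ≤ (K * (l2 L (flux a c) + l2 L (deriv (pot a c)))) ^ 2 :=
            pow_le_pow_left₀ l2_nonneg h9 2
        _ = K ^ 2 * (l2 L (flux a c) + l2 L (deriv (pot a c))) ^ 2 := by ring
        _ ≤ K ^ 2 * (2 * (l2 L (flux a c) ^ 2 + l2 L (deriv (pot a c)) ^ 2)) := by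
            gcongr; exact add_sq_le
        _ ≤ K ^ 2 * (2 * (K ^ 3 * D + K ^ 3 * D)) := by gcongr; exact h4.trans h10
        _ = _ := by ring
    rw [← sq_abs]
    calc _ ≤ (l2 L (fun y => c y * flux a c y - a y * deriv (pot a c) y) * l2 L (deriv ψ)) ^ 2 :=
          pow_le_pow_left₀ (abs_nonneg _) h2 2
      _ = l2 L (fun y => c y * flux a c y - a y * deriv (pot a c) y) ^ 2 * l2 L (deriv ψ) ^ 2 :=
          mul_pow _ _ _
      _ ≤ (4 * K ^ 5 * dissipation L a c) * (2 * K) ^ 2 := by gcongr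
      _ = 16 * K ^ 7 * dissipation L a c := by ring
      _ ≤ _ := by
          gcongr
          have : K ^ 7 ≤ K ^ 8 := pow_le_pow_right₀ (by linarith) (by norm_num)
          calc 16 * K ^ 7 ≤ 16 * K ^ 8 := by gcongr
            _ = (4 * K ^ 4) ^ 2 := by ring

/-- From moduli of continuity in `L²` to pointwise ones. -/
lemma isEquiregular_of_l2 (hL : 0 < L) {u : ℝ → ℝ → ℝ} {q : ℝ → ℝ} (hK : 0 ≤ K)
    (hu : ∀ t ∈ Icc 0 T, SmoothPeriodic L (u t)) (hb : ∀ t ∈ Icc 0 T, ∀ y, |u t y| ≤ K)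
    (hd : ∀ t ∈ Icc 0 T, l2 L (deriv (u t)) ≤ K)
    (hq : ∀ s ∈ Icc 0 T, ∀ t ∈ Icc 0 T, s ≤ t → l2 L (fun y => u t y - u s y) ^ 2 ≤ q (t - s)) :
    IsEquiregular L T K (fun τ => √(q τ / L + 4 * K * √(q τ)) + K * √τ) u := by
  refine ⟨fun t ht => (hu t ht).periodic, hb, ?_⟩
  have time : ∀ s ∈ Icc 0 T, ∀ t ∈ Icc 0 T, s ≤ t → ∀ y,
      |u t y - u s y| ≤ √(q (t - s) / L + 4 * K * √(q (t - s))) := by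
    intro s hs t ht hst y
    have h1 := hq s hs t ht hst
    have sψ := (hu t ht).sub (hu s hs)
    have h2 := sq_le_of_l2 hL sψ y
    have e : deriv (fun y => u t y - u s y) = fun y => deriv (u t) y - deriv (u s) y :=
      funext fun y => (((hu t ht).hasDerivAt y).fun_sub ((hu s hs).hasDerivAt y)).deriv
    have h3 : l2 L (deriv fun y => u t y - u s y) ≤ 2 * K := by
      rw [e]
      have := l2_sub_le hL.le (hu t ht).deriv.continuous (hu s hs).deriv.continuous
      linarith [hd t ht, hd s hs]
    have h4 : l2 L (fun y => u t y - u s y) ≤ √(q (t - s)) := by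
      rw [← Real.sqrt_sq (l2_nonneg (L := L) (u := fun y => u t y - u s y))]
      exact Real.sqrt_le_sqrt h1
    apply Real.abs_le_sqrt
    refine h2.trans ?_
    have h5 : l2 L (fun y => u t y - u s y) ^ 2 / L ≤ q (t - s) / L := by gcongr
    have h6 : l2 L (fun y => u t y - u s y) * l2 L (deriv fun y => u t y - u s y)
        ≤ √(q (t - s)) * (2 * K) := mul_le_mul h4 h3 l2_nonneg (Real.sqrt_nonneg _)
    linarith
  intro s hs t ht y hy z hz
  have h1 : |u s y - u t y| ≤ √(q |s - t| / L + 4 * K * √(q |s - t|)) := by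
    rcases le_total s t with h | h
    · have := time s hs t ht h y
      rwa [abs_sub_comm, abs_sub_comm s, abs_of_nonneg (sub_nonneg.2 h)]
    · have := time t ht s hs h y
      rwa [abs_of_nonneg (sub_nonneg.2 h)]
  have h2 : |u t y - u t z| ≤ K * √|y - z| :=
    (abs_sub_le_sqrt (hu t ht) hy hz).trans (by gcongr; exact hd t ht)
  have h3 := abs_sub_le (u s y) (u t y) (u t z)
  have h4 : 0 ≤ K * √|s - t| := by positivity
  have h5 : 0 ≤ √(q |y - z| / L + 4 * K * √(q |y - z|)) := Real.sqrt_nonneg _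
  linarith

/-- The modulus built from the concentration also serves for the height, since `K ≥ 2` makes it the
larger one. It depends on neither `n` nor `ε`. -/
lemma IsBoundedFlow.isEquiregular (hL : 0 < L) (hφ : IsLaplaceEigenbasis L φ)
    (hg : IsRegularization ε g) (hε : 0 < ε) (hT : 0 < T)
    (hB : EnergyBarrier L κ A K e m X₀ X₁ m₁ φ n)
    (hx : IsBoundedFlow L ε κ A K e φ g n T x) :
    IsEquiregular L T K (spaceTimeMod L K e T) (fun t => vec φ n (x t).1) ∧
    IsEquiregular L T K (spaceTimeMod L K e T) (fun t => vec φ n (x t).2) := by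
  have h0 : (0 : ℝ) ∈ Icc 0 T := ⟨le_rfl, hT.le⟩
  have hK := (hx.bounds 0 h0).two_le
  have hee := (hx.lyapunov_nonneg hL hφ hg hB h0).trans (hx.lyap 0 h0)
  constructor
  · refine isEquiregular_of_l2 hL (by linarith) (fun t _ => hφ.smooth_vec _) (fun t ht y => ?_)
      (fun t ht => (hx.l2_deriv_le ht).1) fun s hs t ht hst => ?_
    · rw [abs_of_pos (hx.pos t ht y)]
      have := (hx.bounds t ht).le y
      linarith
    · refine (hx.height_l2_le hL hφ hg hε hB hs ht hst).trans ?_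
      have h1 : 0 ≤ heightMod K e T (t - s) := by unfold heightMod; positivity
      unfold concMod
      have h2 : 0 ≤ 2 * K ^ 2 * √L * √(heightMod K e T (t - s)) := by positivity
      nlinarith
  · exact isEquiregular_of_l2 hL (by linarith) (fun t _ => hφ.smooth_vec _)
      (fun t ht => (hx.bounds t ht).abs_c_le) (fun t ht => (hx.l2_deriv_le ht).2)
      fun s hs t ht hst => hx.conc_l2_le hL hφ hg hε hB hs ht hst

end Flow


/-! ## Compactness -/

section Compactness

variable {L T B : ℝ} {m : ℝ → ℝ}

lemma UniformLimit.apply {u : ℕ → ℝ → ℝ → ℝ} {v : ℝ → ℝ → ℝ} (h : UniformLimit T u v) {t : ℝ}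
    (ht : t ∈ Icc 0 T) (x : ℝ) : Tendsto (fun k => u k t x) atTop (𝓝 (v t x)) :=
  TendstoUniformlyOn.tendsto_at (x := (t, x)) h ⟨ht, mem_univ x⟩

lemma UniformLimit.comp {u : ℕ → ℝ → ℝ → ℝ} {v : ℝ → ℝ → ℝ} (h : UniformLimit T u v) {σ : ℕ → ℕ}
    (hσ : StrictMono σ) : UniformLimit T (fun k => u (σ k)) v := by
  intro U hU
  exact hσ.tendsto_atTop.eventually (h U hU)

lemma UniformLimit.isEquiregular {u : ℕ → ℝ → ℝ → ℝ} {v : ℝ → ℝ → ℝ} (h : UniformLimit T u v)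
    (hu : ∀ k, IsEquiregular L T B m (u k)) : IsEquiregular L T B m v where
  periodic t ht x := tendsto_nhds_unique (h.apply ht (x + L))
    (by simpa only [((hu _).periodic t ht) x] using h.apply ht x)
  bound t ht x := le_of_tendsto' (h.apply ht x).abs fun k => (hu k).bound t ht x
  modulus s hs t ht x hx y hy := le_of_tendsto' ((h.apply hs x).sub (h.apply ht y)).abs fun k =>
    (hu k).modulus s hs t ht x hx y hy

/-- The points of space-time over one period. -/
abbrev Cell (L T : ℝ) : Type := ↥(Icc (0 : ℝ) T ×ˢ Icc (0 : ℝ) L)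

lemma IsEquiregular.uniform_bound (hm : Tendsto m (𝓝 0) (𝓝 0)) {ε : ℝ} (hε : 0 < ε) :
    ∃ δ > 0, ∀ u : ℝ → ℝ → ℝ, IsEquiregular L T B m u → ∀ p q : Cell L T, dist p q < δ →
      dist (u p.1.1 p.1.2) (u q.1.1 q.1.2) < ε := by
  obtain ⟨δ, hδ, h⟩ := Metric.tendsto_nhds_nhds.1 hm (ε / 2) (half_pos hε)
  refine ⟨δ, hδ, fun u hu p q hpq => ?_⟩
  have h1 := hu.modulus p.1.1 p.2.1 q.1.1 q.2.1 p.1.2 p.2.2 q.1.2 q.2.2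
  have h2 : dist p.1 q.1 < δ := hpq
  rw [Prod.dist_eq, max_lt_iff] at h2
  have key : ∀ r : ℝ, 0 ≤ r → r < δ → m r < ε / 2 := fun r hr hrδ => by
    have h3 := h (x := r) (by rwa [Real.dist_eq, sub_zero, abs_of_nonneg hr])
    rw [Real.dist_eq, sub_zero] at h3
    exact (le_abs_self _).trans_lt h3
  have h4 := key _ (abs_nonneg _) h2.1
  have h5 := key _ (abs_nonneg _) h2.2
  rw [Real.dist_eq]
  linarith

/-- Equiregular sequences have uniformly convergent subsequences. -/
theorem exists_uniformLimit (hL : 0 < L) (hm : Tendsto m (𝓝 0) (𝓝 0)) {u : ℕ → ℝ → ℝ → ℝ}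
    (hu : ∀ k, IsEquiregular L T B m (u k)) :
    ∃ (σ : ℕ → ℕ) (v : ℝ → ℝ → ℝ), StrictMono σ ∧ UniformLimit T (fun k => u (σ k)) v ∧
      IsEquiregular L T B m v := by
  have : CompactSpace (Cell L T) := isCompact_iff_compactSpace.1 (isCompact_Icc.prod isCompact_Icc)
  have hcont : ∀ k, Continuous fun p : Cell L T => u k p.1.1 p.1.2 := fun k => by
    rw [Metric.continuous_iff]
    intro p ε hε
    obtain ⟨δ, hδ, h⟩ := IsEquiregular.uniform_bound (L := L) (T := T) (B := B) hm hε
    exact ⟨δ, hδ, fun q hq => h (u k) (hu k) q p hq⟩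
  let f : ℕ → BoundedContinuousFunction (Cell L T) ℝ := fun k =>
    BoundedContinuousFunction.mkOfCompact ⟨_, hcont k⟩
  have hf : ∀ k (p : Cell L T), f k p = u k p.1.1 p.1.2 := fun _ _ => rfl
  have hcompact : IsCompact (closure (range f)) := by
    refine BoundedContinuousFunction.arzela_ascoli (Icc (-B) B) isCompact_Icc _ ?_ ?_
    · rintro _ p ⟨k, rfl⟩
      exact abs_le.1 ((hu k).bound _ p.2.1 _)
    · intro p
      rw [Metric.equicontinuousAt_iff]
      intro ε hε
      obtain ⟨δ, hδ, h⟩ := IsEquiregular.uniform_bound (L := L) (T := T) (B := B) hm hε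
      refine ⟨δ, hδ, fun q hq => ?_⟩
      rintro ⟨_, k, rfl⟩
      rw [dist_comm] at hq
      exact h (u k) (hu k) p q hq
  obtain ⟨F, -, σ, hσ, hlim⟩ := hcompact.tendsto_subseq fun k => subset_closure (mem_range_self (f := f) k)
  have hmod : ∀ x, toIcoMod hL 0 x ∈ Icc 0 L := fun x => by
    have := toIcoMod_mem_Ico hL 0 x
    rw [zero_add] at this
    exact ⟨this.1, this.2.le⟩
  classical
  -- Periodic extension of the limit on one cell; the value outside the time interval is irrelevant.
  let v : ℝ → ℝ → ℝ := fun t x => if ht : t ∈ Icc 0 T then F ⟨(t, toIcoMod hL 0 x), ht, hmod x⟩ else 0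
  have hv : UniformLimit T (fun k => u (σ k)) v := by
    rw [UniformLimit, Metric.tendstoUniformlyOn_iff]
    intro ε hε
    have h1 := Metric.tendstoUniformly_iff.1
      (BoundedContinuousFunction.tendsto_iff_tendstoUniformly.1 hlim) ε hε
    filter_upwards [h1] with k hk
    rintro ⟨t, x⟩ ⟨ht, -⟩
    have h2 := hk ⟨(t, toIcoMod hL 0 x), ht, hmod x⟩
    have h3 : u (σ k) t (toIcoMod hL 0 x) = u (σ k) t x := by
      rw [toIcoMod]
      exact ((hu (σ k)).periodic t ht).sub_zsmul_eq _
    simp only [Function.comp, hf, h3] at h2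
    simp only [v, dif_pos (show t ∈ Icc 0 T from ht)]
    exact h2
  exact ⟨σ, v, hσ, hv, hv.isEquiregular fun k => hu (σ k)⟩

/-- Pairs of equiregular sequences have a common uniformly convergent subsequence. -/
lemma exists_uniformLimit_pair (hL : 0 < L) (hm : Tendsto m (𝓝 0) (𝓝 0))
    {u w : ℕ → ℝ → ℝ → ℝ} (hu : ∀ k, IsEquiregular L T B m (u k))
    (hw : ∀ k, IsEquiregular L T B m (w k)) :
    ∃ (σ : ℕ → ℕ) (v z : ℝ → ℝ → ℝ), StrictMono σ ∧ UniformLimit T (fun k => u (σ k)) v ∧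
      UniformLimit T (fun k => w (σ k)) z ∧ IsEquiregular L T B m v ∧ IsEquiregular L T B m z := by
  obtain ⟨σ, v, hσ, h1, h2⟩ := exists_uniformLimit hL hm hu
  obtain ⟨τ, z, hτ, h3, h4⟩ := exists_uniformLimit hL hm fun k => hw (σ k)
  exact ⟨σ ∘ τ, v, z, hσ.comp hτ, h1.comp hτ, h3, h2, h4⟩

end Compactness

/-! ## The regularised entropy and the lower bound -/

lemma setIntegral_Ioi_inv_pow_four {s ε : ℝ} (h : 0 < s + ε) :
    ∫ r in Ioi s, 1 / (r + ε) ^ 4 = 1 / (3 * (s + ε) ^ 3) := by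
  have hd : ∀ r ∈ Ioi s, HasDerivAt (fun r => -(1 / (3 * (r + ε) ^ 3))) (1 / (r + ε) ^ 4) r := by
    intro r hr
    have hr0 : r + ε ≠ 0 := by have : s < r := hr; linarith
    have h1 := ((((hasDerivAt_id r).add_const ε).fun_pow 3).const_mul 3).fun_inv
      (show 3 * (id r + ε) ^ 3 ≠ 0 from mul_ne_zero three_ne_zero (pow_ne_zero 3 hr0))
    have h2 := h1.fun_neg
    simp only [id, one_div] at h2 ⊢
    refine h2.congr_deriv ?_
    push_cast
    field_simp
  have hc : ContinuousWithinAt (fun r => -(1 / (3 * (r + ε) ^ 3))) (Ici s) s := by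
    have : ContinuousAt (fun r => -(1 / (3 * (r + ε) ^ 3))) s := by
      refine (ContinuousAt.div continuousAt_const (by fun_prop) ?_).neg
      positivity
    exact this.continuousWithinAt
  have hl : Tendsto (fun r => -(1 / (3 * (r + ε) ^ 3))) atTop (𝓝 (-0)) := by
    refine Tendsto.neg ?_
    refine Tendsto.div_atTop tendsto_const_nhds ?_
    refine Tendsto.const_mul_atTop three_pos ?_
    exact (tendsto_pow_atTop three_ne_zero).comp (tendsto_atTop_add_const_right _ _ tendsto_id)
  rw [integral_Ioi_of_hasDerivAt_of_nonneg hc hd (fun r _ => by positivity) hl]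
  ring

lemma setIntegral_Ioi_inv_pow_three {s ε : ℝ} (h : 0 < s + ε) :
    ∫ r in Ioi s, 1 / (3 * (r + ε) ^ 3) = 1 / (6 * (s + ε) ^ 2) := by
  have hd : ∀ r ∈ Ioi s, HasDerivAt (fun r => -(1 / (6 * (r + ε) ^ 2))) (1 / (3 * (r + ε) ^ 3)) r := by
    intro r hr
    have hr0 : r + ε ≠ 0 := by have : s < r := hr; linarith
    have h1 := ((((hasDerivAt_id r).add_const ε).fun_pow 2).const_mul 6).fun_inv
      (show 6 * (id r + ε) ^ 2 ≠ 0 from mul_ne_zero (by norm_num) (pow_ne_zero 2 hr0))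
    have h2 := h1.fun_neg
    simp only [id, one_div] at h2 ⊢
    refine h2.congr_deriv ?_
    push_cast
    field_simp
    norm_num
  have hc : ContinuousWithinAt (fun r => -(1 / (6 * (r + ε) ^ 2))) (Ici s) s := by
    have : ContinuousAt (fun r => -(1 / (6 * (r + ε) ^ 2))) s := by
      refine (ContinuousAt.div continuousAt_const (by fun_prop) ?_).neg
      positivity
    exact this.continuousWithinAt
  have hl : Tendsto (fun r => -(1 / (6 * (r + ε) ^ 2))) atTop (𝓝 (-0)) := by
    refine Tendsto.neg ?_
    refine Tendsto.div_atTop tendsto_const_nhds ?_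
    refine Tendsto.const_mul_atTop (by norm_num) ?_
    exact (tendsto_pow_atTop two_ne_zero).comp (tendsto_atTop_add_const_right _ _ tendsto_id)
  rw [integral_Ioi_of_hasDerivAt_of_nonneg hc hd (fun r hr => by
    have : 0 < r + ε := by have : s < r := hr; linarith
    positivity) hl]
  ring

/-- The entropy density on nonnegative heights. -/
lemma IsRegularization.G_eq {ε : ℝ} {g : ℝ → ℝ} (hg : IsRegularization ε g) (hε : 0 < ε) {s : ℝ}
    (hs : 0 ≤ s) : G g s = 1 / (6 * (s + ε) ^ 2) := by
  have h1 : ∀ r, 0 ≤ r → Gtilde g r = -(1 / (3 * (r + ε) ^ 3)) := fun r hr => by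
    rw [Gtilde, ← setIntegral_Ioi_inv_pow_four (by linarith)]
    congr 1
    refine setIntegral_congr_fun measurableSet_Ioi fun q hq => ?_
    have : r < q := hq
    simp only [mobility]
    rw [hg.eq_add q (by linarith)]
    ring
  rw [G, ← setIntegral_Ioi_inv_pow_three (by linarith : 0 < s + ε), ← integral_neg]
  refine setIntegral_congr_fun measurableSet_Ioi fun q hq => ?_
  have : s < q := hq
  rw [h1 q (by linarith), neg_neg]

lemma lowerBound_pos {L k₁ k₄ : ℝ} (hL : 0 < L) (h₁ : 0 < k₁) (h₄ : 0 < k₄) :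
    0 < lowerBound L k₁ k₄ := by
  have he : 0 < Real.exp (k₄ * k₁ ^ 2) - 1 := by
    have := Real.add_one_lt_exp (x := k₄ * k₁ ^ 2) (by positivity)
    have : 0 < k₄ * k₁ ^ 2 := by positivity
    linarith
  have h2 : √(k₁ ^ 2 * L) < √(k₁ ^ 2 * L + k₁ ^ 2 * L / (Real.exp (k₄ * k₁ ^ 2) - 1)) := by
    apply Real.sqrt_lt_sqrt (by positivity)
    have : 0 < k₁ ^ 2 * L / (Real.exp (k₄ * k₁ ^ 2) - 1) := by positivity
    linarith
  rw [Real.sqrt_mul (by positivity), Real.sqrt_sq h₁.le] at h2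
  unfold lowerBound
  linarith

/-- From `exp x - 1 ≥ x` and the subadditivity of the square root. The right-hand side does not
involve `k₁` and tends to zero as `k₄` grows. -/
lemma lowerBound_le {L k₁ k₄ : ℝ} (hL : 0 < L) (h₁ : 0 < k₁) (h₄ : 0 < k₄) :
    lowerBound L k₁ k₄ ≤ √(L / k₄) := by
  have he : k₄ * k₁ ^ 2 ≤ Real.exp (k₄ * k₁ ^ 2) - 1 := by
    have := Real.add_one_le_exp (k₄ * k₁ ^ 2)
    linarith
  have h2 : k₁ ^ 2 * L / (Real.exp (k₄ * k₁ ^ 2) - 1) ≤ L / k₄ := by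
    calc k₁ ^ 2 * L / (Real.exp (k₄ * k₁ ^ 2) - 1) ≤ k₁ ^ 2 * L / (k₄ * k₁ ^ 2) := by gcongr
      _ = L / k₄ := by field_simp
  have h3 : √(k₁ ^ 2 * L + k₁ ^ 2 * L / (Real.exp (k₄ * k₁ ^ 2) - 1)) ≤ k₁ * √L + √(L / k₄) := by
    refine (Real.sqrt_le_sqrt (add_le_add_right h2 _)).trans ?_
    rw [Real.sqrt_le_iff]
    refine ⟨by positivity, ?_⟩
    have h5 := Real.sq_sqrt hL.le
    have h6 := Real.sq_sqrt (show 0 ≤ L / k₄ by positivity)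
    have h7 : 0 ≤ 2 * (k₁ * √L) * √(L / k₄) := by positivity
    rw [add_sq, mul_pow, h5, h6]
    linarith
  unfold lowerBound
  linarith


/-! ## Uniform bounds for Galerkin approximations and their limits -/

/-- The coefficients of the projected initial data. -/
noncomputable def initialState (L : ℝ) (φ : ℕ → ℝ → ℝ) (h₀ c₀ : ℝ → ℝ) (n : ℕ) : State n :=
  (fun i => coeff L φ h₀ i, fun i => coeff L φ c₀ i)

lemma vec_coeff (L : ℝ) (φ : ℕ → ℝ → ℝ) (u : ℝ → ℝ) (n : ℕ) :
    vec φ n (fun i => coeff L φ u i) = partialSum L φ n u := by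
  ext x
  rw [vec, partialSum, Finset.sum_range]
  rfl

/-- Initial states below the barrier. -/
structure IsAdmissible (L ε κ A e X₀ X₁ m₁ : ℝ) (φ : ℕ → ℝ → ℝ) (g : ℝ → ℝ) (n : ℕ)
    (z : State n) : Prop where
  pos : ∀ y, 0 < vec φ n z.1 y
  lyap_lt : lyapunov L φ g κ A n z < e
  le_mass : X₀ ≤ mass L φ n (fun _ => 1) z + ε * L
  mass_le : mass L φ n (fun _ => 1) z + ε * L ≤ X₁
  moment_le : |moment L φ g n (fun _ => 1) z| ≤ m₁

section

variable {L ε κ A K e m X₀ X₁ m₁ T : ℝ} {φ : ℕ → ℝ → ℝ} {g h₀ c₀ : ℝ → ℝ} {n : ℕ}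

lemma EnergyBarrier.isBoundedFlow (hL : 0 < L) (hφ : IsLaplaceEigenbasis L φ)
    (hg : IsRegularization ε g) (hε : 0 < ε) (hεm : ε < m)
    (hB : EnergyBarrier L κ A K e m X₀ X₁ m₁ φ n) {x : ℝ → State n}
    (hx : IsConditionalFlow L ε K φ n T x) (h : IsAdmissible L ε κ A e X₀ X₁ m₁ φ g n (x 0)) :
    IsBoundedFlow L ε κ A K e φ g n T x ∧ ∀ t ∈ Icc 0 T, ∀ y, m ≤ vec φ n (x t).1 y + ε := by
  have hc := hB.confined hL hφ hg hε hεm hx h.pos h.lyap_lt h.le_mass h.mass_le h.moment_le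
  have hp : ∀ t ∈ Icc 0 T, ∀ y, 0 < vec φ n (x t).1 y := fun t ht y => by
    have := (hc t ht).height y
    linarith
  refine ⟨⟨hx, hp, fun t ht => ?_, fun t ht => (hc t ht).lyap⟩, fun t ht => (hc t ht).height⟩
  refine hB.bounds_of_lt hφ hg hε (hp t ht) ((hc t ht).lyap.trans_lt (by linarith)) ?_
  rw [(hc t ht).mass]
  linarith [h.mass_le]

lemma IsGalerkinSolution.toState_zero {η γ : ℕ → ℝ → ℝ}
    (h : IsGalerkinSolution L φ g h₀ c₀ n T η γ) :
    toState n η γ 0 = initialState L φ h₀ c₀ n :=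
  Prod.ext (funext fun i => h.init_h i (Nat.lt_succ_iff.1 i.2))
    (funext fun i => h.init_c i (Nat.lt_succ_iff.1 i.2))

end

/-- The constants for given initial data. -/
theorem exists_barrier_constants {L : ℝ} (hL : 0 < L) {h₀ c₀ : ℝ → ℝ} (hh : PeriodicC1 L h₀)
    (hc : PeriodicC1 L c₀) (hpos : ∀ x, 0 < h₀ x) :
    ∃ e m K A X₀ X₁ m₁ : ℝ, 0 < e ∧ 0 < m ∧ ∀ φ : ℕ → ℝ → ℝ, IsLaplaceEigenbasis L φ →
      ∃ (κ : ℝ) (n₀ : ℕ), ∀ n > n₀, (∀ x, 0 < partialSum L φ n h₀ x) ∧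
        EnergyBarrier L κ A K e m X₀ X₁ m₁ φ n ∧ ∀ ε ∈ Ioo (0 : ℝ) 1, ∀ g, IsRegularization ε g →
          IsAdmissible L ε κ A e X₀ X₁ m₁ φ g n (initialState L φ h₀ c₀ n) := by
  obtain ⟨e₀, m₁, hinit⟩ := exists_initial_bounds hL hh hc hpos
  set X₀ := ∫ x in (0 : ℝ)..L, h₀ x with hX₀
  have hX₀pos : 0 < X₀ := intervalIntegral.intervalIntegral_pos_of_pos_on
    (hh.continuous.intervalIntegrable _ _) (fun x _ => hpos x) hL
  obtain ⟨e, m, K, A, he, he0, hm, -, hA, k₀, hk₀, hbar⟩ :=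
    exists_energyBarrier hL hX₀pos (X₀ + L) m₁ e₀
  refine ⟨e, m, K, A, X₀, X₀ + L, m₁, he0, hm, fun φ hφ => ?_⟩
  -- Keeps the initial correction, multiplied by `A / 2`, below one, so that the functional starts
  -- at most at `e₀ + 1`, strictly below `e`. The threshold depends on the basis, which is harmless
  -- as the constants above are already fixed.
  obtain ⟨κ₀, -, hκ₀⟩ := hφ.exists_correction_le hL hh (δ := 1 / (A + 1)) (by positivity)
  set k := max k₀ κ₀ with hk
  have hk1 : 1 ≤ k := hk₀.trans (le_max_left _ _)
  obtain ⟨n₁, hn₁⟩ := hbar k (le_max_left _ _) φ hφ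
  obtain ⟨n₂, hn₂⟩ := hinit φ hφ
  refine ⟨k ^ 2, max n₁ n₂, fun n hn => ?_⟩
  obtain ⟨p1, p2⟩ := hn₂ n ((le_max_right _ _).trans hn.le)
  refine ⟨p1, hn₁ n ((le_max_left _ _).trans hn.le), fun ε hε g hg => ?_⟩
  obtain ⟨q1, q2⟩ := p2 ε hε
  have pz : ∀ y, 0 < vec φ n (initialState L φ h₀ c₀ n).1 y := fun y => by
    rw [initialState, vec_coeff]; exact p1 y
  have hmass : mass L φ n (fun _ => 1) (initialState L φ h₀ c₀ n) = X₀ := by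
    rw [mass, initialState, vec_coeff]
    simp only [mul_one]
    exact hφ.integral_partialSum n h₀
  refine ⟨pz, ?_, ?_, ?_, ?_⟩
  · rw [lyapunov, galerkinEnergy_eq hφ hg pz]
    simp only [initialState]
    rw [vec_coeff, vec_coeff]
    have h1 := hκ₀ (k ^ 2) (le_trans (le_max_right _ _) (le_self_pow₀ hk1 two_ne_zero)) n
    rw [Finset.sum_range] at h1
    have h2 : ∑ i : Fin (n + 1), weight L φ (k ^ 2) i * coeff L φ h₀ i ^ 2 ≤ 1 / (A + 1) := h1
    have h3 : A * (1 / 2 * ∑ i : Fin (n + 1), weight L φ (k ^ 2) i * coeff L φ h₀ i ^ 2)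
        ≤ A * (1 / 2 * (1 / (A + 1))) := by gcongr
    have h4 : A * (1 / 2 * (1 / (A + 1))) ≤ 1 := by
      rw [show A * (1 / 2 * (1 / (A + 1))) = A / (2 * (A + 1)) by field_simp,
        div_le_one (by positivity)]
      linarith
    linarith
  · rw [hmass]
    have := mul_pos hε.1 hL
    linarith
  · rw [hmass]
    have := mul_le_mul_of_nonneg_right hε.2.le hL.le
    linarith
  · rw [moment_eq hg _ pz]
    simp only [initialState, mul_one]
    rw [vec_coeff, vec_coeff]
    exact q2

section

variable {L ε κ A K e m X₀ X₁ m₁ T : ℝ} {φ : ℕ → ℝ → ℝ} {g h₀ c₀ : ℝ → ℝ} {n : ℕ}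

/-- Galerkin approximations exist. -/
lemma EnergyBarrier.exists_isGalerkinSolution (hL : 0 < L) (hφ : IsLaplaceEigenbasis L φ)
    (hg : IsRegularization ε g) (hε : 0 < ε) (hεm : ε < m) (hT : 0 < T)
    (hB : EnergyBarrier L κ A K e m X₀ X₁ m₁ φ n)
    (h : IsAdmissible L ε κ A e X₀ X₁ m₁ φ g n (initialState L φ h₀ c₀ n)) :
    ∃ η γ, IsGalerkinSolution L φ g h₀ c₀ n T η γ := by
  have H := hB.bounds_of_lt hφ hg hε h.pos (by linarith [h.lyap_lt]) (by linarith [h.mass_le])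
  obtain ⟨x, hx0, hx⟩ := exists_conditionalFlow (K := K) hL hφ hg hε hT (by linarith [H.two_le])
    (initialState L φ h₀ c₀ n)
  obtain ⟨hb, -⟩ := hB.isBoundedFlow hL hφ hg hε hεm hx (by rwa [hx0])
  exact ⟨_, _, hx.isGalerkinSolution hφ hg hε (fun t ht => hb.pos t ⟨ht.1.le, ht.2.le⟩)
    (fun t ht => hb.bounds t ⟨ht.1.le, ht.2.le⟩) (fun i => by rw [hx0]; rfl)
    (fun i => by rw [hx0]; rfl)⟩

lemma EnergyBarrier.isBoundedFlow_toState (hL : 0 < L) (hφ : IsLaplaceEigenbasis L φ)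
    (hg : IsRegularization ε g) (hε : 0 < ε) (hεm : ε < m)
    (hB : EnergyBarrier L κ A K e m X₀ X₁ m₁ φ n)
    (h : IsAdmissible L ε κ A e X₀ X₁ m₁ φ g n (initialState L φ h₀ c₀ n)) {η γ : ℕ → ℝ → ℝ}
    (hs : IsGalerkinSolution L φ g h₀ c₀ n T η γ) :
    IsBoundedFlow L ε κ A K e φ g n T (toState n η γ) ∧
      ∀ t ∈ Icc 0 T, ∀ y, m ≤ galerkinSum φ n η t y + ε := by
  obtain ⟨h1, h2⟩ := hB.isBoundedFlow hL hφ hg hε hεm (hs.isConditionalFlow hL hφ hg hε K)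
    (by rwa [hs.toState_zero])
  refine ⟨h1, fun t ht y => ?_⟩
  rw [galerkinSum_eq_vec]
  exact h2 t ht y

/-- The bounds on slope and entropy of Galerkin approximations. -/
lemma IsBoundedFlow.slope_entropy_le (hL : 0 < L) (hφ : IsLaplaceEigenbasis L φ)
    (hg : IsRegularization ε g) (hε : 0 < ε) (hA : 0 ≤ A) {x : ℝ → State n}
    (hx : IsBoundedFlow L ε κ A K e φ g n T x) {t : ℝ} (ht : t ∈ Icc 0 T) :
    √(∫ y in (0 : ℝ)..L, deriv (vec φ n (x t).1) y ^ 2) ≤ √(2 * e) ∧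
      ∫ y in (0 : ℝ)..L, G g (vec φ n (x t).1 y) ≤ e := by
  have H := hx.bounds t ht
  have hp := hx.pos t ht
  have hE : energy L (fun y => vec φ n (x t).1 y + ε) (vec φ n (x t).2) ≤ e := by
    rw [← galerkinEnergy_eq hφ hg hp]
    exact (galerkinEnergy_le_lyapunov hA _).trans (hx.lyap t ht)
  obtain ⟨h1, h2, -, -⟩ := energy_terms_le hL.le H.smooth_a H.smooth_c H.pos hE
  rw [deriv_shift] at h1
  refine ⟨Real.sqrt_le_sqrt h1, ?_⟩
  have e1 : ∀ y, G g (vec φ n (x t).1 y) = 1 / 6 * (vec φ n (x t).1 y + ε)⁻¹ ^ 2 := fun y => by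
    rw [hg.G_eq hε (hp y).le]
    have := (H.pos y).ne'
    field_simp
  simp_rw [e1]
  rw [intervalIntegral.integral_const_mul]
  linarith

end

/-! ## The limits -/

/-- What holds uniformly for all Galerkin approximations of high order. -/
structure UniformGalerkin (L ε₀ B δ : ℝ) (mod : ℝ → ℝ → ℝ) (φ : ℕ → ℝ → ℝ) (h₀ c₀ : ℝ → ℝ)
    (n₀ : ℕ) : Prop where
  exist : ∀ n > n₀, ∀ ε ∈ Ioo 0 ε₀, ∀ g, IsRegularization ε g → ∀ T > 0,
    ∃ η γ, IsGalerkinSolution L φ g h₀ c₀ n T η γ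
  regular : ∀ n > n₀, ∀ ε ∈ Ioo 0 ε₀, ∀ g, IsRegularization ε g → ∀ T > 0, ∀ η γ,
    IsGalerkinSolution L φ g h₀ c₀ n T η γ →
      IsEquiregular L T B (mod T) (galerkinSum φ n η) ∧
      IsEquiregular L T B (mod T) (galerkinSum φ n γ) ∧
      ∀ t ∈ Icc 0 T, ∀ x, δ ≤ galerkinSum φ n η t x
  modulus : ∀ T, Tendsto (mod T) (𝓝 0) (𝓝 0)

section

variable {L ε₀ B δ T : ℝ} {mod : ℝ → ℝ → ℝ} {φ : ℕ → ℝ → ℝ} {h₀ c₀ : ℝ → ℝ} {n₀ : ℕ}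

lemma UniformGalerkin.exists_isRegularizedLimit (hL : 0 < L)
    (h : UniformGalerkin L ε₀ B δ mod φ h₀ c₀ n₀) {ε : ℝ} (hε : ε ∈ Ioo 0 ε₀) {g : ℝ → ℝ}
    (hg : IsRegularization ε g) (hT : 0 < T) :
    ∃ u v, IsRegularizedLimit L φ g h₀ c₀ T u v := by
  choose η γ hs using fun k : ℕ => h.exist (n₀ + 1 + k) (by omega) ε hε g hg T hT
  have hr := fun k : ℕ => h.regular (n₀ + 1 + k) (by omega) ε hε g hg T hT _ _ (hs k)
  obtain ⟨σ, u, v, hσ, h1, h2, -, -⟩ := exists_uniformLimit_pair hL (h.modulus T)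
    (fun k => (hr k).1) fun k => (hr k).2.1
  exact ⟨u, v, fun k => n₀ + 1 + σ k, fun k => η (σ k), fun k => γ (σ k),
    fun i j hij => Nat.add_lt_add_left (hσ hij) _, fun k => hs (σ k), h1, h2⟩

lemma UniformGalerkin.regularizedLimit (h : UniformGalerkin L ε₀ B δ mod φ h₀ c₀ n₀) {ε : ℝ}
    (hε : ε ∈ Ioo 0 ε₀) {g : ℝ → ℝ} (hg : IsRegularization ε g) (hT : 0 < T) {u v : ℝ → ℝ → ℝ}
    (hu : IsRegularizedLimit L φ g h₀ c₀ T u v) :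
    IsEquiregular L T B (mod T) u ∧ IsEquiregular L T B (mod T) v ∧
      ∀ t ∈ Icc 0 T, ∀ x, δ ≤ u t x := by
  obtain ⟨ν, η, γ, hν, hs, h1, h2⟩ := hu
  -- Dropping the first terms ensures that all orders exceed `n₀`.
  have hshift : StrictMono fun k => k + (n₀ + 1) := fun i j hij => by
    change i + (n₀ + 1) < j + (n₀ + 1); omega
  have hr := fun k : ℕ => h.regular (ν (k + (n₀ + 1)))
    (lt_of_lt_of_le (show n₀ < k + (n₀ + 1) by omega) (hν.id_le (k + (n₀ + 1)))) ε hε g hg T hT _ _ (hs (k + (n₀ + 1)))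
  have h1' := h1.comp hshift
  exact ⟨h1'.isEquiregular fun k => (hr k).1, (h2.comp hshift).isEquiregular fun k => (hr k).2.1,
    fun t ht x => ge_of_tendsto' (h1'.apply ht x) fun k => (hr k).2.2 t ht x⟩

lemma UniformGalerkin.exists_isLimitSolution (hL : 0 < L) (hε₀ : 0 < ε₀)
    (h : UniformGalerkin L ε₀ B δ mod φ h₀ c₀ n₀) {g : ℝ → ℝ → ℝ}
    (hg : ∀ ε > 0, IsRegularization ε (g ε)) (hT : 0 < T) :
    ∃ u v, IsLimitSolution L φ g h₀ c₀ T u v := by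
  -- The summand 2 keeps even the first member strictly below `ε₀`.
  have he : ∀ k : ℕ, ε₀ / ((k : ℝ) + 2) ∈ Ioo 0 ε₀ := fun k =>
    ⟨by positivity, div_lt_self hε₀ (by have : (0 : ℝ) ≤ k := k.cast_nonneg; linarith)⟩
  choose u v huv using fun k : ℕ => h.exists_isRegularizedLimit hL (he k) (hg _ (he k).1) hT
  have hr := fun k : ℕ => h.regularizedLimit (he k) (hg _ (he k).1) hT (huv k)
  obtain ⟨σ, u', v', hσ, h1, h2, -, -⟩ := exists_uniformLimit_pair hL (h.modulus T)
    (fun k => (hr k).1) fun k => (hr k).2.1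
  refine ⟨u', v', fun k => ε₀ / ((σ k : ℝ) + 2), fun k => u (σ k), fun k => v (σ k),
    fun k => (he (σ k)).1, ?_, fun k => huv (σ k), h1, h2⟩
  refine Tendsto.div_atTop tendsto_const_nhds (tendsto_atTop_add_const_right _ _ ?_)
  exact tendsto_natCast_atTop_atTop.comp hσ.tendsto_atTop

lemma UniformGalerkin.le_limitSolution (hε₀ : 0 < ε₀)
    (h : UniformGalerkin L ε₀ B δ mod φ h₀ c₀ n₀) {g : ℝ → ℝ → ℝ}
    (hg : ∀ ε > 0, IsRegularization ε (g ε)) (hT : 0 < T) {u v : ℝ → ℝ → ℝ}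
    (hu : IsLimitSolution L φ g h₀ c₀ T u v) : ∀ t ∈ Icc 0 T, ∀ x, δ ≤ u t x := by
  obtain ⟨e, hh, cc, he, he0, hr, h1, -⟩ := hu
  intro t ht x
  refine ge_of_tendsto (h1.apply ht x) ?_
  filter_upwards [he0.eventually (gt_mem_nhds hε₀)] with k hk
  exact (h.regularizedLimit ⟨he k, hk⟩ (hg _ (he k)) hT (hr k)).2.2 t ht x

end

end ThinFilm

/-! ### Choice of the constants and conclusion. -/

theorem mainTheorem2 (L : ℝ) (hL : 0 < L) (h₀ c₀ : ℝ → ℝ)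
    (hh₀ : ThinFilm.IsPeriodicW22 L h₀) (hc₀ : ThinFilm.IsPeriodicW22 L c₀)
    (hpos : ∀ x, 0 < h₀ x) :
    ∃ k₁ k₄ ε₀ : ℝ, 0 < k₁ ∧ 0 < k₄ ∧ 0 < ε₀ ∧ 0 < ThinFilm.lowerBound L k₁ k₄ ∧
      ∀ φ : ℕ → ℝ → ℝ, ThinFilm.IsLaplaceEigenbasis L φ →
        ∃ n₀ : ℕ, (∀ n > n₀, ∀ x, 0 < ThinFilm.partialSum L φ n h₀ x) ∧
          ∀ g : ℝ → ℝ → ℝ, (∀ ε > 0, ThinFilm.IsRegularization ε (g ε)) →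
            -- the Galerkin approximations
            (∀ n > n₀, ∀ ε ∈ Set.Ioo 0 ε₀, ∀ T > 0,
              (∃ η γ : ℕ → ℝ → ℝ, ThinFilm.IsGalerkinSolution L φ (g ε) h₀ c₀ n T η γ) ∧
              ∀ η γ : ℕ → ℝ → ℝ, ThinFilm.IsGalerkinSolution L φ (g ε) h₀ c₀ n T η γ →
                ∀ t ∈ Set.Icc 0 T,
                  √(∫ x in (0 : ℝ)..L, deriv (ThinFilm.galerkinSum φ n η t) x ^ 2) ≤ k₁ ∧
                  ∫ x in (0 : ℝ)..L, ThinFilm.G (g ε) (ThinFilm.galerkinSum φ n η t x) ≤ k₄ ∧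
                  ∀ x, ThinFilm.lowerBound L k₁ k₄ ≤ ThinFilm.galerkinSum φ n η t x) ∧
            -- the limits `n → ∞` at fixed `ε`
            (∀ ε ∈ Set.Ioo 0 ε₀, ∀ T > 0,
              (∃ h c : ℝ → ℝ → ℝ, ThinFilm.IsRegularizedLimit L φ (g ε) h₀ c₀ T h c) ∧
              ∀ h c : ℝ → ℝ → ℝ, ThinFilm.IsRegularizedLimit L φ (g ε) h₀ c₀ T h c →
                ∀ t ∈ Set.Icc 0 T, ∀ x, ThinFilm.lowerBound L k₁ k₄ ≤ h t x) ∧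
            -- the limits `ε → 0`
            (∀ T > 0,
              (∃ h c : ℝ → ℝ → ℝ, ThinFilm.IsLimitSolution L φ g h₀ c₀ T h c) ∧
              ∀ h c : ℝ → ℝ → ℝ, ThinFilm.IsLimitSolution L φ g h₀ c₀ T h c →
                ∀ t ∈ Set.Icc 0 T, ∀ x, ThinFilm.lowerBound L k₁ k₄ ≤ h t x) := by
  obtain ⟨e, m, K, A, X₀, X₁, m₁, he, hm, hφ₀⟩ := ThinFilm.exists_barrier_constants hL
    (hh₀.periodicC1 hL) (hc₀.periodicC1 hL) hpos
  have hk₁ : 0 < √(2 * e) := Real.sqrt_pos.2 (by positivity)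
  -- The level `e` already bounds the entropy; the second entry makes `√(L / k₄) ≤ m / 2`.
  have hk₄ : 0 < max e (4 * L / m ^ 2) := lt_max_of_lt_left he
  -- For `ε < m / 2` the bound `h + ε ≥ m` becomes `h ≥ m / 2`, and `ε < 1` is what the uniform
  -- bounds on the initial data require.
  have hε₀ : 0 < min 1 (m / 2) := lt_min one_pos (half_pos hm)
  have hM : ThinFilm.lowerBound L √(2 * e) (max e (4 * L / m ^ 2)) ≤ m / 2 := by
    refine (ThinFilm.lowerBound_le hL hk₁ hk₄).trans ?_
    rw [Real.sqrt_le_left (half_pos hm).le, div_le_iff₀ hk₄]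
    calc L = (m / 2) ^ 2 * (4 * L / m ^ 2) := by field_simp; norm_num
      _ ≤ (m / 2) ^ 2 * max e (4 * L / m ^ 2) := by gcongr; exact le_max_right _ _
  refine ⟨√(2 * e), max e (4 * L / m ^ 2), min 1 (m / 2), hk₁, hk₄, hε₀,
    ThinFilm.lowerBound_pos hL hk₁ hk₄, fun φ hφ => ?_⟩
  obtain ⟨κ, n₀, hn₀⟩ := hφ₀ φ hφ
  have flow : ∀ n > n₀, ∀ ε ∈ Ioo 0 (min 1 (m / 2)), ∀ g, ThinFilm.IsRegularization ε g →
      ∀ T, ∀ η γ, ThinFilm.IsGalerkinSolution L φ g h₀ c₀ n T η γ →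
        ThinFilm.IsBoundedFlow L ε κ A K e φ g n T (ThinFilm.toState n η γ) ∧
          ∀ t ∈ Icc 0 T, ∀ y, m / 2 ≤ ThinFilm.galerkinSum φ n η t y := by
    intro n hn ε hε g hg T η γ hs
    have h1 : ε < 1 := hε.2.trans_le (min_le_left _ _)
    have h2 : ε < m / 2 := hε.2.trans_le (min_le_right _ _)
    obtain ⟨-, hB, hadm⟩ := hn₀ n hn
    obtain ⟨h3, h4⟩ := hB.isBoundedFlow_toState hL hφ hg hε.1 (by linarith)
      (hadm ε ⟨hε.1, h1⟩ g hg) hs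
    exact ⟨h3, fun t ht y => by have := h4 t ht y; linarith⟩
  have U : ThinFilm.UniformGalerkin L (min 1 (m / 2)) K (m / 2)
      (ThinFilm.spaceTimeMod L K e) φ h₀ c₀ n₀ := by
    refine ⟨fun n hn ε hε g hg T hT => ?_, fun n hn ε hε g hg T hT η γ hs => ?_,
      ThinFilm.tendsto_spaceTimeMod L K e⟩
    · have h1 : ε < 1 := hε.2.trans_le (min_le_left _ _)
      have h2 : ε < m / 2 := hε.2.trans_le (min_le_right _ _)
      obtain ⟨-, hB, hadm⟩ := hn₀ n hn
      exact hB.exists_isGalerkinSolution hL hφ hg hε.1 (by linarith) hT (hadm ε ⟨hε.1, h1⟩ g hg)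
    · obtain ⟨h3, h4⟩ := flow n hn ε hε g hg T η γ hs
      obtain ⟨h5, h6⟩ := h3.isEquiregular hL hφ hg hε.1 hT (hn₀ n hn).2.1
      rw [funext (ThinFilm.galerkinSum_eq_vec φ n η)] at h4 ⊢
      rw [funext (ThinFilm.galerkinSum_eq_vec φ n γ)]
      exact ⟨h5, h6, h4⟩
  refine ⟨n₀, fun n hn => (hn₀ n hn).1, fun g hg => ⟨fun n hn ε hε T hT => ?_,
    fun ε hε T hT => ?_, fun T hT => ?_⟩⟩
  · refine ⟨U.exist n hn ε hε _ (hg ε hε.1) T hT, fun η γ hs t ht => ?_⟩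
    obtain ⟨h3, h4⟩ := flow n hn ε hε _ (hg ε hε.1) T η γ hs
    obtain ⟨h5, h6⟩ := h3.slope_entropy_le hL hφ (hg ε hε.1) hε.1 (hn₀ n hn).2.1.nonneg ht
    refine ⟨?_, ?_, fun x => hM.trans (h4 t ht x)⟩
    · rw [ThinFilm.galerkinSum_eq_vec]
      exact h5
    · rw [ThinFilm.galerkinSum_eq_vec]
      exact h6.trans (le_max_left _ _)
  · refine ⟨U.exists_isRegularizedLimit hL hε (hg ε hε.1) hT, fun h c hhc t ht x => ?_⟩
    exact hM.trans ((U.regularizedLimit hε (hg ε hε.1) hT hhc).2.2 t ht x)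
  · refine ⟨U.exists_isLimitSolution hL hε₀ hg hT, fun h c hhc t ht x => ?_⟩
    exact hM.trans (U.le_limitSolution hε₀ hg hT hhc t ht x)
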